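/- **Setting.** Let $(W,\omega)$ be a compact symplectic manifold of dimension $2n$, $n\ge 1$, with contact type boundary $M=\partial W$, contact form $\lambda$, contact distribution $\xi=\ker\lambda$, Reeb field $R_\lambda$ with flow $\phi_\lambda$, and let $\widehat W=W\cup (M\times\mathbb R^+)$ be its symplectic completion, with $\widehat\omega=\omega$ on $W$ and $\widehat\omega=d(e^t\lambda)$ on $M\times\mathbb R^+$. Assume that all closed Reeb orbits are transversally nondegenerate, i.e. $\det(1-d\phi_\lambda^T(p)|_\xi)\ne0$ whenever $\phi_\lambda^T(p)=p$, $T>0$. Hamiltonian vector fields are defined by $\widehat\omega(X_H,\cdot)=dH$, and $S^1=\mathbb R/\mathbb Z$. Let $H:\widehat W\to\mathbb R$ be smooth, negative and Morse on $W$, with $H=h(t)$ on $M\times\mathbb R^+$, where $h$ is strictly increasing, $h(t)=\alpha e^t+\beta$ for $t\ge t_0$, $\alpha$ is not the period of a closed Reeb orbit, and $h''-h'>0$ on $[0,t_0)$. If $\gamma(s)=\phi_\lambda^s(p)$, $0\le s\le T$, is a closed Reeb orbit and $T=e^{-t}h'(t)$ with $0<t<t_0$, then $\gamma_H(\theta)=(\phi_\lambda^{-T\theta}(p),t)$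 is a $1$-periodic orbit of $X_H$; let $S_\gamma$ be the circle of its shifts $\gamma_H(\cdot+c)$, and $\ell_\gamma$ the largest positive integer with $\gamma_H(\theta+1/\ell_\gamma)=\gamma_H(\theta)$ for all $\theta$. Take finitely many such $\gamma$. For each of them choose a symplectic diffeomorphism $\psi_\gamma=(\psi_{\gamma,1},\psi_{\gamma,2})$ from an open neighbourhood $U_\gamma$ of $\gamma_H(S^1)$ onto an open neighbourhood of $S^1\times\{0\}$ in $(S^1\times\mathbb R^{2n-1},\sum dq_i\wedge dp_i)$, $q_1\in S^1$, with $\psi_\gamma(\gamma_H(\theta))=(\ell_\gamma\theta,0)$ and the $U_\gamma$ pairwise disjoint, a smooth cutoff function $\rho_\gamma$ with values in $[0,1]$ and compact support in $\psi_\gamma(U_\gamma)$ which is $1$ on $S^1\times\{0\}$, and a Morse function $f_\gamma:S^1\to\mathbb R$ whose only critical points are one minimum and one maximum. Put $$H_\delta(\theta,x)=H(x)+\delta\sum_\gamma\rho_\gamma(\psi_\gamma(x))\,f_\gamma(\psi_{\gamma,1}(x)-\ell_\gamma\theta),$$ where the summand of $\gamma$ is $0$ outside $U_\gamma$. Let $\gamma_{\min},\gamma_{Max}\in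 S_\gamma$ be the elements whose starting points have $\psi_{\gamma,1}$-coordinate the minimum, respectively the maximum, of $f_\gamma$. **Indices.** Let $\mu_{CZ}(\Psi)\in\mathbb Z$ be the Conley–Zehnder index of a path $\Psi:[0,1]\to \mathrm{Sp}(2k)$ with $\Psi(0)=1$, $\det(1-\Psi(1))\neq0$, where $\mathbb R^{2k}\cong\mathbb C^k$, $z=x+iy$, carries the form $\sum dx_i\wedge dy_i$, normalized so that $s\mapsto e^{\pi i s}$ on $\mathbb C^k$ has index $k$. Let $l_a$ be a loop in $\widehat W$ with a symplectic trivialization $\Phi_a$ of $l_a^*T\widehat W$, let $h_{ab}$ be a homotopy in $\widehat W$ from $l_a$ to a loop $l_b$ in $M$, and suppose that the extension of $\Phi_a$ over $h_{ab}$ restricts on $l_b$ to a trivialization homotopic to one that maps $\mathbb R^{2n-2}\times0\times0$, $0\times\mathbb R\times0$, $0\times0\times\mathbb R$ to $\xi$, $\langle\partial_t\rangle$, $\langle R_\lambda\rangle$; let $\Phi_b$ be the restriction of the latter to $\mathbb R^{2n-2}$. Let $\sigma_\gamma:\Sigma\to M$ be a map from a compact connected oriented surface with two boundary circles, equal to $l_b$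 on $\partial_0\Sigma$ (with the opposite boundary orientation) and to $\gamma$ on $\partial_1\Sigma$, and let $\Phi_\gamma$ be a trivialization of $\sigma_\gamma^*(\xi,d\lambda)$ which extends $\Phi_b$. The index of $\gamma$ is $$\mu(\gamma)=\mu_{CZ}\big(s\mapsto \Phi_\gamma^{-1}\circ d\phi_\lambda^{Ts}(p)|_\xi\circ\Phi_\gamma\big).$$ A $1$-periodic orbit $x\in S_\gamma$ of $H_\delta$ is capped by the concatenation of $h_{ab}$, $\sigma_\gamma$ and the cylinder in $M\times[0,t]$ from $\gamma$ to the level $t$, with reversed orientation (as $\gamma_H$ runs along $-R_\lambda$), and, if $\Phi$ is the symplectic trivialization of $T\widehat W$ along $x$ obtained by extending $\Phi_a$ over this surface, then $$\mu(x)=-\mu_{CZ}\big(\theta\mapsto\Phi(\theta)^{-1}\circ d\phi_{H_\delta}^\theta(x(0))\circ\Phi(0)\big).$$ **Statement.** There is $\delta_0>0$ such that for all $0<\delta\le\delta_0$ and each of the chosen $\gamma$, the loops $\gamma_{\min}$ and $\gamma_{Max}$ are nondegenerate $1$-periodic orbits of $H_\delta$, and, for all choices of the data that define the indices, $$\mu(\gamma_{\min})=\mu(\gamma)+1,\qquad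 \mu(\gamma_{Max})=\mu(\gamma).$$ -/

import Mathlib

open Set
open scoped Manifold ContDiff

namespace MorseBott

noncomputable section

/-! ### The Conley–Zehnder index of a path of symplectic matrices -/

/-- The space `ℝ^{2k}` with coordinates `x_i = v (inl i)` and `y_i = v (inr i)`. -/
abbrev Std (k : ℕ) : Type := Fin k ⊕ Fin k → ℝ

/-- Real `2k × 2k` matrices. -/
abbrev Mat (k : ℕ) : Type := Matrix (Fin k ⊕ Fin k) (Fin k ⊕ Fin k) ℝ

/-- The standard symplectic form `∑ dx_i ∧ dy_i`. -/
def stdForm {k : ℕ} (v w : Std k) : ℝ :=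
  ∑ i, (v (.inl i) * w (.inr i) - v (.inr i) * w (.inl i))

/-- The complex determinant of (twice) the complex linear part of a real matrix, where `ℝ^{2k}`
is identified with `ℂ^k` by `z = x + i y`. If `A` is symplectic with polar decomposition `A = U P`,
the complex linear part of `A` is `U` times a positive definite Hermitian matrix, so that this
number is nonzero and its argument is that of `det_ℂ U`. -/
def complexDet {k : ℕ} (A : Mat k) : ℂ :=
  Matrix.det (Matrix.of fun i j : Fin k =>
    ((A (.inl i) (.inl j) + A (.inr i) (.inr j) : ℝ) : ℂ) +
      Complex.I * ((A (.inr i) (.inl j) - A (.inl i) (.inr j) : ℝ) : ℂ))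

/-- The matrix `W⁻ = diag(2, -1, …, -1, 1/2, -1, …, -1)`. -/
def matWMinus (k : ℕ) : Mat k :=
  Matrix.diagonal (Sum.elim (fun i => if (i : ℕ) = 0 then 2 else -1)
    (fun i => if (i : ℕ) = 0 then 1 / 2 else -1))

/-- `k` is the Conley–Zehnder index of the path `Ψ : [0,1] → Sp(2n)` with `Ψ(0) = 1` and
`det (1 - Ψ(1)) ≠ 0`: the path is prolonged over `[1,2]`, inside the symplectic matrices without
eigenvalue `1`, up to one of the matrices `W⁺ = -1` and `W⁻`, and `k` is the degree of the square
of the rotation map `det_ℂ U` along the prolonged path, i.e. its angle `α` changes by `k π`.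
The normalization is that `s ↦ e^{π i s}` on `ℂ^n` has index `n`. -/
def IsConleyZehnderIndex {n : ℕ} (Ψ : ℝ → Mat n) (k : ℤ) : Prop :=
  Ψ 0 = 1 ∧
  ∃ (χ : ℝ → Mat n) (α : ℝ → ℝ),
    ContinuousOn χ (Icc 0 2) ∧ ContinuousOn α (Icc 0 2) ∧
    (∀ s ∈ Icc (0 : ℝ) 1, χ s = Ψ s) ∧
    (∀ s ∈ Icc (0 : ℝ) 2, χ s ∈ Matrix.symplecticGroup (Fin n) ℝ) ∧
    (∀ s ∈ Icc (1 : ℝ) 2, (1 - χ s).det ≠ 0) ∧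
    (χ 2 = -1 ∨ χ 2 = matWMinus n) ∧
    (∀ s ∈ Icc (0 : ℝ) 2,
      complexDet (χ s) = (‖complexDet (χ s)‖ : ℂ) * Complex.exp (Complex.I * (α s : ℂ))) ∧
    α 2 - α 0 = k * Real.pi

/-! ### Forms, flows and frames on manifolds -/

section Manifold

variable {n : ℕ} {X : Type*} [TopologicalSpace X] [ChartedSpace (EuclideanSpace ℝ (Fin n)) X]

/-- The expression of a 1-form in the preferred chart at `x₀`. -/
def chartOneForm (a : ∀ x : X, TangentSpace (𝓡 n) x →L[ℝ] ℝ) (x₀ : X)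
    (y : EuclideanSpace ℝ (Fin n)) : EuclideanSpace ℝ (Fin n) →L[ℝ] ℝ :=
  (a ((extChartAt (𝓡 n) x₀).symm y)).comp
    (mfderiv 𝓘(ℝ, EuclideanSpace ℝ (Fin n)) (𝓡 n) (extChartAt (𝓡 n) x₀).symm y)

/-- The expression of a bilinear form in the preferred chart at `x₀`. -/
def chartTwoForm (b : ∀ x : X, TangentSpace (𝓡 n) x →L[ℝ] TangentSpace (𝓡 n) x →L[ℝ] ℝ) (x₀ : X)
    (y : EuclideanSpace ℝ (Fin n)) :
    EuclideanSpace ℝ (Fin n) →L[ℝ] EuclideanSpace ℝ (Fin n) →L[ℝ] ℝ :=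
  let D : EuclideanSpace ℝ (Fin n) →L[ℝ] EuclideanSpace ℝ (Fin n) :=
    mfderiv 𝓘(ℝ, EuclideanSpace ℝ (Fin n)) (𝓡 n) (extChartAt (𝓡 n) x₀).symm y
  let B : EuclideanSpace ℝ (Fin n) →L[ℝ] EuclideanSpace ℝ (Fin n) →L[ℝ] ℝ :=
    b ((extChartAt (𝓡 n) x₀).symm y)
  B.bilinearComp D D

/-- The exterior derivative of a 1-form, computed in the preferred chart at the point (in which
the tangent space at that point is the model space). -/
def extDerivOne (a : ∀ x : X, TangentSpace (𝓡 n) x →L[ℝ] ℝ) (x : X)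
    (v w : TangentSpace (𝓡 n) x) : ℝ :=
  fderiv ℝ (chartOneForm a x) (extChartAt (𝓡 n) x x) v w -
    fderiv ℝ (chartOneForm a x) (extChartAt (𝓡 n) x x) w v

/-- Smoothness of a 1-form. -/
def SmoothOneForm (a : ∀ x : X, TangentSpace (𝓡 n) x →L[ℝ] ℝ) : Prop :=
  ∀ x₀, ContDiffOn ℝ ∞ (chartOneForm a x₀) (extChartAt (𝓡 n) x₀).target

/-- `b` is a symplectic form: smooth, alternating, nondegenerate and closed. -/
structure IsSymplecticForm
    (b : ∀ x : X, TangentSpace (𝓡 n) x →L[ℝ] TangentSpace (𝓡 n) x →L[ℝ] ℝ) : Prop where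
  smooth : ∀ x₀, ContDiffOn ℝ ∞ (chartTwoForm b x₀) (extChartAt (𝓡 n) x₀).target
  alternating : ∀ x v, b x v v = 0
  nondegenerate : ∀ x v, (∀ w, b x v w = 0) → v = 0
  closed : ∀ x (u v w : EuclideanSpace ℝ (Fin n)),
    fderiv ℝ (chartTwoForm b x) (extChartAt (𝓡 n) x x) u v w -
      fderiv ℝ (chartTwoForm b x) (extChartAt (𝓡 n) x x) v u w +
      fderiv ℝ (chartTwoForm b x) (extChartAt (𝓡 n) x x) w u v = 0

/-- If `x` is a critical point of `H`, then the Hessian of `H` at `x` is nondegenerate. -/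
def MorseAt (H : X → ℝ) (x : X) : Prop :=
  mfderiv (𝓡 n) 𝓘(ℝ, ℝ) H x = 0 →
    ∀ v : EuclideanSpace ℝ (Fin n),
      fderiv ℝ (fderiv ℝ (H ∘ (extChartAt (𝓡 n) x).symm)) (extChartAt (𝓡 n) x x) v = 0 → v = 0

/-- `φ` is the (smooth, globally defined) flow, starting at time `0`, of the time-dependent vector
field `V`. -/
structure IsFlow (V : ℝ → ∀ x : X, TangentSpace (𝓡 n) x) (φ : ℝ → X → X) : Prop where
  smooth : ContMDiff (𝓘(ℝ, ℝ).prod (𝓡 n)) (𝓡 n) ∞ (fun p : ℝ × X => φ p.1 p.2)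
  zero : ∀ x, φ 0 x = x
  velocity : ∀ s x, mfderiv 𝓘(ℝ, ℝ) (𝓡 n) (fun τ => φ τ x) s (1 : ℝ) = V s (φ s x)

/-- A continuous family, over `u : Z → X`, of linear maps `ℝ^{2k} → T_{u(z)} X` which pull the
(pointwise) bilinear form `b` back to the standard symplectic form. If `b` is a symplectic form and
`dim X = 2k`, this is a symplectic trivialization of `u^* TX`. -/
structure SymplecticFrame [IsManifold (𝓡 n) ∞ X]
    (b : ∀ x : X, TangentSpace (𝓡 n) x → TangentSpace (𝓡 n) x → ℝ)
    (k : ℕ) {Z : Type*} [TopologicalSpace Z] (u : Z → X) where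
  map : ∀ z, Std k →ₗ[ℝ] TangentSpace (𝓡 n) (u z)
  continuous_map : ∀ v, Continuous fun z => (⟨u z, map z v⟩ : TangentBundle (𝓡 n) X)
  symplectic : ∀ z v w, b (u z) (map z v) (map z w) = stdForm v w

/-- The image of `v` under the frame at `z`, as a point of the tangent bundle. -/
def SymplecticFrame.vec [IsManifold (𝓡 n) ∞ X]
    {b : ∀ x : X, TangentSpace (𝓡 n) x → TangentSpace (𝓡 n) x → ℝ}
    {k : ℕ} {Z : Type*} [TopologicalSpace Z] {u : Z → X} (Φ : SymplecticFrame b k u)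
    (z : Z) (v : Std k) : TangentBundle (𝓡 n) X :=
  ⟨u z, Φ.map z v⟩

end Manifold

/-- The matrix of `B⁻¹ ∘ L ∘ A`, for injective `A`, `B` such that `L` maps the image of `A` into
that of `B`. -/
def transportMatrix {k : ℕ} {F : Type*} [AddCommGroup F] [Module ℝ F]
    (B : Std k →ₗ[ℝ] F) (L : F →ₗ[ℝ] F) (A : Std k →ₗ[ℝ] F) : Mat k :=
  Matrix.of fun i j => Function.invFun B (L (A (Pi.single j 1))) i

/-! ### Surfaces with two boundary circles -/

/-- The identifications on the strip `ℝ × [0,1]` which produce the compact oriented surface of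
genus `g` with two boundary circles: the strip is rolled up to an annulus by `(r,s) ∼ (r+1,s)`,
and the circle `s = 1`, cut into `4 g + 1` equal edges, is glued according to the word
`∂₁ · x₀ y₀ x₀⁻¹ y₀⁻¹ ⋯ x_{g-1} y_{g-1} x_{g-1}⁻¹ y_{g-1}⁻¹`. -/
inductive SurfaceRel (g : ℕ) : ℝ × Icc (0 : ℝ) 1 → ℝ × Icc (0 : ℝ) 1 → Prop
  | period (r : ℝ) (s : Icc (0 : ℝ) 1) : SurfaceRel g (r, s) (r + 1, s)
  | edgeX (i : ℕ) (hi : i < g) (r : ℝ) (hr : r ∈ Icc (0 : ℝ) 1) :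
      SurfaceRel g ((4 * i + 1 + r) / (4 * g + 1), 1) ((4 * i + 4 - r) / (4 * g + 1), 1)
  | edgeY (i : ℕ) (hi : i < g) (r : ℝ) (hr : r ∈ Icc (0 : ℝ) 1) :
      SurfaceRel g ((4 * i + 2 + r) / (4 * g + 1), 1) ((4 * i + 5 - r) / (4 * g + 1), 1)

/-- The compact oriented surface of genus `g` with two boundary circles, with the quotient
topology. -/
abbrev Surface (g : ℕ) : Type := Quot (SurfaceRel g)

/-- The boundary circle `∂₀` (with the opposite boundary orientation), parametrized by `[0,1]`. -/
def Surface.bdry₀ {g : ℕ} (r : ℝ) : Surface g := Quot.mk _ (r, 0)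

/-- The boundary circle `∂₁` (with the boundary orientation), parametrized by `[0,1]`. -/
def Surface.bdry₁ {g : ℕ} (r : ℝ) : Surface g := Quot.mk _ (r / (4 * g + 1), 1)

/-! ### Symplectic manifolds with contact type boundary and their completions -/

/-- The symplectic completion `(Ŵ, ω̂)`, of dimension `2 (m + 1)`, of a compact symplectic
manifold `W` with contact type boundary `(M, λ)`. Here `G` is the parametrization by
`M × (-ε, ∞)` of the union of a collar of `M = ∂W` and of the end `M × ℝ⁺`, in which `∂/∂t` is the
Liouville field, and `W` is the complement of `G (M × (0, ∞))`. -/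
structure SymplecticCompletion (m : ℕ) (What M : Type*)
    [TopologicalSpace What] [ChartedSpace (EuclideanSpace ℝ (Fin (2 * m + 2))) What]
    [TopologicalSpace M] [ChartedSpace (EuclideanSpace ℝ (Fin (2 * m + 1))) M] where
  Ω : ∀ x : What, TangentSpace (𝓡 (2 * m + 2)) x →L[ℝ] TangentSpace (𝓡 (2 * m + 2)) x →L[ℝ] ℝ
  isSymplectic : IsSymplecticForm Ω
  lam : ∀ p : M, TangentSpace (𝓡 (2 * m + 1)) p →L[ℝ] ℝ
  lam_smooth : SmoothOneForm lam
  /-- `dλ` is nondegenerate on `ξ = ker λ`. -/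
  lam_contact : ∀ p v, lam p v = 0 →
    (∀ w, lam p w = 0 → extDerivOne lam p v w = 0) → v = 0
  ε : ℝ
  ε_pos : 0 < ε
  G : M × ℝ → What
  G_smooth : ContMDiffOn ((𝓡 (2 * m + 1)).prod 𝓘(ℝ, ℝ)) (𝓡 (2 * m + 2)) ∞ G (univ ×ˢ Ioi (-ε))
  G_injOn : InjOn G (univ ×ˢ Ioi (-ε))
  G_isOpen : IsOpen (G '' (univ ×ˢ Ioi (-ε)))
  G_isClosed : IsClosed (G '' (univ ×ˢ Ici 0))
  /-- `G^* ω̂ = d(e^t λ) = e^t (dt ∧ λ + dλ)`. -/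
  G_symplectic : ∀ (p : M) (t : ℝ), -ε < t → ∀ (v w : TangentSpace (𝓡 (2 * m + 1)) p) (a b : ℝ),
    Ω (G (p, t))
      (mfderiv ((𝓡 (2 * m + 1)).prod 𝓘(ℝ, ℝ)) (𝓡 (2 * m + 2)) G (p, t)
        ((v, a) : EuclideanSpace ℝ (Fin (2 * m + 1)) × ℝ))
      (mfderiv ((𝓡 (2 * m + 1)).prod 𝓘(ℝ, ℝ)) (𝓡 (2 * m + 2)) G (p, t)
        ((w, b) : EuclideanSpace ℝ (Fin (2 * m + 1)) × ℝ)) =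
      Real.exp t * (a * lam p w - b * lam p v + extDerivOne lam p v w)
  isCompact_W : IsCompact (G '' (univ ×ˢ Ioi 0))ᶜ

variable {m : ℕ} {What M : Type*}
  [TopologicalSpace What] [ChartedSpace (EuclideanSpace ℝ (Fin (2 * m + 2))) What]
  [TopologicalSpace M] [ChartedSpace (EuclideanSpace ℝ (Fin (2 * m + 1))) M]

namespace SymplecticCompletion

variable (C : SymplecticCompletion m What M)

/-- The compact domain `W`. -/
def W : Set What := (C.G '' (univ ×ˢ Ioi 0))ᶜ

/-- The tangent vector `v + a ∂/∂t` at `G (p, t)`. -/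
def push (p : M) (t : ℝ) (v : TangentSpace (𝓡 (2 * m + 1)) p) (a : ℝ) :
    TangentSpace (𝓡 (2 * m + 2)) (C.G (p, t)) :=
  mfderiv ((𝓡 (2 * m + 1)).prod 𝓘(ℝ, ℝ)) (𝓡 (2 * m + 2)) C.G (p, t)
    ((v, a) : EuclideanSpace ℝ (Fin (2 * m + 1)) × ℝ)

/-- The Reeb vector field: `dλ(R, ·) = 0` and `λ(R) = 1`. -/
def reeb (p : M) : TangentSpace (𝓡 (2 * m + 1)) p :=
  Classical.epsilon fun v : TangentSpace (𝓡 (2 * m + 1)) p =>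
    C.lam p v = 1 ∧ ∀ w, extDerivOne C.lam p v w = 0

/-- The Hamiltonian vector field: `ω̂(X_H, ·) = dH`. -/
def hamField (H : What → ℝ) (x : What) : TangentSpace (𝓡 (2 * m + 2)) x :=
  Classical.epsilon fun v : TangentSpace (𝓡 (2 * m + 2)) x =>
    ∀ w, C.Ω x v w = (mfderiv (𝓡 (2 * m + 2)) 𝓘(ℝ, ℝ) H x w : ℝ)

/-- All closed Reeb orbits are transversally nondegenerate: `dφ_λ^T(p)` has no eigenvalue `1` on
`ξ` whenever `φ_λ^T(p) = p`, `T > 0`. -/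
def ReebNondegenerate (φlam : ℝ → M → M) : Prop :=
  ∀ (p : M) (T : ℝ), 0 < T → φlam T p = p →
    ∀ v : EuclideanSpace ℝ (Fin (2 * m + 1)), C.lam p v = 0 →
      mfderiv (𝓡 (2 * m + 1)) (𝓡 (2 * m + 1)) (φlam T) p v = v → v = 0

/-- Autonomous admissible Hamiltonians: negative and Morse on `W`, a function `h(t)` with
`h'' - h' > 0` on `[0, t₀)` on the end, and `h(t) = α e^t + β` for `t ≥ t₀`, where `α` is not the
period of a closed Reeb orbit. No smallness is required on `W`. -/
structure AdmissibleHamiltonian (φlam : ℝ → M → M) where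
  H : What → ℝ
  smooth : ContMDiff (𝓡 (2 * m + 2)) 𝓘(ℝ, ℝ) ∞ H
  neg_on_W : ∀ x ∈ C.W, H x < 0
  morse_on_W : ∀ x ∈ C.W, MorseAt (n := 2 * m + 2) H x
  h : ℝ → ℝ
  h_smooth : ContDiff ℝ ∞ h
  H_eq : ∀ p t, 0 ≤ t → H (C.G (p, t)) = h t
  h_strictMono : StrictMonoOn h (Ici 0)
  t₀ : ℝ
  α : ℝ
  β : ℝ
  h_linear : ∀ t, t₀ ≤ t → h t = α * Real.exp t + β
  α_notMem_spec : 0 < α → ∀ p, φlam α p ≠ p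
  h_convex : ∀ t, 0 ≤ t → t < t₀ → 0 < deriv (deriv h) t - deriv h t

end SymplecticCompletion

/-! ### The perturbed Hamiltonian -/

/-- The unit vector in the direction of the first coordinate `q₁ = x_0` of `ℝ^{2 (m + 1)}`. -/
def e₁ (m : ℕ) : Std (m + 1) := Pi.single (Sum.inl 0) 1

/-- The data of the perturbation near one circle `S_γ`. The closed Reeb orbit `γ` is
`s ↦ φ_λ^s(p)`, `0 ≤ s ≤ T`, and `S_γ` consists of the shifts of the 1-periodic orbit
`γ_H(θ) = (φ_λ^{-Tθ}(p), t)` of `X_H`, where `T = e^{-t} h'(t)`.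

The symplectic trivialization `ψ : U_γ → V ⊂ S¹ × ℝ^{2m+1}`, `S¹ = ℝ/ℤ`, is given by the lift `κ` of
its inverse: functions on `S¹ × ℝ^{2m+1}` are functions on `ℝ^{2(m+1)}` which are 1-periodic in `q₁`,
`V` is an open set invariant under `q₁ ↦ q₁ + 1`, and `κ : V → Ŵ` descends to a symplectic
embedding of `V/ℤ` with image `U_γ`. Likewise `f` is a 1-periodic function on `ℝ`. -/
structure OrbitPerturbation (C : SymplecticCompletion m What M) (φlam : ℝ → M → M)
    (K : C.AdmissibleHamiltonian φlam) where
  p : M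
  T : ℝ
  T_pos : 0 < T
  closed : φlam T p = p
  t : ℝ
  t_pos : 0 < t
  t_lt : t < K.t₀
  period_eq : T = Real.exp (-t) * deriv K.h t
  /-- The multiplicity `ℓ_γ`. -/
  l : ℕ
  l_isGreatest : IsGreatest {k : ℕ | 0 < k ∧ ∀ θ : ℝ,
    C.G (φlam (-(T * (θ + 1 / k))) p, t) = C.G (φlam (-(T * θ)) p, t)} l
  V : Set (Std (m + 1))
  V_isOpen : IsOpen V
  V_periodic : ∀ y, y ∈ V ↔ y + e₁ m ∈ V
  V_circle : ∀ q : ℝ, q • e₁ m ∈ V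
  κ : Std (m + 1) → What
  κ_smooth : ContMDiffOn 𝓘(ℝ, Std (m + 1)) (𝓡 (2 * m + 2)) ∞ κ V
  κ_eq_iff : ∀ y ∈ V, ∀ y' ∈ V, κ y = κ y' ↔ ∃ j : ℤ, y' = y + (j : ℝ) • e₁ m
  κ_symplectic : ∀ y ∈ V, ∀ v w : Std (m + 1),
    C.Ω (κ y) (mfderiv 𝓘(ℝ, Std (m + 1)) (𝓡 (2 * m + 2)) κ y v)
      (mfderiv 𝓘(ℝ, Std (m + 1)) (𝓡 (2 * m + 2)) κ y w) = stdForm v w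
  /-- `ψ(γ_H(θ)) = (ℓ_γ θ, 0)`. -/
  κ_circle : ∀ θ : ℝ, κ ((l * θ) • e₁ m) = C.G (φlam (-(T * θ)) p, t)
  /-- The cutoff function. -/
  ρ : Std (m + 1) → ℝ
  ρ_smooth : ContDiff ℝ ∞ ρ
  ρ_periodic : ∀ y, ρ (y + e₁ m) = ρ y
  ρ_mem : ∀ y, ρ y ∈ Icc (0 : ℝ) 1
  ρ_circle : ∀ q : ℝ, ρ (q • e₁ m) = 1
  ρ_support : ∃ S : Set (Std (m + 1)), IsCompact S ∧ S ⊆ V ∧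
    ∀ y, ρ y ≠ 0 → ∃ j : ℤ, y + (j : ℝ) • e₁ m ∈ S
  /-- The Morse function on the circle, with one minimum and one maximum. -/
  f : ℝ → ℝ
  f_smooth : ContDiff ℝ ∞ f
  f_periodic : ∀ q, f (q + 1) = f q
  qmin : ℝ
  qmax : ℝ
  f_crit : ∀ q, deriv f q = 0 ↔ (∃ j : ℤ, q = qmin + j) ∨ ∃ j : ℤ, q = qmax + j
  f_min : 0 < deriv (deriv f) qmin
  f_max : deriv (deriv f) qmax < 0

namespace OrbitPerturbation

variable {C : SymplecticCompletion m What M} {φlam : ℝ → M → M} {K : C.AdmissibleHamiltonian φlam}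

/-- The open set `U_γ`. -/
def U (d : OrbitPerturbation C φlam K) : Set What := d.κ '' d.V

open Classical in
/-- The function `ρ(ψ(x)) f_γ(ψ₁(x) - ℓ_γ θ)` on `U_γ`, extended by `0`. -/
def bump (d : OrbitPerturbation C φlam K) (θ : ℝ) (x : What) : ℝ :=
  if hx : ∃ y, y ∈ d.V ∧ d.κ y = x then
    d.ρ hx.choose * d.f (hx.choose (Sum.inl 0) - d.l * θ)
  else 0

/-- The element of the circle `S_γ` which starts at the point with coordinate `ψ₁ = q`, that is,
the orbit `θ ↦ γ_H(θ + q / ℓ_γ)`. -/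
def orbit (d : OrbitPerturbation C φlam K) (q θ : ℝ) : What := d.κ ((d.l * θ + q) • e₁ m)

end OrbitPerturbation

/-- The perturbed Hamiltonian `H_δ`, for a finite family of circles. -/
def perturbedHamiltonian {C : SymplecticCompletion m What M} {φlam : ℝ → M → M}
    {K : C.AdmissibleHamiltonian φlam} {ι : Type*} [Fintype ι]
    (d : ι → OrbitPerturbation C φlam K) (δ θ : ℝ) (x : What) : ℝ :=
  K.H x + δ * ∑ i, (d i).bump θ x

/-! ### Trivializations and indices -/

/-- The inclusion `ℝ^{2m} = ℝ^{2m} × 0 × 0 → ℝ^{2(m+1)}`. -/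
def inclStd (v : Std m) : Std (m + 1) :=
  Sum.elim (fun i => Fin.lastCases (motive := fun _ => ℝ) 0 (fun j => v (.inl j)) i)
    (fun i => Fin.lastCases (motive := fun _ => ℝ) 0 (fun j => v (.inr j)) i)

/-- The choices which determine the indices of `γ` and of the orbits in `S_γ`. Maps on `S¹ = ℝ/ℤ`
are 1-periodic maps on `ℝ`. -/
structure CappingData [IsManifold (𝓡 (2 * m + 2)) ∞ What]
    [IsManifold (𝓡 (2 * m + 1)) ∞ M] {C : SymplecticCompletion m What M} {φlam : ℝ → M → M}
    {K : C.AdmissibleHamiltonian φlam} (d : OrbitPerturbation C φlam K) where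
  /-- The reference loop `l_a` in `Ŵ` and the trivialization `Φ_a`. -/
  la : ℝ → What
  Φa : SymplecticFrame (fun x v w => C.Ω x v w) (m + 1) la
  Φa_periodic : ∀ r v, Φa.vec (r + 1) v = Φa.vec r v
  /-- The reference loop `l_b` in `M`. -/
  lb : ℝ → M
  /-- The homotopy `h_{ab}` from `l_a` to `l_b`, and the extension of `Φ_a` over it; its restriction
  to the end `l_b` is `Φ'_b`. -/
  hab : ℝ × Icc (0 : ℝ) 1 → What
  hab_end : ∀ r, hab (r, 1) = C.G (lb r, 0)
  Φab : SymplecticFrame (fun x v w => C.Ω x v w) (m + 1) hab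
  Φab_periodic : ∀ r s v, Φab.vec (r + 1, s) v = Φab.vec (r, s) v
  Φab_start : ∀ r v, Φab.vec (r, 0) v = Φa.vec r v
  /-- The trivialization `Φ_b` of `l_b^* ξ`. -/
  Φb : SymplecticFrame (extDerivOne C.lam) m lb
  Φb_mem : ∀ r v, C.lam (lb r) (Φb.map r v) = 0
  Φb_periodic : ∀ r v, Φb.vec (r + 1) v = Φb.vec r v
  /-- A homotopy of trivializations of `l_b^* TŴ`, from `Φ'_b` to one that maps `ℝ^{2m} × 0 × 0`,
  `0 × ℝ × 0` and `0 × 0 × ℝ` to `ξ`, `⟨∂/∂t⟩` and `⟨R_λ⟩`, and that restricts to `Φ_b`. -/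
  Θ : SymplecticFrame (fun x v w => C.Ω x v w) (m + 1)
    (fun z : ℝ × Icc (0 : ℝ) 1 => C.G (lb z.1, 0))
  Θ_periodic : ∀ r s v, Θ.vec (r + 1, s) v = Θ.vec (r, s) v
  Θ_start : ∀ r v, Θ.vec (r, 0) v = Φab.vec (r, 1) v
  Θ_xi : ∀ r v, Θ.map (r, 1) (inclStd v) = C.push (lb r) 0 (Φb.map r v) 0
  Θ_liouville : ∀ r, ∃ c : ℝ,
    Θ.map (r, 1) (Pi.single (Sum.inl (Fin.last m)) 1) = c • C.push (lb r) 0 0 1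
  Θ_reeb : ∀ r, ∃ c : ℝ,
    Θ.map (r, 1) (Pi.single (Sum.inr (Fin.last m)) 1) = c • C.push (lb r) 0 (C.reeb (lb r)) 0
  /-- The surface `σ_γ : Σ → M` from `l_b` to `γ`, and the trivialization `Φ_γ` of `σ_γ^* ξ` which
  extends `Φ_b`. -/
  g : ℕ
  σ : Surface g → M
  σ_start : ∀ r ∈ Icc (0 : ℝ) 1, σ (Surface.bdry₀ r) = lb r
  σ_end : ∀ r ∈ Icc (0 : ℝ) 1, σ (Surface.bdry₁ r) = φlam (d.T * r) d.p
  Φγ : SymplecticFrame (extDerivOne C.lam) m σ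
  Φγ_mem : ∀ z v, C.lam (σ z) (Φγ.map z v) = 0
  Φγ_start : ∀ r ∈ Icc (0 : ℝ) 1, ∀ v, Φγ.vec (Surface.bdry₀ r) v = Φb.vec r v
  /-- The surface for the orbits in `S_γ` is the concatenation of `h_{ab}`, of `σ_γ` and of the
  cylinder from `γ` to the level `t`, with the opposite orientation because `γ_H` runs along `-R_λ`
  (so that it starts at the reversed loop of `l_a`, with the reversed trivialization). The
  trivialization over it that extends `Φ_a` consists of trivializations over the pieces which agree
  on the common boundary circles: the first piece is `Φ_{ab}`, the others follow. -/
  ΦS : SymplecticFrame (fun x v w => C.Ω x v w) (m + 1) (fun z => C.G (σ z, 0))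
  ΦS_start : ∀ r ∈ Icc (0 : ℝ) 1, ∀ v, ΦS.vec (Surface.bdry₀ r) v = Φab.vec (r, 1) v
  Φcyl : SymplecticFrame (fun x v w => C.Ω x v w) (m + 1)
    (fun z : ℝ × Icc (0 : ℝ) 1 => C.G (φlam (d.T * z.1) d.p, (z.2 : ℝ) * d.t))
  Φcyl_periodic : ∀ r s v, Φcyl.vec (r + 1, s) v = Φcyl.vec (r, s) v
  Φcyl_start : ∀ r ∈ Icc (0 : ℝ) 1, ∀ v, Φcyl.vec (r, 0) v = ΦS.vec (Surface.bdry₁ r) v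

namespace CappingData

variable [IsManifold (𝓡 (2 * m + 2)) ∞ What] [IsManifold (𝓡 (2 * m + 1)) ∞ M]
  {C : SymplecticCompletion m What M} {φlam : ℝ → M → M} {K : C.AdmissibleHamiltonian φlam}
  {d : OrbitPerturbation C φlam K}

/-- The path `s ↦ Φ_γ⁻¹ ∘ dφ_λ^{Ts}(p) ∘ Φ_γ`, `0 ≤ s ≤ 1`, in `Sp(2m)`. -/
def reebPath (c : CappingData d) (s : ℝ) : Mat m :=
  transportMatrix (F := EuclideanSpace ℝ (Fin (2 * m + 1)))
    (c.Φγ.map (Surface.bdry₁ s))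
    (mfderiv (𝓡 (2 * m + 1)) (𝓡 (2 * m + 1)) (φlam (d.T * s)) d.p).toLinearMap
    (c.Φγ.map (Surface.bdry₁ 0))

/-- The trivialization of `TŴ` along `θ ↦ γ_H(θ + q / ℓ_γ)`. -/
def orbitFrame (c : CappingData d) (q θ : ℝ) :
    Std (m + 1) →ₗ[ℝ] EuclideanSpace ℝ (Fin (2 * m + 2)) :=
  c.Φcyl.map (-(θ + q / d.l), 1)

/-- The path `θ ↦ Φ⁻¹ ∘ dφ^θ(x(0)) ∘ Φ` in `Sp(2(m+1))`, for the orbit `x` of `φ` in `S_γ` which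
starts at `ψ₁ = q`. -/
def orbitPath (c : CappingData d) (φ : ℝ → What → What) (q θ : ℝ) : Mat (m + 1) :=
  transportMatrix (c.orbitFrame q θ)
    (mfderiv (𝓡 (2 * m + 2)) (𝓡 (2 * m + 2)) (φ θ) (d.orbit q 0)).toLinearMap
    (c.orbitFrame q 0)

/-- `μ(γ) = k` for the closed Reeb orbit `γ`: the Conley–Zehnder index of the linearized flow. -/
def HasReebIndex (c : CappingData d) (k : ℤ) : Prop :=
  IsConleyZehnderIndex c.reebPath k

/-- `μ(x) = k` for the orbit `x` of the Hamiltonian flow `φ` which starts at `ψ₁ = q`: minus the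
Conley–Zehnder index of the linearized flow. -/
def HasOrbitIndex (c : CappingData d) (φ : ℝ → What → What) (q : ℝ) (k : ℤ) : Prop :=
  IsConleyZehnderIndex (c.orbitPath φ q) (-k)

end CappingData

/-- The element of `S_γ` which starts at `ψ₁ = q` is a nondegenerate 1-periodic orbit of `φ`. -/
def IsNondegenerateOrbit {C : SymplecticCompletion m What M} {φlam : ℝ → M → M}
    {K : C.AdmissibleHamiltonian φlam} (d : OrbitPerturbation C φlam K)
    (φ : ℝ → What → What) (q : ℝ) : Prop :=
  (∀ θ, φ θ (d.orbit q 0) = d.orbit q θ) ∧ (∀ θ, d.orbit q (θ + 1) = d.orbit q θ) ∧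
  ∀ v : EuclideanSpace ℝ (Fin (2 * m + 2)),
    mfderiv (𝓡 (2 * m + 2)) (𝓡 (2 * m + 2)) (φ 1) (d.orbit q 0) v = v → v = 0

end

end MorseBott

namespace MorseBott

noncomputable section

/-! ### Continuous angles of nonvanishing complex functions -/

/-! On the end, `X_H = -e^{-t} h'(t) R_λ`. Along `γ_H` its linearized flow `Z` is therefore the
linearized Reeb flow run backwards on `ξ`, together with a shear of rate `b = e^{-t}(h'' - h') > 0`
in the plane of `∂_t` and `R_λ`. Transversal nondegeneracy on `ξ` and `b ≠ 0` on `∂_t` leave the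
direction `e₁` of the circle as the only eigendirection of `Z(1)` for the eigenvalue 1
(`ker_Zmat_one`).

On the circle the cutoff function attains its maximum and `f_γ` is evaluated at `ψ₁ - ℓθ`, which is
constant along each orbit. So the loop starting at a critical point `q` of `f_γ` remains an orbit of
`H_δ` (`flow_orbit`). The linearized flow along it is `Z(θ+a) N(θ) Z(a)⁻¹` with `a = q/ℓ`, where `N'
= δ B N` and `ω(B e₁, e₁) = f_γ''(q)` for all `θ` (`hasDerivAt_Nmat`, `stdForm_Bmat_e₁`). For small
`δ` only the sign of `f_γ''(q)` matters. By a first-order perturbation argument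
(`nondegenerate_perturbation`), `N` can be deformed to a shear in the direction of `∂_t` whose rate
`c` has the sign of `f_γ''(q)`, while `Z(1) N(1)` never acquires the eigenvalue 1
(`exists_perturbation_homotopy`). This yields the nondegeneracy of the orbits as well.

In the split frame the deformed path is the direct sum of `s ↦ Ψ(1-s) Ψ(1)⁻¹`, where `Ψ` is the
linearized Reeb flow, and of a product of two shears of rates `b` and `c` in a plane. The first
summand has index `-μ(γ)`. The second has index `-1` if `c > 0` and `0` if `c < 0`
(`shear_index_neg_one`, `shear_index_zero`). The product formula, and the minus sign in the
definition of `μ(x)`, give `μ(γ) + 1` at the minimum and `μ(γ)` at the maximum.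

It remains to replace the split frame by the frame of the capping surface. Their ratio is a loop of
symplectic matrices. Over `l_b` it is homotopic to matrices `1 ⊕ diag(a, 1/a)`, so its degree is
zero there. The degree does not change across the surface, because the handles contribute
commutators (`AngleInc.surface`, `angleInc_capping`), and a frame change of degree zero leaves the
index alone (`IsConleyZehnderIndex.change_frame`).

Indices are handled through `isConleyZehnderIndex_iff`: the increment of an angle along the path
plus the increment along a nondegenerate path to a reference matrix. The relation "`k` is the index"
is carried from one path to the next, so uniqueness of `k` never enters. -/

/-- The angle is the imaginary part of a lift of `f` through the covering `exp` of the punctured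
plane; the lift exists because `A` is simply connected. -/
theorem exists_continuous_angle {A : Type*} [TopologicalSpace A] [SimplyConnectedSpace A]
    [LocallyPathConnectedSpace A] [Nonempty A] (f : A → ℂ) (hf : Continuous f)
    (h0 : ∀ a, f a ≠ 0) :
    ∃ α : A → ℝ, Continuous α ∧ ∀ a, f a = (‖f a‖ : ℂ) * Complex.exp (Complex.I * (α a : ℂ)) := by
  obtain ⟨a₀⟩ := ‹Nonempty A›
  obtain ⟨F, ⟨-, hF⟩, -⟩ := Complex.isCoveringMapOn_exp.existsUnique_continuousMap_lifts
    (⟨f, hf⟩ : C(A, ℂ)) (a₀ := a₀) (e₀ := Complex.log (f a₀)) (Complex.exp_log (h0 a₀))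
    (fun a => h0 a)
  refine ⟨fun a => (F a).im, Complex.continuous_im.comp F.continuous, fun a => ?_⟩
  have h : Complex.exp (F a) = f a := congrFun hF a
  rw [← h, Complex.norm_exp, mul_comm Complex.I, Complex.ofReal_exp, ← Complex.exp_add,
    Complex.re_add_im]

/-- The continuous angle of the nonvanishing function `c` changes by `r` along `[a, b]`. -/
def AngleInc (c : ℝ → ℂ) (a b r : ℝ) : Prop :=
  (∀ s ∈ Icc a b, c s ≠ 0) ∧ ∃ α : ℝ → ℝ, ContinuousOn α (Icc a b) ∧
    (∀ s ∈ Icc a b, c s = (‖c s‖ : ℂ) * Complex.exp (Complex.I * (α s : ℂ))) ∧ α b - α a = r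

theorem exists_angle_rect (F : ℝ → ℝ → ℂ) {a b c d : ℝ} (hab : a ≤ b) (hcd : c ≤ d)
    (hF : ContinuousOn (fun z : ℝ × ℝ => F z.1 z.2) (Icc a b ×ˢ Icc c d))
    (h0 : ∀ u ∈ Icc a b, ∀ s ∈ Icc c d, F u s ≠ 0) :
    ∃ α : ℝ → ℝ → ℝ, Continuous (fun z : ℝ × ℝ => α z.1 z.2) ∧
      ∀ u ∈ Icc a b, ∀ s ∈ Icc c d,
        F u s = (‖F u s‖ : ℂ) * Complex.exp (Complex.I * (α u s : ℂ)) := by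
  -- Retracting the plane onto the rectangle gives a function on a simply connected space without
  -- any assumption on `F` outside the rectangle.
  let g : ℝ × ℝ → ℝ × ℝ := fun z => (projIcc a b hab z.1, projIcc c d hcd z.2)
  have hg : Continuous g := by fun_prop
  have hg' : ∀ z, g z ∈ Icc a b ×ˢ Icc c d := fun z => ⟨Subtype.coe_prop _, Subtype.coe_prop _⟩
  obtain ⟨α, hα, h⟩ := exists_continuous_angle (fun z : ℝ × ℝ => F (g z).1 (g z).2)
    (hF.comp_continuous hg hg') (fun z => h0 _ (hg' z).1 _ (hg' z).2)
  refine ⟨fun u s => α (u, s), hα, fun u hu s hs => ?_⟩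
  have := h (u, s)
  simpa [g, projIcc_of_mem hab hu, projIcc_of_mem hcd hs] using this

theorem AngleInc.exists {c : ℝ → ℂ} {a b : ℝ} (hab : a ≤ b) (hc : ContinuousOn c (Icc a b))
    (h0 : ∀ s ∈ Icc a b, c s ≠ 0) : ∃ r, AngleInc c a b r := by
  obtain ⟨α, hα, h⟩ := exists_angle_rect (fun _ s => c s) (zero_le_one (α := ℝ)) hab
    (hc.comp continuousOn_snd fun z hz => hz.2) (fun _ _ s hs => h0 s hs)
  exact ⟨_, h0, α 0, (hα.comp (by fun_prop : Continuous fun s : ℝ => ((0 : ℝ), s))).continuousOn,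
    fun s hs => h 0 (by simp) s hs, rfl⟩

/-- Two continuous angles of the same function differ by a constant. -/
theorem angle_unique {c : ℝ → ℂ} {a b : ℝ} (hab : a ≤ b) (h0 : ∀ s ∈ Icc a b, c s ≠ 0)
    {α β : ℝ → ℝ} (hα : ContinuousOn α (Icc a b)) (hβ : ContinuousOn β (Icc a b))
    (h : ∀ s ∈ Icc a b, c s = (‖c s‖ : ℂ) * Complex.exp (Complex.I * (α s : ℂ)))
    (h' : ∀ s ∈ Icc a b, c s = (‖c s‖ : ℂ) * Complex.exp (Complex.I * (β s : ℂ))) :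
    α b - α a = β b - β a := by
  have key : ∀ s ∈ Icc a b, ∃ n : ℤ, α s - β s = n * (2 * Real.pi) := by
    intro s hs
    have h1 : Complex.exp (Complex.I * (α s : ℂ)) = Complex.exp (Complex.I * (β s : ℂ)) := by
      have hn : (‖c s‖ : ℂ) ≠ 0 := by simpa using h0 s hs
      exact mul_left_cancel₀ hn ((h s hs).symm.trans (h' s hs))
    obtain ⟨n, hn⟩ := Complex.exp_eq_exp_iff_exists_int.1 h1
    refine ⟨n, ?_⟩
    have := congrArg Complex.im hn
    simp at this
    linarith
  let γ : ℝ → ℝ := fun s => (α s - β s) / (2 * Real.pi)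
  have hγ : ContinuousOn γ (Icc a b) := (hα.sub hβ).div_const _
  have hpi : (2 * Real.pi) ≠ 0 := by positivity
  have hγ' : ∀ s ∈ Icc a b, γ s ∈ range (Int.cast : ℤ → ℝ) := by
    intro s hs
    obtain ⟨n, hn⟩ := key s hs
    exact ⟨n, by simp [γ, hn, hpi]⟩
  have : γ b = γ a := by
    have hd : IsPreconnected (γ '' Icc a b) := isPreconnected_Icc.image _ hγ
    -- The normalized difference of the angles is integer valued and continuous on an interval,
    -- hence constant.
    have hsub : (γ '' Icc a b).Subsingleton := by
      have hti : IsTotallyDisconnected (range (Int.cast : ℤ → ℝ)) :=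
        (countable_range _).isTotallyDisconnected
      exact hti _ (by rintro _ ⟨s, hs, rfl⟩; exact hγ' s hs) hd
    exact hsub ⟨b, right_mem_Icc.2 hab, rfl⟩ ⟨a, left_mem_Icc.2 hab, rfl⟩
  have : α b - β b = α a - β a := by
    have := congrArg (· * (2 * Real.pi)) this
    simpa [γ, hpi] using this
  linarith

/-! ### Calculus of angle increments -/

namespace AngleInc

variable {c c' : ℝ → ℂ} {a b r r' : ℝ}

theorem unique (hab : a ≤ b) (h : AngleInc c a b r) (h' : AngleInc c a b r') : r = r' := by
  obtain ⟨h0, α, hα, h1, rfl⟩ := h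
  obtain ⟨-, β, hβ, h2, rfl⟩ := h'
  exact angle_unique hab h0 hα hβ h1 h2

theorem congr (h : AngleInc c a b r) (hc : ∀ s ∈ Icc a b, c' s = c s) : AngleInc c' a b r := by
  obtain ⟨h0, α, hα, h1, h2⟩ := h
  refine ⟨fun s hs => hc s hs ▸ h0 s hs, α, hα, fun s hs => ?_, h2⟩
  rw [hc s hs]; exact h1 s hs

/-- Reparametrization by a continuous map. -/
theorem comp {a' b' : ℝ} (h : AngleInc c a b r) {g : ℝ → ℝ} (hg : ContinuousOn g (Icc a' b'))
    (hm : MapsTo g (Icc a' b') (Icc a b)) (ha : g a' = a) (hb : g b' = b) :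
    AngleInc (fun s => c (g s)) a' b' r := by
  obtain ⟨h0, α, hα, h1, h2⟩ := h
  exact ⟨fun s hs => h0 _ (hm hs), fun s => α (g s), hα.comp hg hm, fun s hs => h1 _ (hm hs),
    by simp only [ha, hb, h2]⟩

theorem reverse {a' b' : ℝ} (h : AngleInc c a b r) {g : ℝ → ℝ} (hg : ContinuousOn g (Icc a' b'))
    (hm : MapsTo g (Icc a' b') (Icc a b)) (ha : g a' = b) (hb : g b' = a) :
    AngleInc (fun s => c (g s)) a' b' (-r) := by
  obtain ⟨h0, α, hα, h1, h2⟩ := h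
  exact ⟨fun s hs => h0 _ (hm hs), fun s => α (g s), hα.comp hg hm, fun s hs => h1 _ (hm hs),
    by simp only [ha, hb, ← h2]; ring⟩

theorem conj (h : AngleInc c a b r) : AngleInc (fun s => (starRingEnd ℂ) (c s)) a b (-r) := by
  obtain ⟨h0, α, hα, h1, h2⟩ := h
  refine ⟨fun s hs => by simpa using h0 s hs, fun s => - α s, hα.neg, fun s hs => ?_, by
    rw [← h2]; ring⟩
  beta_reduce
  conv_lhs => rw [h1 s hs]
  rw [map_mul, ← Complex.exp_conj]
  simp

theorem mul (h : AngleInc c a b r) (h' : AngleInc c' a b r') :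
    AngleInc (fun s => c s * c' s) a b (r + r') := by
  obtain ⟨h0, α, hα, h1, h2⟩ := h
  obtain ⟨h0', α', hα', h1', h2'⟩ := h'
  refine ⟨fun s hs => mul_ne_zero (h0 s hs) (h0' s hs), fun s => α s + α' s, hα.add hα',
    fun s hs => ?_, by rw [← h2, ← h2']; ring⟩
  beta_reduce
  conv_lhs => rw [h1 s hs, h1' s hs]
  rw [norm_mul]
  push_cast
  rw [mul_add, Complex.exp_add]
  ring

theorem const {z : ℂ} (hz : z ≠ 0) : AngleInc (fun _ => z) a b 0 := by
  refine ⟨fun _ _ => hz, fun _ => z.arg, continuousOn_const, fun _ _ => ?_, by simp⟩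
  rw [mul_comm Complex.I, Complex.norm_mul_exp_arg_mul_I]

theorem const_mul {z : ℂ} (hz : z ≠ 0) (h : AngleInc c a b r) :
    AngleInc (fun s => z * c s) a b r := by
  simpa using (const hz).mul h

/-- The angle of a continuous nonvanishing real function is constant. -/
theorem of_im_eq_zero (hc : ContinuousOn c (Icc a b)) (h0 : ∀ s ∈ Icc a b, c s ≠ 0)
    (him : ∀ s ∈ Icc a b, (c s).im = 0) : AngleInc c a b 0 := by
  have hre0 : ∀ s ∈ Icc a b, (c s).re ≠ 0 := fun s hs h => h0 s hs (Complex.ext h (him s hs))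
  have hre : ContinuousOn (fun s => (c s).re) (Icc a b) := Complex.continuous_re.comp_continuousOn hc
  have hsub : IsPreconnected ((fun s => (c s).re) '' Icc a b) := isPreconnected_Icc.image _ hre
  have hsign : (∀ s ∈ Icc a b, 0 < (c s).re) ∨ ∀ s ∈ Icc a b, (c s).re < 0 := by
    by_contra hcon
    push Not at hcon
    obtain ⟨⟨s, hs, h1⟩, ⟨t, ht, h2⟩⟩ := hcon
    obtain ⟨w, hw, hw0⟩ := hsub.ordConnected.out ⟨s, hs, rfl⟩ ⟨t, ht, rfl⟩ ⟨h1, h2⟩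
    exact hre0 w hw hw0
  rcases hsign with h | h
  · refine ⟨h0, fun _ => 0, continuousOn_const, fun s hs => ?_, by simp⟩
    have : ‖c s‖ = (c s).re := by
      rw [← Complex.re_add_im (c s), him s hs]; simp [abs_of_pos (h s hs)]
    rw [this]; apply Complex.ext <;> simp [him s hs]
  · refine ⟨h0, fun _ => Real.pi, continuousOn_const, fun s hs => ?_, by simp⟩
    have : ‖c s‖ = -(c s).re := by
      rw [← Complex.re_add_im (c s), him s hs]; simp [abs_of_neg (h s hs)]
    rw [this, mul_comm Complex.I, Complex.exp_pi_mul_I]; apply Complex.ext <;> simp [him s hs]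

theorem of_slitPlane (hc : ContinuousOn c (Icc a b)) (h : ∀ s ∈ Icc a b, c s ∈ Complex.slitPlane) :
    AngleInc c a b ((c b).arg - (c a).arg) := by
  refine ⟨fun s hs => Complex.slitPlane_ne_zero (h s hs), fun s => (c s).arg, fun s hs => ?_,
    fun s hs => ?_, rfl⟩
  · exact (Complex.continuousAt_arg (h s hs)).comp_continuousWithinAt (hc s hs)
  · rw [mul_comm Complex.I, Complex.norm_mul_exp_arg_mul_I]

theorem trans {e : ℝ} (hab : a ≤ b) (hbe : b ≤ e) (h : AngleInc c a b r)
    (h' : AngleInc c b e r') : AngleInc c a e (r + r') := by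
  obtain ⟨h0, α, hα, h1, h2⟩ := h
  obtain ⟨h0', β, hβ, h1', h2'⟩ := h'
  have hb : ∃ n : ℤ, α b = β b + n * (2 * Real.pi) := by
    have hn : (‖c b‖ : ℂ) ≠ 0 := by simpa using h0 b (right_mem_Icc.2 hab)
    have := mul_left_cancel₀ hn ((h1 b (right_mem_Icc.2 hab)).symm.trans
      (h1' b (left_mem_Icc.2 hbe)))
    obtain ⟨n, hn⟩ := Complex.exp_eq_exp_iff_exists_int.1 this
    refine ⟨n, ?_⟩
    have := congrArg Complex.im hn
    simpa using this
  obtain ⟨n, hn⟩ := hb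
  have hU : Icc a e = Icc a b ∪ Icc b e := (Icc_union_Icc_eq_Icc hab hbe).symm
  let γ : ℝ → ℝ := fun s => if s ≤ b then α s else β s + n * (2 * Real.pi)
  have hγ1 : ∀ s ∈ Icc a b, γ s = α s := fun s hs => by simp [γ, hs.2]
  have hγ2 : ∀ s ∈ Icc b e, γ s = β s + n * (2 * Real.pi) := by
    intro s hs
    rcases hs.1.eq_or_lt with rfl | hlt
    · simp [γ, hn]
    · simp [γ, not_le.2 hlt]
  refine ⟨?_, γ, ?_, ?_, ?_⟩
  · intro s hs
    rw [hU] at hs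
    exact hs.elim (h0 s) (h0' s)
  · rw [hU]
    exact (hα.congr hγ1).union_of_isClosed ((hβ.add continuousOn_const).congr hγ2)
      isClosed_Icc isClosed_Icc
  · intro s hs
    rw [hU] at hs
    rcases hs with hs | hs
    · rw [hγ1 s hs]; exact h1 s hs
    · rw [hγ2 s hs]
      have : Complex.exp (Complex.I * ((β s + n * (2 * Real.pi) : ℝ) : ℂ)) =
          Complex.exp (Complex.I * (β s : ℂ)) :=
        Complex.exp_eq_exp_iff_exists_int.2 ⟨n, by push_cast; ring⟩
      rw [this]; exact h1' s hs
  · rw [hγ1 a (left_mem_Icc.2 hab), hγ2 e (right_mem_Icc.2 hbe), ← h2, ← h2', hn]; ring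

/-- The change of the angle along the boundary of a rectangle is zero. -/
theorem rect {F : ℝ → ℝ → ℂ} {a b c d : ℝ} (hab : a ≤ b) (hcd : c ≤ d)
    (hF : ContinuousOn (fun z : ℝ × ℝ => F z.1 z.2) (Icc a b ×ˢ Icc c d))
    (h0 : ∀ u ∈ Icc a b, ∀ s ∈ Icc c d, F u s ≠ 0) {r₁ r₂ r₃ r₄ : ℝ}
    (h₁ : AngleInc (fun u => F u c) a b r₁) (h₂ : AngleInc (F b) c d r₂)
    (h₃ : AngleInc (F a) c d r₃) (h₄ : AngleInc (fun u => F u d) a b r₄) :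
    r₁ + r₂ = r₃ + r₄ := by
  obtain ⟨α, hα, h⟩ := exists_angle_rect F hab hcd hF h0
  have hc := left_mem_Icc.2 hcd
  have hd := right_mem_Icc.2 hcd
  have ha := left_mem_Icc.2 hab
  have hb := right_mem_Icc.2 hab
  have e₁ : r₁ = α b c - α a c := h₁.unique hab ⟨h₁.1, fun u => α u c,
    (hα.comp (by fun_prop : Continuous fun u : ℝ => (u, c))).continuousOn,
    fun u hu => h u hu c hc, rfl⟩
  have e₄ : r₄ = α b d - α a d := h₄.unique hab ⟨h₄.1, fun u => α u d,
    (hα.comp (by fun_prop : Continuous fun u : ℝ => (u, d))).continuousOn,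
    fun u hu => h u hu d hd, rfl⟩
  have e₂ : r₂ = α b d - α b c := h₂.unique hcd ⟨h₂.1, fun u => α b u,
    (hα.comp (by fun_prop : Continuous fun u : ℝ => (b, u))).continuousOn,
    fun u hu => h b hb u hu, rfl⟩
  have e₃ : r₃ = α a d - α a c := h₃.unique hcd ⟨h₃.1, fun u => α a u,
    (hα.comp (by fun_prop : Continuous fun u : ℝ => (a, u))).continuousOn,
    fun u hu => h a ha u hu, rfl⟩
  rw [e₁, e₂, e₃, e₄]; ring

/-- The change of the angle along the diagonal of a square. -/
theorem diag {F : ℝ → ℝ → ℂ} {a b : ℝ} (hab : a ≤ b)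
    (hF : ContinuousOn (fun z : ℝ × ℝ => F z.1 z.2) (Icc a b ×ˢ Icc a b))
    (h0 : ∀ u ∈ Icc a b, ∀ s ∈ Icc a b, F u s ≠ 0) {r₁ r₂ : ℝ}
    (h₁ : AngleInc (fun u => F u a) a b r₁) (h₂ : AngleInc (F b) a b r₂) :
    AngleInc (fun s => F s s) a b (r₁ + r₂) := by
  obtain ⟨α, hα, h⟩ := exists_angle_rect F hab hab hF h0
  have ha := left_mem_Icc.2 hab
  have hb := right_mem_Icc.2 hab
  have e₁ : r₁ = α b a - α a a := h₁.unique hab ⟨h₁.1, fun u => α u a,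
    (hα.comp (by fun_prop : Continuous fun u : ℝ => (u, a))).continuousOn,
    fun u hu => h u hu a ha, rfl⟩
  have e₂ : r₂ = α b b - α b a := h₂.unique hab ⟨h₂.1, fun u => α b u,
    (hα.comp (by fun_prop : Continuous fun u : ℝ => (b, u))).continuousOn,
    fun u hu => h b hb u hu, rfl⟩
  exact ⟨fun s hs => h0 s hs s hs, fun s => α s s,
    (hα.comp (by fun_prop : Continuous fun u : ℝ => (u, u))).continuousOn,
    fun s hs => h s hs s hs, by rw [e₁, e₂]; ring⟩

/-- The change of the angle along the sides of a homotopy of loops. -/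
theorem rect_loops {F : ℝ → ℝ → ℂ} {a b c d : ℝ} (hab : a ≤ b) (hcd : c ≤ d)
    (hF : ContinuousOn (fun z : ℝ × ℝ => F z.1 z.2) (Icc a b ×ˢ Icc c d))
    (h0 : ∀ u ∈ Icc a b, ∀ s ∈ Icc c d, F u s ≠ 0) (hper : ∀ s ∈ Icc c d, F b s = F a s) {r : ℝ}
    (h : AngleInc (fun u => F u c) a b r) : AngleInc (fun u => F u d) a b r := by
  have hc := left_mem_Icc.2 hcd
  have hd := right_mem_Icc.2 hcd
  have cont : ∀ u ∈ Icc a b, ContinuousOn (F u) (Icc c d) := fun u hu =>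
    hF.comp (by fun_prop : ContinuousOn (fun s : ℝ => (u, s)) _) fun s hs => ⟨hu, hs⟩
  obtain ⟨r', h'⟩ := AngleInc.exists hab
    (hF.comp (by fun_prop : ContinuousOn (fun u : ℝ => (u, d)) (Icc a b)) fun s hs => ⟨hs, hd⟩)
    (fun u hu => h0 u hu d hd)
  obtain ⟨s, hs⟩ := AngleInc.exists hcd (cont a (left_mem_Icc.2 hab))
    (fun u hu => h0 a (left_mem_Icc.2 hab) u hu)
  have hs' : AngleInc (F b) c d s := hs.congr hper
  have := rect hab hcd hF h0 h hs' hs h'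
  have : r = r' := by linarith
  exact this ▸ h'

end AngleInc

/-! ### Symplectic matrices and the complex determinant -/

/-- The symplectic inverse. -/
def sinv {n : ℕ} (A : Mat n) : Mat n := -(Matrix.J (Fin n) ℝ * A.transpose * Matrix.J (Fin n) ℝ)

section SymplecticInverse

variable {n : ℕ} {A B : Mat n}

theorem continuous_sinv : Continuous (sinv : Mat n → Mat n) := by
  unfold sinv
  fun_prop

theorem sinv_mul_self (hA : A ∈ Matrix.symplecticGroup (Fin n) ℝ) : sinv A * A = 1 := by
  rw [sinv, Matrix.neg_mul]
  exact SymplecticGroup.inv_left_mul_aux hA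

theorem mul_sinv_self (hA : A ∈ Matrix.symplecticGroup (Fin n) ℝ) : A * sinv A = 1 :=
  mul_eq_one_comm.1 (sinv_mul_self hA)

theorem sinv_mem (hA : A ∈ Matrix.symplecticGroup (Fin n) ℝ) :
    sinv A ∈ Matrix.symplecticGroup (Fin n) ℝ := by
  unfold sinv
  exact SymplecticGroup.neg_mem (mul_mem (mul_mem (SymplecticGroup.J_mem _ _)
    (SymplecticGroup.transpose_mem hA)) (SymplecticGroup.J_mem _ _))

theorem sinv_one : sinv (1 : Mat n) = 1 := by
  simp [sinv, Matrix.J_squared]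

theorem sinv_mul (A B : Mat n) : sinv (A * B) = sinv B * sinv A := by
  have h := Matrix.J_squared (Fin n) ℝ
  simp only [sinv, Matrix.transpose_mul, neg_mul_neg]
  calc -(Matrix.J (Fin n) ℝ * (B.transpose * A.transpose) * Matrix.J (Fin n) ℝ)
      = Matrix.J (Fin n) ℝ * B.transpose * (Matrix.J (Fin n) ℝ * Matrix.J (Fin n) ℝ) *
          (A.transpose * Matrix.J (Fin n) ℝ) := by rw [h]; noncomm_ring
    _ = _ := by noncomm_ring

theorem det_one_sub_conj (hA : A ∈ Matrix.symplecticGroup (Fin n) ℝ) (B : Mat n) :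
    (1 - sinv A * B * A).det = (1 - B).det := by
  have : 1 - sinv A * B * A = sinv A * (1 - B) * A := by
    rw [mul_sub, sub_mul, mul_one, sinv_mul_self hA]
  have h1 : (sinv A).det * A.det = 1 := by
    rw [← Matrix.det_mul, sinv_mul_self hA, Matrix.det_one]
  rw [this, Matrix.det_mul, Matrix.det_mul, mul_right_comm, h1, one_mul]

/-- The sign reflects the convention that `Matrix.J` has the blocks `0, -1, 1, 0`. -/
theorem stdForm_eq (v w : Std n) : stdForm v w = -(v ⬝ᵥ (Matrix.J (Fin n) ℝ).mulVec w) := by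
  simp [stdForm, Matrix.J, Matrix.fromBlocks_mulVec, dotProduct, Fintype.sum_sum_type,
    Finset.sum_sub_distrib, Matrix.neg_mulVec]
  ring

theorem mem_symplecticGroup_iff_stdForm :
    A ∈ Matrix.symplecticGroup (Fin n) ℝ ↔
      ∀ v w, stdForm (A.mulVec v) (A.mulVec w) = stdForm v w := by
  rw [SymplecticGroup.mem_iff']
  have key : ∀ v w, stdForm (A.mulVec v) (A.mulVec w) =
      -(v ⬝ᵥ (A.transpose * Matrix.J (Fin n) ℝ * A).mulVec w) := by
    intro v w
    rw [stdForm_eq, Matrix.mul_assoc, ← Matrix.mulVec_mulVec, ← Matrix.mulVec_mulVec,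
      Matrix.dotProduct_mulVec v, Matrix.vecMul_transpose]
  constructor
  · intro h v w
    rw [key, h, stdForm_eq]
  · intro h
    ext i j
    have := h (Pi.single i 1) (Pi.single j 1)
    rw [key, stdForm_eq, neg_inj] at this
    simpa using this

end SymplecticInverse

/-- (Twice) the complex linear part of a real matrix. -/
def complexMat {k : ℕ} (A : Mat k) : Matrix (Fin k) (Fin k) ℂ :=
  Matrix.of fun i j : Fin k =>
    ((A (.inl i) (.inl j) + A (.inr i) (.inr j) : ℝ) : ℂ) +
      Complex.I * ((A (.inr i) (.inl j) - A (.inl i) (.inr j) : ℝ) : ℂ)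

theorem complexDet_eq {k : ℕ} (A : Mat k) : complexDet A = (complexMat A).det := rfl

theorem continuous_complexDet {k : ℕ} : Continuous (complexDet : Mat k → ℂ) := by
  unfold complexDet
  refine Continuous.matrix_det (continuous_matrix fun i j => ?_)
  simp only [Matrix.of_apply]
  fun_prop

theorem complexDet_transpose {k : ℕ} (A : Mat k) :
    complexDet A.transpose = (starRingEnd ℂ) (complexDet A) := by
  rw [complexDet_eq, complexDet_eq, starRingEnd_apply, ← Matrix.det_conjTranspose]
  congr 1
  ext i j
  simp [complexMat, Matrix.conjTranspose_apply]
  ring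

/-- A complex vector killed by the complex linear part is a real vector `v` killed by `A - JAJ`.
Multiplying by `Aᵀ` and using `AᵀJA = J` gives `(AᵀA + 1) v = 0`, and `AᵀA + 1` is positive
definite. -/
theorem complexDet_ne_zero {k : ℕ} {A : Mat k} (hA : A ∈ Matrix.symplecticGroup (Fin k) ℝ) :
    complexDet A ≠ 0 := by
  intro h
  obtain ⟨z, hz, hz0⟩ := Matrix.exists_mulVec_eq_zero_iff.2 h
  apply hz
  let v : Std k := Sum.elim (fun i => (z i).re) (fun i => (z i).im)
  have hv : (A - Matrix.J (Fin k) ℝ * A * Matrix.J (Fin k) ℝ).mulVec v = 0 := by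
    have hcomp : A - Matrix.J (Fin k) ℝ * A * Matrix.J (Fin k) ℝ =
        Matrix.of fun i j => match i, j with
          | .inl i, .inl j => A (.inl i) (.inl j) + A (.inr i) (.inr j)
          | .inl i, .inr j => A (.inl i) (.inr j) - A (.inr i) (.inl j)
          | .inr i, .inl j => A (.inr i) (.inl j) - A (.inl i) (.inr j)
          | .inr i, .inr j => A (.inl i) (.inl j) + A (.inr i) (.inr j) := by
      obtain ⟨a, b, c, d, rfl⟩ : ∃ a b c d, A = Matrix.fromBlocks a b c d :=
        ⟨_, _, _, _, (Matrix.fromBlocks_toBlocks A).symm⟩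
      ext (i | i) (j | j) <;> simp [Matrix.J, Matrix.fromBlocks_multiply]; ring
    rw [hcomp]
    ext (i | i)
    · have := congrArg Complex.re (congrFun hz0 i)
      simp only [Matrix.mulVec, dotProduct, Matrix.of_apply, Pi.zero_apply, Complex.re_sum,
        Complex.zero_re] at this
      simp only [Matrix.mulVec, dotProduct, Fintype.sum_sum_type, Matrix.of_apply, v,
        Sum.elim_inl, Sum.elim_inr, Pi.zero_apply, ← Finset.sum_add_distrib]
      rw [← this]
      refine Finset.sum_congr rfl fun j _ => ?_
      simp
      ring
    · have := congrArg Complex.im (congrFun hz0 i)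
      simp only [Matrix.mulVec, dotProduct, Matrix.of_apply, Pi.zero_apply, Complex.im_sum,
        Complex.zero_im] at this
      simp only [Matrix.mulVec, dotProduct, Fintype.sum_sum_type, Matrix.of_apply, v,
        Sum.elim_inl, Sum.elim_inr, Pi.zero_apply, ← Finset.sum_add_distrib]
      rw [← this]
      refine Finset.sum_congr rfl fun j _ => ?_
      simp
      ring
  have h1 : (A.transpose * A + 1).mulVec v = 0 := by
    have h2 : A.transpose * (A - Matrix.J (Fin k) ℝ * A * Matrix.J (Fin k) ℝ) =
        A.transpose * A + 1 := by
      have := SymplecticGroup.mem_iff'.1 hA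
      calc _ = A.transpose * A - (A.transpose * Matrix.J (Fin k) ℝ * A) * Matrix.J (Fin k) ℝ := by
            noncomm_ring
        _ = _ := by rw [this, Matrix.J_squared]; noncomm_ring
    rw [← h2, ← Matrix.mulVec_mulVec, hv, Matrix.mulVec_zero]
  have h3 : A.mulVec v ⬝ᵥ A.mulVec v + v ⬝ᵥ v = 0 := by
    have := congrArg (fun w => v ⬝ᵥ w) h1
    simp only [Matrix.add_mulVec, Matrix.one_mulVec, dotProduct_add, dotProduct_zero,
      ← Matrix.mulVec_mulVec] at this
    rwa [Matrix.dotProduct_mulVec v, Matrix.vecMul_transpose] at this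
  have hpos : ∀ w : Std k, 0 ≤ w ⬝ᵥ w := fun w =>
    Finset.sum_nonneg fun i _ => mul_self_nonneg _
  have h4 : v ⬝ᵥ v = 0 := le_antisymm (by linarith [hpos (A.mulVec v)]) (hpos v)
  have h5 : v = 0 := dotProduct_self_eq_zero.1 h4
  ext i
  exact Complex.ext (congrFun h5 (.inl i)) (congrFun h5 (.inr i))

/-! ### Direct sums -/

/-- The splitting of the coordinates of `ℝ^{2(m+1)}` into those of `ℝ^{2m}` and those of the last
plane. -/
def splitEquiv (m : ℕ) : (Fin m ⊕ Fin m) ⊕ (Fin 1 ⊕ Fin 1) ≃ Fin (m + 1) ⊕ Fin (m + 1) :=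
  (Equiv.sumSumSumComm _ _ _ _).trans (Equiv.sumCongr finSumFinEquiv finSumFinEquiv)

/-- The direct sum of a matrix on `ℝ^{2m}` and one on the last coordinate plane. -/
def dsum {m : ℕ} (P : Mat m) (Q : Mat 1) : Mat (m + 1) :=
  Matrix.reindex (splitEquiv m) (splitEquiv m) (Matrix.fromBlocks P 0 0 Q)

section DirectSum

variable {m : ℕ}

theorem dsum_mul (P P' : Mat m) (Q Q' : Mat 1) :
    dsum P Q * dsum P' Q' = dsum (P * P') (Q * Q') := by
  simp [dsum, Matrix.submatrix_mul_equiv, Matrix.fromBlocks_multiply]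

theorem dsum_one : dsum (1 : Mat m) (1 : Mat 1) = 1 := by
  simp [dsum, Matrix.fromBlocks_one]

theorem dsum_sub (P P' : Mat m) (Q Q' : Mat 1) :
    dsum P Q - dsum P' Q' = dsum (P - P') (Q - Q') := by
  ext i j
  obtain ⟨i, rfl⟩ := (splitEquiv m).surjective i
  obtain ⟨j, rfl⟩ := (splitEquiv m).surjective j
  rcases i with i | i <;> rcases j with j | j <;> simp [dsum]

theorem dsum_neg (P : Mat m) (Q : Mat 1) : -dsum P Q = dsum (-P) (-Q) := by
  have h : dsum (0 : Mat m) 0 = 0 := by simp [dsum]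
  have := dsum_sub 0 P 0 Q
  simpa [h] using this

theorem dsum_neg_one : dsum (-1 : Mat m) (-1 : Mat 1) = -1 := by
  rw [← dsum_neg, dsum_one]

theorem dsum_transpose (P : Mat m) (Q : Mat 1) :
    (dsum P Q).transpose = dsum P.transpose Q.transpose := by
  simp [dsum, Matrix.fromBlocks_transpose]

theorem dsum_J : dsum (Matrix.J (Fin m) ℝ) (Matrix.J (Fin 1) ℝ) = Matrix.J (Fin (m + 1)) ℝ := by
  ext i j
  obtain ⟨i, rfl⟩ := (splitEquiv m).surjective i
  obtain ⟨j, rfl⟩ := (splitEquiv m).surjective j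
  simp only [dsum, Matrix.reindex_apply, Matrix.submatrix_apply, Equiv.symm_apply_apply]
  rcases i with (i | i) | (i | i) <;> rcases j with (j | j) | (j | j) <;>
    simp [splitEquiv, Matrix.J, Matrix.one_apply, Fin.ext_iff] <;> omega

theorem dsum_mem {P : Mat m} {Q : Mat 1} (hP : P ∈ Matrix.symplecticGroup (Fin m) ℝ)
    (hQ : Q ∈ Matrix.symplecticGroup (Fin 1) ℝ) :
    dsum P Q ∈ Matrix.symplecticGroup (Fin (m + 1)) ℝ := by
  rw [SymplecticGroup.mem_iff, dsum_transpose, ← dsum_J, dsum_mul, dsum_mul,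
    SymplecticGroup.mem_iff.1 hP, SymplecticGroup.mem_iff.1 hQ]

theorem det_one_sub_dsum (P : Mat m) (Q : Mat 1) :
    (1 - dsum P Q).det = (1 - P).det * (1 - Q).det := by
  rw [← dsum_one, dsum_sub, dsum, Matrix.det_reindex_self, Matrix.det_fromBlocks_zero₂₁]

theorem complexDet_dsum (P : Mat m) (Q : Mat 1) :
    complexDet (dsum P Q) = complexDet P * complexDet Q := by
  simp only [complexDet_eq]
  have : complexMat (dsum P Q) =
      Matrix.reindex finSumFinEquiv finSumFinEquiv
        (Matrix.fromBlocks (complexMat P) 0 0 (complexMat Q)) := by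
    ext i j
    obtain ⟨i, rfl⟩ := finSumFinEquiv.surjective i
    obtain ⟨j, rfl⟩ := finSumFinEquiv.surjective j
    have h1 : ∀ i : Fin m ⊕ Fin 1, (splitEquiv m).symm (.inl (finSumFinEquiv i)) =
        Sum.map Sum.inl Sum.inl i := by
      intro i; rw [Equiv.symm_apply_eq]; rcases i with i | i <;> simp [splitEquiv]
    have h2 : ∀ i : Fin m ⊕ Fin 1, (splitEquiv m).symm (.inr (finSumFinEquiv i)) =
        Sum.map Sum.inr Sum.inr i := by
      intro i; rw [Equiv.symm_apply_eq]; rcases i with i | i <;> simp [splitEquiv]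
    simp only [complexMat, dsum, Matrix.reindex_apply, Matrix.submatrix_apply, Matrix.of_apply,
      h1, h2, Equiv.symm_apply_apply]
    rcases i with i | i <;> rcases j with j | j <;> simp
  rw [this, Matrix.det_reindex_self, Matrix.det_fromBlocks_zero₂₁]

theorem continuous_dsum : Continuous fun z : Mat m × Mat 1 => dsum z.1 z.2 := by
  unfold dsum
  simp only [Matrix.reindex_apply]
  exact Continuous.matrix_submatrix (Continuous.matrix_fromBlocks continuous_fst continuous_const
    continuous_const continuous_snd) _ _

end DirectSum

/-! ### Paths of symplectic matrices without eigenvalue one -/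

/-- There is a path from `A` to `B` in the symplectic matrices without eigenvalue `1`, along which
the angle of `complexDet` changes by `r`. -/
def Conn {n : ℕ} (A B : Mat n) (r : ℝ) : Prop :=
  ∃ ζ : ℝ → Mat n, ContinuousOn ζ (Icc 0 1) ∧
    (∀ s ∈ Icc (0 : ℝ) 1, ζ s ∈ Matrix.symplecticGroup (Fin n) ℝ) ∧
    (∀ s ∈ Icc (0 : ℝ) 1, (1 - ζ s).det ≠ 0) ∧ ζ 0 = A ∧ ζ 1 = B ∧
    AngleInc (fun s => complexDet (ζ s)) 0 1 r

/-- `A` is joined, in the symplectic matrices without eigenvalue `1`, to one of the two reference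
matrices. -/
def Terminal {n : ℕ} (A : Mat n) (r : ℝ) : Prop :=
  Conn A (-1) r ∨ Conn A (matWMinus n) r

theorem continuousOn_concat {E : Type*} [TopologicalSpace E] {f g : ℝ → E} {a b c : ℝ}
    (hab : a ≤ b) (hbc : b ≤ c) (hf : ContinuousOn f (Icc a b)) (hg : ContinuousOn g (Icc b c))
    (h : f b = g b) : ContinuousOn (fun s => if s ≤ b then f s else g s) (Icc a c) := by
  have h1 : ∀ s ∈ Icc a b, (if s ≤ b then f s else g s) = f s := fun s hs => if_pos hs.2
  have h2 : ∀ s ∈ Icc b c, (if s ≤ b then f s else g s) = g s := by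
    intro s hs
    rcases hs.1.eq_or_lt with rfl | hlt
    · simp [h]
    · simp [not_le.2 hlt]
  rw [← Icc_union_Icc_eq_Icc hab hbc]
  exact (hf.congr h1).union_of_isClosed (hg.congr h2) isClosed_Icc isClosed_Icc

theorem mapsTo_affine {a b c d x y : ℝ} (h : ∀ s ∈ Icc a b, c ≤ x * s + y ∧ x * s + y ≤ d) :
    MapsTo (fun s : ℝ => x * s + y) (Icc a b) (Icc c d) := fun s hs => h s hs

namespace Conn

variable {n : ℕ} {A B D : Mat n} {r r' : ℝ}

theorem trans (h : Conn A B r) (h' : Conn B D r') : Conn A D (r + r') := by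
  obtain ⟨ζ, hc, hs, hd, rfl, rfl, ha⟩ := h
  obtain ⟨ξ, hc', hs', hd', h0', rfl, ha'⟩ := h'
  have m1 : MapsTo (fun s : ℝ => 2 * s + 0) (Icc 0 (1 / 2)) (Icc 0 1) :=
    mapsTo_affine fun s hs => ⟨by linarith [hs.1], by linarith [hs.2]⟩
  have m2 : MapsTo (fun s : ℝ => 2 * s + (-1)) (Icc (1 / 2) 1) (Icc 0 1) :=
    mapsTo_affine fun s hs => ⟨by linarith [hs.1], by linarith [hs.2]⟩
  have key : ∀ P : Mat n → Prop, (∀ s ∈ Icc (0 : ℝ) 1, P (ζ s)) → (∀ s ∈ Icc (0 : ℝ) 1, P (ξ s)) →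
      ∀ s ∈ Icc (0 : ℝ) 1, P (if s ≤ 1 / 2 then ζ (2 * s + 0) else ξ (2 * s + (-1))) := by
    intro P h1 h2 s hs
    split_ifs with h
    · exact h1 _ (m1 ⟨hs.1, h⟩)
    · exact h2 _ (m2 ⟨(not_le.1 h).le, hs.2⟩)
  have hj : ζ (2 * (1 / 2) + 0) = ξ (2 * (1 / 2) + (-1)) := by norm_num [h0']
  refine ⟨fun s => if s ≤ 1 / 2 then ζ (2 * s + 0) else ξ (2 * s + (-1)), ?_,
    key (· ∈ Matrix.symplecticGroup (Fin n) ℝ) hs hs', key (fun B => (1 - B).det ≠ 0) hd hd', by norm_num, by norm_num, ?_⟩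
  · exact continuousOn_concat (by norm_num) (by norm_num) (hc.comp (by fun_prop) m1)
      (hc'.comp (by fun_prop) m2) hj
  · refine AngleInc.trans (b := 1 / 2) (by norm_num) (by norm_num)
      ((ha.comp (by fun_prop) m1 (by norm_num) (by norm_num)).congr fun s hs => ?_)
      ((ha'.comp (by fun_prop) m2 (by norm_num) (by norm_num)).congr fun s hs => ?_)
    · beta_reduce; rw [if_pos hs.2]
    · beta_reduce
      rcases hs.1.eq_or_lt with rfl | hlt
      · rw [if_pos le_rfl, hj]
      · rw [if_neg (not_le.2 hlt)]

theorem symm (h : Conn A B r) : Conn B A (-r) := by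
  obtain ⟨ζ, hc, hs, hd, rfl, rfl, ha⟩ := h
  have m1 : MapsTo (fun s : ℝ => -1 * s + 1) (Icc 0 1) (Icc 0 1) :=
    mapsTo_affine fun s hs => ⟨by linarith [hs.2], by linarith [hs.1]⟩
  exact ⟨fun s => ζ (-1 * s + 1), hc.comp (by fun_prop) m1, fun s h => hs _ (m1 h),
    fun s h => hd _ (m1 h), by norm_num, by norm_num,
    ha.reverse (by fun_prop) m1 (by norm_num) (by norm_num)⟩

theorem det_left (h : Conn A B r) : (1 - A).det ≠ 0 := by
  obtain ⟨ζ, hc, hs, hd, rfl, rfl, ha⟩ := h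
  exact hd 0 (by simp)

theorem transpose (h : Conn A B r) : Conn A.transpose B.transpose (-r) := by
  obtain ⟨ζ, hc, hs, hd, rfl, rfl, ha⟩ := h
  refine ⟨fun s => (ζ s).transpose, by fun_prop, fun s h => SymplecticGroup.transpose_mem (hs s h),
    fun s h => ?_, rfl, rfl, ha.conj.congr fun s _ => complexDet_transpose _⟩
  have := hd s h
  rwa [← Matrix.det_transpose, Matrix.transpose_sub, Matrix.transpose_one] at this

theorem dsum {m : ℕ} {P P' : Mat m} {Q Q' : Mat 1} (h : Conn P P' r) (h' : Conn Q Q' r') :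
    Conn (dsum P Q) (MorseBott.dsum P' Q') (r + r') := by
  obtain ⟨ζ, hc, hs, hd, rfl, rfl, ha⟩ := h
  obtain ⟨ξ, hc', hs', hd', rfl, rfl, ha'⟩ := h'
  refine ⟨fun s => MorseBott.dsum (ζ s) (ξ s), continuous_dsum.comp_continuousOn (hc.prodMk hc'),
    fun s h => dsum_mem (hs s h) (hs' s h), fun s h => ?_, rfl, rfl,
    (ha.mul ha').congr fun s _ => complexDet_dsum _ _⟩
  rw [det_one_sub_dsum]
  exact mul_ne_zero (hd s h) (hd' s h)

/-- A path along which `complexDet` is real. -/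
theorem of_real {ζ : ℝ → Mat n} (hc : ContinuousOn ζ (Icc 0 1))
    (hs : ∀ s ∈ Icc (0 : ℝ) 1, ζ s ∈ Matrix.symplecticGroup (Fin n) ℝ)
    (hd : ∀ s ∈ Icc (0 : ℝ) 1, (1 - ζ s).det ≠ 0)
    (him : ∀ s ∈ Icc (0 : ℝ) 1, (complexDet (ζ s)).im = 0) : Conn (ζ 0) (ζ 1) 0 :=
  ⟨ζ, hc, hs, hd, rfl, rfl, AngleInc.of_im_eq_zero (continuous_complexDet.comp_continuousOn hc)
    (fun s h => complexDet_ne_zero (hs s h)) him⟩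

end Conn

theorem Conn.terminal {n : ℕ} {A B : Mat n} {r r' : ℝ} (h : Conn A B r) (h' : Terminal B r') :
    Terminal A (r + r') :=
  h'.imp h.trans h.trans

/-- The Conley–Zehnder index in terms of the changes of the angle along the path and along a path
from its end to one of the reference matrices. -/
theorem isConleyZehnderIndex_iff {n : ℕ} {Ψ : ℝ → Mat n} {k : ℤ} :
    IsConleyZehnderIndex Ψ k ↔ Ψ 0 = 1 ∧ ContinuousOn Ψ (Icc 0 1) ∧
      (∀ s ∈ Icc (0 : ℝ) 1, Ψ s ∈ Matrix.symplecticGroup (Fin n) ℝ) ∧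
      ∃ r r', AngleInc (fun s => complexDet (Ψ s)) 0 1 r ∧ Terminal (Ψ 1) r' ∧
        r + r' = k * Real.pi := by
  constructor
  · rintro ⟨h0, χ, α, hχ, hα, heq, hsp, hd, hend, hang, hk⟩
    have s1 : Icc (0 : ℝ) 1 ⊆ Icc 0 2 := Icc_subset_Icc le_rfl one_le_two
    have m1 : MapsTo (fun s : ℝ => 1 * s + 1) (Icc 0 1) (Icc 1 2) :=
      mapsTo_affine fun s hs => ⟨by linarith [hs.1], by linarith [hs.2]⟩
    have m2 : MapsTo (fun s : ℝ => 1 * s + 1) (Icc 0 1) (Icc 0 2) :=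
      mapsTo_affine fun s hs => ⟨by linarith [hs.1], by linarith [hs.2]⟩
    refine ⟨h0, (hχ.mono s1).congr fun s hs => (heq s hs).symm,
      fun s hs => heq s hs ▸ hsp s (s1 hs), α 1 - α 0, α 2 - α 1, ?_, ?_, by rw [← hk]; ring⟩
    · refine ⟨fun s hs => ?_, α, hα.mono s1, fun s hs => ?_, rfl⟩
      · beta_reduce; rw [← heq s hs]; exact complexDet_ne_zero (hsp s (s1 hs))
      · beta_reduce; rw [← heq s hs]; exact hang s (s1 hs)
    · have hconn : ∀ B, χ 2 = B → Conn (Ψ 1) B (α 2 - α 1) := by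
        rintro B rfl
        refine ⟨fun s => χ (1 * s + 1), hχ.comp (by fun_prop) m2, fun s hs => hsp _ (m2 hs),
          fun s hs => hd _ (m1 hs), ?_, by norm_num, fun s hs => complexDet_ne_zero (hsp _ (m2 hs)),
          fun s => α (1 * s + 1), hα.comp (by fun_prop) m2, fun s hs => hang _ (m2 hs), by norm_num⟩
        rw [← heq 1 (by simp)]; norm_num
      exact hend.imp (hconn _) (hconn _)
  · rintro ⟨h0, hΨ, hsp, r, r', hr, hT, hk⟩
    have hconn : ∃ B, (B = -1 ∨ B = matWMinus n) ∧ Conn (Ψ 1) B r' := by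
      rcases hT with h | h
      · exact ⟨_, .inl rfl, h⟩
      · exact ⟨_, .inr rfl, h⟩
    obtain ⟨B, hB, ζ, hc, hs, hd, hζ0, rfl, ha⟩ := hconn
    have m1 : MapsTo (fun s : ℝ => 1 * s + (-1)) (Icc 1 2) (Icc 0 1) :=
      mapsTo_affine fun s hs => ⟨by linarith [hs.1], by linarith [hs.2]⟩
    let χ : ℝ → Mat n := fun s => if s ≤ 1 then Ψ s else ζ (1 * s + (-1))
    have hj : Ψ 1 = ζ (1 * 1 + (-1)) := by norm_num [hζ0]
    have e1 : ∀ s ∈ Icc (0 : ℝ) 1, χ s = Ψ s := fun s hs => if_pos hs.2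
    have e2 : ∀ s ∈ Icc (1 : ℝ) 2, χ s = ζ (1 * s + (-1)) := by
      intro s hs
      rcases hs.1.eq_or_lt with rfl | hlt
      · simp only [χ, le_refl, if_true, hj]
      · simp only [χ, if_neg (not_le.2 hlt)]
    have hang : AngleInc (fun s => complexDet (χ s)) 0 2 (r + r') :=
      AngleInc.trans zero_le_one one_le_two (hr.congr fun s hs => by rw [e1 s hs])
        ((ha.comp (by fun_prop) m1 (by norm_num) (by norm_num)).congr fun s hs => by rw [e2 s hs])
    obtain ⟨-, α, hα, h1, h2⟩ := hang
    refine ⟨h0, χ, α, continuousOn_concat zero_le_one one_le_two hΨ (hc.comp (by fun_prop) m1) hj,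
      hα, e1, fun s hs' => ?_, fun s hs' => ?_, ?_, h1, by rw [h2, hk]⟩
    · rcases le_total s 1 with h | h
      · rw [e1 s ⟨hs'.1, h⟩]; exact hsp s ⟨hs'.1, h⟩
      · rw [e2 s ⟨h, hs'.2⟩]; exact hs _ (m1 ⟨h, hs'.2⟩)
    · rw [e2 s hs']; exact hd _ (m1 hs')
    · have : χ 2 = ζ 1 := by rw [e2 2 (by norm_num)]; norm_num
      rwa [this]

/-! ### Invariance properties of the Conley–Zehnder index -/

namespace IsConleyZehnderIndex

variable {n : ℕ} {Ψ : ℝ → Mat n} {k : ℤ}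

theorem congr {Ψ' : ℝ → Mat n} (h : IsConleyZehnderIndex Ψ k)
    (he : ∀ s ∈ Icc (0 : ℝ) 1, Ψ' s = Ψ s) : IsConleyZehnderIndex Ψ' k := by
  obtain ⟨h0, χ, α, hχ, hα, heq, h⟩ := h
  exact ⟨by rw [he 0 (by simp), h0], χ, α, hχ, hα, fun s hs => by rw [he s hs, heq s hs], h⟩

theorem continuousOn (h : IsConleyZehnderIndex Ψ k) : ContinuousOn Ψ (Icc 0 1) :=
  (isConleyZehnderIndex_iff.1 h).2.1

theorem mem (h : IsConleyZehnderIndex Ψ k) :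
    ∀ s ∈ Icc (0 : ℝ) 1, Ψ s ∈ Matrix.symplecticGroup (Fin n) ℝ :=
  (isConleyZehnderIndex_iff.1 h).2.2.1

theorem zero (h : IsConleyZehnderIndex Ψ k) : Ψ 0 = 1 := h.1

theorem det_ne_zero (h : IsConleyZehnderIndex Ψ k) : (1 - Ψ 1).det ≠ 0 := by
  obtain ⟨-, -, -, r, r', -, hT, -⟩ := isConleyZehnderIndex_iff.1 h
  exact hT.elim (·.det_left) (·.det_left)

/-- Homotopy invariance, for homotopies whose end stays in the matrices without eigenvalue `1`. -/
theorem homotopy {H : ℝ → ℝ → Mat n}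
    (hH : ContinuousOn (fun z : ℝ × ℝ => H z.1 z.2) (Icc 0 1 ×ˢ Icc 0 1))
    (hsp : ∀ u ∈ Icc (0 : ℝ) 1, ∀ s ∈ Icc (0 : ℝ) 1, H u s ∈ Matrix.symplecticGroup (Fin n) ℝ)
    (h0 : ∀ u ∈ Icc (0 : ℝ) 1, H u 0 = 1) (h1 : ∀ u ∈ Icc (0 : ℝ) 1, (1 - H u 1).det ≠ 0)
    (h : IsConleyZehnderIndex (H 0) k) : IsConleyZehnderIndex (H 1) k := by
  obtain ⟨-, -, -, r, r', hr, hT, hk⟩ := isConleyZehnderIndex_iff.1 h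
  have z0 : (0 : ℝ) ∈ Icc (0 : ℝ) 1 := by simp
  have z1 : (1 : ℝ) ∈ Icc (0 : ℝ) 1 := by simp
  have hF := continuous_complexDet.comp_continuousOn hH
  have hF0 : ∀ u ∈ Icc (0 : ℝ) 1, ∀ s ∈ Icc (0 : ℝ) 1, complexDet (H u s) ≠ 0 :=
    fun u hu s hs => complexDet_ne_zero (hsp u hu s hs)
  have c1 : ContinuousOn (H 1) (Icc 0 1) :=
    hH.comp (by fun_prop : ContinuousOn (fun s : ℝ => ((1 : ℝ), s)) _) fun s hs => ⟨z1, hs⟩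
  have c2 : ContinuousOn (fun u => H u 1) (Icc 0 1) :=
    hH.comp (by fun_prop : ContinuousOn (fun s : ℝ => (s, (1 : ℝ))) _) fun s hs => ⟨hs, z1⟩
  obtain ⟨r₂, hr₂⟩ := AngleInc.exists zero_le_one (continuous_complexDet.comp_continuousOn c1)
    (hF0 1 z1)
  obtain ⟨r₄, hr₄⟩ := AngleInc.exists zero_le_one (continuous_complexDet.comp_continuousOn c2)
    (fun u hu => hF0 u hu 1 z1)
  have hr₁ : AngleInc (fun u => complexDet (H u 0)) 0 1 0 :=
    (AngleInc.const (complexDet_ne_zero (one_mem _))).congr fun u hu => by rw [h0 u hu]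
  -- The side `s = 0` of the square is constant, so the increments along the old and the new path
  -- differ by the one along the side `s = 1`. That side consists of nondegenerate matrices; run
  -- backwards, it precedes the old path to the reference matrix.
  have hsum := AngleInc.rect zero_le_one zero_le_one hF hF0 hr₁ hr₂ hr hr₄
  have hconn : Conn (H 0 1) (H 1 1) r₄ :=
    ⟨fun u => H u 1, c2, fun u hu => hsp u hu 1 z1, h1, rfl, rfl, hr₄⟩
  exact isConleyZehnderIndex_iff.2 ⟨h0 1 z1, c1, hsp 1 z1, r₂, -r₄ + r', hr₂,
    hconn.symm.terminal hT, by rw [← hk]; linarith⟩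

/-- Multiplication with a loop of degree zero. -/
theorem loop_mul {L : ℝ → Mat n} (hL : ContinuousOn L (Icc 0 1))
    (hLsp : ∀ s ∈ Icc (0 : ℝ) 1, L s ∈ Matrix.symplecticGroup (Fin n) ℝ) (hL0 : L 0 = 1)
    (hL1 : L 1 = 1) (hdeg : AngleInc (fun s => complexDet (L s)) 0 1 0)
    (h : IsConleyZehnderIndex Ψ k) : IsConleyZehnderIndex (fun s => L s * Ψ s) k := by
  obtain ⟨h0, hΨ, hsp, r, r', hr, hT, hk⟩ := isConleyZehnderIndex_iff.1 h
  have hc : ContinuousOn (fun z : ℝ × ℝ => L z.1 * Ψ z.2) (Icc 0 1 ×ˢ Icc 0 1) :=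
    (hL.comp continuousOn_fst fun z hz => hz.1).mul (hΨ.comp continuousOn_snd fun z hz => hz.2)
  refine isConleyZehnderIndex_iff.2 ⟨by simp [h0, hL0], hL.mul hΨ,
    fun s hs => mul_mem (hLsp s hs) (hsp s hs), 0 + r, r', ?_, by simpa [hL1] using hT,
    by rw [zero_add, hk]⟩
  -- The product is the diagonal of the square `(u, s) ↦ L u * Ψ s`. Going along two sides instead,
  -- first `L` with `Ψ 0 = 1` and then `Ψ` with `L 1 = 1`, gives `0 + r`.
  refine AngleInc.diag (F := fun u s => complexDet (L u * Ψ s)) zero_le_one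
    (continuous_complexDet.comp_continuousOn hc)
    (fun u hu s hs => complexDet_ne_zero (mul_mem (hLsp u hu) (hsp s hs))) ?_ ?_
  · simpa [h0] using hdeg
  · simpa [hL1] using hr

/-- Transposition conjugates `complexDet`, preserves `det (1 - A)`, and fixes both reference
matrices, which are diagonal. -/
theorem transpose (h : IsConleyZehnderIndex Ψ k) :
    IsConleyZehnderIndex (fun s => (Ψ s).transpose) (-k) := by
  obtain ⟨h0, hΨ, hsp, r, r', hr, hT, hk⟩ := isConleyZehnderIndex_iff.1 h
  refine isConleyZehnderIndex_iff.2 ⟨by simp [h0], by fun_prop,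
    fun s hs => SymplecticGroup.transpose_mem (hsp s hs), -r, -r',
    hr.conj.congr fun s _ => complexDet_transpose _, ?_, by push_cast; linarith⟩
  refine hT.imp (fun h => ?_) (fun h => ?_)
  · simpa using h.transpose
  · simpa [matWMinus] using h.transpose

/-- Conjugation with a path of symplectic matrices which ends at the identity. -/
theorem conj {D : ℝ → Mat n} (hD : ContinuousOn D (Icc 0 1))
    (hDsp : ∀ s ∈ Icc (0 : ℝ) 1, D s ∈ Matrix.symplecticGroup (Fin n) ℝ) (hD1 : D 0 = 1)
    (h : IsConleyZehnderIndex Ψ k) :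
    IsConleyZehnderIndex (fun s => sinv (D 1) * Ψ s * D 1) k := by
  refine homotopy (H := fun u s => sinv (D u) * Ψ s * D u) ?_ ?_ ?_ ?_
    (h.congr fun s _ => by simp [hD1, sinv_one])
  · have h1 : ContinuousOn (fun z : ℝ × ℝ => D z.1) (Icc 0 1 ×ˢ Icc 0 1) :=
      hD.comp continuousOn_fst fun z hz => hz.1
    have h2 : ContinuousOn (fun z : ℝ × ℝ => Ψ z.2) (Icc 0 1 ×ˢ Icc 0 1) :=
      h.continuousOn.comp continuousOn_snd fun z hz => hz.2
    exact ((continuous_sinv.comp_continuousOn h1).mul h2).mul h1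
  · exact fun u hu s hs => mul_mem (mul_mem (sinv_mem (hDsp u hu)) (h.mem s hs)) (hDsp u hu)
  · intro u hu
    simp [h.zero, sinv_mul_self (hDsp u hu)]
  · intro u hu
    rw [det_one_sub_conj (hDsp u hu)]
    exact h.det_ne_zero

end IsConleyZehnderIndex

/-! ### The reference matrices and direct sums -/

/-- A path of matrices `A ⊕ A⁻ᵀ`. -/
theorem Conn.of_hyperbolic {n : ℕ} {A B : ℝ → Matrix (Fin n) (Fin n) ℝ}
    (hA : ContinuousOn A (Icc 0 1)) (hB : ContinuousOn B (Icc 0 1))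
    (hAB : ∀ s ∈ Icc (0 : ℝ) 1, (A s).transpose * B s = 1)
    (hd : ∀ s ∈ Icc (0 : ℝ) 1, (1 - A s).det ≠ 0) :
    Conn (Matrix.fromBlocks (A 0) 0 0 (B 0)) (Matrix.fromBlocks (A 1) 0 0 (B 1)) 0 := by
  refine Conn.of_real (ζ := fun s => Matrix.fromBlocks (A s) 0 0 (B s)) ?_ ?_ ?_ ?_
  · have hc : Continuous fun z : Matrix (Fin n) (Fin n) ℝ × Matrix (Fin n) (Fin n) ℝ =>
        Matrix.fromBlocks z.1 0 0 z.2 := Continuous.matrix_fromBlocks continuous_fst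
      continuous_const continuous_const continuous_snd
    exact hc.comp_continuousOn (hA.prodMk hB)
  · intro s hs
    have h1 := hAB s hs
    have h2 : (B s).transpose * A s = 1 := by
      rw [← Matrix.transpose_inj]; simpa using h1
    rw [SymplecticGroup.mem_iff']
    simp [Matrix.J, Matrix.fromBlocks_transpose, Matrix.fromBlocks_multiply, h1, h2]
  · intro s hs
    have h1 := hAB s hs
    have h3 : (1 - Matrix.fromBlocks (A s) 0 0 (B s) : Mat n) =
        Matrix.fromBlocks (1 - A s) 0 0 (1 - B s) := by
      ext (i | i) (j | j) <;> simp [Matrix.one_apply]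
    have h4 : (A s).transpose * (1 - B s) = -(1 - A s).transpose := by
      rw [mul_sub, h1, Matrix.transpose_sub]; simp
    have h5 : (1 - B s).det ≠ 0 := by
      intro h
      have := congrArg Matrix.det h4
      rw [Matrix.det_mul, h, mul_zero, Matrix.det_neg, Matrix.det_transpose] at this
      exact hd s hs (by simpa using this.symm)
    rw [h3, Matrix.det_fromBlocks_zero₂₁]
    exact mul_ne_zero (hd s hs) h5
  · intro s _
    -- The complex linear part is the real matrix `A + B`, so the angle is constant.
    have : complexMat (Matrix.fromBlocks (A s) 0 0 (B s)) = (A s + B s).map Complex.ofRealHom := by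
      ext i j
      simp [complexMat]
    rw [complexDet_eq, this, ← RingHom.mapMatrix_apply, ← RingHom.map_det]
    simp

theorem det_ne_zero_of_mul_eq_one {ι : Type*} [Fintype ι] [DecidableEq ι] {A B : Matrix ι ι ℝ}
    (h : A * B = 1) : A.det ≠ 0 := by
  intro h0
  have := congrArg Matrix.det h
  simp [h0] at this

/-- The matrix with eigenvalue `2` on `v` and `-1` on the orthogonal complement, for a unit vector
`v`, together with its inverse transpose. -/
def reflBlock {n : ℕ} (v : Fin n → ℝ) : Mat n :=
  Matrix.fromBlocks (-1 + (3 : ℝ) • Matrix.vecMulVec v v) 0 0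
    (-1 + (3 / 2 : ℝ) • Matrix.vecMulVec v v)

/-- The hyperbolic direction can be turned freely: the spectrum of `reflBlock v` is `2`, `1/2` and
`-1` for every unit vector `v`. -/
theorem conn_reflBlock {n : ℕ} {v : ℝ → Fin n → ℝ} (hv : ContinuousOn v (Icc 0 1))
    (h1 : ∀ s ∈ Icc (0 : ℝ) 1, v s ⬝ᵥ v s = 1) : Conn (reflBlock (v 0)) (reflBlock (v 1)) 0 := by
  have hp : ∀ s ∈ Icc (0 : ℝ) 1, Matrix.vecMulVec (v s) (v s) * Matrix.vecMulVec (v s) (v s) =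
      Matrix.vecMulVec (v s) (v s) := by
    intro s hs
    rw [Matrix.vecMulVec_mul_vecMulVec, h1 s hs]; simp
  have hc : ContinuousOn (fun s => Matrix.vecMulVec (v s) (v s)) (Icc 0 1) := by
    have : Continuous fun w : Fin n → ℝ => Matrix.vecMulVec w w := by fun_prop
    exact this.comp_continuousOn hv
  refine Conn.of_hyperbolic (A := fun s => -1 + (3 : ℝ) • Matrix.vecMulVec (v s) (v s))
    (B := fun s => -1 + (3 / 2 : ℝ) • Matrix.vecMulVec (v s) (v s)) (by fun_prop) (by fun_prop)
    (fun s hs => ?_) (fun s hs => ?_)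
  · have ht : (Matrix.vecMulVec (v s) (v s)).transpose = Matrix.vecMulVec (v s) (v s) := by
      rw [Matrix.transpose_vecMulVec]
    simp only [Matrix.transpose_add, Matrix.transpose_neg, Matrix.transpose_one,
      Matrix.transpose_smul, ht, add_mul, mul_add, smul_mul_assoc, mul_smul_comm, hp s hs,
      neg_mul, one_mul, mul_neg, mul_one]
    module
  -- `1 - A` is `-1` on `v` and `2` on the orthogonal complement, which gives this inverse.
  · apply det_ne_zero_of_mul_eq_one (B := (1 / 2 : ℝ) • 1 - (3 / 2 : ℝ) • Matrix.vecMulVec (v s) (v s))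
    simp only [sub_mul, add_mul, mul_sub, smul_mul_assoc, mul_smul_comm, hp s hs, neg_mul,
      one_mul, mul_one]
    module

theorem splitEquiv_forall {m : ℕ} {p : Fin (m + 1) ⊕ Fin (m + 1) → Prop} :
    (∀ i, p i) ↔ ∀ i, p (splitEquiv m i) := (splitEquiv m).forall_congr_right.symm

theorem castAdd_ne_natAdd {m : ℕ} (i : Fin m) (j : Fin 1) : Fin.castAdd 1 i ≠ Fin.natAdd m j := by
  intro h
  have := congrArg Fin.val h
  simp only [Fin.val_castAdd, Fin.val_natAdd] at this
  omega

theorem castAdd_eq_zero {m : ℕ} (i : Fin (m + 1)) : Fin.castAdd 1 i = 0 ↔ i = 0 := by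
  constructor <;> intro h <;> have := congrArg Fin.val h <;> apply Fin.ext <;> simpa using this

theorem natAdd_ne_zero {m : ℕ} (j : Fin 1) : Fin.natAdd (m + 1) j ≠ 0 := by
  intro h
  have := congrArg Fin.val h
  simp only [Fin.val_natAdd, Fin.val_zero] at this
  omega

theorem castAdd_ne_last {m : ℕ} (i : Fin m) : Fin.castAdd 1 i ≠ Fin.last m :=
  castAdd_ne_natAdd i 0

theorem natAdd_eq_last {m : ℕ} (j : Fin 1) : Fin.natAdd m j = Fin.last m := by
  rw [Subsingleton.elim j 0]; rfl

theorem matWMinus_eq_reflBlock (m : ℕ) :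
    matWMinus (m + 1) = reflBlock (Pi.single 0 1 : Fin (m + 1) → ℝ) := by
  ext (i | i) (j | j) <;>
    simp [matWMinus, reflBlock, Matrix.diagonal_apply, Matrix.vecMulVec_apply, Matrix.one_apply,
      Pi.single_apply] <;> grind

theorem dsum_neg_one_matWMinus (m : ℕ) :
    dsum (-1 : Mat m) (matWMinus 1) = reflBlock (Pi.single (Fin.last m) 1 : Fin (m + 1) → ℝ) := by
  ext i j
  revert i j
  rw [splitEquiv_forall]
  intro i
  rw [splitEquiv_forall]
  intro j
  simp only [dsum, Matrix.reindex_apply, Matrix.submatrix_apply, Equiv.symm_apply_apply]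
  rcases i with (i | i) | (i | i) <;> rcases j with (j | j) | (j | j) <;>
    simp [splitEquiv, matWMinus, reflBlock, Matrix.diagonal_apply, Matrix.vecMulVec_apply,
      Matrix.one_apply, Pi.single_apply, Fin.ext_iff] <;> grind

theorem dsum_matWMinus_neg_one (m : ℕ) :
    dsum (matWMinus (m + 1)) (-1) = matWMinus (m + 2) := by
  ext i j
  revert i j
  rw [splitEquiv_forall]
  intro i
  rw [splitEquiv_forall]
  intro j
  simp only [dsum, Matrix.reindex_apply, Matrix.submatrix_apply, Equiv.symm_apply_apply]
  rcases i with (i | i) | (i | i) <;> rcases j with (j | j) | (j | j) <;>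
    simp [splitEquiv, matWMinus, Matrix.diagonal_apply,
      Matrix.one_apply, castAdd_ne_natAdd, (castAdd_ne_natAdd _ _).symm, castAdd_eq_zero,
      natAdd_ne_zero] <;> grind

/-- The direct sum has its hyperbolic direction in the last coordinate and `W⁻` in the first one; a
quarter turn takes one to the other. For `m = 0` the two coordinates coincide. -/
theorem conn_dsum_neg_one_matWMinus (m : ℕ) :
    Conn (dsum (-1 : Mat m) (matWMinus 1)) (matWMinus (m + 1)) 0 := by
  rw [dsum_neg_one_matWMinus, matWMinus_eq_reflBlock]
  rcases m with _ | m
  · have := conn_reflBlock (n := 1) (v := fun _ => Pi.single 0 1) continuousOn_const (by simp)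
    simpa using this
  · have hne : (0 : Fin (m + 2)) ≠ Fin.last (m + 1) := by simp [Fin.ext_iff]
    have := conn_reflBlock (n := m + 2) (v := fun s =>
      Real.cos (Real.pi / 2 * s) • Pi.single (Fin.last (m + 1)) (1 : ℝ) +
        Real.sin (Real.pi / 2 * s) • Pi.single (0 : Fin (m + 2)) (1 : ℝ)) (by fun_prop) (by
      intro s _
      simp [dotProduct_add, hne, hne.symm]
      have := Real.cos_sq_add_sin_sq (Real.pi / 2 * s)
      nlinarith)
    simpa using this

/-- Two hyperbolic directions cancel. On the plane of the first and the last position coordinate, `A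
= diag(2, 2)` is multiplication by the complex number `2`. It moves to `-1` along the half circle `x
+ iy` of centre `1/2` and radius `3/2`, which avoids both `0` (so that `A` stays invertible) and `1`
(so that `1 - A` does). `P` and `R` are the unit and the imaginary unit of this copy of `ℂ`. -/
theorem conn_dsum_matWMinus_matWMinus (m : ℕ) :
    Conn (dsum (matWMinus (m + 1)) (matWMinus 1)) (-1) 0 := by
  have hne : (0 : Fin (m + 2)) ≠ Fin.last (m + 1) := by simp [Fin.ext_iff]
  let P : Matrix (Fin (m + 2)) (Fin (m + 2)) ℝ :=
    Matrix.single 0 0 1 + Matrix.single (Fin.last (m + 1)) (Fin.last (m + 1)) 1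
  let R : Matrix (Fin (m + 2)) (Fin (m + 2)) ℝ :=
    Matrix.single (Fin.last (m + 1)) 0 1 - Matrix.single 0 (Fin.last (m + 1)) 1
  have hPP : P * P = P := by simp [P, add_mul, mul_add, hne, hne.symm]
  have hRR : R * R = -P := by simp [P, R, sub_mul, mul_sub, hne, hne.symm]; abel
  have hPR : P * R = R := by simp [P, R, add_mul, mul_sub, hne, hne.symm]
  have hRP : R * P = R := by simp [P, R, sub_mul, mul_add, hne, hne.symm]; abel
  have hPt : P.transpose = P := by simp [P]
  have hRt : R.transpose = -R := by simp [R]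
  let x : ℝ → ℝ := fun s => 1 / 2 + 3 / 2 * Real.cos (Real.pi * s)
  let y : ℝ → ℝ := fun s => 3 / 2 * Real.sin (Real.pi * s)
  have hxy : ∀ s, x s ^ 2 + y s ^ 2 = 5 / 2 + 3 / 2 * Real.cos (Real.pi * s) := by
    intro s
    have := Real.cos_sq_add_sin_sq (Real.pi * s)
    simp only [x, y]; nlinarith
  have hxy' : ∀ s, (1 - x s) ^ 2 + y s ^ 2 = 5 / 2 - 3 / 2 * Real.cos (Real.pi * s) := by
    intro s
    have := Real.cos_sq_add_sin_sq (Real.pi * s)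
    simp only [x, y]; nlinarith
  have h1 : ∀ s, x s ^ 2 + y s ^ 2 ≠ 0 := by
    intro s; rw [hxy]; have := Real.neg_one_le_cos (Real.pi * s); linarith
  have h2 : ∀ s, (1 - x s) ^ 2 + y s ^ 2 ≠ 0 := by
    intro s; rw [hxy']; have := Real.cos_le_one (Real.pi * s); linarith
  have hx : Continuous x := by fun_prop
  have hy : Continuous y := by fun_prop
  have key := Conn.of_hyperbolic (A := fun s => -1 + (x s + 1) • P + y s • R)
    (B := fun s => -1 + P + (x s ^ 2 + y s ^ 2)⁻¹ • (x s • P + y s • R)) (by fun_prop)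
    (by
      have : Continuous fun s => (x s ^ 2 + y s ^ 2)⁻¹ := by fun_prop (disch := exact h1)
      fun_prop)
    (fun s _ => by
      have h := h1 s
      simp only [Matrix.transpose_add, Matrix.transpose_neg, Matrix.transpose_one,
        Matrix.transpose_smul, hPt, hRt, add_mul, mul_add, smul_mul_assoc, mul_smul_comm, hPP, hRR,
        hPR, hRP, neg_mul, mul_neg, one_mul, mul_one, neg_neg]
      match_scalars <;> field_simp <;> ring)
    (fun s _ => by
      have h := h2 s
      apply det_ne_zero_of_mul_eq_one (B := (1 / 2 : ℝ) • (1 - P) +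
        ((1 - x s) ^ 2 + y s ^ 2)⁻¹ • ((1 - x s) • P + y s • R))
      simp only [sub_mul, add_mul, mul_add, mul_sub, smul_mul_assoc, mul_smul_comm, hPP, hRR,
        hPR, hRP, neg_mul, one_mul, mul_one]
      match_scalars <;> field_simp <;> ring)
  convert key using 1
  · ext i j
    revert i j
    rw [splitEquiv_forall]
    intro i
    rw [splitEquiv_forall]
    intro j
    simp only [dsum, Matrix.reindex_apply, Matrix.submatrix_apply, Equiv.symm_apply_apply]
    rcases i with (i | i) | (i | i) <;> rcases j with (j | j) | (j | j) <;>
      simp [splitEquiv, matWMinus, x, y, P, R, Matrix.diagonal_apply, Matrix.single_apply,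
        Matrix.one_apply, castAdd_eq_zero, castAdd_ne_last, natAdd_eq_last, (castAdd_ne_last _).symm,
        eq_comm (a := (0 : Fin (m + 2))), hne.symm] <;> grind
  · ext (i | i) (j | j) <;> simp [x, y] <;> norm_num <;> simp [Matrix.one_apply]

/-- A sum of two reference matrices is joined to a reference matrix without change of the angle:
equal types give `-1`, different types give `W⁻`. -/
theorem terminal_dsum {m : ℕ} {P : Mat m} {Q : Mat 1} {r r' : ℝ} (h : Terminal P r)
    (h' : Terminal Q r') : Terminal (dsum P Q) (r + r') := by
  -- In dimension zero `W⁻` has no hyperbolic direction and counts as `-1`, hence the case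
  -- distinctions on `m`.
  have hm : matWMinus 0 = -1 := Subsingleton.elim _ _
  rcases h with h | h <;> rcases h' with h' | h'
  · left; simpa [dsum_neg_one] using h.dsum h'
  · right; simpa using (h.dsum h').trans (conn_dsum_neg_one_matWMinus m)
  · rcases m with _ | m
    · left; simpa [hm, dsum_neg_one] using h.dsum h'
    · right; simpa [dsum_matWMinus_neg_one] using h.dsum h'
  · rcases m with _ | m
    · right
      rw [hm] at h
      simpa using (h.dsum h').trans (conn_dsum_neg_one_matWMinus 0)
    · left; simpa using (h.dsum h').trans (conn_dsum_matWMinus_matWMinus m)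

/-- The product formula. -/
theorem IsConleyZehnderIndex.dsum {m : ℕ} {Ψ : ℝ → Mat m} {Q : ℝ → Mat 1} {j k : ℤ}
    (h : IsConleyZehnderIndex Ψ k) (h' : IsConleyZehnderIndex Q j) :
    IsConleyZehnderIndex (fun s => dsum (Ψ s) (Q s)) (k + j) := by
  obtain ⟨h0, hΨ, hsp, r, r', hr, hT, hk⟩ := isConleyZehnderIndex_iff.1 h
  obtain ⟨h0', hΨ', hsp', q, q', hq, hT', hk'⟩ := isConleyZehnderIndex_iff.1 h'
  exact isConleyZehnderIndex_iff.2 ⟨by simp [h0, h0', dsum_one],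
    continuous_dsum.comp_continuousOn (hΨ.prodMk hΨ'), fun s hs => dsum_mem (hsp s hs) (hsp' s hs),
    r + q, r' + q', (hr.mul hq).congr fun s _ => complexDet_dsum _ _, terminal_dsum hT hT',
    by push_cast; linarith⟩

/-! ### The plane -/

/-- The `2 × 2` matrix with the given entries. -/
def planeMat (a b c d : ℝ) : Mat 1 :=
  Matrix.fromBlocks (Matrix.of fun _ _ => a) (Matrix.of fun _ _ => b) (Matrix.of fun _ _ => c)
    (Matrix.of fun _ _ => d)

theorem planeMat_mul (a b c d a' b' c' d' : ℝ) : planeMat a b c d * planeMat a' b' c' d' =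
    planeMat (a * a' + b * c') (a * b' + b * d') (c * a' + d * c') (c * b' + d * d') := by
  ext (i | i) (j | j) <;> simp [planeMat, Matrix.mul_apply]

theorem planeMat_one : planeMat 1 0 0 1 = 1 := by
  ext (i | i) (j | j) <;> simp [planeMat, Matrix.one_apply, Subsingleton.elim i j]

theorem continuous_planeMat :
    Continuous fun z : ℝ × ℝ × ℝ × ℝ => planeMat z.1 z.2.1 z.2.2.1 z.2.2.2 := by
  refine continuous_matrix fun i j => ?_
  rcases i with i | i <;> rcases j with j | j <;> simp [planeMat] <;> fun_prop

theorem planeMat_mem {a b c d : ℝ} (h : a * d - b * c = 1) :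
    planeMat a b c d ∈ Matrix.symplecticGroup (Fin 1) ℝ := by
  rw [mem_symplecticGroup_iff_stdForm]
  intro v w
  simp [stdForm, planeMat, Matrix.mulVec, dotProduct, Fintype.sum_sum_type]
  linear_combination (v (.inl 0) * w (.inr 0) - v (.inr 0) * w (.inl 0)) * h

theorem det_one_sub_planeMat (a b c d : ℝ) :
    (1 - planeMat a b c d).det = (1 - a) * (1 - d) - b * c := by
  have : 1 - planeMat a b c d = planeMat (1 - a) (-b) (-c) (1 - d) := by
    rw [← planeMat_one]
    ext (i | i) (j | j) <;> simp [planeMat]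
  rw [this, ← Matrix.det_reindex_self finSumFinEquiv]
  refine (Matrix.det_fin_two _).trans ?_
  have e0 : finSumFinEquiv.symm (0 : Fin (1 + 1)) = Sum.inl 0 := rfl
  have e1 : finSumFinEquiv.symm (1 : Fin (1 + 1)) = Sum.inr 0 := rfl
  simp [planeMat, e0, e1]

theorem complexDet_planeMat (a b c d : ℝ) :
    complexDet (planeMat a b c d) = ((a + d : ℝ) : ℂ) + Complex.I * ((c - b : ℝ) : ℂ) := by
  simp [complexDet, planeMat]

/-- A product of a lower and an upper shear. -/
def shearMat (b c : ℝ) : Mat 1 := planeMat 1 c (-b) (1 - b * c)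

theorem shearMat_mem (b c : ℝ) : shearMat b c ∈ Matrix.symplecticGroup (Fin 1) ℝ :=
  planeMat_mem (by ring)

theorem det_one_sub_shearMat (b c : ℝ) : (1 - shearMat b c).det = b * c := by
  rw [shearMat, det_one_sub_planeMat]; ring

theorem continuous_shearMat : Continuous fun z : ℝ × ℝ => shearMat z.1 z.2 := by
  unfold shearMat
  exact continuous_planeMat.comp
    (by fun_prop : Continuous fun z : ℝ × ℝ => ((1 : ℝ), z.2, -z.1, 1 - z.1 * z.2))

/-- After a rotation the curve avoids the negative real axis, and the principal argument is a
continuous angle. -/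
theorem angleInc_of_slitPlane_mul {c : ℝ → ℂ} {z : ℂ} (hz : z ≠ 0) {a b : ℝ}
    (hc : ContinuousOn c (Icc a b)) (h : ∀ s ∈ Icc a b, z * c s ∈ Complex.slitPlane) :
    AngleInc c a b ((z * c b).arg - (z * c a).arg) := by
  have := (AngleInc.of_slitPlane (c := fun s => z * c s) (by fun_prop) h).const_mul (inv_ne_zero hz)
  exact this.congr fun s _ => by rw [inv_mul_cancel_left₀ hz]

/-- `i · complexDet` stays in the slit plane along the path and along its continuation to `-1`, and
moves from `2i` to `-2i`, so the angle changes by `-π`. The continuation first brings both rates to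
`2`, where `det (1 - A)` is the product of the rates and hence positive. Then it follows matrices of
trace `-2`, for which `det (1 - A) = 2 - tr A = 4`. -/
theorem shear_index_neg_one {b c : ℝ} (hb : 0 < b) (hc : 0 < c) :
    IsConleyZehnderIndex (fun θ => shearMat (b * θ) (c * θ)) (-1) := by
  have hI : ∀ x y z w : ℝ, 0 < y - z ∨ x + w ≠ 0 →
      Complex.I * complexDet (planeMat x y z w) ∈ Complex.slitPlane := by
    intro x y z w h
    rw [complexDet_planeMat, Complex.mem_slitPlane_iff]
    refine h.imp (fun h => ?_) (fun h => ?_)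
    · simpa using h
    · simpa using h
  have hcont : Continuous fun θ : ℝ => shearMat (b * θ) (c * θ) :=
    continuous_shearMat.comp (by fun_prop : Continuous fun θ : ℝ => (b * θ, c * θ))
  have hcont2 : Continuous fun s : ℝ => shearMat (b + (2 - b) * s) (c + (2 - c) * s) :=
    continuous_shearMat.comp
      (by fun_prop : Continuous fun s : ℝ => (b + (2 - b) * s, c + (2 - c) * s))
  have hcont3 : Continuous fun s : ℝ =>
      planeMat (-1 + 2 * (1 - s)) (2 * (1 - s)) (-2 * (1 - s)) (-1 - 2 * (1 - s)) :=
    continuous_planeMat.comp (by fun_prop : Continuous fun s : ℝ =>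
      (-1 + 2 * (1 - s), 2 * (1 - s), -2 * (1 - s), -1 - 2 * (1 - s)))
  have a1 := angleInc_of_slitPlane_mul (a := 0) (b := 1) Complex.I_ne_zero
    (continuous_complexDet.comp hcont).continuousOn (fun s hs => hI _ _ _ _ (by
      rcases hs.1.eq_or_lt with rfl | h
      · right; norm_num
      · left; nlinarith))
  have p2 : ∀ s ∈ Icc (0 : ℝ) 1, 0 < b + (2 - b) * s ∧ 0 < c + (2 - c) * s := by
    intro s hs
    constructor
    · nlinarith [hs.1, hs.2, mul_nonneg hb.le (sub_nonneg.2 hs.2)]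
    · nlinarith [hs.1, hs.2, mul_nonneg hc.le (sub_nonneg.2 hs.2)]
  have a2 := angleInc_of_slitPlane_mul (a := 0) (b := 1) Complex.I_ne_zero
    (continuous_complexDet.comp hcont2).continuousOn (fun s hs => hI _ _ _ _ (by
      left; linarith [(p2 s hs).1, (p2 s hs).2]))
  have a3 := angleInc_of_slitPlane_mul (a := 0) (b := 1) Complex.I_ne_zero
    (continuous_complexDet.comp hcont3).continuousOn (fun s hs => hI _ _ _ _ (by
      right; ring_nf; norm_num))
  have e3 : planeMat (-1 + 2 * (1 - 0)) (2 * (1 - 0)) (-2 * (1 - 0)) (-1 - 2 * (1 - 0)) =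
      shearMat 2 2 := by norm_num [shearMat]
  have e4 : planeMat (-1 + 2 * (1 - 1)) (2 * (1 - 1)) (-2 * (1 - 1)) (-1 - 2 * (1 - 1)) = -1 := by
    rw [← planeMat_one]
    ext (i | i) (j | j) <;> simp [planeMat]
  have e2 : shearMat (b + (2 - b) * 0) (c + (2 - c) * 0) = shearMat b c := by simp
  have e2' : shearMat (b + (2 - b) * 1) (c + (2 - c) * 1) = shearMat 2 2 := by norm_num
  have c2 : Conn (shearMat b c) (shearMat 2 2) _ := ⟨_, hcont2.continuousOn,
    fun s _ => shearMat_mem _ _, fun s hs => by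
      rw [det_one_sub_shearMat]
      exact (mul_pos (p2 s hs).1 (p2 s hs).2).ne', e2, e2', a2⟩
  have c3 : Conn (shearMat 2 2) (-1) _ := ⟨_, hcont3.continuousOn,
    fun s _ => planeMat_mem (by ring), fun s hs => by
      rw [det_one_sub_planeMat]
      ring_nf
      norm_num, e3, e4, a3⟩
  refine isConleyZehnderIndex_iff.2 ⟨by simp [shearMat, planeMat_one], hcont.continuousOn,
    fun s _ => shearMat_mem _ _, _, _, a1,
    Or.inl (by simpa only [mul_one] using c2.trans c3), ?_⟩
  · simp only [Function.comp_apply, mul_one, mul_zero, e3, e4]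
    have f1 : Complex.I * complexDet (shearMat 0 0) = (2 : ℝ) * Complex.I := by
      simp [shearMat, complexDet_planeMat]; ring_nf
    have f2 : Complex.I * complexDet (-1 : Mat 1) = (2 : ℝ) * -Complex.I := by
      rw [← e4, complexDet_planeMat]; push_cast; ring
    rw [f1, f2, Complex.arg_real_mul _ two_pos, Complex.arg_real_mul _ two_pos, Complex.arg_I,
      Complex.arg_neg_I]
    push_cast
    ring

/-- The rates have opposite signs, so the trace is at least `2` and `complexDet` has positive real
part throughout. It is a positive number at both ends, and the angle does not change. The
continuation to `W⁻` keeps the trace above `2`, so that `det (1 - A) = 2 - tr A` is negative; its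
last entry is dictated by `det A = 1`. -/
theorem shear_index_zero {b c : ℝ} (hb : 0 < b) (hc : c < 0) :
    IsConleyZehnderIndex (fun θ => shearMat (b * θ) (c * θ)) 0 := by
  have hI : ∀ x y z w : ℝ, 0 < x + w → complexDet (planeMat x y z w) ∈ Complex.slitPlane := by
    intro x y z w h
    rw [complexDet_planeMat, Complex.mem_slitPlane_iff]
    left
    simpa using h
  have hbc : 0 < b * -c := mul_pos hb (neg_pos.2 hc)
  have hcont : Continuous fun θ : ℝ => shearMat (b * θ) (c * θ) :=
    continuous_shearMat.comp (by fun_prop : Continuous fun θ : ℝ => (b * θ, c * θ))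
  have hcont2 : ContinuousOn (fun s : ℝ => planeMat (1 + s) (c * (1 - s)) (-b * (1 - s))
      ((1 - b * c * (1 - s) ^ 2) / (1 + s))) (Icc 0 1) :=
    continuous_planeMat.comp_continuousOn
      (f := fun s : ℝ => (1 + s, c * (1 - s), -b * (1 - s), (1 - b * c * (1 - s) ^ 2) / (1 + s))) (by
        refine ContinuousOn.prodMk (by fun_prop) (ContinuousOn.prodMk (by fun_prop)
          (ContinuousOn.prodMk (by fun_prop) (ContinuousOn.div (by fun_prop) (by fun_prop) ?_)))
        intro s hs; linarith [hs.1])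
  have htr : ∀ s ∈ Icc (0 : ℝ) 1, 2 < 1 + s + (1 - b * c * (1 - s) ^ 2) / (1 + s) := by
    intro s hs
    have h1 : 0 < 1 + s := by linarith [hs.1]
    rw [← sub_pos]
    have : 1 + s + (1 - b * c * (1 - s) ^ 2) / (1 + s) - 2 =
        (s ^ 2 + b * -c * (1 - s) ^ 2) / (1 + s) := by field_simp; ring
    rw [this]
    apply div_pos _ h1
    rcases hs.1.eq_or_lt with rfl | h
    · simpa using hbc
    · positivity
  have a1 := AngleInc.of_slitPlane (a := 0) (b := 1)
    (continuous_complexDet.comp hcont).continuousOn (fun s hs => hI _ _ _ _ (by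
      have : 0 ≤ b * -c * s ^ 2 := by positivity
      nlinarith))
  have a2 := AngleInc.of_slitPlane (continuous_complexDet.comp_continuousOn hcont2)
    (fun s hs => hI _ _ _ _ (by linarith [htr s hs]))
  have e1 : planeMat (1 + 0) (c * (1 - 0)) (-b * (1 - 0)) ((1 - b * c * (1 - 0) ^ 2) / (1 + 0)) =
      shearMat b c := by simp [shearMat]
  have e2 : planeMat (1 + 1) (c * (1 - 1)) (-b * (1 - 1)) ((1 - b * c * (1 - 1) ^ 2) / (1 + 1)) =
      matWMinus 1 := by
    ext (i | i) (j | j) <;>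
      simp [planeMat, matWMinus, Subsingleton.elim i 0, Subsingleton.elim j 0] <;> norm_num
  have c2 : Conn (shearMat b c) (matWMinus 1) _ := ⟨_, hcont2, fun s hs => planeMat_mem (by
      have : 1 + s ≠ 0 := by linarith [hs.1]
      field_simp; ring), fun s hs => by
      have : 1 + s ≠ 0 := by linarith [hs.1]
      rw [det_one_sub_planeMat]
      have h2 : (1 - (1 + s)) * (1 - (1 - b * c * (1 - s) ^ 2) / (1 + s)) -
          c * (1 - s) * (-b * (1 - s)) =
          2 - (1 + s + (1 - b * c * (1 - s) ^ 2) / (1 + s)) := by field_simp; ring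
      rw [h2]
      linarith [htr s hs], e1, e2, a2⟩
  refine isConleyZehnderIndex_iff.2 ⟨by simp [shearMat, planeMat_one], hcont.continuousOn,
    fun s _ => shearMat_mem _ _, _, _, a1, Or.inr (by simpa only [mul_one] using c2), ?_⟩
  · simp only [Function.comp_apply, mul_one, mul_zero, e1]
    have f1 : complexDet (shearMat 0 0) = ((2 : ℝ) : ℂ) := by
      simp [shearMat, complexDet_planeMat]; norm_num
    have f2 : complexDet (planeMat (1 + 1) (c * (1 - 1)) (-b * (1 - 1))
        ((1 - b * c * (1 - 1) ^ 2) / (1 + 1))) = ((5 / 2 : ℝ) : ℂ) := by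
      rw [complexDet_planeMat]; push_cast; ring
    rw [f1, f2, Complex.arg_ofReal_of_nonneg (by norm_num), Complex.arg_ofReal_of_nonneg (by norm_num)]
    simp

/-! ### The index of the inverse path and of a change of frames of degree zero -/

theorem complexDet_sinv {k : ℕ} (A : Mat k) :
    complexDet (sinv A) = (starRingEnd ℂ) (complexDet A) := by
  rw [complexDet_eq, complexDet_eq, starRingEnd_apply, ← Matrix.det_conjTranspose]
  congr 1
  obtain ⟨a, b, c, d, rfl⟩ : ∃ a b c d, A = Matrix.fromBlocks a b c d :=
    ⟨_, _, _, _, (Matrix.fromBlocks_toBlocks A).symm⟩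
  ext i j
  simp [complexMat, sinv, Matrix.J, Matrix.fromBlocks_transpose, Matrix.fromBlocks_multiply,
    Matrix.conjTranspose_apply]
  ring

/-- The unitary matrix `e^{iτ}`. -/
def rotMat (n : ℕ) (τ : ℝ) : Mat n := Real.cos τ • 1 + Real.sin τ • Matrix.J (Fin n) ℝ

theorem rotMat_mem (n : ℕ) (τ : ℝ) : rotMat n τ ∈ Matrix.symplecticGroup (Fin n) ℝ := by
  rw [SymplecticGroup.mem_iff']
  have h := Matrix.J_squared (Fin n) ℝ
  simp only [rotMat, Matrix.transpose_add, Matrix.transpose_smul, Matrix.transpose_one,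
    Matrix.J_transpose, add_mul, mul_add, smul_mul_assoc, mul_smul_comm, one_mul, mul_one, neg_mul,
    h]
  have h2 := Real.cos_sq_add_sin_sq τ
  match_scalars <;> linarith

theorem continuous_rotMat (n : ℕ) : Continuous (rotMat n) := by
  unfold rotMat
  fun_prop

theorem rotMat_zero (n : ℕ) : rotMat n 0 = 1 := by simp [rotMat]

theorem rotMat_pi_div_two (n : ℕ) : rotMat n (Real.pi / 2) = Matrix.J (Fin n) ℝ := by simp [rotMat]

namespace IsConleyZehnderIndex

variable {m : ℕ} {Ψ : ℝ → Mat m} {k : ℤ}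

/-- The symplectic inverse is the transpose conjugated by `J`, and the rotations `e^{iτ}` join `J`
to the identity. -/
theorem sinv (h : IsConleyZehnderIndex Ψ k) :
    IsConleyZehnderIndex (fun s => MorseBott.sinv (Ψ s)) (-k) := by
  have := h.transpose.conj (D := fun s => rotMat m (Real.pi / 2 * s))
    ((continuous_rotMat m).comp (by fun_prop)).continuousOn (fun s _ => rotMat_mem _ _)
    (by simp [rotMat_zero])
  refine this.congr fun s _ => ?_
  have hJ : MorseBott.sinv (Matrix.J (Fin m) ℝ) = -Matrix.J (Fin m) ℝ := by
    simp [MorseBott.sinv, Matrix.J_squared]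
  rw [mul_one, rotMat_pi_div_two, hJ, MorseBott.sinv]
  noncomm_ring

/-- The path is homotopic to `s ↦ Ψ(s)⁻¹` through `Ψ(u(1-s)) Ψ(u+(1-u)s)⁻¹`, which starts at `1` and
ends at `Ψ(1)⁻¹` for every `u`. -/
theorem reverse (h : IsConleyZehnderIndex Ψ k) :
    IsConleyZehnderIndex (fun s => Ψ (1 - s) * MorseBott.sinv (Ψ 1)) (-k) := by
  have z1 : (1 : ℝ) ∈ Icc (0 : ℝ) 1 := by simp
  have m1 : MapsTo (fun z : ℝ × ℝ => z.1 * (1 - z.2)) (Icc 0 1 ×ˢ Icc 0 1) (Icc 0 1) := by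
    rintro ⟨u, s⟩ ⟨⟨h1, h2⟩, ⟨h3, h4⟩⟩
    exact ⟨by nlinarith, by nlinarith⟩
  have m2 : MapsTo (fun z : ℝ × ℝ => z.1 + (1 - z.1) * z.2) (Icc 0 1 ×ˢ Icc 0 1) (Icc 0 1) := by
    rintro ⟨u, s⟩ ⟨⟨h1, h2⟩, ⟨h3, h4⟩⟩
    exact ⟨by nlinarith, by nlinarith⟩
  have := homotopy (k := -k)
    (H := fun u s => Ψ (u * (1 - s)) * MorseBott.sinv (Ψ (u + (1 - u) * s))) ?_ ?_ ?_ ?_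
    (h.sinv.congr fun s _ => by simp [h.zero])
  · exact this.congr fun s _ => by simp
  · exact (h.continuousOn.comp (by fun_prop) m1).mul
      (continuous_sinv.comp_continuousOn (h.continuousOn.comp (by fun_prop) m2))
  · exact fun u hu s hs => mul_mem (h.mem _ (m1 (mk_mem_prod hu hs)))
      (sinv_mem (h.mem _ (m2 (mk_mem_prod hu hs))))
  · intro u hu
    simp [mul_sinv_self (h.mem u hu)]
  · intro u hu
    simpa [h.zero] using h.sinv.det_ne_zero

/-- The index of a path in a frame which differs from a given one by a loop of degree zero that can
be joined to the identity. -/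
theorem change_frame {n : ℕ} {Ψ D Γ : ℝ → Mat n} {k : ℤ} (hD : ContinuousOn D (Icc 0 1))
    (hDsp : ∀ s ∈ Icc (0 : ℝ) 1, D s ∈ Matrix.symplecticGroup (Fin n) ℝ) (hper : D 1 = D 0)
    (hdeg : AngleInc (fun s => complexDet (D s)) 0 1 0)
    (hΓ : ContinuousOn Γ (Icc 0 1))
    (hΓsp : ∀ s ∈ Icc (0 : ℝ) 1, Γ s ∈ Matrix.symplecticGroup (Fin n) ℝ) (hΓ0 : Γ 0 = 1)
    (hΓ1 : Γ 1 = D 0) (h : IsConleyZehnderIndex Ψ k) :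
    IsConleyZehnderIndex (fun s => MorseBott.sinv (D (1 - s)) * Ψ s * D 0) k := by
  have z0 : (0 : ℝ) ∈ Icc (0 : ℝ) 1 := by simp
  have z1 : (1 : ℝ) ∈ Icc (0 : ℝ) 1 := by simp
  have m1 : MapsTo (fun s : ℝ => 1 - s) (Icc 0 1) (Icc 0 1) :=
    fun s hs => ⟨by linarith [hs.2], by linarith [hs.1]⟩
  have hD' : ContinuousOn (fun s => MorseBott.sinv (D (1 - s))) (Icc 0 1) :=
    continuous_sinv.comp_continuousOn (hD.comp (by fun_prop) m1)
  have hdeg' : AngleInc (fun s => complexDet (MorseBott.sinv (D (1 - s)))) 0 1 0 := by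
    have := (hdeg.reverse (g := fun s => 1 - s) (by fun_prop) m1 (by simp) (by simp)).conj
    simp only [neg_zero] at this
    exact this.congr fun s _ => complexDet_sinv _
  -- Shrinking the constant factor `D 0` to the identity along `Γ` is a homotopy of loops.
  have hL : AngleInc (fun s => complexDet (MorseBott.sinv (D (1 - s)) * D 0)) 0 1 0 := by
    rw [← hΓ1]
    refine AngleInc.rect_loops
      (F := fun s u => complexDet (MorseBott.sinv (D (1 - s)) * Γ u)) zero_le_one zero_le_one
      (continuous_complexDet.comp_continuousOn ((hD'.comp continuousOn_fst fun z hz => hz.1).mul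
        (hΓ.comp continuousOn_snd fun z hz => hz.2)))
      (fun s hs u hu => complexDet_ne_zero (mul_mem (sinv_mem (hDsp _ (m1 hs))) (hΓsp u hu)))
      (fun u _ => by simp [hper]) ?_
    simpa [hΓ0] using hdeg'
  have h1 := h.conj hΓ hΓsp hΓ0
  rw [hΓ1] at h1
  -- The new path is the loop `D(1-s)⁻¹ D(0)` times the conjugate `D(0)⁻¹ Ψ(s) D(0)`.
  have h2 := h1.loop_mul (L := fun s => MorseBott.sinv (D (1 - s)) * D 0)
    (hD'.mul continuousOn_const) (fun s hs => mul_mem (sinv_mem (hDsp _ (m1 hs))) (hDsp 0 z0))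
    (by simp [hper, sinv_mul_self (hDsp 0 z0)]) (by simp [sinv_mul_self (hDsp 0 z0)]) hL
  refine h2.congr fun s _ => ?_
  have := mul_sinv_self (hDsp 0 z0)
  calc _ = MorseBott.sinv (D (1 - s)) * 1 * Ψ s * D 0 := by rw [mul_one]
    _ = _ := by rw [← this]; noncomm_ring

end IsConleyZehnderIndex

/-- The index of the linearized Hamiltonian flow, in terms of the index of the linearized Reeb flow
and of the index of the shear in the plane spanned by the Liouville and the Reeb field. -/
theorem index_of_blocks {m : ℕ} {Ψ : ℝ → Mat m} {Q : ℝ → Mat 1} {k j : ℤ}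
    {D Γ : ℝ → Mat (m + 1)} (hD : ContinuousOn D (Icc 0 1))
    (hDsp : ∀ s ∈ Icc (0 : ℝ) 1, D s ∈ Matrix.symplecticGroup (Fin (m + 1)) ℝ) (hper : D 1 = D 0)
    (hdeg : AngleInc (fun s => complexDet (D s)) 0 1 0)
    (hΓ : ContinuousOn Γ (Icc 0 1))
    (hΓsp : ∀ s ∈ Icc (0 : ℝ) 1, Γ s ∈ Matrix.symplecticGroup (Fin (m + 1)) ℝ) (hΓ0 : Γ 0 = 1)
    (hΓ1 : Γ 1 = D 0) (h : IsConleyZehnderIndex Ψ k) (hQ : IsConleyZehnderIndex Q j) :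
    IsConleyZehnderIndex
      (fun s => sinv (D (1 - s)) * dsum (Ψ (1 - s) * sinv (Ψ 1)) (Q s) * D 0) (-k + j) :=
  (h.reverse.dsum hQ).change_frame hD hDsp hper hdeg hΓ hΓsp hΓ0 hΓ1

/-! ### Hamiltonian matrices and the Cayley transform -/

section Form

variable {n : ℕ}

theorem stdForm_add_left (u v w : Std n) : stdForm (u + v) w = stdForm u w + stdForm v w := by
  simp [stdForm_eq, add_dotProduct]; ring

theorem stdForm_add_right (u v w : Std n) : stdForm u (v + w) = stdForm u v + stdForm u w := by
  simp [stdForm_eq, Matrix.mulVec_add, dotProduct_add]; ring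

theorem stdForm_smul_left (a : ℝ) (v w : Std n) : stdForm (a • v) w = a * stdForm v w := by
  simp [stdForm_eq]

theorem stdForm_smul_right (a : ℝ) (v w : Std n) : stdForm v (a • w) = a * stdForm v w := by
  simp [stdForm_eq, Matrix.mulVec_smul]

theorem stdForm_sub_left (u v w : Std n) : stdForm (u - v) w = stdForm u w - stdForm v w := by
  simp [stdForm_eq, sub_dotProduct]; ring

theorem stdForm_sub_right (u v w : Std n) : stdForm u (v - w) = stdForm u v - stdForm u w := by
  simp [stdForm_eq, Matrix.mulVec_sub, dotProduct_sub]; ring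

theorem stdForm_antisymm (v w : Std n) : stdForm v w = -stdForm w v := by
  simp only [stdForm, ← Finset.sum_neg_distrib]
  exact Finset.sum_congr rfl fun i _ => by ring

theorem stdForm_self (v : Std n) : stdForm v v = 0 := by
  simp only [stdForm]
  exact Finset.sum_eq_zero fun i _ => by ring

theorem stdForm_single_inl (v : Std n) (i : Fin n) :
    stdForm (Pi.single (.inl i) 1) v = v (.inr i) := by
  simp [stdForm, Pi.single_apply]

theorem stdForm_single_inr (v : Std n) (i : Fin n) :
    stdForm (Pi.single (.inr i) 1) v = -v (.inl i) := by
  simp [stdForm, Pi.single_apply]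

theorem stdForm_nondegenerate {v : Std n} (h : ∀ w, stdForm v w = 0) : v = 0 := by
  ext (i | i)
  · have := h (Pi.single (.inr i) 1)
    rw [stdForm_antisymm, stdForm_single_inr] at this
    simpa using this
  · have := h (Pi.single (.inl i) 1)
    rw [stdForm_antisymm, stdForm_single_inl] at this
    simpa using this

theorem abs_stdForm_le (v w : Std n) : |stdForm v w| ≤ 2 * n * (‖v‖ * ‖w‖) := by
  have h : ∀ i ∈ Finset.univ, |v (.inl i) * w (.inr i) - v (.inr i) * w (.inl i)| ≤
      2 * (‖v‖ * ‖w‖) := by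
    intro i _
    have h1 : ∀ a b, |v a * w b| ≤ ‖v‖ * ‖w‖ := fun a b => by
      rw [abs_mul]
      exact mul_le_mul (norm_le_pi_norm v a) (norm_le_pi_norm w b) (abs_nonneg _) (norm_nonneg _)
    have := abs_sub (v (.inl i) * w (.inr i)) (v (.inr i) * w (.inl i))
    linarith [h1 (.inl i) (.inr i), h1 (.inr i) (.inl i)]
  refine (Finset.abs_sum_le_sum_abs _ _).trans ((Finset.sum_le_sum h).trans ?_)
  simp
  linarith

end Form

/-- The matrix `A` is bounded by `C` as an operator. -/
def OpBound {n : ℕ} (A : Mat n) (C : ℝ) : Prop := ∀ v, ‖A.mulVec v‖ ≤ C * ‖v‖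

theorem exists_opBound {n : ℕ} (A : Mat n) : ∃ C, 0 < C ∧ OpBound A C := by
  obtain ⟨C, hC, h⟩ := (LinearMap.toContinuousLinearMap (Matrix.mulVecLin A)).bound
  exact ⟨C, hC, h⟩

theorem OpBound.mono {n : ℕ} {A : Mat n} {C C' : ℝ} (h : OpBound A C) (hC : C ≤ C') :
    OpBound A C' := fun v => (h v).trans (mul_le_mul_of_nonneg_right hC (norm_nonneg v))

/-- The matrix `Y` lies in the Lie algebra of the symplectic group. -/
def IsHam {n : ℕ} (Y : Mat n) : Prop := ∀ v w, stdForm (Y.mulVec v) w = stdForm (Y.mulVec w) v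

theorem IsHam.combo {n : ℕ} {Y Y' : Mat n} (h : IsHam Y) (h' : IsHam Y') (a b : ℝ) :
    IsHam (a • Y + b • Y') := by
  intro v w
  simp only [Matrix.add_mulVec, Matrix.smul_mulVec, stdForm_add_left, stdForm_smul_left, h v w,
    h' v w]

/-- The matrix of `v ↦ ω(η, v) η`. -/
def etaMat {n : ℕ} (η : Std n) : Mat n :=
  Matrix.vecMulVec η (fun i => stdForm η (Pi.single i 1))

theorem etaMat_mulVec {n : ℕ} (η v : Std n) : (etaMat η).mulVec v = stdForm η v • η := by
  have h : (fun i => stdForm η (Pi.single i 1)) ⬝ᵥ v = stdForm η v := by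
    have : v = ∑ i, v i • (Pi.single i 1 : Std n) := by
      ext j; simp [Finset.sum_apply, Pi.single_apply]
    conv_rhs => rw [this]
    have hs : ∀ s : Finset (Fin n ⊕ Fin n), stdForm η (∑ i ∈ s, v i • (Pi.single i 1 : Std n)) =
        ∑ i ∈ s, v i * stdForm η (Pi.single i 1) := by
      intro s
      induction s using Finset.induction_on with
      | empty => simp [stdForm_eq]
      | insert a s ha ih =>
        rw [Finset.sum_insert ha, Finset.sum_insert ha, stdForm_add_right, stdForm_smul_right, ih]
    rw [hs]
    simp [dotProduct, mul_comm]
  rw [etaMat, Matrix.vecMulVec_mulVec, h]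
  ext; simp [mul_comm]

theorem isHam_etaMat {n : ℕ} (η : Std n) : IsHam (etaMat η) := by
  intro v w
  rw [etaMat_mulVec, etaMat_mulVec, stdForm_smul_left, stdForm_smul_left, mul_comm]

/-- Nilpotency makes the Cayley transform of a multiple of `etaMat η` affine: it is `1 + 2x · etaMat
η` for the multiple `x`. -/
theorem etaMat_mul_self {n : ℕ} (η : Std n) : etaMat η * etaMat η = 0 := by
  refine Matrix.ext_of_mulVec_single fun i => ?_
  rw [← Matrix.mulVec_mulVec, etaMat_mulVec, etaMat_mulVec, stdForm_smul_right, stdForm_self]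
  ext j
  simp

/-- The Cayley transform. -/
def cayley {n : ℕ} (Y : Mat n) : Mat n := (1 + Y) * (1 - Y)⁻¹

section Cayley

variable {n : ℕ} {Y : Mat n}

theorem det_ne_zero_of_injective {ι : Type*} [Fintype ι] [DecidableEq ι] {A : Matrix ι ι ℝ}
    (h : ∀ v, A.mulVec v = 0 → v = 0) : A.det ≠ 0 := by
  intro h0
  obtain ⟨v, hv, hv0⟩ := Matrix.exists_mulVec_eq_zero_iff.2 h0
  exact hv (h v hv0)

theorem det_one_sub_ne_zero (hY : OpBound Y (1 / 2)) : (1 - Y).det ≠ 0 := by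
  refine det_ne_zero_of_injective fun v hv => ?_
  have h1 : Y.mulVec v = v := by
    rw [Matrix.sub_mulVec, Matrix.one_mulVec] at hv
    exact (sub_eq_zero.1 hv).symm
  have := hY v
  rw [h1] at this
  exact norm_le_zero_iff.1 (by linarith)

theorem cayley_mul (hY : (1 - Y).det ≠ 0) : cayley Y * (1 - Y) = 1 + Y := by
  rw [cayley, Matrix.mul_assoc, Matrix.nonsing_inv_mul _ (Ne.isUnit hY), mul_one]

theorem eq_cayley (hY : (1 - Y).det ≠ 0) {N : Mat n} (h : N * (1 - Y) = 1 + Y) : N = cayley Y := by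
  rw [cayley, ← h, Matrix.mul_assoc, Matrix.mul_nonsing_inv _ (Ne.isUnit hY), mul_one]

/-- For a Hamiltonian `Y` the terms linear in `Y` cancel in `ω((1 ± Y)v, (1 ± Y)w)`, so the two
signs give the same value. -/
theorem cayley_mem (hY : (1 - Y).det ≠ 0) (hH : IsHam Y) :
    cayley Y ∈ Matrix.symplecticGroup (Fin n) ℝ := by
  rw [mem_symplecticGroup_iff_stdForm]
  have key : ∀ v w, stdForm ((cayley Y).mulVec ((1 - Y).mulVec v))
      ((cayley Y).mulVec ((1 - Y).mulVec w)) = stdForm ((1 - Y).mulVec v) ((1 - Y).mulVec w) := by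
    intro v w
    rw [Matrix.mulVec_mulVec, Matrix.mulVec_mulVec, cayley_mul hY]
    simp only [Matrix.add_mulVec, Matrix.sub_mulVec, Matrix.one_mulVec, stdForm_add_left,
      stdForm_add_right, stdForm_sub_left, stdForm_sub_right]
    have h1 := hH v w
    have h2 := stdForm_antisymm v (Y.mulVec w)
    linarith
  intro v w
  have hs : ∀ v, (1 - Y).mulVec ((1 - Y)⁻¹.mulVec v) = v := fun v => by
    rw [Matrix.mulVec_mulVec, Matrix.mul_nonsing_inv _ (Ne.isUnit hY), Matrix.one_mulVec]
  have := key ((1 - Y)⁻¹.mulVec v) ((1 - Y)⁻¹.mulVec w)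
  rwa [hs, hs] at this

theorem continuousOn_inv {n : ℕ} : ContinuousOn (fun A : Mat n => A⁻¹) {A | A.det ≠ 0} := by
  intro A hA
  have : (fun A : Mat n => A⁻¹) = fun A => (A.det)⁻¹ • A.adjugate := by
    funext A; rw [Matrix.inv_def, Ring.inverse_eq_inv']
  rw [this]
  refine ContinuousAt.continuousWithinAt (ContinuousAt.smul (ContinuousAt.inv₀ ?_ hA) ?_)
  · exact (Continuous.matrix_det continuous_id).continuousAt
  · exact (Continuous.matrix_adjugate continuous_id).continuousAt

theorem ContinuousOn.cayley {X : Type*} [TopologicalSpace X] {Y : X → Mat n} {s : Set X}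
    (hY : ContinuousOn Y s) (h : ∀ x ∈ s, (1 - Y x).det ≠ 0) :
    ContinuousOn (fun x => cayley (Y x)) s :=
  (continuousOn_const.add hY).mul
    (continuousOn_inv.comp (continuousOn_const.sub hY) fun x hx => h x hx)

/-- The inverse Cayley transform. -/
def cayleyLog {n : ℕ} (N : Mat n) : Mat n := (N - 1) * (N + 1)⁻¹

theorem det_add_one_ne_zero {N : Mat n} (hN : OpBound (N - 1) 1) : (N + 1).det ≠ 0 := by
  refine det_ne_zero_of_injective fun v hv => ?_
  have h1 : (N - 1).mulVec v = -(2 : ℝ) • v := by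
    have : N - 1 = (N + 1) - (2 : ℝ) • 1 := by module
    rw [this, Matrix.sub_mulVec, hv, Matrix.smul_mulVec, Matrix.one_mulVec]; simp
  have := hN v
  rw [h1, norm_smul] at this
  norm_num at this
  exact norm_le_zero_iff.1 (by linarith)

theorem cayleyLog_mul {N : Mat n} (hN : (N + 1).det ≠ 0) : cayleyLog N * (N + 1) = N - 1 := by
  rw [cayleyLog, Matrix.mul_assoc, Matrix.nonsing_inv_mul _ (Ne.isUnit hN), mul_one]

theorem mul_one_sub_cayleyLog {N : Mat n} (hN : (N + 1).det ≠ 0) :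
    N * (1 - cayleyLog N) = 1 + cayleyLog N := by
  have h := cayleyLog_mul hN
  have h1 : (N * (1 - cayleyLog N)) * (N + 1) = (1 + cayleyLog N) * (N + 1) := by
    rw [Matrix.mul_assoc, sub_mul, add_mul, h]; noncomm_ring
  have := congrArg (· * (N + 1)⁻¹) h1
  simpa only [Matrix.mul_assoc, Matrix.mul_nonsing_inv _ (Ne.isUnit hN), mul_one] using this

/-- With `w = (N+1)⁻¹ v` one has `2w = v - (N-1)w`, hence `‖w‖ ≤ ‖v‖` when `ε ≤ 1`, and the bound
for `N - 1` passes to the logarithm without loss. -/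
theorem opBound_cayleyLog {N : Mat n} {ε : ℝ} (hε : ε ≤ 1) (hN : OpBound (N - 1) ε) :
    OpBound (cayleyLog N) ε := by
  have hd := det_add_one_ne_zero (hN.mono hε)
  intro v
  set w := (N + 1)⁻¹.mulVec v with hw
  have hv : (N + 1).mulVec w = v := by
    rw [hw, Matrix.mulVec_mulVec, Matrix.mul_nonsing_inv _ (Ne.isUnit hd), Matrix.one_mulVec]
  have h1 : (cayleyLog N).mulVec v = (N - 1).mulVec w := by
    rw [cayleyLog, ← Matrix.mulVec_mulVec]
  have h2 : ‖w‖ ≤ ‖v‖ := by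
    have : (2 : ℝ) • w = v - (N - 1).mulVec w := by
      rw [← hv, Matrix.add_mulVec, Matrix.sub_mulVec, Matrix.one_mulVec]; module
    have h3 : ‖(2 : ℝ) • w‖ ≤ ‖v‖ + ε * ‖w‖ := by
      rw [this]; exact (norm_sub_le _ _).trans (by linarith [hN w])
    rw [norm_smul] at h3
    norm_num at h3
    nlinarith [norm_nonneg w]
  rw [h1]
  rcases le_or_gt 0 ε with h0 | h0
  · exact (hN w).trans (mul_le_mul_of_nonneg_left h2 h0)
  · have h4 : ‖w‖ ≤ 0 := by
      have := hN w
      nlinarith [norm_nonneg ((N - 1).mulVec w), norm_nonneg w]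
    have h5 : w = 0 := norm_le_zero_iff.1 h4
    have h6 : v = 0 := by rw [← hv, h5, Matrix.mulVec_zero]
    simp [h5, h6]

theorem isHam_cayleyLog {N : Mat n} (hd : (N + 1).det ≠ 0)
    (hN : N ∈ Matrix.symplecticGroup (Fin n) ℝ) : IsHam (cayleyLog N) := by
  have key : ∀ v w, stdForm ((cayleyLog N).mulVec ((N + 1).mulVec v)) ((N + 1).mulVec w) =
      stdForm ((cayleyLog N).mulVec ((N + 1).mulVec w)) ((N + 1).mulVec v) := by
    intro v w
    rw [Matrix.mulVec_mulVec, Matrix.mulVec_mulVec, cayleyLog_mul hd]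
    simp only [Matrix.add_mulVec, Matrix.sub_mulVec, Matrix.one_mulVec, stdForm_add_right,
      stdForm_sub_left]
    have h1 := mem_symplecticGroup_iff_stdForm.1 hN v w
    have h2 := mem_symplecticGroup_iff_stdForm.1 hN w v
    have h3 := stdForm_antisymm (N.mulVec v) w
    have h4 := stdForm_antisymm (N.mulVec w) v
    have h5 := stdForm_antisymm v w
    linarith
  intro v w
  have hs : ∀ v, (N + 1).mulVec ((N + 1)⁻¹.mulVec v) = v := fun v => by
    rw [Matrix.mulVec_mulVec, Matrix.mul_nonsing_inv _ (Ne.isUnit hd), Matrix.one_mulVec]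
  have := key ((N + 1)⁻¹.mulVec v) ((N + 1)⁻¹.mulVec w)
  rwa [hs, hs] at this

end Cayley

/-! ### Perturbation of a matrix with one-dimensional eigenspace -/

/-- If the eigenspace of the symplectic matrix `Z` for the eigenvalue `1` is spanned by `e₁`, then
small perturbations which are nondegenerate on it have no eigenvalue `1`. -/
theorem nondegenerate_perturbation {m : ℕ} {Z : Mat (m + 1)}
    (hZ : Z ∈ Matrix.symplecticGroup (Fin (m + 1)) ℝ) (hZe : Z.mulVec (e₁ m) = e₁ m)
    (hker : ∀ w, Z.mulVec w = w → ∃ a : ℝ, w = a • e₁ m) {C c : ℝ} (hC : 0 < C) (hc : 0 < c) :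
    ∃ δ₀ > 0, ∀ δ, 0 < δ → δ ≤ δ₀ → ∀ Y : Mat (m + 1), IsHam Y → OpBound Y (C * δ) →
      c * δ ≤ |stdForm (Y.mulVec (e₁ m)) (e₁ m)| →
      ∀ w, Z.mulVec (w + Y.mulVec w) = w - Y.mulVec w → w = 0 := by
  -- The first coordinate detects multiples of `e₁`, so `T` is injective. In finite dimension this
  -- bounds the distance of `w` from the line of `e₁` by a multiple of `‖Z w - w‖`.
  let T : Std (m + 1) →ₗ[ℝ] Std (m + 1) × ℝ :=
    (Matrix.mulVecLin Z - LinearMap.id).prod (LinearMap.proj (Sum.inl 0))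
  have hT : LinearMap.ker T = ⊥ := by
    rw [LinearMap.ker_eq_bot']
    intro w hw
    have h1 : Z.mulVec w = w := sub_eq_zero.1 (congrArg Prod.fst hw)
    have h2 : w (Sum.inl 0) = 0 := congrArg Prod.snd hw
    obtain ⟨a, rfl⟩ := hker w h1
    have : a = 0 := by simpa [e₁] using h2
    simp [this]
  obtain ⟨K, hK, hK'⟩ := T.exists_antilipschitzWith hT
  obtain ⟨Cz, hCz, hCz'⟩ := exists_opBound (Z + 1)
  have hdist : ∀ w : Std (m + 1), ‖w - w (Sum.inl 0) • e₁ m‖ ≤ K * ‖Z.mulVec w - w‖ := by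
    intro w
    have h1 := hK'.le_mul_dist (w - w (Sum.inl 0) • e₁ m) 0
    rw [dist_zero_right, map_zero, dist_zero_right] at h1
    have h2 : T (w - w (Sum.inl 0) • e₁ m) = (Z.mulVec w - w, 0) := by
      refine Prod.ext ?_ ?_
      · show Z.mulVec (w - w (Sum.inl 0) • e₁ m) - (w - w (Sum.inl 0) • e₁ m) = _
        rw [Matrix.mulVec_sub, Matrix.mulVec_smul, hZe]; abel
      · show (w - w (Sum.inl 0) • e₁ m) (Sum.inl 0) = 0
        simp [e₁]
    rw [h2] at h1
    simpa [Prod.norm_def] using h1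
  have he : ‖e₁ m‖ = 1 := by rw [e₁, Pi.norm_single]; simp
  -- `A δ ‖w‖` will bound the part of `w` transverse to the line of `e₁`, and `A' δ ‖w‖` its
  -- component along `e₁`.
  let A : ℝ := K * Cz * C
  let A' : ℝ := (2 * (m + 1) * C * A / c)
  have hA : 0 ≤ A := by positivity
  have hA' : 0 ≤ A' := by positivity
  refine ⟨1 / (2 * (A + A' + 1)), by positivity, fun δ hδ hδ' Y hY hYb hYe w hw => ?_⟩
  have hsmall : (A + A') * δ ≤ 1 / 2 := by
    rw [le_div_iff₀ (by positivity)] at hδ'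
    nlinarith
  have e1 : Z.mulVec w - w = -((Z + 1).mulVec (Y.mulVec w)) := by
    rw [Matrix.mulVec_add] at hw
    rw [Matrix.add_mulVec, Matrix.one_mulVec, eq_neg_iff_add_eq_zero]
    linear_combination (exp := 1) hw
  have h0 : ∀ v, stdForm (Z.mulVec v) (e₁ m) = stdForm v (e₁ m) := by
    intro v
    have := mem_symplecticGroup_iff_stdForm.1 hZ v (e₁ m)
    rwa [hZe] at this
  -- Pairing the equation with the fixed vector `e₁` of the symplectic matrix `Z` eliminates `Z` and
  -- leaves `2 ω(Y w, e₁) = 0`.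
  have e2 : stdForm (Y.mulVec (e₁ m)) w = 0 := by
    have := congrArg (fun v => stdForm v (e₁ m)) hw
    simp only [stdForm_sub_left, h0, stdForm_add_left] at this
    rw [hY]; linarith
  set a := w (Sum.inl 0) with ha
  set r := w - a • e₁ m with hr
  have hr' : ‖r‖ ≤ A * δ * ‖w‖ := by
    calc ‖r‖ ≤ K * ‖Z.mulVec w - w‖ := hdist w
      _ = K * ‖(Z + 1).mulVec (Y.mulVec w)‖ := by rw [e1, norm_neg]
      _ ≤ K * (Cz * (C * δ * ‖w‖)) := by
          gcongr
          exact (hCz' _).trans (mul_le_mul_of_nonneg_left (hYb w) hCz.le)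
      _ = A * δ * ‖w‖ := by simp only [A]; ring
  have hwr : w = a • e₁ m + r := by rw [hr]; abel
  have e3 : a * stdForm (Y.mulVec (e₁ m)) (e₁ m) = -stdForm (Y.mulVec (e₁ m)) r := by
    rw [hwr, stdForm_add_right, stdForm_smul_right] at e2; linarith
  -- The transverse part `r` is of order `δ ‖w‖` and `Y` of order `δ`, so the right side is of order
  -- `δ² ‖w‖`, against the lower bound of order `δ` for the form on `e₁`. Hence `a` is of order `δ
  -- ‖w‖` too, and `w` is bounded by half its own norm.
  have e4 : |a| * (c * δ) ≤ 2 * (m + 1) * (C * δ * (A * δ * ‖w‖)) := by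
    calc |a| * (c * δ) ≤ |a| * |stdForm (Y.mulVec (e₁ m)) (e₁ m)| := by gcongr
      _ = |stdForm (Y.mulVec (e₁ m)) r| := by rw [← abs_mul, e3, abs_neg]
      _ ≤ 2 * ((m + 1 : ℕ) : ℝ) * (‖Y.mulVec (e₁ m)‖ * ‖r‖) := abs_stdForm_le _ _
      _ ≤ 2 * (m + 1) * (C * δ * (A * δ * ‖w‖)) := by
          push_cast
          gcongr
          simpa [he] using hYb (e₁ m)
  have e5 : |a| ≤ A' * δ * ‖w‖ := by
    have : |a| * c ≤ 2 * (m + 1) * C * A * δ * ‖w‖ := by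
      have h := mul_le_mul_of_nonneg_right e4 (inv_pos.2 hδ).le
      have e6 : |a| * (c * δ) * δ⁻¹ = |a| * c := by field_simp
      have e7 : 2 * (m + 1) * (C * δ * (A * δ * ‖w‖)) * δ⁻¹ = 2 * (m + 1) * C * A * δ * ‖w‖ := by
        field_simp
      rwa [e6, e7] at h
    have h2 : A' * δ * ‖w‖ = 2 * (m + 1) * C * A * δ * ‖w‖ / c := by simp only [A']; ring
    rwa [h2, le_div_iff₀ hc]
  have e8 : ‖w‖ ≤ (A + A') * δ * ‖w‖ := by
    calc ‖w‖ ≤ ‖a • e₁ m‖ + ‖r‖ := by conv_lhs => rw [hwr]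
                                      exact norm_add_le _ _
      _ ≤ A' * δ * ‖w‖ + A * δ * ‖w‖ := by
          rw [norm_smul, he, mul_one]; exact add_le_add e5 hr'
      _ = _ := by ring
  have : ‖w‖ ≤ 0 := by nlinarith [norm_nonneg w]
  exact norm_le_zero_iff.1 this

/-! ### Small solutions of linear differential equations -/

theorem continuousOn_of_mulVec {X : Type*} [TopologicalSpace X] {n : ℕ} {N : X → Mat n} {s : Set X}
    (h : ∀ v, ContinuousOn (fun x => (N x).mulVec v) s) : ContinuousOn N s := by
  refine continuousOn_pi.2 fun i => continuousOn_pi.2 fun j => ?_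
  have := (continuousOn_pi.1 (h (Pi.single j 1))) i
  simpa using this

/-- This is Grönwall's inequality for `N v - v`. The factor `2` comes from `e^x - 1 ≤ 2x` for `0 ≤ x
≤ 1`, and this is the purpose of `C δ ≤ 1`. -/
theorem linear_ode_bound {n : ℕ} {B N : ℝ → Mat n} {C δ : ℝ} (hC : 0 < C) (hδ : 0 < δ)
    (hCδ : C * δ ≤ 1) (hB : ∀ θ ∈ Icc (0 : ℝ) 1, OpBound (B θ) C) (h0 : N 0 = 1)
    (hN : ∀ v, ∀ θ ∈ Icc (0 : ℝ) 1,
      HasDerivAt (fun θ => (N θ).mulVec v) (δ • (B θ).mulVec ((N θ).mulVec v)) θ) :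
    ∀ θ ∈ Icc (0 : ℝ) 1, OpBound (N θ - 1) (2 * C * δ) := by
  intro θ hθ v
  have hK : C * δ ≠ 0 := (mul_pos hC hδ).ne'
  have key := norm_le_gronwallBound_of_norm_deriv_right_le (f := fun s => (N s).mulVec v - v)
    (f' := fun s => δ • (B s).mulVec ((N s).mulVec v)) (δ := 0) (K := C * δ)
    (ε := C * δ * ‖v‖) (a := 0) (b := 1)
    (fun s hs => ((hN v s hs).continuousAt.sub continuousAt_const).continuousWithinAt)
    (fun s hs => ((hN v s (Ico_subset_Icc_self hs)).sub_const v).hasDerivWithinAt)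
    (by simp [h0]) (fun s hs => by
      rw [norm_smul, Real.norm_of_nonneg hδ.le]
      have h1 := hB s (Ico_subset_Icc_self hs) ((N s).mulVec v)
      have h2 : ‖(N s).mulVec v‖ ≤ ‖(N s).mulVec v - v‖ + ‖v‖ := by
        simpa using norm_add_le ((N s).mulVec v - v) v
      calc δ * ‖(B s).mulVec ((N s).mulVec v)‖ ≤ δ * (C * (‖(N s).mulVec v - v‖ + ‖v‖)) := by
            gcongr; exact h1.trans (by gcongr)
        _ = _ := by ring) θ hθ
  rw [Matrix.sub_mulVec, Matrix.one_mulVec]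
  refine key.trans ?_
  rw [gronwallBound_of_K_ne_0 hK]
  have hx : 0 ≤ C * δ * (θ - 0) := mul_nonneg (mul_pos hC hδ).le (by linarith [hθ.1])
  have hx' : C * δ * (θ - 0) ≤ C * δ := by
    have := (mul_pos hC hδ).le; nlinarith [hθ.2]
  have hexp : Real.exp (C * δ * (θ - 0)) - 1 ≤ 2 * (C * δ) := by
    have := Real.abs_exp_sub_one_le (x := C * δ * (θ - 0)) (by rw [abs_of_nonneg hx]; linarith)
    rw [abs_of_nonneg hx] at this
    linarith [le_abs_self (Real.exp (C * δ * (θ - 0)) - 1)]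
  have : C * δ * ‖v‖ / (C * δ) = ‖v‖ := by field_simp
  beta_reduce
  rw [this, zero_mul, zero_add]
  nlinarith [norm_nonneg v]

/-- The derivative of `ω(N(θ)e, e) - δaθ` is `δ ω(B(N-1)e, e)`, which is of order `δ²` since `N - 1`
is of order `δ`. -/
theorem linear_ode_first_order {n : ℕ} {B N : ℝ → Mat n} {C C' δ a : ℝ} {e : Std n} (hC : 0 < C)
    (hδ : 0 < δ) (hB : ∀ θ ∈ Icc (0 : ℝ) 1, OpBound (B θ) C)
    (hBe : ∀ θ ∈ Icc (0 : ℝ) 1, stdForm ((B θ).mulVec e) e = a) (h0 : N 0 = 1)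
    (hN : ∀ v, ∀ θ ∈ Icc (0 : ℝ) 1,
      HasDerivAt (fun θ => (N θ).mulVec v) (δ • (B θ).mulVec ((N θ).mulVec v)) θ)
    (hb : ∀ θ ∈ Icc (0 : ℝ) 1, OpBound (N θ - 1) (C' * δ)) :
    |stdForm ((N 1 - 1).mulVec e) e - δ * a| ≤ 2 * n * (C * C' * ‖e‖ ^ 2) * δ ^ 2 := by
  let L : Std n →L[ℝ] ℝ := LinearMap.toContinuousLinearMap
    { toFun := fun v => stdForm v e
      map_add' := fun u v => stdForm_add_left u v e
      map_smul' := fun a v => stdForm_smul_left a v e }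
  have hL : ∀ v, L v = stdForm v e := fun v => rfl
  have hder : ∀ θ ∈ Icc (0 : ℝ) 1, HasDerivWithinAt
      (fun θ => stdForm ((N θ).mulVec e) e - δ * a * θ)
      (δ * stdForm ((B θ).mulVec ((N θ - 1).mulVec e)) e) (Icc 0 1) θ := by
    intro θ hθ
    have h1 := (L.hasFDerivAt.comp_hasDerivAt θ (hN e θ hθ)).sub
      ((hasDerivAt_id θ).const_mul (δ * a))
    refine (h1.hasDerivWithinAt (s := Icc 0 1)).congr_deriv ?_
    rw [hL, stdForm_smul_left, Matrix.sub_mulVec, Matrix.one_mulVec, Matrix.mulVec_sub,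
      stdForm_sub_left, hBe θ hθ]
    ring
  have := norm_image_sub_le_of_norm_deriv_le_segment_01' (C := 2 * n * (C * C' * ‖e‖ ^ 2) * δ ^ 2)
    hder (fun θ hθ => by
      have hθ' := Ico_subset_Icc_self hθ
      rw [Real.norm_eq_abs, abs_mul, abs_of_pos hδ]
      calc δ * |stdForm ((B θ).mulVec ((N θ - 1).mulVec e)) e|
          ≤ δ * (2 * n * (C * (C' * δ * ‖e‖) * ‖e‖)) := by
            gcongr
            refine (abs_stdForm_le _ _).trans ?_
            gcongr
            exact (hB θ hθ' _).trans (by gcongr; exact hb θ hθ' e)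
        _ = _ := by ring)
  rw [Real.norm_eq_abs] at this
  convert this using 2
  simp [h0, Matrix.sub_mulVec, stdForm_sub_left]
  ring

set_option maxHeartbeats 1000000 in
/-- The flow of a small Hamiltonian perturbation is homotopic to the shear in the direction `η`, in
such a way that the composition of the end with `Z` never has the eigenvalue `1`. -/
theorem exists_perturbation_homotopy {m : ℕ} {Z : Mat (m + 1)}
    (hZ : Z ∈ Matrix.symplecticGroup (Fin (m + 1)) ℝ) (hZe : Z.mulVec (e₁ m) = e₁ m)
    (hker : ∀ w, Z.mulVec w = w → ∃ a : ℝ, w = a • e₁ m) {B : ℝ → Mat (m + 1)} {C a : ℝ}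
    (hC : 0 < C) (hB : ∀ θ ∈ Icc (0 : ℝ) 1, OpBound (B θ) C)
    (hBe : ∀ θ ∈ Icc (0 : ℝ) 1, stdForm ((B θ).mulVec (e₁ m)) (e₁ m) = a) (ha : a ≠ 0)
    {η : Std (m + 1)} (hη : stdForm η (e₁ m) ≠ 0) :
    ∃ δ₀ : ℝ, 0 < δ₀ ∧ ∀ δ : ℝ, 0 < δ → δ ≤ δ₀ → ∀ N : ℝ → Mat (m + 1),
      (∀ θ ∈ Icc (0 : ℝ) 1, N θ ∈ Matrix.symplecticGroup (Fin (m + 1)) ℝ) → N 0 = 1 →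
      (∀ v, ∀ θ ∈ Icc (0 : ℝ) 1,
        HasDerivAt (fun θ => (N θ).mulVec v) (δ • (B θ).mulVec ((N θ).mulVec v)) θ) →
      ∃ (c : ℝ) (H : ℝ → ℝ → Mat (m + 1)), 0 < c * a ∧
        ContinuousOn (fun z : ℝ × ℝ => H z.1 z.2) (Icc 0 1 ×ˢ Icc 0 1) ∧
        (∀ u ∈ Icc (0 : ℝ) 1, ∀ s ∈ Icc (0 : ℝ) 1,
          H u s ∈ Matrix.symplecticGroup (Fin (m + 1)) ℝ) ∧
        (∀ u ∈ Icc (0 : ℝ) 1, H u 0 = 1) ∧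
        (∀ u ∈ Icc (0 : ℝ) 1, (1 - Z * H u 1).det ≠ 0) ∧
        (∀ s ∈ Icc (0 : ℝ) 1, H 0 s = 1 + (c * s) • etaMat η) ∧
        (∀ s ∈ Icc (0 : ℝ) 1, H 1 s = N s) := by
  obtain ⟨Cη, hCη, hCη'⟩ := exists_opBound (etaMat η)
  have he : ‖e₁ m‖ = 1 := by rw [e₁, Pi.norm_single]; simp
  have ha2 : 0 < a ^ 2 := by positivity
  -- `C₁ δ` bounds the whole homotopy of generators `Y`. The constant `κ` below is chosen so that `a
  -- ω(Y e₁, e₁) ≥ κ δ` at both of its ends, hence in between.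
  set C₁ : ℝ := 2 * C + |a| * Cη with hC₁
  have hC₁pos : 0 < C₁ := by positivity
  set w₀ := stdForm η (e₁ m) with hw₀
  have hw2 : 0 < w₀ ^ 2 := by positivity
  set κ : ℝ := min (a ^ 2 / 4) (a ^ 2 * w₀ ^ 2) with hκ
  have hκpos : 0 < κ := by positivity
  have hapos : 0 < |a| := abs_pos.2 ha
  obtain ⟨δ₁, hδ₁, hcore⟩ := nondegenerate_perturbation hZ hZe hker hC₁pos (div_pos hκpos hapos)
  set A : ℝ := |a| * (2 * (m + 1) * (C * (2 * C)) + 2 * (m + 1) * (2 * C * (2 * C))) with hA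
  have hApos : 0 < A := by positivity
  refine ⟨min (min δ₁ (1 / (2 * C₁))) (a ^ 2 / (2 * A)), by positivity,
    fun δ hδ hδ' N hNsp hN0 hN => ?_⟩
  have hd1 : δ ≤ δ₁ := hδ'.trans ((min_le_left _ _).trans (min_le_left _ _))
  have hd2 : C₁ * δ ≤ 1 / 2 := by
    have := hδ'.trans ((min_le_left _ _).trans (min_le_right _ _))
    rw [le_div_iff₀ (by positivity)] at this
    linarith
  have hd3 : A * δ ≤ a ^ 2 / 2 := by
    have := hδ'.trans (min_le_right _ _)
    rw [le_div_iff₀ (by positivity)] at this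
    linarith
  have hCC : 2 * C ≤ C₁ := by rw [hC₁]; have := mul_pos hapos hCη; linarith
  have hCδ : 2 * C * δ ≤ 1 / 2 := (mul_le_mul_of_nonneg_right hCC hδ.le).trans hd2
  have hNb := linear_ode_bound hC hδ (by linarith) hB hN0 hN
  have hfo := linear_ode_first_order hC hδ hB hBe hN0 hN hNb
  have hNd : ∀ θ ∈ Icc (0 : ℝ) 1, (N θ + 1).det ≠ 0 := fun θ hθ =>
    det_add_one_ne_zero ((hNb θ hθ).mono (by linarith))
  have hNcont : ContinuousOn N (Icc 0 1) :=
    continuousOn_of_mulVec fun v θ hθ => (hN v θ hθ).continuousAt.continuousWithinAt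
  let L : ℝ → Mat (m + 1) := fun θ => cayleyLog (N θ)
  have hLham : ∀ θ ∈ Icc (0 : ℝ) 1, IsHam (L θ) := fun θ hθ =>
    isHam_cayleyLog (hNd θ hθ) (hNsp θ hθ)
  have hLb : ∀ θ ∈ Icc (0 : ℝ) 1, OpBound (L θ) (2 * C * δ) := fun θ hθ =>
    opBound_cayleyLog (by linarith) (hNb θ hθ)
  have hLcont : ContinuousOn L (Icc 0 1) := (hNcont.sub continuousOn_const).mul
    (continuousOn_inv.comp (hNcont.add continuousOn_const) fun θ hθ => hNd θ hθ)
  -- Hamiltonian matrices form a vector space, so the Cayley logarithm of `N` can be joined to a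
  -- multiple of `etaMat η` by a segment. The factor `a` gives the two ends the same sign on `e₁`.
  let Y : ℝ → ℝ → Mat (m + 1) := fun u s => u • L s + ((1 - u) * s * (a * δ)) • etaMat η
  have hYham : ∀ u ∈ Icc (0 : ℝ) 1, ∀ s ∈ Icc (0 : ℝ) 1, IsHam (Y u s) := fun u _ s hs =>
    (hLham s hs).combo (isHam_etaMat η) _ _
  have hYb : ∀ u ∈ Icc (0 : ℝ) 1, ∀ s ∈ Icc (0 : ℝ) 1, OpBound (Y u s) (C₁ * δ) := by
    intro u hu s hs v
    have hcoef : |(1 - u) * s * (a * δ)| ≤ |a| * δ := by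
      rw [abs_mul, abs_mul, abs_mul, abs_of_nonneg (by linarith [hu.2] : 0 ≤ 1 - u),
        abs_of_nonneg hs.1, abs_of_pos hδ]
      have : (1 - u) * s ≤ 1 := by nlinarith [hu.1, hu.2, hs.1, hs.2]
      have h2 : 0 ≤ |a| * δ := by positivity
      nlinarith
    simp only [Y, Matrix.add_mulVec, Matrix.smul_mulVec]
    calc ‖u • (L s).mulVec v + ((1 - u) * s * (a * δ)) • (etaMat η).mulVec v‖
        ≤ ‖u • (L s).mulVec v‖ + ‖((1 - u) * s * (a * δ)) • (etaMat η).mulVec v‖ :=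
          norm_add_le _ _
      _ ≤ 1 * (2 * C * δ * ‖v‖) + |a| * δ * (Cη * ‖v‖) := by
          rw [norm_smul, norm_smul, Real.norm_eq_abs, Real.norm_eq_abs, abs_of_nonneg hu.1]
          have h1 := hLb s hs v
          have h2 := hCη' v
          have h3 := hu.2
          gcongr
      _ = C₁ * δ * ‖v‖ := by rw [hC₁]; ring
  have hYd : ∀ u ∈ Icc (0 : ℝ) 1, ∀ s ∈ Icc (0 : ℝ) 1, (1 - Y u s).det ≠ 0 := fun u hu s hs =>
    det_one_sub_ne_zero ((hYb u hu s hs).mono hd2)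
  have hYcont : ContinuousOn (fun z : ℝ × ℝ => Y z.1 z.2) (Icc 0 1 ×ˢ Icc 0 1) := by
    have h1 : ContinuousOn (fun z : ℝ × ℝ => L z.2) (Icc 0 1 ×ˢ Icc 0 1) :=
      hLcont.comp continuousOn_snd fun z hz => hz.2
    exact (continuousOn_fst.smul h1).add (by fun_prop)
  have hL0 : L 0 = 0 := by simp [L, cayleyLog, hN0]
  -- the quadratic form on the kernel
  have hLe : δ * (a ^ 2 / 4) ≤ a * stdForm ((L 1).mulVec (e₁ m)) (e₁ m) := by
    have z1 : (1 : ℝ) ∈ Icc (0 : ℝ) 1 := by simp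
    -- Up to second order in `δ`, the logarithm is `(N - 1)/2`, whose value on `e₁` is known to
    -- first order from `hfo`.
    have h2 : (2 : ℝ) • L 1 = (N 1 - 1) - L 1 * (N 1 - 1) := by
      have h := cayleyLog_mul (hNd 1 z1)
      have h' : L 1 * (N 1 + 1) = N 1 - 1 := h
      have : (2 : ℝ) • L 1 = L 1 * (N 1 + 1) - L 1 * (N 1 - 1) := by
        rw [mul_add, mul_sub, mul_one]; module
      rw [this, h']
    have h3 : 2 * stdForm ((L 1).mulVec (e₁ m)) (e₁ m) = stdForm ((N 1 - 1).mulVec (e₁ m)) (e₁ m) -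
        stdForm ((L 1).mulVec ((N 1 - 1).mulVec (e₁ m))) (e₁ m) := by
      rw [← stdForm_smul_left, ← Matrix.smul_mulVec, h2, Matrix.sub_mulVec, stdForm_sub_left,
        Matrix.mulVec_mulVec]
    have h4 : |stdForm ((L 1).mulVec ((N 1 - 1).mulVec (e₁ m))) (e₁ m)| ≤
        2 * (m + 1) * (2 * C * (2 * C)) * δ ^ 2 := by
      refine (abs_stdForm_le _ _).trans ?_
      have h5 : ‖(L 1).mulVec ((N 1 - 1).mulVec (e₁ m))‖ ≤ 2 * C * δ * (2 * C * δ * 1) := by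
        refine (hLb 1 z1 _).trans ?_
        have := hNb 1 z1 (e₁ m)
        rw [he] at this
        gcongr
      rw [he]
      push_cast
      calc 2 * ((m : ℝ) + 1) * (‖(L 1).mulVec ((N 1 - 1).mulVec (e₁ m))‖ * 1)
          ≤ 2 * ((m : ℝ) + 1) * (2 * C * δ * (2 * C * δ * 1) * 1) := by gcongr
        _ = _ := by ring
    rw [he] at hfo
    push_cast at hfo
    set x := stdForm ((N 1 - 1).mulVec (e₁ m)) (e₁ m) with hx
    set y := stdForm ((L 1).mulVec ((N 1 - 1).mulVec (e₁ m))) (e₁ m) with hy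
    have h6 : |a * (x - y) - δ * a ^ 2| ≤ A * δ ^ 2 := by
      have : a * (x - y) - δ * a ^ 2 = a * ((x - δ * a) - y) := by ring
      rw [this, abs_mul]
      have h7 := abs_sub (x - δ * a) y
      calc |a| * |x - δ * a - y| ≤ |a| * (2 * (m + 1) * (C * (2 * C) * 1 ^ 2) * δ ^ 2 +
            2 * (m + 1) * (2 * C * (2 * C)) * δ ^ 2) := by
            gcongr; linarith
        _ = A * δ ^ 2 := by rw [hA]; ring
    have h8 := (abs_le.1 h6).1
    have h9 : A * δ ^ 2 ≤ a ^ 2 / 2 * δ := by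
      have := mul_le_mul_of_nonneg_right hd3 hδ.le
      linarith
    have h10 : a * (x - y) = 2 * (a * stdForm ((L 1).mulVec (e₁ m)) (e₁ m)) := by
      rw [← h3]; ring
    linarith
  have hform : ∀ u ∈ Icc (0 : ℝ) 1,
      κ / |a| * δ ≤ |stdForm ((Y u 1).mulVec (e₁ m)) (e₁ m)| := by
    intro u hu
    have h1 : a * stdForm ((Y u 1).mulVec (e₁ m)) (e₁ m) =
        u * (a * stdForm ((L 1).mulVec (e₁ m)) (e₁ m)) + (1 - u) * (δ * (a ^ 2 * w₀ ^ 2)) := by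
      simp only [Y, Matrix.add_mulVec, Matrix.smul_mulVec, stdForm_add_left, stdForm_smul_left,
        etaMat_mulVec, ← hw₀]
      ring
    have h2 : κ ≤ a ^ 2 / 4 := min_le_left _ _
    have h3 : κ ≤ a ^ 2 * w₀ ^ 2 := min_le_right _ _
    have h4 : κ * δ ≤ a * stdForm ((Y u 1).mulVec (e₁ m)) (e₁ m) := by
      rw [h1]
      have h5 : κ * δ ≤ a * stdForm ((L 1).mulVec (e₁ m)) (e₁ m) := by
        have := mul_le_mul_of_nonneg_right h2 hδ.le
        linarith
      have h6 : κ * δ ≤ δ * (a ^ 2 * w₀ ^ 2) := by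
        have := mul_le_mul_of_nonneg_right h3 hδ.le
        linarith
      have h7 := mul_le_mul_of_nonneg_left h5 hu.1
      have h8 := mul_le_mul_of_nonneg_left h6 (sub_nonneg.2 hu.2)
      have h9 : κ * δ = u * (κ * δ) + (1 - u) * (κ * δ) := by ring
      rw [h9]
      exact add_le_add h7 h8
    have h5 := h4.trans (le_abs_self _)
    rw [abs_mul] at h5
    rw [div_mul_eq_mul_div, div_le_iff₀ hapos]
    linarith
  have hca : 0 < 2 * (a * δ) * a := by
    have : 2 * (a * δ) * a = 2 * (a ^ 2 * δ) := by ring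
    rw [this]; positivity
  -- The Cayley transform of `(aδs) · etaMat η` is `1 + (2aδs) · etaMat η`, because `etaMat η` has
  -- square zero.
  refine ⟨2 * (a * δ), fun u s => cayley (Y u s), hca, ContinuousOn.cayley hYcont
    (fun z hz => hYd _ hz.1 _ hz.2), fun u hu s hs => cayley_mem (hYd u hu s hs) (hYham u hu s hs),
    fun u _ => ?_, fun u hu => ?_, fun s hs => ?_, fun s hs => ?_⟩
  · simp [Y, hL0, cayley]
  · have z1 : (1 : ℝ) ∈ Icc (0 : ℝ) 1 := by simp
    refine det_ne_zero_of_injective fun v hv => ?_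
    rw [Matrix.sub_mulVec, Matrix.one_mulVec, sub_eq_zero] at hv
    -- In terms of `v = (1 - Y) w`, the equation `Z · cayley Y · v = v` becomes `Z (w + Y w) = w - Y
    -- w`.
    set w := (1 - Y u 1)⁻¹.mulVec v with hw
    have hvw : v = (1 - Y u 1).mulVec w := by
      rw [hw, Matrix.mulVec_mulVec, Matrix.mul_nonsing_inv _ (Ne.isUnit (hYd u hu 1 z1)),
        Matrix.one_mulVec]
    have h1 : (cayley (Y u 1)).mulVec v = (1 + Y u 1).mulVec w := by
      rw [hvw, Matrix.mulVec_mulVec, cayley_mul (hYd u hu 1 z1)]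
    have h2 : w = 0 := by
      refine hcore δ hδ hd1 (Y u 1) (hYham u hu 1 z1) (hYb u hu 1 z1) (hform u hu) w ?_
      rw [← Matrix.mulVec_mulVec, h1] at hv
      rw [hvw] at hv
      simpa only [Matrix.add_mulVec, Matrix.sub_mulVec, Matrix.one_mulVec] using hv.symm
    rw [hvw, h2, Matrix.mulVec_zero]
  · have hY0 : Y 0 s = (s * (a * δ)) • etaMat η := by simp [Y]
    symm
    refine eq_cayley (hYd 0 (by simp) s hs) ?_
    rw [hY0]
    simp only [add_mul, mul_sub, one_mul, mul_one, smul_mul_assoc, mul_smul_comm, etaMat_mul_self]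
    module
  · have hY1 : Y 1 s = cayleyLog (N s) := by simp [Y, L]
    have hd := hYd 1 (by simp) s hs
    beta_reduce
    rw [hY1] at hd ⊢
    exact (eq_cayley hd (mul_one_sub_cayleyLog (hNd s hs))).symm

/-! ### The index of the linearized Hamiltonian flow, in terms of matrices -/

/-- The unit vector in the direction of the coordinate `x_m` of `ℝ^{2 (m + 1)}`. -/
def eLast (m : ℕ) : Std (m + 1) := Pi.single (Sum.inl (Fin.last m)) 1

theorem one_add_smul_etaMat_eLast {m : ℕ} (x : ℝ) :
    1 + x • etaMat (eLast m) = dsum 1 (planeMat 1 x 0 1) := by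
  have h : ∀ j, stdForm (eLast m) (Pi.single j 1) = (Pi.single j 1 : Std (m + 1)) (Sum.inr (Fin.last m)) := by
    intro j
    rw [eLast, stdForm_single_inl]
  ext i j
  simp only [etaMat, h]
  obtain ⟨i, rfl⟩ := (splitEquiv m).surjective i
  obtain ⟨j, rfl⟩ := (splitEquiv m).surjective j
  simp only [Matrix.add_apply, Matrix.smul_apply, Matrix.vecMulVec_apply, eLast, dsum, Matrix.reindex_apply,
    Matrix.submatrix_apply, Equiv.symm_apply_apply]
  rw [Matrix.one_apply]
  simp only [(splitEquiv m).injective.eq_iff]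
  rcases i with (i | i) | (i | i) <;> rcases j with (j | j) | (j | j) <;>
    simp [splitEquiv, planeMat, Matrix.one_apply, Pi.single_apply, castAdd_ne_last, natAdd_eq_last,
      (castAdd_ne_last _).symm, eq_iff_true_of_subsingleton]

theorem one_add_smul_etaMat {m : ℕ} {A : Mat (m + 1)}
    (hA : A ∈ Matrix.symplecticGroup (Fin (m + 1)) ℝ) (x : ℝ) :
    1 + x • etaMat (A.mulVec (eLast m)) = A * dsum 1 (planeMat 1 x 0 1) * sinv A := by
  have hAA := mul_sinv_self hA
  have : etaMat (A.mulVec (eLast m)) = A * etaMat (eLast m) * sinv A := by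
    refine Matrix.ext_of_mulVec_single fun i => ?_
    rw [etaMat_mulVec, ← Matrix.mulVec_mulVec, ← Matrix.mulVec_mulVec, etaMat_mulVec,
      Matrix.mulVec_smul, ← mem_symplecticGroup_iff_stdForm.1 hA (eLast m), Matrix.mulVec_mulVec _ A,
      hAA, Matrix.one_mulVec]
  rw [this, ← one_add_smul_etaMat_eLast, mul_add, add_mul, mul_one, hAA]
  simp

/-- The linearized Hamiltonian flow in the coordinates `κ` (`Z` for the unperturbed flow, and
`Z (· + a) * N * Z(a)⁻¹` for the perturbed one), in a frame `F`. -/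
def framedPath {n : ℕ} (F Z N : ℝ → Mat n) (a θ : ℝ) : Mat n :=
  sinv (F (θ + a)) * (Z (θ + a) * N θ * sinv (Z a)) * F a

section

variable {n : ℕ} {F Z : ℝ → Mat n}

theorem framedPath_mem
    (hFsp : ∀ θ, F θ ∈ Matrix.symplecticGroup (Fin n) ℝ)
    (hZsp : ∀ θ, Z θ ∈ Matrix.symplecticGroup (Fin n) ℝ) {N : ℝ → Mat n} {a θ : ℝ}
    (hN : N θ ∈ Matrix.symplecticGroup (Fin n) ℝ) :
    framedPath F Z N a θ ∈ Matrix.symplecticGroup (Fin n) ℝ :=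
  mul_mem (mul_mem (sinv_mem (hFsp _)) (mul_mem (mul_mem (hZsp _) hN) (sinv_mem (hZsp _))))
    (hFsp _)

theorem framedPath_zero
    (hFsp : ∀ θ, F θ ∈ Matrix.symplecticGroup (Fin n) ℝ)
    (hZsp : ∀ θ, Z θ ∈ Matrix.symplecticGroup (Fin n) ℝ) {N : ℝ → Mat n} {a : ℝ} (hN : N 0 = 1) :
    framedPath F Z N a 0 = 1 := by
  rw [framedPath, hN, zero_add, mul_one, mul_sinv_self (hZsp a), mul_one, sinv_mul_self (hFsp a)]

/-- Since `Z(1+a) = Z(a) Z(1)` and `F` has period 1, the end of the framed path is conjugate to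
`Z(1) N(1)`, whatever `a` is. -/
theorem det_one_sub_framedPath
    (hFsp : ∀ θ, F θ ∈ Matrix.symplecticGroup (Fin n) ℝ)
    (hZsp : ∀ θ, Z θ ∈ Matrix.symplecticGroup (Fin n) ℝ)
    (hFper : ∀ θ, F (θ + 1) = F θ)
    (hZ1 : ∀ θ, Z (θ + 1) = Z θ * Z 1) {N : ℝ → Mat n} {a : ℝ} :
    (1 - framedPath F Z N a 1).det = (1 - Z 1 * N 1).det := by
  have h : framedPath F Z N a 1 = sinv (sinv (Z a) * F a) * (Z 1 * N 1) * (sinv (Z a) * F a) := by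
    have hss : sinv (sinv (Z a)) = Z a := by
      calc sinv (sinv (Z a)) = sinv (sinv (Z a)) * (sinv (Z a) * Z a) := by
            rw [sinv_mul_self (hZsp a), mul_one]
        _ = Z a := by rw [← mul_assoc, sinv_mul_self (sinv_mem (hZsp a)), one_mul]
    rw [framedPath, add_comm 1 a, hFper, hZ1, sinv_mul, hss]
    noncomm_ring
  rw [h, det_one_sub_conj (mul_mem (sinv_mem (hZsp a)) (hFsp a))]

/-- The relative flow and the base point `a` are deformed simultaneously. The base point may move
freely because it does not affect whether the end is nondegenerate. -/
theorem IsConleyZehnderIndex.framedPath_homotopy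
    (hF : Continuous F)
    (hZ : Continuous Z)
    (hFsp : ∀ θ, F θ ∈ Matrix.symplecticGroup (Fin n) ℝ)
    (hZsp : ∀ θ, Z θ ∈ Matrix.symplecticGroup (Fin n) ℝ)
    (hFper : ∀ θ, F (θ + 1) = F θ)
    (hZ1 : ∀ θ, Z (θ + 1) = Z θ * Z 1) {k : ℤ} {a : ℝ} {H : ℝ → ℝ → Mat n}
    (hH : ContinuousOn (fun z : ℝ × ℝ => H z.1 z.2) (Icc 0 1 ×ˢ Icc 0 1))
    (hHsp : ∀ u ∈ Icc (0 : ℝ) 1, ∀ s ∈ Icc (0 : ℝ) 1, H u s ∈ Matrix.symplecticGroup (Fin n) ℝ)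
    (hH0 : ∀ u ∈ Icc (0 : ℝ) 1, H u 0 = 1)
    (hdet : ∀ u ∈ Icc (0 : ℝ) 1, (1 - Z 1 * H u 1).det ≠ 0)
    (h : IsConleyZehnderIndex (framedPath F Z (H 0) 0) k) :
    IsConleyZehnderIndex (framedPath F Z (H 1) a) k := by
  refine IsConleyZehnderIndex.homotopy (H := fun u s => framedPath F Z (H u) (u * a) s) ?_ ?_ ?_ ?_
    (by simpa using h) |> fun h' => by simpa using h'
  · unfold framedPath
    have h1 : Continuous fun z : ℝ × ℝ => MorseBott.sinv (F (z.2 + z.1 * a)) :=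
      continuous_sinv.comp (hF.comp (by fun_prop))
    have h2 : Continuous fun z : ℝ × ℝ => Z (z.2 + z.1 * a) := hZ.comp (by fun_prop)
    have h3 : Continuous fun z : ℝ × ℝ => MorseBott.sinv (Z (z.1 * a)) :=
      continuous_sinv.comp (hZ.comp (by fun_prop))
    have h4 : Continuous fun z : ℝ × ℝ => F (z.1 * a) := hF.comp (by fun_prop)
    exact (h1.continuousOn.mul ((h2.continuousOn.mul hH).mul h3.continuousOn)).mul h4.continuousOn
  · exact fun u hu s hs => framedPath_mem hFsp hZsp (hHsp u hu s hs)
  · exact fun u hu => framedPath_zero hFsp hZsp (hH0 u hu)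
  · intro u hu
    rw [det_one_sub_framedPath hFsp hZsp hFper hZ1]
    exact hdet u hu

end

/-- The index of the linearized Hamiltonian flow, for the model perturbation given by a shear. -/
theorem index_shear_framedPath {m : ℕ} {F Z E : ℝ → Mat (m + 1)} {Ψ : ℝ → Mat m} {Γ : ℝ → Mat (m + 1)}
    {b c : ℝ} {k j : ℤ} (hFc : Continuous F)
    (hFsp : ∀ θ, F θ ∈ Matrix.symplecticGroup (Fin (m + 1)) ℝ)
    (hFper : ∀ θ, F (θ + 1) = F θ) (hZ0 : Z 0 = 1) (hZ1 : ∀ θ, Z (θ + 1) = Z θ * Z 1)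
    (hE : ContinuousOn E (Icc 0 1))
    (hEsp : ∀ s ∈ Icc (0 : ℝ) 1, E s ∈ Matrix.symplecticGroup (Fin (m + 1)) ℝ) (hE1 : E 1 = E 0)
    (hZE : ∀ s ∈ Icc (0 : ℝ) 1, Z (-s) = E s * dsum (Ψ s) (planeMat 1 0 (b * s) 1) * sinv (E 0))
    (hdeg : AngleInc (fun r => complexDet (sinv (E r) * F (-r))) 0 1 0)
    (hΓ : ContinuousOn Γ (Icc 0 1))
    (hΓsp : ∀ s ∈ Icc (0 : ℝ) 1, Γ s ∈ Matrix.symplecticGroup (Fin (m + 1)) ℝ) (hΓ0 : Γ 0 = 1)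
    (hΓ1 : Γ 1 = sinv (E 0) * F 0) (h : IsConleyZehnderIndex Ψ k)
    (hQ : IsConleyZehnderIndex (fun θ => shearMat (b * θ) (c * θ)) j) :
    IsConleyZehnderIndex
      (framedPath F Z (fun s => 1 + (c * s) • etaMat ((E 0).mulVec (eLast m))) 0) (-k + j) := by
  have z0 : (0 : ℝ) ∈ Icc (0 : ℝ) 1 := by simp
  have z1 : (1 : ℝ) ∈ Icc (0 : ℝ) 1 := by simp
  have hF1 : F (-1) = F 0 := by simpa using (hFper (-1)).symm
  have hΨ1 := h.mem 1 z1
  have key := index_of_blocks (D := fun r => sinv (E r) * F (-r)) (Γ := Γ)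
    ((continuous_sinv.comp_continuousOn hE).mul (hFc.comp continuous_neg).continuousOn)
    (fun s hs => mul_mem (sinv_mem (hEsp s hs)) (hFsp _)) (by simp [hE1, hF1]) hdeg hΓ hΓsp hΓ0
    (by simpa using hΓ1) h hQ
  refine key.congr fun θ hθ => ?_
  have hθ' : 1 - θ ∈ Icc (0 : ℝ) 1 := ⟨by linarith [hθ.2], by linarith [hθ.1]⟩
  have hEE := mul_sinv_self (hEsp 0 z0)
  have hEE' := sinv_mul_self (hEsp 0 z0)
  have hEθ := mul_sinv_self (hEsp _ hθ')
  -- `hZE` gives `Z` on `[-1, 0]` only. From `Z(-1) Z(1) = 1` and `Z(θ) = Z(-(1-θ)) Z(1)` one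
  -- obtains it on `[0, 1]`; this produces the reversed path `Ψ(1-θ) Ψ(1)⁻¹` and the shear of rate
  -- `-b`.
  have hZm1 : Z (-1) * (E 0 * dsum (sinv (Ψ 1)) (planeMat 1 0 (-b) 1) * sinv (E 0)) = 1 := by
    rw [hZE 1 z1, hE1]
    calc _ = E 0 * (dsum (Ψ 1) (planeMat 1 0 (b * 1) 1) * (sinv (E 0) * E 0) *
          dsum (sinv (Ψ 1)) (planeMat 1 0 (-b) 1)) * sinv (E 0) := by noncomm_ring
      _ = 1 := by
        rw [hEE', mul_one, dsum_mul, mul_sinv_self hΨ1, planeMat_mul]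
        norm_num
        rw [planeMat_one, dsum_one, mul_one, hEE]
  have hZ1' : Z 1 = E 0 * dsum (sinv (Ψ 1)) (planeMat 1 0 (-b) 1) * sinv (E 0) := by
    have h1 : Z (-1) * Z 1 = 1 := by rw [← hZ1]; simpa using hZ0
    have h2 := mul_eq_one_comm.1 h1
    calc Z 1 = Z 1 * (Z (-1) * (E 0 * dsum (sinv (Ψ 1)) (planeMat 1 0 (-b) 1) * sinv (E 0))) := by
          rw [hZm1, mul_one]
      _ = _ := by rw [← mul_assoc, h2, one_mul]
  have hZθ : Z θ = E (1 - θ) * dsum (Ψ (1 - θ) * sinv (Ψ 1)) (planeMat 1 0 (-(b * θ)) 1) *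
      sinv (E 0) := by
    have h1 : Z θ = Z (-(1 - θ)) * Z 1 := by rw [← hZ1]; congr 1; ring
    rw [h1, hZE _ hθ', hZ1']
    calc _ = E (1 - θ) * (dsum (Ψ (1 - θ)) (planeMat 1 0 (b * (1 - θ)) 1) * (sinv (E 0) * E 0) *
          dsum (sinv (Ψ 1)) (planeMat 1 0 (-b) 1)) * sinv (E 0) := by noncomm_ring
      _ = _ := by
        rw [hEE', mul_one, dsum_mul, planeMat_mul]
        congr 4 <;> ring
  have hFθ : F θ = F (-(1 - θ)) := by rw [← hFper (-(1 - θ))]; congr 1; ring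
  -- The lower shear comes from the unperturbed flow and the upper one from the model perturbation.
  have hsh : shearMat (b * θ) (c * θ) = planeMat 1 0 (-(b * θ)) 1 * planeMat 1 (c * θ) 0 1 := by
    rw [planeMat_mul, shearMat]; congr 1 <;> ring
  have hss : sinv (sinv (E (1 - θ))) = E (1 - θ) := by
    have h3 := sinv_mul_self (sinv_mem (hEsp _ hθ'))
    calc sinv (sinv (E (1 - θ))) = sinv (sinv (E (1 - θ))) * (sinv (E (1 - θ)) * E (1 - θ)) := by
          rw [sinv_mul_self (hEsp _ hθ'), mul_one]
      _ = _ := by rw [← mul_assoc, h3, one_mul]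
  have hs1 : sinv (1 : Mat (m + 1)) = 1 := sinv_one
  rw [framedPath, one_add_smul_etaMat (hEsp 0 z0), hZ0, hs1, mul_one, add_zero, hZθ, hFθ, sinv_mul,
    hss, hsh]
  have hd : dsum (Ψ (1 - θ) * sinv (Ψ 1)) (planeMat 1 0 (-(b * θ)) 1 * planeMat 1 (c * θ) 0 1) =
      dsum (Ψ (1 - θ) * sinv (Ψ 1)) (planeMat 1 0 (-(b * θ)) 1) *
        dsum 1 (planeMat 1 (c * θ) 0 1) := by
    rw [dsum_mul, mul_one]
  rw [hd, neg_zero]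
  generalize dsum (Ψ (1 - θ) * sinv (Ψ 1)) (planeMat 1 0 (-(b * θ)) 1) = X
  generalize dsum 1 (planeMat 1 (c * θ) 0 1) = Y at *
  calc _ = sinv (F (-(1 - θ))) * E (1 - θ) * X * (sinv (E 0) * E 0) * Y * sinv (E 0) * F 0 := by
        noncomm_ring
    _ = _ := by rw [hEE']; noncomm_ring

/-! ### Coordinates with respect to a symplectic basis -/

section FrameCoordinates

variable {k : ℕ} {F : Type*} [AddCommGroup F] [Module ℝ F]

/-- The linear map `A` pulls the bilinear form `b` back to the standard symplectic form. -/
def IsSymplecticMap (b : F →ₗ[ℝ] F →ₗ[ℝ] ℝ) (A : Std k →ₗ[ℝ] F) : Prop :=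
  ∀ v w, b (A v) (A w) = stdForm v w

/-- The coordinates of a vector with respect to the symplectic basis given by `A`. -/
def frameCoord (b : F →ₗ[ℝ] F →ₗ[ℝ] ℝ) (A : Std k →ₗ[ℝ] F) (w : F) : Std k :=
  Sum.elim (fun i => b w (A (Pi.single (Sum.inr i) 1))) fun i => -b w (A (Pi.single (Sum.inl i) 1))

variable {b : F →ₗ[ℝ] F →ₗ[ℝ] ℝ} {A B C : Std k →ₗ[ℝ] F}

theorem IsSymplecticMap.frameCoord_map (hA : IsSymplecticMap b A) (v : Std k) :
    frameCoord b A (A v) = v := by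
  ext (i | i)
  · simp only [frameCoord, Sum.elim_inl]
    rw [hA, stdForm_antisymm, stdForm_single_inr, neg_neg]
  · simp only [frameCoord, Sum.elim_inr]
    rw [hA, stdForm_antisymm, stdForm_single_inl, neg_neg]

theorem IsSymplecticMap.injective (hA : IsSymplecticMap b A) : Function.Injective A :=
  Function.LeftInverse.injective hA.frameCoord_map

theorem IsSymplecticMap.surjective [FiniteDimensional ℝ F] (hA : IsSymplecticMap b A)
    (hF : Module.finrank ℝ F = k + k) : Function.Surjective A := by
  have h : Module.finrank ℝ (Std k) = Module.finrank ℝ F := by simp [hF]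
  exact (LinearMap.injective_iff_surjective_of_finrank_eq_finrank h).1 hA.injective

theorem IsSymplecticMap.map_frameCoord (hA : IsSymplecticMap b A) (hs : Function.Surjective A)
    (w : F) : A (frameCoord b A w) = w := by
  obtain ⟨v, rfl⟩ := hs w
  rw [hA.frameCoord_map]

/-- The matrix of `B⁻¹ ∘ A`. -/
def frameRatio (b : F →ₗ[ℝ] F →ₗ[ℝ] ℝ) (B A : Std k →ₗ[ℝ] F) : Mat k :=
  Matrix.of fun i j => frameCoord b B (A (Pi.single j 1)) i

theorem frameRatio_mulVec (v : Std k) : (frameRatio b B A).mulVec v = frameCoord b B (A v) := by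
  have hv : A v = ∑ j, v j • A (Pi.single j 1) := by
    conv_lhs => rw [show v = ∑ j, v j • (Pi.single j 1 : Std k) by
      ext j; simp [Finset.sum_apply, Pi.single_apply]]
    simp
  have hb : ∀ w, b (A v) w = ∑ j, v j * b (A (Pi.single j 1)) w := by
    intro w
    rw [hv]
    simp
  ext (i | i)
  · simp [Matrix.mulVec, dotProduct, frameRatio, frameCoord, hb, mul_comm]
  · simp [Matrix.mulVec, dotProduct, frameRatio, frameCoord, hb, mul_comm]

theorem IsSymplecticMap.map_frameRatio (hB : IsSymplecticMap b B) (hs : Function.Surjective B)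
    (v : Std k) : B ((frameRatio b B A).mulVec v) = A v := by
  rw [frameRatio_mulVec, hB.map_frameCoord hs]

theorem IsSymplecticMap.frameRatio_mem (hB : IsSymplecticMap b B) (hs : Function.Surjective B)
    (hA : IsSymplecticMap b A) : frameRatio b B A ∈ Matrix.symplecticGroup (Fin k) ℝ := by
  rw [mem_symplecticGroup_iff_stdForm]
  intro v w
  rw [← hB, hB.map_frameRatio hs, hB.map_frameRatio hs, hA]

theorem IsSymplecticMap.eq_frameRatio (hB : IsSymplecticMap b B) {N : Mat k}
    (h : ∀ v, B (N.mulVec v) = A v) : N = frameRatio b B A := by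
  refine Matrix.ext_of_mulVec_single fun i => ?_
  rw [frameRatio_mulVec, ← h, hB.frameCoord_map]

theorem IsSymplecticMap.frameRatio_mul (hA : IsSymplecticMap b A) (hs : Function.Surjective A)
    (hB : IsSymplecticMap b B) (hs' : Function.Surjective B) :
    frameRatio b A B * frameRatio b B C = frameRatio b A C := by
  refine hA.eq_frameRatio fun v => ?_
  rw [← Matrix.mulVec_mulVec, hA.map_frameRatio hs, hB.map_frameRatio hs']

theorem IsSymplecticMap.sinv_frameRatio (hA : IsSymplecticMap b A) (hs : Function.Surjective A)
    (hB : IsSymplecticMap b B) (hs' : Function.Surjective B) :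
    sinv (frameRatio b A B) = frameRatio b B A := by
  have h : frameRatio b A B * frameRatio b B A = 1 := by
    rw [hA.frameRatio_mul hs hB hs']
    exact (hA.eq_frameRatio fun v => by rw [Matrix.one_mulVec]).symm
  have h' := sinv_mul_self (hA.frameRatio_mem hs hB)
  calc sinv (frameRatio b A B) = sinv (frameRatio b A B) *
        (frameRatio b A B * frameRatio b B A) := by rw [h, mul_one]
    _ = frameRatio b B A := by rw [← mul_assoc, h', one_mul]

theorem IsSymplecticMap.transportMatrix_eq (hB : IsSymplecticMap b B)
    {L : F →ₗ[ℝ] F} (h : ∀ v, L (A v) ∈ range B) :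
    transportMatrix B L A = frameRatio b B (L ∘ₗ A) := by
  ext i j
  obtain ⟨v, hv⟩ := h (Pi.single j 1)
  simp only [transportMatrix, frameRatio, Matrix.of_apply, LinearMap.comp_apply]
  rw [← hv, Function.leftInverse_invFun hB.injective, hB.frameCoord_map]

end FrameCoordinates

/-! ### Continuity of the symplectic form along sections of the tangent bundle -/

section FormContinuity

variable {n : ℕ} {X : Type*} [TopologicalSpace X] [ChartedSpace (EuclideanSpace ℝ (Fin n)) X]
  [IsManifold (𝓡 n) ∞ X]

theorem twoForm_eq_chart
    (b : ∀ x : X, TangentSpace (𝓡 n) x →L[ℝ] TangentSpace (𝓡 n) x →L[ℝ] ℝ) {x₀ x : X}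
    (hx : x ∈ (chartAt (EuclideanSpace ℝ (Fin n)) x₀).source) (v w : TangentSpace (𝓡 n) x) :
    b x v w = chartTwoForm b x₀ (extChartAt (𝓡 n) x₀ x)
      (mfderiv (𝓡 n) 𝓘(ℝ, EuclideanSpace ℝ (Fin n)) (extChartAt (𝓡 n) x₀) x v)
      (mfderiv (𝓡 n) 𝓘(ℝ, EuclideanSpace ℝ (Fin n)) (extChartAt (𝓡 n) x₀) x w) := by
  have hx' : x ∈ (extChartAt (𝓡 n) x₀).source := by rwa [extChartAt_source]
  have hl := (extChartAt (𝓡 n) x₀).left_inv hx'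
  have : IsManifold (𝓡 n) 1 X := IsManifold.of_le (n := ∞) (by simp)
  have h := mfderivWithin_extChartAt_symm_comp_mfderiv_extChartAt' (I := 𝓡 n) (x := x₀) hx'
  simp only [ModelWithCorners.range_eq_univ, mfderivWithin_univ] at h
  have h' : ∀ v : TangentSpace (𝓡 n) x,
      mfderiv 𝓘(ℝ, EuclideanSpace ℝ (Fin n)) (𝓡 n) (extChartAt (𝓡 n) x₀).symm
        (extChartAt (𝓡 n) x₀ x)
        (mfderiv (𝓡 n) 𝓘(ℝ, EuclideanSpace ℝ (Fin n)) (extChartAt (𝓡 n) x₀) x v) = v :=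
    fun v => DFunLike.congr_fun h v
  -- The base point of the form is generalized so that the round trip through the chart can be
  -- rewritten inside the dependent type.
  have key : ∀ y, y = x → ∀ v' w' : EuclideanSpace ℝ (Fin n), v' = v → w' = w → b x v w = b y v' w' := by
    rintro y rfl v' w' rfl rfl; rfl
  exact key _ hl _ _ (h' v) (h' w)

theorem mfderiv_extChartAt_eq_trivializationAt {x₀ x : X}
    (hx : x ∈ (chartAt (EuclideanSpace ℝ (Fin n)) x₀).source) (v : TangentSpace (𝓡 n) x) :
    (mfderiv (𝓡 n) 𝓘(ℝ, EuclideanSpace ℝ (Fin n)) (extChartAt (𝓡 n) x₀) x v :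
      EuclideanSpace ℝ (Fin n)) =
      (trivializationAt (EuclideanSpace ℝ (Fin n)) (TangentSpace (𝓡 n)) x₀ ⟨x, v⟩).2 := by
  have : IsManifold (𝓡 n) 1 X := IsManifold.of_le (n := ∞) (by simp)
  refine (DFunLike.congr_fun
    (TangentBundle.continuousLinearMapAt_trivializationAt (I := 𝓡 n) hx) v).symm.trans ?_
  have h := congrFun (Bundle.Trivialization.coe_linearMapAt_of_mem (R := ℝ)
    (trivializationAt (EuclideanSpace ℝ (Fin n)) (TangentSpace (𝓡 n)) x₀) (b := x)
    (by simpa using hx)) v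
  exact h

/-- Near `y₀` everything is read in the chart at `u y₀`, where the form has smooth coefficients and
the vectors have continuous coordinates. -/
theorem continuousOn_twoForm
    {b : ∀ x : X, TangentSpace (𝓡 n) x →L[ℝ] TangentSpace (𝓡 n) x →L[ℝ] ℝ}
    (hb : ∀ x₀, ContDiffOn ℝ ∞ (chartTwoForm b x₀) (extChartAt (𝓡 n) x₀).target)
    {Y : Type*} [TopologicalSpace Y] {s : Set Y} {u : Y → X}
    {v w : ∀ y, TangentSpace (𝓡 n) (u y)}
    (hv : ContinuousOn (fun y => (⟨u y, v y⟩ : TangentBundle (𝓡 n) X)) s)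
    (hw : ContinuousOn (fun y => (⟨u y, w y⟩ : TangentBundle (𝓡 n) X)) s) :
    ContinuousOn (fun y => b (u y) (v y) (w y)) s := by
  intro y₀ hy₀
  have : IsManifold (𝓡 n) 1 X := IsManifold.of_le (n := ∞) (by simp)
  have hu : ContinuousWithinAt u s y₀ :=
    (FiberBundle.continuous_proj (EuclideanSpace ℝ (Fin n))
      (TangentSpace (𝓡 n))).continuousAt.comp_continuousWithinAt (hv y₀ hy₀)
  set x₀ := u y₀
  have hmem : ∀ᶠ y in nhdsWithin y₀ s, u y ∈ (chartAt (EuclideanSpace ℝ (Fin n)) x₀).source :=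
    hu.eventually (chart_source_mem_nhds _ x₀)
  have htriv : ∀ v : (∀ y, TangentSpace (𝓡 n) (u y)),
      ContinuousOn (fun y => (⟨u y, v y⟩ : TangentBundle (𝓡 n) X)) s →
      ContinuousWithinAt (fun y => (mfderiv (𝓡 n) 𝓘(ℝ, EuclideanSpace ℝ (Fin n))
        (extChartAt (𝓡 n) x₀) (u y) (v y) : EuclideanSpace ℝ (Fin n))) s y₀ := by
    intro v hv
    have h1 := ((FiberBundle.continuousWithinAt_totalSpace (EuclideanSpace ℝ (Fin n)) _).1
      (hv y₀ hy₀)).2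
    refine h1.congr_of_eventuallyEq ?_ ?_
    · filter_upwards [hmem] with y hy using mfderiv_extChartAt_eq_trivializationAt hy _
    · exact mfderiv_extChartAt_eq_trivializationAt (mem_chart_source _ x₀) _
  have hc : ContinuousWithinAt (fun y => chartTwoForm b x₀ (extChartAt (𝓡 n) x₀ (u y))) s y₀ := by
    have h1 : ContinuousAt (chartTwoForm b x₀) (extChartAt (𝓡 n) x₀ x₀) :=
      (hb x₀).continuousOn.continuousAt (extChartAt_target_mem_nhds x₀)
    exact ContinuousAt.comp_continuousWithinAt (g := chartTwoForm b x₀)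
      (f := fun y => extChartAt (𝓡 n) x₀ (u y)) h1
      ((continuousAt_extChartAt x₀).comp_continuousWithinAt hu)
  refine (((hc.clm_apply (htriv v hv)).clm_apply (htriv w hw))).congr_of_eventuallyEq ?_ ?_
  · filter_upwards [hmem] with y hy using twoForm_eq_chart b hy _ _
  · exact twoForm_eq_chart b (mem_chart_source _ x₀) _ _

end FormContinuity

/-! ### The Reeb field and the derivative of the parametrization of the end -/

/-- A continuous bilinear form as a bilinear form. -/
def clmBilin {E : Type*} [NormedAddCommGroup E] [NormedSpace ℝ E] (B : E →L[ℝ] E →L[ℝ] ℝ) :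
    E →ₗ[ℝ] E →ₗ[ℝ] ℝ :=
  LinearMap.mk₂ ℝ (fun v w => B v w) (fun _ _ _ => by simp) (fun _ _ _ => by simp)
    (fun _ _ _ => by simp) (fun _ _ _ => by simp)

/-- The matrix of the form satisfies `det A = det Aᵀ = (-1)^{2m+1} det A`, so it is singular. -/
theorem exists_ker_of_alternating_odd {m : ℕ}
    (b : EuclideanSpace ℝ (Fin (2 * m + 1)) →ₗ[ℝ] EuclideanSpace ℝ (Fin (2 * m + 1)) →ₗ[ℝ] ℝ)
    (hb : ∀ v w, b v w = -b w v) : ∃ v, v ≠ 0 ∧ ∀ w, b v w = 0 := by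
  let e := (EuclideanSpace.basisFun (Fin (2 * m + 1)) ℝ).toBasis
  let A : Matrix (Fin (2 * m + 1)) (Fin (2 * m + 1)) ℝ := Matrix.of fun i j => b (e i) (e j)
  have hA : A.transpose = -A := by
    ext i j
    simp only [A, Matrix.transpose_apply, Matrix.of_apply, Matrix.neg_apply]
    exact hb _ _
  have hdet : A.det = 0 := by
    have h1 : A.det = -A.det := by
      conv_lhs => rw [← Matrix.det_transpose, hA, Matrix.det_neg]
      rw [Fintype.card_fin, Odd.neg_one_pow ⟨m, rfl⟩]
      ring
    linarith
  obtain ⟨x, hx, hAx⟩ := Matrix.exists_vecMul_eq_zero_iff.2 hdet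
  refine ⟨∑ i, x i • e i, fun h => hx ?_, fun w => ?_⟩
  · ext i
    exact Fintype.linearIndependent_iff.1 e.linearIndependent x h i
  · have h : ∀ j, b (∑ i, x i • e i) (e j) = 0 := by
      intro j
      have := congrFun hAx j
      simpa [Matrix.vecMul, dotProduct, A] using this
    have h2 : b (∑ i, x i • e i) = 0 := e.ext fun j => by rw [h j]; rfl
    rw [h2]; rfl

section

variable {m : ℕ} {What M : Type*}
  [TopologicalSpace What] [ChartedSpace (EuclideanSpace ℝ (Fin (2 * m + 2))) What]
  [TopologicalSpace M] [ChartedSpace (EuclideanSpace ℝ (Fin (2 * m + 1))) M]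

namespace SymplecticCompletion

variable (C : SymplecticCompletion m What M)

/-- The symplectic form at a point, on the model space. -/
def formAt (x : What) : EuclideanSpace ℝ (Fin (2 * m + 2)) →ₗ[ℝ]
    EuclideanSpace ℝ (Fin (2 * m + 2)) →ₗ[ℝ] ℝ :=
  clmBilin (E := EuclideanSpace ℝ (Fin (2 * m + 2))) (C.Ω x)

theorem formAt_nondegenerate (x : What) {v v' : EuclideanSpace ℝ (Fin (2 * m + 2))}
    (h : ∀ w, C.formAt x v w = C.formAt x v' w) : v = v' := by
  have h1 : ∀ w, C.formAt x (v - v') w = 0 := fun w => by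
    rw [map_sub, LinearMap.sub_apply, h, sub_self]
  exact sub_eq_zero.1 (C.isSymplectic.nondegenerate x _ h1)

/-- The exterior derivative of the contact form at a point, on the model space. -/
def dlam (p : M) : EuclideanSpace ℝ (Fin (2 * m + 1)) →ₗ[ℝ]
    EuclideanSpace ℝ (Fin (2 * m + 1)) →ₗ[ℝ] ℝ :=
  clmBilin (E := EuclideanSpace ℝ (Fin (2 * m + 1)))
      (fderiv ℝ (chartOneForm C.lam p) (extChartAt (𝓡 (2 * m + 1)) p p)) -
    (clmBilin (E := EuclideanSpace ℝ (Fin (2 * m + 1)))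
      (fderiv ℝ (chartOneForm C.lam p) (extChartAt (𝓡 (2 * m + 1)) p p))).flip

theorem dlam_antisymm (p : M) (v w : EuclideanSpace ℝ (Fin (2 * m + 1))) :
    C.dlam p v w = -C.dlam p w v := by
  simp only [dlam, LinearMap.sub_apply, LinearMap.flip_apply]
  ring

/-- The contact form at a point, on the model space. -/
def lamAt (p : M) : EuclideanSpace ℝ (Fin (2 * m + 1)) →ₗ[ℝ] ℝ := (C.lam p).toLinearMap

/-- The Reeb field, on the model space. -/
def reebAt (p : M) : EuclideanSpace ℝ (Fin (2 * m + 1)) := C.reeb p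

/-- The choice made by `reeb` is meaningful once a candidate exists: `dλ` has a kernel because the
dimension is odd, the contact condition keeps a kernel vector out of `ξ`, and rescaling makes `λ`
equal to 1 on it. -/
theorem reeb_spec (p : M) : C.lamAt p (C.reebAt p) = 1 ∧ ∀ w, C.dlam p (C.reebAt p) w = 0 := by
  obtain ⟨v, hv, h⟩ := exists_ker_of_alternating_odd (C.dlam p) (C.dlam_antisymm p)
  have hl : C.lamAt p v ≠ 0 := fun h0 => hv (C.lam_contact p v h0 fun w _ => h w)
  exact Classical.epsilon_spec (p := fun v : EuclideanSpace ℝ (Fin (2 * m + 1)) =>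
    C.lamAt p v = 1 ∧ ∀ w, C.dlam p v w = 0) ⟨(C.lamAt p v)⁻¹ • v, by
      rw [map_smul, smul_eq_mul, inv_mul_cancel₀ hl], fun w => by
      rw [map_smul, LinearMap.smul_apply, h w, smul_zero]⟩

theorem lamAt_reebAt (p : M) : C.lamAt p (C.reebAt p) = 1 := (C.reeb_spec p).1

theorem dlam_reebAt (p : M) (w) : C.dlam p (C.reebAt p) w = 0 := (C.reeb_spec p).2 w

theorem dlam_reebAt_right (p : M) (w) : C.dlam p w (C.reebAt p) = 0 := by
  rw [dlam_antisymm, dlam_reebAt, neg_zero]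

/-- The derivative of the parametrization of the end, on the model spaces. -/
def pushAt (p : M) (t : ℝ) : EuclideanSpace ℝ (Fin (2 * m + 1)) × ℝ →L[ℝ]
    EuclideanSpace ℝ (Fin (2 * m + 2)) :=
  mfderiv ((𝓡 (2 * m + 1)).prod 𝓘(ℝ, ℝ)) (𝓡 (2 * m + 2)) C.G (p, t)

theorem formAt_pushAt (p : M) {t : ℝ} (ht : -C.ε < t) (v w : EuclideanSpace ℝ (Fin (2 * m + 1)) × ℝ) :
    C.formAt (C.G (p, t)) (C.pushAt p t v) (C.pushAt p t w) =
      Real.exp t * (v.2 * C.lamAt p w.1 - w.2 * C.lamAt p v.1 + C.dlam p v.1 w.1) :=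
  C.G_symplectic p t ht v.1 w.1 v.2 w.2

/-- A vector in the kernel is `ω`-orthogonal to every image. Testing with `∂_t`, with the Reeb field
and with `ξ` kills its three components in turn. -/
theorem pushAt_injective (p : M) {t : ℝ} (ht : -C.ε < t) : Function.Injective (C.pushAt p t) := by
  refine (injective_iff_map_eq_zero _).2 fun v hv => ?_
  have h : ∀ w : EuclideanSpace ℝ (Fin (2 * m + 1)) × ℝ,
      v.2 * C.lamAt p w.1 - w.2 * C.lamAt p v.1 + C.dlam p v.1 w.1 = 0 := by
    intro w
    have h1 := C.formAt_pushAt p ht v w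
    rw [hv, map_zero, LinearMap.zero_apply] at h1
    exact ((mul_eq_zero.1 h1.symm).resolve_left (Real.exp_pos t).ne')
  have h2 : C.lamAt p v.1 = 0 := by simpa using h (0, 1)
  have h3 : v.2 = 0 := by simpa [C.lamAt_reebAt, C.dlam_reebAt_right] using h (C.reebAt p, 0)
  have h4 : v.1 = 0 := C.lam_contact p v.1 h2 fun w hw => by
    have := h (w, 0)
    rw [h3, zero_mul, zero_mul, sub_zero, zero_add] at this
    exact this
  exact Prod.ext h4 h3

theorem pushAt_surjective (p : M) {t : ℝ} (ht : -C.ε < t) :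
    Function.Surjective (C.pushAt p t) :=
  (LinearMap.injective_iff_surjective_of_finrank_eq_finrank
    (f := (C.pushAt p t).toLinearMap) (by simp)).1 (C.pushAt_injective p ht)

end SymplecticCompletion

/-! ### Frames adapted to the splitting into the contact distribution and its complement -/

/-- The projection `ℝ^{2(m+1)} → ℝ^{2m}`. -/
def projStd : Std (m + 1) →ₗ[ℝ] Std m where
  toFun v := Sum.elim (fun i => v (Sum.inl i.castSucc)) fun i => v (Sum.inr i.castSucc)
  map_add' v w := by ext (i | i) <;> rfl
  map_smul' c v := by ext (i | i) <;> rfl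

theorem stdForm_succ (v w : Std (m + 1)) : stdForm v w = stdForm (projStd v) (projStd w) +
    (v (Sum.inl (Fin.last m)) * w (Sum.inr (Fin.last m)) -
      v (Sum.inr (Fin.last m)) * w (Sum.inl (Fin.last m))) := by
  rw [stdForm, Fin.sum_univ_castSucc]; rfl

theorem dsum_mulVec_splitEquiv (P : Mat m) (Q : Mat 1) (v : Std (m + 1))
    (i : (Fin m ⊕ Fin m) ⊕ (Fin 1 ⊕ Fin 1)) :
    (dsum P Q).mulVec v (splitEquiv m i) = (Matrix.fromBlocks P 0 0 Q).mulVec (v ∘ splitEquiv m) i := by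
  rw [dsum, Matrix.reindex_apply, Matrix.submatrix_mulVec_equiv]
  simp

theorem projStd_dsum_mulVec (P : Mat m) (Q : Mat 1) (v : Std (m + 1)) :
    projStd ((dsum P Q).mulVec v) = P.mulVec (projStd v) := by
  have h : ∀ u : Std (m + 1), projStd u = fun i => u (splitEquiv m (Sum.inl i)) := by
    intro u; ext (i | i) <;> rfl
  rw [h, h]
  ext i
  rw [dsum_mulVec_splitEquiv, Matrix.fromBlocks_mulVec]
  simp [Function.comp_def]

theorem dsum_planeMat_mulVec_inl (P : Mat m) (a b c d : ℝ) (v : Std (m + 1)) :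
    (dsum P (planeMat a b c d)).mulVec v (Sum.inl (Fin.last m)) =
      a * v (Sum.inl (Fin.last m)) + b * v (Sum.inr (Fin.last m)) := by
  refine (dsum_mulVec_splitEquiv P _ v (Sum.inr (Sum.inl 0))).trans ?_
  rw [Matrix.fromBlocks_mulVec]
  simp [planeMat, Matrix.mulVec, dotProduct]
  rfl

theorem dsum_planeMat_mulVec_inr (P : Mat m) (a b c d : ℝ) (v : Std (m + 1)) :
    (dsum P (planeMat a b c d)).mulVec v (Sum.inr (Fin.last m)) =
      c * v (Sum.inl (Fin.last m)) + d * v (Sum.inr (Fin.last m)) := by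
  refine (dsum_mulVec_splitEquiv P _ v (Sum.inr (Sum.inr 0))).trans ?_
  rw [Matrix.fromBlocks_mulVec]
  simp [planeMat, Matrix.mulVec, dotProduct]
  rfl

namespace SymplecticCompletion

variable (C : SymplecticCompletion m What M)

/-- The frame of `TŴ` at `G (p, t)` which consists of a frame of `ξ`, `∂/∂t` and `R_λ`, rescaled so
as to be symplectic. -/
def splitFrame (p : M) (t : ℝ) (Φ : Std m →ₗ[ℝ] EuclideanSpace ℝ (Fin (2 * m + 1))) :
    Std (m + 1) →ₗ[ℝ] EuclideanSpace ℝ (Fin (2 * m + 2)) where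
  toFun v := Real.exp (-t / 2) • C.pushAt p t
    (Φ (projStd v) + v (Sum.inr (Fin.last m)) • C.reebAt p, v (Sum.inl (Fin.last m)))
  map_add' v w := by
    rw [← smul_add, ← map_add]
    refine congrArg _ (congrArg _ (Prod.ext ?_ ?_))
    · simp only [map_add, Pi.add_apply, Prod.mk_add_mk]; module
    · simp
  map_smul' c v := by
    rw [RingHom.id_apply, smul_comm c]
    refine congrArg _ ?_
    rw [← map_smul (C.pushAt p t)]
    refine congrArg _ (Prod.ext ?_ ?_)
    · simp only [map_smul, Pi.smul_apply, Prod.smul_mk, smul_eq_mul]; module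
    · simp

theorem splitFrame_apply (p : M) (t : ℝ) (Φ : Std m →ₗ[ℝ] EuclideanSpace ℝ (Fin (2 * m + 1)))
    (v : Std (m + 1)) : C.splitFrame p t Φ v = Real.exp (-t / 2) • C.pushAt p t
      (Φ (projStd v) + v (Sum.inr (Fin.last m)) • C.reebAt p, v (Sum.inl (Fin.last m))) := rfl

theorem isSymplecticMap_splitFrame (p : M) {t : ℝ} (ht : -C.ε < t)
    {Φ : Std m →ₗ[ℝ] EuclideanSpace ℝ (Fin (2 * m + 1))} (hΦ : IsSymplecticMap (C.dlam p) Φ)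
    (hker : ∀ v, C.lamAt p (Φ v) = 0) :
    IsSymplecticMap (C.formAt (C.G (p, t))) (C.splitFrame p t Φ) := by
  intro v w
  rw [splitFrame_apply, splitFrame_apply, map_smul, map_smul, LinearMap.smul_apply,
    C.formAt_pushAt p ht, stdForm_succ]
  simp only [map_add, map_smul, LinearMap.add_apply, LinearMap.smul_apply, hker, hΦ (projStd v),
    C.lamAt_reebAt, C.dlam_reebAt, C.dlam_reebAt_right, smul_eq_mul]
  have he : Real.exp (-t / 2) * (Real.exp (-t / 2) * Real.exp t) = 1 := by
    rw [← Real.exp_add, ← Real.exp_add, Real.exp_eq_one_iff]; ring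
  linear_combination (stdForm (projStd v) (projStd w) +
    (v (Sum.inl (Fin.last m)) * w (Sum.inr (Fin.last m)) -
      v (Sum.inr (Fin.last m)) * w (Sum.inl (Fin.last m)))) * he

end SymplecticCompletion

end

section

variable {m : ℕ} {What M : Type*}
  [TopologicalSpace What] [ChartedSpace (EuclideanSpace ℝ (Fin (2 * m + 2))) What]
  [TopologicalSpace M] [ChartedSpace (EuclideanSpace ℝ (Fin (2 * m + 1))) M]
  [IsManifold (𝓡 (2 * m + 1)) ∞ M]

/-! ### Continuous vector fields along maps -/

theorem continuousOn_tangent_real {Y : Type*} [TopologicalSpace Y] {s : Set Y} {τ a : Y → ℝ}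
    (hτ : ContinuousOn τ s) (ha : ContinuousOn a s) :
    ContinuousOn (fun y => (⟨τ y, a y⟩ : TangentBundle 𝓘(ℝ, ℝ) ℝ)) s := by
  have h := (tangentBundleModelSpaceHomeomorph 𝓘(ℝ, ℝ)).symm.continuous
  exact h.comp_continuousOn (hτ.prodMk ha)

theorem continuousOn_section_add_smul {n : ℕ} {X : Type*} [TopologicalSpace X]
    [ChartedSpace (EuclideanSpace ℝ (Fin n)) X] [IsManifold (𝓡 n) ∞ X]
    {Y : Type*} [TopologicalSpace Y] {s : Set Y} {u : Y → X}
    {v w : Y → EuclideanSpace ℝ (Fin n)} {a b : Y → ℝ}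
    (hv : ContinuousOn (fun y => (⟨u y, v y⟩ : TangentBundle (𝓡 n) X)) s)
    (hw : ContinuousOn (fun y => (⟨u y, w y⟩ : TangentBundle (𝓡 n) X)) s)
    (ha : ContinuousOn a s) (hb : ContinuousOn b s) :
    ContinuousOn (fun y => (⟨u y, a y • v y + b y • w y⟩ : TangentBundle (𝓡 n) X)) s := by
  have : IsManifold (𝓡 n) 1 X := IsManifold.of_le (n := ∞) (by simp)
  intro y₀ hy₀
  have h1 := (FiberBundle.continuousWithinAt_totalSpace (EuclideanSpace ℝ (Fin n)) _).1
    (hv y₀ hy₀)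
  have h2 := (FiberBundle.continuousWithinAt_totalSpace (EuclideanSpace ℝ (Fin n)) _).1
    (hw y₀ hy₀)
  refine (FiberBundle.continuousWithinAt_totalSpace (EuclideanSpace ℝ (Fin n)) _).2 ⟨h1.1, ?_⟩
  have hmem : ∀ᶠ y in nhdsWithin y₀ s,
      u y ∈ (chartAt (EuclideanSpace ℝ (Fin n)) (u y₀)).source :=
    h1.1.eventually (chart_source_mem_nhds _ (u y₀))
  have hlin : ∀ y, u y ∈ (chartAt (EuclideanSpace ℝ (Fin n)) (u y₀)).source →
      (trivializationAt (EuclideanSpace ℝ (Fin n)) (TangentSpace (𝓡 n)) (u y₀)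
        ⟨u y, a y • v y + b y • w y⟩).2 =
      a y • (trivializationAt (EuclideanSpace ℝ (Fin n)) (TangentSpace (𝓡 n)) (u y₀)
        ⟨u y, v y⟩).2 + b y • (trivializationAt (EuclideanSpace ℝ (Fin n))
          (TangentSpace (𝓡 n)) (u y₀) ⟨u y, w y⟩).2 := by
    intro y hy
    let D : EuclideanSpace ℝ (Fin n) →L[ℝ] EuclideanSpace ℝ (Fin n) :=
      mfderiv (𝓡 n) 𝓘(ℝ, EuclideanSpace ℝ (Fin n)) (extChartAt (𝓡 n) (u y₀)) (u y)
    have : D (a y • v y + b y • w y) = a y • D (v y) + b y • D (w y) := by simp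
    have e : ∀ x : EuclideanSpace ℝ (Fin n), (trivializationAt (EuclideanSpace ℝ (Fin n))
        (TangentSpace (𝓡 n)) (u y₀) ⟨u y, x⟩).2 = D x := fun x =>
      (mfderiv_extChartAt_eq_trivializationAt hy x).symm
    refine (e _).trans (this.trans ?_)
    rw [e, e]
  refine (((ha y₀ hy₀).smul h1.2).add ((hb y₀ hy₀).smul h2.2)).congr_of_eventuallyEq ?_ ?_
  · filter_upwards [hmem] with y hy using hlin y hy
  · exact hlin y₀ (mem_chart_source _ _)

namespace SymplecticCompletion

variable (C : SymplecticCompletion m What M)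

/-- The Reeb field is defined by a pointwise choice; its continuity is read off from the smooth
flow, as the image of `∂/∂τ` at time `0` under the tangent map. -/
theorem continuous_reebAt {φlam : ℝ → M → M} (hφ : IsFlow (fun _ => C.reeb) φlam) :
    Continuous fun p => (⟨p, C.reebAt p⟩ : TangentBundle (𝓡 (2 * m + 1)) M) := by
  have : IsManifold (𝓡 (2 * m + 1)) 1 M := IsManifold.of_le (n := ∞) (by simp)
  have h1 := hφ.smooth.continuous_tangentMap (by simp)
  have h0 : Continuous fun p : M => (⟨p, 0⟩ : TangentBundle (𝓡 (2 * m + 1)) M) :=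
    (Bundle.contMDiff_zeroSection ℝ (TangentSpace (𝓡 (2 * m + 1)) : M → Type _)
      (IB := 𝓡 (2 * m + 1)) (n := 0)).continuous
  have h2 : Continuous (fun p => (equivTangentBundleProd 𝓘(ℝ, ℝ) ℝ (𝓡 (2 * m + 1)) M).symm
      (⟨0, (1 : ℝ)⟩, ⟨p, 0⟩)) :=
    ((contMDiff_equivTangentBundleProd_symm (n := 1)).continuous).comp
      (continuous_const.prodMk h0)
  refine (h1.comp h2).congr fun p => ?_
  have hz := hφ.zero p
  have hd : mfderiv (𝓘(ℝ, ℝ).prod (𝓡 (2 * m + 1))) (𝓡 (2 * m + 1))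
      (fun z : ℝ × M => φlam z.1 z.2) (0, p) ((1 : ℝ), (0 : EuclideanSpace ℝ (Fin (2 * m + 1)))) =
        (C.reeb (φlam 0 p) : EuclideanSpace ℝ (Fin (2 * m + 1))) := by
    have hv := hφ.velocity 0 p
    have hc := mfderiv_comp (I := 𝓘(ℝ, ℝ)) (I' := 𝓘(ℝ, ℝ).prod (𝓡 (2 * m + 1))) (I'' := 𝓡 (2 * m + 1))
      (g := fun z : ℝ × M => φlam z.1 z.2) (f := fun τ : ℝ => (τ, p)) 0
      ((hφ.smooth (0, p)).mdifferentiableAt (by simp))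
      (mdifferentiableAt_id.prodMk mdifferentiableAt_const)
    rw [mfderiv_prod_left] at hc
    rw [← hv]
    exact (DFunLike.congr_fun hc (1 : ℝ)).symm
  have key : ∀ (x : M) (w : EuclideanSpace ℝ (Fin (2 * m + 1))), x = p → w = C.reebAt x →
      (⟨x, w⟩ : TangentBundle (𝓡 (2 * m + 1)) M) = ⟨p, C.reebAt p⟩ := by
    rintro x w rfl rfl; rfl
  exact key _ _ hz hd

variable [IsManifold (𝓡 (2 * m + 2)) ∞ What]

theorem continuousOn_push {Y : Type*} [TopologicalSpace Y] {s : Set Y} {u : Y → M} {τ a : Y → ℝ}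
    {v : Y → EuclideanSpace ℝ (Fin (2 * m + 1))}
    (hv : ContinuousOn (fun y => (⟨u y, v y⟩ : TangentBundle (𝓡 (2 * m + 1)) M)) s)
    (hτ : ContinuousOn τ s) (ha : ContinuousOn a s) (hε : ∀ y ∈ s, -C.ε < τ y) :
    ContinuousOn (fun y => (⟨C.G (u y, τ y), C.pushAt (u y) (τ y) (v y, a y)⟩ :
      TangentBundle (𝓡 (2 * m + 2)) What)) s := by
  have : IsManifold (𝓡 (2 * m + 2)) 1 What := IsManifold.of_le (n := ∞) (by simp)
  have : IsManifold (𝓡 (2 * m + 1)) 1 M := IsManifold.of_le (n := ∞) (by simp)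
  have hopen : IsOpen (univ ×ˢ Ioi (-C.ε) : Set (M × ℝ)) := isOpen_univ.prod isOpen_Ioi
  have hu := hopen.uniqueMDiffOn (I := (𝓡 (2 * m + 1)).prod 𝓘(ℝ, ℝ))
  have h1 := C.G_smooth.continuousOn_tangentMapWithin (by simp) hu
  have h2 : ContinuousOn (fun y => (equivTangentBundleProd (𝓡 (2 * m + 1)) M 𝓘(ℝ, ℝ) ℝ).symm
      (⟨u y, v y⟩, ⟨τ y, a y⟩)) s :=
    ((contMDiff_equivTangentBundleProd_symm (n := 1)).continuous).comp_continuousOn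
      (hv.prodMk (continuousOn_tangent_real hτ ha))
  refine (h1.comp h2 fun y hy => ⟨mem_univ _, hε y hy⟩).congr fun y hy => ?_
  have hmem : (u y, τ y) ∈ (univ ×ˢ Ioi (-C.ε) : Set (M × ℝ)) := ⟨mem_univ _, hε y hy⟩
  rw [Function.comp_apply, tangentMapWithin_eq_tangentMap (hu _ hmem)
    ((C.G_smooth.contMDiffAt (hopen.mem_nhds hmem)).mdifferentiableAt (by simp))]
  rfl

/-- Frames of the contact distribution and the Reeb field give a continuous frame. -/
theorem continuousOn_splitFrame {φlam : ℝ → M → M} (hφ : IsFlow (fun _ => C.reeb) φlam)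
    {Y : Type*} [TopologicalSpace Y] {s : Set Y} {u : Y → M} {τ : Y → ℝ}
    {Φ : Y → Std m →ₗ[ℝ] EuclideanSpace ℝ (Fin (2 * m + 1))} (hu : ContinuousOn u s)
    (hΦ : ∀ v, ContinuousOn (fun y => (⟨u y, Φ y v⟩ : TangentBundle (𝓡 (2 * m + 1)) M)) s)
    (hτ : ContinuousOn τ s) (hε : ∀ y ∈ s, -C.ε < τ y) (v : Std (m + 1)) :
    ContinuousOn (fun y => (⟨C.G (u y, τ y), C.splitFrame (u y) (τ y) (Φ y) v⟩ :
      TangentBundle (𝓡 (2 * m + 2)) What)) s := by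
  have h1 : ContinuousOn (fun y => (⟨u y, Φ y (projStd v) + v (Sum.inr (Fin.last m)) •
      C.reebAt (u y)⟩ : TangentBundle (𝓡 (2 * m + 1)) M)) s := by
    simpa using continuousOn_section_add_smul (hΦ (projStd v))
      ((C.continuous_reebAt hφ).comp_continuousOn hu) (continuousOn_const (c := (1 : ℝ)))
      (continuousOn_const (c := v (Sum.inr (Fin.last m))))
  have h2 := C.continuousOn_push h1 hτ (continuousOn_const (c := v (Sum.inl (Fin.last m)))) hε
  have h3 := continuousOn_section_add_smul h2 h2 (a := fun y => Real.exp (-τ y / 2))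
    (Real.continuous_exp.comp_continuousOn (hτ.neg.div_const 2)) (continuousOn_const (c := (0 : ℝ)))
  simpa [splitFrame_apply] using h3

end SymplecticCompletion

end

/-! ### Velocities of curves -/

section Velocity

variable {E : Type*} [NormedAddCommGroup E] [NormedSpace ℝ E] {H : Type*} [TopologicalSpace H]
  {I : ModelWithCorners ℝ E H} {X : Type*} [TopologicalSpace X] [ChartedSpace H X]
  {E' : Type*} [NormedAddCommGroup E'] [NormedSpace ℝ E'] {H' : Type*} [TopologicalSpace H']
  {I' : ModelWithCorners ℝ E' H'} {X' : Type*} [TopologicalSpace X'] [ChartedSpace H' X']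

variable (I) in
/-- The curve `c` is differentiable at `τ`, with velocity `v` (an element of the model space). -/
def HasVel (c : ℝ → X) (v : E) (τ : ℝ) : Prop :=
  MDifferentiableAt 𝓘(ℝ, ℝ) I c τ ∧ (mfderiv 𝓘(ℝ, ℝ) I c τ (1 : ℝ) : E) = v

variable (I I') in
/-- The derivative of a map between manifolds, on the model spaces. -/
def dmap (f : X → X') (x : X) : E →L[ℝ] E' := mfderiv I I' f x

variable {c c' : ℝ → X} {v : E} {τ : ℝ}

theorem HasVel.unique {v' : E} (h : HasVel I c v τ) (h' : HasVel I c v' τ) : v = v' :=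
  h.2.symm.trans h'.2

theorem HasVel.congr (h : HasVel I c v τ) (hc : c' =ᶠ[nhds τ] c) : HasVel I c' v τ := by
  refine ⟨h.1.congr_of_eventuallyEq hc, Eq.trans ?_ h.2⟩
  have h1 := (h.1.hasMFDerivAt.congr_of_eventuallyEq hc).mfderiv
  exact DFunLike.congr_fun h1 (1 : ℝ)

theorem HasVel.comp {f : X → X'} (h : HasVel I c v τ) (hf : MDifferentiableAt I I' f (c τ)) :
    HasVel I' (fun s => f (c s)) (dmap I I' f (c τ) v) τ := by
  have h1 := hf.hasMFDerivAt.comp τ h.1.hasMFDerivAt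
  refine ⟨h1.mdifferentiableAt, ?_⟩
  have h2 := DFunLike.congr_fun h1.mfderiv (1 : ℝ)
  refine h2.trans ?_
  rw [← h.2]
  rfl

theorem HasVel.prodMk {d : ℝ → X'} {w : E'} (h : HasVel I c v τ) (h' : HasVel I' d w τ) :
    HasVel (I.prod I') (fun s => (c s, d s)) (v, w) τ := by
  have h1 := h.1.hasMFDerivAt.prodMk h'.1.hasMFDerivAt
  refine ⟨h1.mdifferentiableAt, ?_⟩
  have h2 := DFunLike.congr_fun h1.mfderiv (1 : ℝ)
  refine h2.trans ?_
  rw [← h.2, ← h'.2]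
  rfl

theorem hasVel_iff_hasDerivAt {c : ℝ → E} {v : E} {τ : ℝ} :
    HasVel 𝓘(ℝ, E) c v τ ↔ HasDerivAt c v τ := by
  rw [HasVel, mdifferentiableAt_iff_differentiableAt, mfderiv_eq_fderiv]
  constructor
  · rintro ⟨h1, h2⟩
    have := h1.hasDerivAt
    rw [← fderiv_apply_one_eq_deriv] at this
    exact h2 ▸ this
  · intro h
    refine ⟨h.differentiableAt, ?_⟩
    have := h.deriv
    rw [← fderiv_apply_one_eq_deriv] at this
    exact this

theorem hasVel_const (x : X) (τ : ℝ) : HasVel I (fun _ => x) 0 τ := by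
  refine ⟨mdifferentiableAt_const, ?_⟩
  rw [mfderiv_const]
  rfl

end Velocity

/-! ### The symplectic gradient -/

theorem two_le_infty : (2 : ℕ∞ω) ≤ ∞ := WithTop.coe_le_coe.2 le_top

/-- The vector `X` with `stdForm X w = ℓ w` for all `w`. -/
def sgrad {n : ℕ} : (Std n →L[ℝ] ℝ) →L[ℝ] Std n :=
  ContinuousLinearMap.pi (Sum.elim
    (fun i => ContinuousLinearMap.apply ℝ ℝ (Pi.single (Sum.inr i) (1 : ℝ) : Std n))
    (fun i => -ContinuousLinearMap.apply ℝ ℝ (Pi.single (Sum.inl i) (1 : ℝ) : Std n)))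

theorem stdForm_sgrad {n : ℕ} (ℓ : Std n →L[ℝ] ℝ) (w : Std n) : stdForm (sgrad ℓ) w = ℓ w := by
  have hw : ℓ w = ∑ i, w i * ℓ (Pi.single i 1) := by
    conv_lhs => rw [show w = ∑ i, w i • (Pi.single i 1 : Std n) by
      ext j; simp [Finset.sum_apply, Pi.single_apply]]
    simp
  rw [hw, Fintype.sum_sum_type, stdForm, ← Finset.sum_add_distrib]
  refine Finset.sum_congr rfl fun i _ => ?_
  simp [sgrad]
  ring

/-- The derivative of a Hamiltonian vector field on `ℝ^{2n}` is given by the Hessian. -/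
theorem stdForm_fderiv_sgrad {n : ℕ} {h : Std n → ℝ} {y : Std n} (hh : ContDiffAt ℝ ∞ h y)
    (v w : Std n) : stdForm (fderiv ℝ (fun z => sgrad (fderiv ℝ h z)) y v) w =
      fderiv ℝ (fderiv ℝ h) y v w := by
  have h1 : DifferentiableAt ℝ (fderiv ℝ h) y :=
    (hh.fderiv_right (m := ∞) le_rfl).differentiableAt (by simp)
  have h2 : fderiv ℝ (fun z => sgrad (fderiv ℝ h z)) y = sgrad.comp (fderiv ℝ (fderiv ℝ h) y) :=
    (sgrad.hasFDerivAt.comp y h1.hasFDerivAt).fderiv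
  rw [h2, ContinuousLinearMap.comp_apply, stdForm_sgrad]

/-- The symmetry of the Hessian makes the linearized field a Hamiltonian matrix. -/
theorem stdForm_fderiv_sgrad_symm {n : ℕ} {h : Std n → ℝ} {y : Std n} (hh : ContDiffAt ℝ ∞ h y)
    (v w : Std n) : stdForm (fderiv ℝ (fun z => sgrad (fderiv ℝ h z)) y v) w =
      stdForm (fderiv ℝ (fun z => sgrad (fderiv ℝ h z)) y w) v := by
  rw [stdForm_fderiv_sgrad hh, stdForm_fderiv_sgrad hh]
  exact hh.isSymmSndFDerivAt (by simpa using two_le_infty) v w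

/-! ### The variational equation -/

/-- The two mixed second derivatives of `y` agree; one is the time derivative of the variation, the
other the derivative of `X θ₀` in the direction of the variation. -/
theorem hasDerivAt_variation {E : Type*} [NormedAddCommGroup E] [NormedSpace ℝ E]
    {y : ℝ × ℝ → E} {X : ℝ → E → E} {θ₀ : ℝ} (hy : ContDiffAt ℝ ∞ y (θ₀, 0))
    (hX : DifferentiableAt ℝ (X θ₀) (y (θ₀, 0)))
    (hode : ∀ᶠ z in nhds (θ₀, (0 : ℝ)), fderiv ℝ y z (1, 0) = X z.1 (y z)) :
    HasDerivAt (fun θ => fderiv ℝ y (θ, 0) (0, 1))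
      (fderiv ℝ (X θ₀) (y (θ₀, 0)) (fderiv ℝ y (θ₀, 0) (0, 1))) θ₀ := by
  have h1 : DifferentiableAt ℝ (fderiv ℝ y) (θ₀, 0) :=
    (hy.fderiv_right (m := ∞) le_rfl).differentiableAt (by simp)
  have hyd : DifferentiableAt ℝ y (θ₀, 0) := hy.differentiableAt (by simp)
  have hsymm := hy.isSymmSndFDerivAt (by simpa using two_le_infty) (1, 0) (0, 1)
  have hl1 : HasDerivAt (fun θ : ℝ => (θ, (0 : ℝ))) (1, 0) θ₀ :=
    (hasDerivAt_id θ₀).prodMk (hasDerivAt_const θ₀ 0)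
  have hl2 : HasDerivAt (fun σ : ℝ => (θ₀, σ)) (0, 1) 0 :=
    (hasDerivAt_const (0 : ℝ) θ₀).prodMk (hasDerivAt_id 0)
  have h2 : HasDerivAt (fun θ => fderiv ℝ y (θ, 0) (0, 1))
      (fderiv ℝ (fderiv ℝ y) (θ₀, 0) (1, 0) (0, 1)) θ₀ := by
    exact (ContinuousLinearMap.apply ℝ E ((0 : ℝ), (1 : ℝ))).hasFDerivAt.comp_hasDerivAt θ₀
      (h1.hasFDerivAt.comp_hasDerivAt θ₀ hl1)
  have h3 : HasDerivAt (fun σ => fderiv ℝ y (θ₀, σ) (1, 0))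
      (fderiv ℝ (fderiv ℝ y) (θ₀, 0) (0, 1) (1, 0)) 0 := by
    exact (ContinuousLinearMap.apply ℝ E ((1 : ℝ), (0 : ℝ))).hasFDerivAt.comp_hasDerivAt (0 : ℝ)
      (h1.hasFDerivAt.comp_hasDerivAt (0 : ℝ) hl2)
  have h4 : HasDerivAt (fun σ => X θ₀ (y (θ₀, σ)))
      (fderiv ℝ (X θ₀) (y (θ₀, 0)) (fderiv ℝ y (θ₀, 0) (0, 1))) 0 :=
    hX.hasFDerivAt.comp_hasDerivAt (0 : ℝ) (hyd.hasFDerivAt.comp_hasDerivAt (0 : ℝ) hl2)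
  have h5 : (fun σ => fderiv ℝ y (θ₀, σ) (1, 0)) =ᶠ[nhds 0] fun σ => X θ₀ (y (θ₀, σ)) :=
    hl2.continuousAt.eventually hode
  have h6 := (h4.congr_of_eventuallyEq h5).unique h3
  rw [h6, ← hsymm]
  exact h2

/-! ### Linear Hamiltonian systems -/

/-- `Y` is a matrix solution of the linear system with coefficients `A`. -/
def IsLinSol {n : ℕ} (A : ℝ → Std n → Std n) (Y : ℝ → Mat n) : Prop :=
  ∀ v θ, HasDerivAt (fun θ => (Y θ).mulVec v) (A θ ((Y θ).mulVec v)) θ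

theorem HasDerivAt.stdForm {n : ℕ} {x y : ℝ → Std n} {x' y' : Std n} {θ : ℝ}
    (hx : HasDerivAt x x' θ) (hy : HasDerivAt y y' θ) :
    HasDerivAt (fun θ => MorseBott.stdForm (x θ) (y θ))
      (MorseBott.stdForm x' (y θ) + MorseBott.stdForm (x θ) y') θ := by
  have hx' := hasDerivAt_pi.1 hx
  have hy' := hasDerivAt_pi.1 hy
  have := HasDerivAt.fun_sum (u := Finset.univ) fun i _ =>
    ((hx' (Sum.inl i)).mul (hy' (Sum.inr i))).sub ((hx' (Sum.inr i)).mul (hy' (Sum.inl i)))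
  refine this.congr_deriv ?_
  rw [MorseBott.stdForm, MorseBott.stdForm, ← Finset.sum_add_distrib]
  refine Finset.sum_congr rfl fun i _ => ?_
  ring

theorem eq_of_hasDerivAt_zero {F : Type*} [NormedAddCommGroup F] [NormedSpace ℝ F] {f : ℝ → F}
    (h : ∀ θ, HasDerivAt f 0 θ) (a b : ℝ) : f a = f b :=
  is_const_of_deriv_eq_zero (fun θ => (h θ).differentiableAt) (fun θ => (h θ).deriv) a b

theorem IsLinSol.stdForm_const {n : ℕ} {A : ℝ → Std n → Std n}
    (hA : ∀ θ v w, stdForm (A θ v) w = stdForm (A θ w) v) {x y : ℝ → Std n}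
    (hx : ∀ θ, HasDerivAt x (A θ (x θ)) θ) (hy : ∀ θ, HasDerivAt y (A θ (y θ)) θ) (a b : ℝ) :
    stdForm (x a) (y a) = stdForm (x b) (y b) := by
  refine eq_of_hasDerivAt_zero (f := fun θ => stdForm (x θ) (y θ)) (fun θ => ?_) a b
  refine (HasDerivAt.stdForm (hx θ) (hy θ)).congr_deriv ?_
  rw [hA, stdForm_antisymm (A θ (y θ))]
  ring

theorem IsLinSol.mem {n : ℕ} {A : ℝ → Std n → Std n}
    (hA : ∀ θ v w, stdForm (A θ v) w = stdForm (A θ w) v) {Y : ℝ → Mat n} (hY : IsLinSol A Y)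
    (h0 : Y 0 = 1) (θ : ℝ) : Y θ ∈ Matrix.symplecticGroup (Fin n) ℝ := by
  rw [mem_symplecticGroup_iff_stdForm]
  intro v w
  rw [IsLinSol.stdForm_const hA (hY v) (hY w) θ 0, h0, Matrix.one_mulVec, Matrix.one_mulVec]

/-- A solution of a linear Hamiltonian system is determined by its initial value. -/
theorem IsLinSol.eq_mulVec {n : ℕ} {A : ℝ → Std n → Std n}
    (hA : ∀ θ v w, stdForm (A θ v) w = stdForm (A θ w) v) {Y : ℝ → Mat n} (hY : IsLinSol A Y)
    (h0 : Y 0 = 1) {x : ℝ → Std n} (hx : ∀ θ, HasDerivAt x (A θ (x θ)) θ) (θ : ℝ) :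
    x θ = (Y θ).mulVec (x 0) := by
  -- Uniqueness follows from a conserved quantity: the pairing of any two solutions is constant, and
  -- the columns of `Y θ` span.
  refine sub_eq_zero.1 (stdForm_nondegenerate fun w => ?_)
  have hm := hY.mem hA h0 θ
  have hw : w = (Y θ).mulVec ((sinv (Y θ)).mulVec w) := by
    rw [Matrix.mulVec_mulVec, mul_sinv_self hm, Matrix.one_mulVec]
  rw [hw, stdForm_sub_left, IsLinSol.stdForm_const hA hx (hY _) θ 0,
    IsLinSol.stdForm_const hA (hY _) (hY _) θ 0, h0, Matrix.one_mulVec, Matrix.one_mulVec, sub_self]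

theorem IsLinSol.continuous {n : ℕ} {A : ℝ → Std n → Std n} {Y : ℝ → Mat n} (hY : IsLinSol A Y) :
    Continuous Y := by
  rw [← continuousOn_univ]
  exact continuousOn_of_mulVec fun v θ _ => (hY v θ).continuousAt.continuousWithinAt

section

variable {m : ℕ} {What M : Type*}
  [TopologicalSpace What] [ChartedSpace (EuclideanSpace ℝ (Fin (2 * m + 2))) What]
  [TopologicalSpace M] [ChartedSpace (EuclideanSpace ℝ (Fin (2 * m + 1))) M]
  {C : SymplecticCompletion m What M} {φlam : ℝ → M → M} {K : C.AdmissibleHamiltonian φlam}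

theorem finrank_model : Module.finrank ℝ (EuclideanSpace ℝ (Fin (2 * m + 2))) =
    (m + 1) + (m + 1) := by
  rw [finrank_euclideanSpace_fin]; ring

namespace OrbitPerturbation

variable (d : OrbitPerturbation C φlam K)

/-! ### Symplectic coordinates near the circle of orbits -/

/-- The derivative of the coordinates. -/
def kd (y : Std (m + 1)) : Std (m + 1) →L[ℝ] EuclideanSpace ℝ (Fin (2 * m + 2)) :=
  dmap 𝓘(ℝ, Std (m + 1)) (𝓡 (2 * m + 2)) d.κ y

variable {d}

theorem isSymplecticMap_kd {y : Std (m + 1)} (hy : y ∈ d.V) :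
    IsSymplecticMap (C.formAt (d.κ y)) (d.kd y).toLinearMap := fun v w => d.κ_symplectic y hy v w

theorem surjective_kd {y : Std (m + 1)} (hy : y ∈ d.V) : Function.Surjective (d.kd y) :=
  (isSymplecticMap_kd hy).surjective finrank_model

theorem injective_kd {y : Std (m + 1)} (hy : y ∈ d.V) : Function.Injective (d.kd y) :=
  (isSymplecticMap_kd hy).injective

theorem contMDiffAt_κ {y : Std (m + 1)} (hy : y ∈ d.V) :
    ContMDiffAt 𝓘(ℝ, Std (m + 1)) (𝓡 (2 * m + 2)) ∞ d.κ y :=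
  d.κ_smooth.contMDiffAt (d.V_isOpen.mem_nhds hy)

theorem mdifferentiableAt_κ {y : Std (m + 1)} (hy : y ∈ d.V) :
    MDifferentiableAt 𝓘(ℝ, Std (m + 1)) (𝓡 (2 * m + 2)) d.κ y :=
  (contMDiffAt_κ hy).mdifferentiableAt (by simp)

/-- The inverse function theorem applies in a chart because a symplectic map between spaces of equal
dimension is bijective. -/
theorem exists_local_inverse {y₀ : Std (m + 1)} (hy₀ : y₀ ∈ d.V) :
    ∃ ψ : What → Std (m + 1), ContMDiffAt (𝓡 (2 * m + 2)) 𝓘(ℝ, Std (m + 1)) ∞ ψ (d.κ y₀) ∧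
      ψ (d.κ y₀) = y₀ ∧ (∀ᶠ x in nhds (d.κ y₀), d.κ (ψ x) = x ∧ ψ x ∈ d.V) ∧
      ∀ᶠ y in nhds y₀, ψ (d.κ y) = y := by
  set x₀ := d.κ y₀ with hx₀
  let g : Std (m + 1) → EuclideanSpace ℝ (Fin (2 * m + 2)) :=
    fun y => extChartAt (𝓡 (2 * m + 2)) x₀ (d.κ y)
  have hκ := contMDiffAt_κ hy₀
  have hg : ContDiffAt ℝ ∞ g y₀ := by
    rw [← contMDiffAt_iff_contDiffAt]
    exact (contMDiffAt_extChartAt (I := 𝓡 (2 * m + 2)) (n := ∞) (x := x₀)).comp y₀ hκ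
  have hfd : HasFDerivAt g (d.kd y₀) y₀ := by
    have h := (mdifferentiableAt_κ hy₀).hasMFDerivAt.2
    simp only [writtenInExtChartAt, extChartAt_model_space_eq_id, ModelWithCorners.range_eq_univ,
      PartialEquiv.refl_coe, PartialEquiv.refl_symm, id_eq,
      Function.comp_id] at h
    exact HasFDerivWithinAt.hasFDerivAt
      (h : HasFDerivWithinAt g (d.kd y₀) univ y₀) Filter.univ_mem
  let e : Std (m + 1) ≃L[ℝ] EuclideanSpace ℝ (Fin (2 * m + 2)) :=
    ContinuousLinearEquiv.ofBijective (d.kd y₀) (LinearMap.ker_eq_bot.2 (injective_kd hy₀))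
      (LinearMap.range_eq_top.2 (surjective_kd hy₀))
  have he : (e : Std (m + 1) →L[ℝ] EuclideanSpace ℝ (Fin (2 * m + 2))) = d.kd y₀ :=
    ContinuousLinearEquiv.coe_ofBijective _ _ _
  have hfd' : HasFDerivAt g (e : Std (m + 1) →L[ℝ] EuclideanSpace ℝ (Fin (2 * m + 2))) y₀ := by
    rwa [he]
  have hstrict : HasStrictFDerivAt g
      (e : Std (m + 1) →L[ℝ] EuclideanSpace ℝ (Fin (2 * m + 2))) y₀ :=
    hg.hasStrictFDerivAt' hfd' (by simp)
  let ψ₀ := hstrict.localInverse g e y₀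
  have hψ₀ : ContDiffAt ℝ ∞ ψ₀ (g y₀) := hg.to_localInverse hfd' (by simp)
  have hgx : g y₀ = extChartAt (𝓡 (2 * m + 2)) x₀ x₀ := rfl
  have hψc : ContMDiffAt (𝓡 (2 * m + 2)) 𝓘(ℝ, Std (m + 1)) ∞
      (fun x => ψ₀ (extChartAt (𝓡 (2 * m + 2)) x₀ x)) x₀ := by
    have h1 : ContMDiffAt 𝓘(ℝ, EuclideanSpace ℝ (Fin (2 * m + 2))) 𝓘(ℝ, Std (m + 1)) ∞ ψ₀
      (extChartAt (𝓡 (2 * m + 2)) x₀ x₀) := contMDiffAt_iff_contDiffAt.2 hψ₀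
    exact h1.comp x₀ contMDiffAt_extChartAt
  have hψ0 : ψ₀ (extChartAt (𝓡 (2 * m + 2)) x₀ x₀) = y₀ := hstrict.localInverse_apply_image
  refine ⟨fun x => ψ₀ (extChartAt (𝓡 (2 * m + 2)) x₀ x), hψc, hψ0, ?_, ?_⟩
  · have h1 : ∀ᶠ x in nhds x₀, g (ψ₀ (extChartAt (𝓡 (2 * m + 2)) x₀ x)) =
        extChartAt (𝓡 (2 * m + 2)) x₀ x :=
      (continuousAt_extChartAt x₀).eventually hstrict.eventually_right_inverse
    have h2 : ∀ᶠ x in nhds x₀, ψ₀ (extChartAt (𝓡 (2 * m + 2)) x₀ x) ∈ d.V := by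
      refine hψc.continuousAt.eventually (p := fun y => y ∈ d.V) ?_
      beta_reduce
      rw [hψ0]
      exact d.V_isOpen.mem_nhds hy₀
    have h3 : ∀ᶠ x in nhds x₀,
        d.κ (ψ₀ (extChartAt (𝓡 (2 * m + 2)) x₀ x)) ∈ (extChartAt (𝓡 (2 * m + 2)) x₀).source := by
      have hc : ContinuousAt (fun x => d.κ (ψ₀ (extChartAt (𝓡 (2 * m + 2)) x₀ x))) x₀ := by
        refine ContinuousAt.comp (g := d.κ) ?_ hψc.continuousAt
        rw [hψ0]
        exact hκ.continuousAt
      refine hc.eventually (p := fun y => y ∈ (extChartAt (𝓡 (2 * m + 2)) x₀).source) ?_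
      beta_reduce
      rw [hψ0]
      exact extChartAt_source_mem_nhds x₀
    filter_upwards [h1, h2, h3, extChartAt_source_mem_nhds (I := 𝓡 (2 * m + 2)) x₀]
      with x hx1 hx2 hx3 hx4
    exact ⟨(extChartAt (𝓡 (2 * m + 2)) x₀).injOn hx3 hx4 hx1, hx2⟩
  · exact hstrict.eventually_left_inverse

/-! ### Hamiltonian vector fields in symplectic coordinates -/

/-- Symplectic coordinates take symplectic gradients to Hamiltonian fields. Differentiability is
required of `H ∘ κ` only, which suits the perturbed Hamiltonian: its formula is transparent in the
coordinates and not on the manifold. -/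
theorem hamField_κ {H : What → ℝ} {y : Std (m + 1)} (hy : y ∈ d.V)
    (hH : DifferentiableAt ℝ (fun z => H (d.κ z)) y) :
    (C.hamField H (d.κ y) : EuclideanSpace ℝ (Fin (2 * m + 2))) =
      d.kd y (sgrad (fderiv ℝ (fun z => H (d.κ z)) y)) := by
  obtain ⟨ψ, hψ, hψ0, hκψ, -⟩ := exists_local_inverse hy
  have hHm : MDifferentiableAt (𝓡 (2 * m + 2)) 𝓘(ℝ, ℝ) H (d.κ y) := by
    have h1 : MDifferentiableAt 𝓘(ℝ, Std (m + 1)) 𝓘(ℝ, ℝ) (fun z => H (d.κ z)) (ψ (d.κ y)) := by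
      rw [hψ0]; exact mdifferentiableAt_iff_differentiableAt.2 hH
    refine (h1.comp (d.κ y) (hψ.mdifferentiableAt (by simp))).congr_of_eventuallyEq ?_
    filter_upwards [hκψ] with x hx
    simp [hx.1]
  let DH : EuclideanSpace ℝ (Fin (2 * m + 2)) →L[ℝ] ℝ :=
    mfderiv (𝓡 (2 * m + 2)) 𝓘(ℝ, ℝ) H (d.κ y)
  have hD : ∀ w, DH (d.kd y w) = fderiv ℝ (fun z => H (d.κ z)) y w := by
    intro w
    have h1 : mfderiv 𝓘(ℝ, Std (m + 1)) 𝓘(ℝ, ℝ) (fun z => H (d.κ z)) y = DH.comp (d.kd y) :=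
      (hHm.hasMFDerivAt.comp y (mdifferentiableAt_κ hy).hasMFDerivAt).mfderiv
    rw [mfderiv_eq_fderiv] at h1
    rw [h1]
    rfl
  have hex : ∀ w, C.formAt (d.κ y) (d.kd y (sgrad (fderiv ℝ (fun z => H (d.κ z)) y))) w = DH w := by
    intro w
    obtain ⟨w, rfl⟩ := surjective_kd hy w
    rw [hD, ← stdForm_sgrad]
    exact isSymplecticMap_kd hy _ _
  have hspec : ∀ w, C.formAt (d.κ y) (C.hamField H (d.κ y)) w = DH w :=
    Classical.epsilon_spec (p := fun v : EuclideanSpace ℝ (Fin (2 * m + 2)) =>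
      ∀ w, C.formAt (d.κ y) v w = DH w) ⟨_, hex⟩
  exact C.formAt_nondegenerate _ fun w => by rw [hspec, hex]

/-- The variational equation, in symplectic coordinates. -/
theorem hasDerivAt_variation {F : ℝ × ℝ → What} {X : ℝ → Std (m + 1) → Std (m + 1)} {θ₀ : ℝ}
    {y : ℝ → Std (m + 1)} (hy : ContinuousAt y θ₀) (hyV : ∀ θ, y θ ∈ d.V)
    (hF : ContMDiffAt 𝓘(ℝ, ℝ × ℝ) (𝓡 (2 * m + 2)) ∞ F (θ₀, 0))
    (hFy : ∀ θ, F (θ, 0) = d.κ (y θ)) (hX : DifferentiableAt ℝ (X θ₀) (y θ₀))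
    (hode : ∀ᶠ z in nhds (θ₀, (0 : ℝ)), ∀ x ∈ d.V, d.κ x = F z →
      HasVel (𝓡 (2 * m + 2)) (fun θ => F (θ, z.2)) (d.kd x (X z.1 x)) z.1)
    {u : ℝ → EuclideanSpace ℝ (Fin (2 * m + 2))}
    (hu : ∀ θ, HasVel (𝓡 (2 * m + 2)) (fun σ => F (θ, σ)) (u θ) 0) :
    HasDerivAt (fun θ => frameCoord (C.formAt (d.κ (y θ))) (d.kd (y θ)).toLinearMap (u θ))
      (fderiv ℝ (X θ₀) (y θ₀)
        (frameCoord (C.formAt (d.κ (y θ₀))) (d.kd (y θ₀)).toLinearMap (u θ₀))) θ₀ := by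
  -- Near `(θ₀, 0)` the family `F` lifts to `Y = ψ ∘ F` in the linear space, where the variational
  -- equation is known; the frame coordinates of `u` are the variation of `Y`.
  obtain ⟨ψ, hψ, hψ0, hκψ, hψκ⟩ := exists_local_inverse (hyV θ₀)
  let Y : ℝ × ℝ → Std (m + 1) := fun z => ψ (F z)
  have hF0 : F (θ₀, 0) = d.κ (y θ₀) := hFy θ₀
  have hY : ContDiffAt ℝ ∞ Y (θ₀, 0) := by
    rw [← contMDiffAt_iff_contDiffAt]
    rw [← hF0] at hψ
    exact hψ.comp (θ₀, 0) hF
  have hY0 : Y (θ₀, 0) = y θ₀ := by simp only [Y, hF0, hψ0]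
  have hev : ∀ᶠ z in nhds (θ₀, (0 : ℝ)), d.κ (Y z) = F z ∧ Y z ∈ d.V := by
    rw [← hF0] at hκψ
    exact hF.continuousAt.eventually hκψ
  have hYd : ∀ᶠ z in nhds (θ₀, (0 : ℝ)), DifferentiableAt ℝ Y z :=
    ((hY.of_le (m := 1) (by simp)).eventually (by simp)).mono
      fun z hz => hz.differentiableAt (by simp)
  have hev' := hev.eventually_nhds
  have hode' : ∀ᶠ z in nhds (θ₀, (0 : ℝ)), fderiv ℝ Y z (1, 0) = X z.1 (Y z) := by
    filter_upwards [hev', hode, hYd] with z hz hz2 hz3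
    obtain ⟨h1, h2⟩ := hz.self_of_nhds
    have h3 := hz2 _ h2 h1
    have hl : HasDerivAt (fun θ : ℝ => (θ, z.2)) (1, 0) z.1 :=
      (hasDerivAt_id z.1).prodMk (hasDerivAt_const z.1 z.2)
    have h4 : HasVel 𝓘(ℝ, Std (m + 1)) (fun θ => Y (θ, z.2)) (fderiv ℝ Y z (1, 0)) z.1 :=
      hasVel_iff_hasDerivAt.2 (HasFDerivAt.comp_hasDerivAt (l := Y) z.1 hz3.hasFDerivAt hl)
    have h5 := h4.comp (I' := 𝓡 (2 * m + 2)) (f := d.κ) (mdifferentiableAt_κ h2)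
    have h6 : (fun θ => F (θ, z.2)) =ᶠ[nhds z.1] fun θ => d.κ (Y (θ, z.2)) := by
      filter_upwards [hl.continuousAt.eventually hz] with θ hθ using hθ.1.symm
    exact injective_kd h2 ((h5.congr h6).unique h3)
  have key := MorseBott.hasDerivAt_variation hY (by rwa [hY0]) hode'
  have hl1 : ContinuousAt (fun θ : ℝ => (θ, (0 : ℝ))) θ₀ := by fun_prop
  have hcoord : ∀ᶠ θ in nhds θ₀,
      frameCoord (C.formAt (d.κ (y θ))) (d.kd (y θ)).toLinearMap (u θ) =
        fderiv ℝ Y (θ, 0) (0, 1) := by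
    have h7 : ∀ᶠ θ in nhds θ₀, Y (θ, 0) = y θ := by
      filter_upwards [hy.eventually hψκ] with θ hθ
      simp only [Y, hFy, hθ]
    filter_upwards [h7, hl1.eventually hev', hl1.eventually hYd] with θ h7 hz hz3
    obtain ⟨h1, h2⟩ := hz.self_of_nhds
    have hl : HasDerivAt (fun σ : ℝ => (θ, σ)) (0, 1) 0 :=
      (hasDerivAt_const (0 : ℝ) θ).prodMk (hasDerivAt_id 0)
    have h4 : HasVel 𝓘(ℝ, Std (m + 1)) (fun σ => Y (θ, σ)) (fderiv ℝ Y (θ, 0) (0, 1)) 0 :=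
      hasVel_iff_hasDerivAt.2 (HasFDerivAt.comp_hasDerivAt (0 : ℝ) hz3.hasFDerivAt hl)
    have h5 := h4.comp (I' := 𝓡 (2 * m + 2)) (f := d.κ) (mdifferentiableAt_κ h2)
    have h6 : (fun σ => F (θ, σ)) =ᶠ[nhds 0] fun σ => d.κ (Y (θ, σ)) := by
      filter_upwards [hl.continuousAt.eventually hz] with σ hσ using hσ.1.symm
    have h8 : d.kd (y θ) (fderiv ℝ Y (θ, 0) (0, 1)) = u θ := by
      rw [← h7]
      exact (h5.congr h6).unique (hu θ)
    rw [← h8]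
    exact (isSymplecticMap_kd (hyV θ)).frameCoord_map _
  rw [hcoord.self_of_nhds, ← hY0]
  exact key.congr_of_eventuallyEq hcoord

/-- Two integral curves of a time-dependent vector field agree if the coordinates of one of them
are known. -/
theorem eq_of_hasVel [IsManifold (𝓡 (2 * m + 2)) ∞ What] [T2Space What] {c : ℝ → What}
    {y : ℝ → Std (m + 1)} (hyV : ∀ θ, y θ ∈ d.V)
    {X : ℝ → Std (m + 1) → Std (m + 1)}
    (hX : ∀ θ, ContDiffAt ℝ 1 (fun z : ℝ × Std (m + 1) => X z.1 z.2) (θ, y θ))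
    (hy : ∀ θ, HasDerivAt y (X θ (y θ)) θ)
    (hc : Continuous c) (hode : ∀ θ, ∀ x ∈ d.V, d.κ x = c θ →
      HasVel (𝓡 (2 * m + 2)) c (d.kd x (X θ x)) θ) (h0 : c 0 = d.κ (y 0)) (θ : ℝ) :
    c θ = d.κ (y θ) := by
  have hycont : Continuous y := continuous_iff_continuousAt.2 fun θ => (hy θ).continuousAt
  have hκy : Continuous fun θ => d.κ (y θ) := continuous_iff_continuousAt.2 fun θ =>
    ContinuousAt.comp (g := d.κ) (contMDiffAt_κ (hyV θ)).continuousAt hycont.continuousAt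
  -- The set of agreement is closed since the space is Hausdorff, and open by local uniqueness of
  -- solutions in the coordinates.
  have hclosed : IsClosed {θ | c θ = d.κ (y θ)} := isClosed_eq hc hκy
  have hopen : IsOpen {θ | c θ = d.κ (y θ)} := by
    rw [isOpen_iff_mem_nhds]
    intro θ₁ (hθ₁ : c θ₁ = d.κ (y θ₁))
    obtain ⟨ψ, hψ, hψ0, hκψ, hψκ⟩ := exists_local_inverse (hyV θ₁)
    have hψc : ∀ᶠ θ in nhds θ₁, d.κ (ψ (c θ)) = c θ ∧ ψ (c θ) ∈ d.V :=
      hc.continuousAt.eventually (by rwa [hθ₁])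
    have hψd : ∀ᶠ x in nhds (d.κ (y θ₁)), ContMDiffAt (𝓡 (2 * m + 2)) 𝓘(ℝ, Std (m + 1)) 1 ψ x :=
      (contMDiffAt_iff_contMDiffAt_nhds (by simp)).1 (hψ.of_le (m := 1) (by simp))
    have hψd' : ∀ᶠ θ in nhds θ₁, ContMDiffAt (𝓡 (2 * m + 2)) 𝓘(ℝ, Std (m + 1)) 1 ψ (c θ) :=
      hc.continuousAt.eventually (by rwa [hθ₁])
    obtain ⟨L, s, hs, hL⟩ := (hX θ₁).exists_lipschitzOnWith
    have hcψ : ContinuousAt (fun θ => ψ (c θ)) θ₁ := by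
      refine ContinuousAt.comp (g := ψ) ?_ hc.continuousAt
      rw [hθ₁]; exact hψ.continuousAt
    have hLip : ∀ t, LipschitzOnWith L (X t) {x | (t, x) ∈ s} := by
      intro t x hx x' hx'
      have := hL hx hx'
      simpa [Prod.edist_eq] using this
    have hmem1 : ∀ᶠ θ in nhds θ₁, (θ, ψ (c θ)) ∈ s := by
      refine (continuousAt_id.prodMk hcψ).eventually (p := fun z => z ∈ s) ?_
      simpa [hθ₁, hψ0] using hs
    have hmem2 : ∀ᶠ θ in nhds θ₁, (θ, y θ) ∈ s :=
      (continuousAt_id.prodMk hycont.continuousAt).eventually (p := fun z => z ∈ s) (by simpa using hs)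
    have hode' : ∀ᶠ θ in nhds θ₁, HasDerivAt (fun θ => ψ (c θ)) (X θ (ψ (c θ))) θ := by
      filter_upwards [hψc.eventually_nhds, hψd'] with θ h1 h2
      obtain ⟨h3, h4⟩ := h1.self_of_nhds
      have h5 := hode θ _ h4 h3
      have h6 := h5.comp (I' := 𝓘(ℝ, Std (m + 1))) (f := ψ) (h2.mdifferentiableAt (by simp))
      have h7 := h6.comp (I' := 𝓡 (2 * m + 2)) (f := d.κ) (mdifferentiableAt_κ h4)
      have h8 : c =ᶠ[nhds θ] fun θ => d.κ (ψ (c θ)) := by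
        filter_upwards [h1] with θ h using h.1.symm
      have h9 := injective_kd h4 ((h7.congr h8).unique h5)
      rw [h9] at h6
      exact hasVel_iff_hasDerivAt.1 h6
    have heq := ODE_solution_unique_of_eventually (K := L) (s := fun t => {x | (t, x) ∈ s})
      (Filter.Eventually.of_forall hLip) (hode'.and hmem1)
      ((Filter.Eventually.of_forall hy).and hmem2) (by rw [hθ₁, hψ0])
    filter_upwards [heq, hψc] with θ h1 h2
    rw [← h2.1, h1]
  have huniv : {θ | c θ = d.κ (y θ)} = univ := IsClopen.eq_univ ⟨hclosed, hopen⟩ ⟨0, h0⟩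
  exact (huniv.symm ▸ mem_univ θ : θ ∈ {θ | c θ = d.κ (y θ)})

end OrbitPerturbation

end

section

variable {m : ℕ} {What M : Type*}
  [TopologicalSpace What] [ChartedSpace (EuclideanSpace ℝ (Fin (2 * m + 2))) What]
  [TopologicalSpace M] [ChartedSpace (EuclideanSpace ℝ (Fin (2 * m + 1))) M]
  {C : SymplecticCompletion m What M} {φlam : ℝ → M → M} {K : C.AdmissibleHamiltonian φlam}

/-! ### The derivative of the Reeb flow -/

/-- The derivative of the time `τ` map of the Reeb flow. -/
def flowD (m : ℕ) {M : Type*} [TopologicalSpace M]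
    [ChartedSpace (EuclideanSpace ℝ (Fin (2 * m + 1))) M] (φlam : ℝ → M → M) (τ : ℝ) (p : M) :
    EuclideanSpace ℝ (Fin (2 * m + 1)) →L[ℝ] EuclideanSpace ℝ (Fin (2 * m + 1)) :=
  dmap (𝓡 (2 * m + 1)) (𝓡 (2 * m + 1)) (φlam τ) p

theorem flowD_zero (hφ : IsFlow (fun _ => C.reeb) φlam) (p : M) (v) : flowD m φlam 0 p v = v := by
  have h : φlam 0 = id := funext hφ.zero
  rw [flowD, h, dmap, mfderiv_id]
  rfl

theorem hasVel_flow (hφ : IsFlow (fun _ => C.reeb) φlam) (p : M) (τ : ℝ) :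
    HasVel (𝓡 (2 * m + 1)) (fun τ => φlam τ p) (C.reebAt (φlam τ p)) τ := by
  refine ⟨?_, hφ.velocity τ p⟩
  exact ((hφ.smooth (τ, p)).mdifferentiableAt (by simp)).comp τ
    (f := fun τ : ℝ => (τ, p)) (mdifferentiableAt_id.prodMk mdifferentiableAt_const)

theorem dmap_flow (hφ : IsFlow (fun _ => C.reeb) φlam) (p : M) (τ a : ℝ)
    (v : EuclideanSpace ℝ (Fin (2 * m + 1))) :
    dmap (𝓘(ℝ, ℝ).prod (𝓡 (2 * m + 1))) (𝓡 (2 * m + 1)) (fun z : ℝ × M => φlam z.1 z.2) (τ, p)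
      (a, v) = a • C.reebAt (φlam τ p) + flowD m φlam τ p v := by
  have hs : MDifferentiableAt (𝓘(ℝ, ℝ).prod (𝓡 (2 * m + 1))) (𝓡 (2 * m + 1))
      (fun z : ℝ × M => φlam z.1 z.2) (τ, p) := (hφ.smooth (τ, p)).mdifferentiableAt (by simp)
  have hsum : ((a, v) : ℝ × EuclideanSpace ℝ (Fin (2 * m + 1))) = a • (1, 0) + (0, v) := by simp
  rw [hsum, map_add, map_smul]
  refine congrArg₂ (· + ·) (congrArg _ ?_) ?_
  · have h1 : HasVel (𝓘(ℝ, ℝ).prod (𝓡 (2 * m + 1))) (fun s : ℝ => (s, p))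
        ((1 : ℝ), (0 : EuclideanSpace ℝ (Fin (2 * m + 1)))) τ :=
      HasVel.prodMk (hasVel_iff_hasDerivAt.2 (hasDerivAt_id τ)) (hasVel_const p τ)
    exact (h1.comp (I' := 𝓡 (2 * m + 1)) (f := fun z : ℝ × M => φlam z.1 z.2) hs).unique
      (hasVel_flow hφ p τ)
  · have hc := hs.hasMFDerivAt.comp p (mdifferentiableAt_const.prodMk mdifferentiableAt_id :
      MDifferentiableAt (𝓡 (2 * m + 1)) (𝓘(ℝ, ℝ).prod (𝓡 (2 * m + 1))) (fun x : M => (τ, x))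
        p).hasMFDerivAt
    have h2 := hc.mfderiv
    rw [mfderiv_prod_right] at h2
    exact (DFunLike.congr_fun h2 v).symm

theorem hasVel_flow_comp (hφ : IsFlow (fun _ => C.reeb) φlam) {c : ℝ → ℝ} {c' : ℝ} {γ : ℝ → M}
    {v : EuclideanSpace ℝ (Fin (2 * m + 1))} {s : ℝ} (hc : HasDerivAt c c' s)
    (hγ : HasVel (𝓡 (2 * m + 1)) γ v s) :
    HasVel (𝓡 (2 * m + 1)) (fun s => φlam (c s) (γ s))
      (c' • C.reebAt (φlam (c s) (γ s)) + flowD m φlam (c s) (γ s) v) s := by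
  have h := (HasVel.prodMk (hasVel_iff_hasDerivAt.2 hc) hγ).comp (I' := 𝓡 (2 * m + 1))
    (f := fun z : ℝ × M => φlam z.1 z.2) ((hφ.smooth _).mdifferentiableAt (by simp))
  rwa [dmap_flow hφ] at h

namespace SymplecticCompletion

theorem G_contMDiffAt (p : M) {t : ℝ} (ht : -C.ε < t) :
    ContMDiffAt ((𝓡 (2 * m + 1)).prod 𝓘(ℝ, ℝ)) (𝓡 (2 * m + 2)) ∞ C.G (p, t) :=
  C.G_smooth.contMDiffAt ((isOpen_univ.prod isOpen_Ioi).mem_nhds ⟨mem_univ _, ht⟩)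

theorem hasVel_G {γ : ℝ → M} {τ : ℝ → ℝ} {v : EuclideanSpace ℝ (Fin (2 * m + 1))} {a s : ℝ}
    (hγ : HasVel (𝓡 (2 * m + 1)) γ v s) (hτ : HasDerivAt τ a s) (hε : -C.ε < τ s) :
    HasVel (𝓡 (2 * m + 2)) (fun s => C.G (γ s, τ s)) (C.pushAt (γ s) (τ s) (v, a)) s :=
  (HasVel.prodMk hγ (hasVel_iff_hasDerivAt.2 hτ)).comp (I' := 𝓡 (2 * m + 2)) (f := C.G)
    ((G_contMDiffAt (γ s) hε).mdifferentiableAt (by simp))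

namespace AdmissibleHamiltonian

/-- The slope `e^{-s} h'(s)` of the Hamiltonian. -/
def slope (K : C.AdmissibleHamiltonian φlam) (s : ℝ) : ℝ := Real.exp (-s) * deriv K.h s

theorem contDiff_slope : ContDiff ℝ ∞ K.slope := by
  have h1 : ContDiff ℝ ∞ (deriv K.h) :=
    (contDiff_infty_iff_deriv.1 K.h_smooth).2
  exact (Real.contDiff_exp.comp contDiff_neg).mul h1

theorem hasDerivAt_slope (s : ℝ) :
    HasDerivAt K.slope (Real.exp (-s) * (deriv (deriv K.h) s - deriv K.h s)) s := by
  have h1 : ContDiff ℝ ∞ (deriv K.h) :=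
    (contDiff_infty_iff_deriv.1 K.h_smooth).2
  have h2 : HasDerivAt (deriv K.h) (deriv (deriv K.h) s) s :=
    (h1.differentiable (by simp) s).hasDerivAt
  have h3 : HasDerivAt (fun s : ℝ => Real.exp (-s)) (Real.exp (-s) * -1) s :=
    (Real.hasDerivAt_exp (-s)).comp s (hasDerivAt_neg s)
  refine (h3.mul h2).congr_deriv ?_
  ring

/-- The Hamiltonian vector field on the end. -/
theorem hamField_end (p : M) {τ : ℝ} (hτ : 0 < τ) :
    (C.hamField K.H (C.G (p, τ)) : EuclideanSpace ℝ (Fin (2 * m + 2))) =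
      C.pushAt p τ (-K.slope τ • C.reebAt p, 0) := by
  have hε : -C.ε < τ := by linarith [C.ε_pos]
  have hG : MDifferentiableAt ((𝓡 (2 * m + 1)).prod 𝓘(ℝ, ℝ)) (𝓡 (2 * m + 2)) C.G (p, τ) :=
    (G_contMDiffAt p hε).mdifferentiableAt (by simp)
  have hH : MDifferentiableAt (𝓡 (2 * m + 2)) 𝓘(ℝ, ℝ) K.H (C.G (p, τ)) :=
    (K.smooth _).mdifferentiableAt (by simp)
  let DH : EuclideanSpace ℝ (Fin (2 * m + 2)) →L[ℝ] ℝ :=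
    mfderiv (𝓡 (2 * m + 2)) 𝓘(ℝ, ℝ) K.H (C.G (p, τ))
  have hh : DifferentiableAt ℝ K.h τ := K.h_smooth.differentiable (by simp) τ
  have hD : ∀ x : EuclideanSpace ℝ (Fin (2 * m + 1)) × ℝ,
      DH (C.pushAt p τ x) = deriv K.h τ * x.2 := by
    intro x
    have h1 : HasMFDerivAt ((𝓡 (2 * m + 1)).prod 𝓘(ℝ, ℝ)) 𝓘(ℝ, ℝ) (fun z => K.H (C.G z)) (p, τ)
      (DH.comp (C.pushAt p τ)) := hH.hasMFDerivAt.comp (p, τ) hG.hasMFDerivAt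
    have h2 : HasMFDerivAt ((𝓡 (2 * m + 1)).prod 𝓘(ℝ, ℝ)) 𝓘(ℝ, ℝ) (fun z : M × ℝ => K.h z.2) (p, τ)
      ((fderiv ℝ K.h τ).comp (ContinuousLinearMap.snd ℝ (EuclideanSpace ℝ (Fin (2 * m + 1))) ℝ)) :=
      HasMFDerivAt.comp (p, τ) hh.hasFDerivAt.hasMFDerivAt (hasMFDerivAt_snd (p, τ))
    have h3 : (fun z : M × ℝ => K.H (C.G z)) =ᶠ[nhds (p, τ)] fun z => K.h z.2 := by
      filter_upwards [(isOpen_univ.prod isOpen_Ioi).mem_nhds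
        (⟨mem_univ _, hτ⟩ : (p, τ) ∈ (univ ×ˢ Ioi 0 : Set (M × ℝ)))] with z hz
      exact K.H_eq z.1 z.2 (le_of_lt hz.2)
    have h4 := hasMFDerivAt_unique h1 (h2.congr_of_eventuallyEq h3)
    have h5 := congrArg (fun L : EuclideanSpace ℝ (Fin (2 * m + 1)) × ℝ →L[ℝ] ℝ => L x) h4
    refine h5.trans ?_
    have h6 : fderiv ℝ K.h τ x.2 = deriv K.h τ * x.2 := by
      generalize x.2 = c
      rw [← fderiv_apply_one_eq_deriv, mul_comm, ← smul_eq_mul, ← map_smul, smul_eq_mul, mul_one]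
    exact h6
  have hex : ∀ w, C.formAt (C.G (p, τ)) (C.pushAt p τ (-K.slope τ • C.reebAt p, 0)) w = DH w := by
    intro w
    obtain ⟨w, rfl⟩ := C.pushAt_surjective p hε w
    rw [hD, C.formAt_pushAt p hε]
    simp only [map_smul, LinearMap.smul_apply, C.dlam_reebAt, C.lamAt_reebAt, slope, smul_eq_mul]
    have : Real.exp τ * Real.exp (-τ) = 1 := by rw [← Real.exp_add]; simp
    linear_combination (deriv K.h τ * w.2) * this
  have hspec : ∀ w, C.formAt (C.G (p, τ)) (C.hamField K.H (C.G (p, τ))) w = DH w :=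
    Classical.epsilon_spec (p := fun v : EuclideanSpace ℝ (Fin (2 * m + 2)) =>
      ∀ w, C.formAt (C.G (p, τ)) v w = DH w) ⟨_, hex⟩
  exact C.formAt_nondegenerate _ fun w => by rw [hspec, hex]

end AdmissibleHamiltonian

end SymplecticCompletion

end

section

variable {m : ℕ} {What M : Type*}
  [TopologicalSpace What] [ChartedSpace (EuclideanSpace ℝ (Fin (2 * m + 2))) What]
  [TopologicalSpace M] [ChartedSpace (EuclideanSpace ℝ (Fin (2 * m + 1))) M]
  {C : SymplecticCompletion m What M} {φlam : ℝ → M → M} {K : C.AdmissibleHamiltonian φlam}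

namespace OrbitPerturbation

variable {d : OrbitPerturbation C φlam K}

/-! ### Periodicity of the coordinates -/

theorem l_pos : 0 < d.l := d.l_isGreatest.1.1

theorem l_ne_zero : (d.l : ℝ) ≠ 0 := Nat.cast_ne_zero.2 l_pos.ne'

theorem add_nat_mem {y : Std (m + 1)} (hy : y ∈ d.V) (j : ℕ) : y + (j : ℝ) • e₁ m ∈ d.V := by
  induction j with
  | zero => simpa using hy
  | succ j ih =>
    have := (d.V_periodic _).1 ih
    rw [add_assoc] at this
    convert this using 2
    push_cast
    module

theorem κ_add_nat {y : Std (m + 1)} (hy : y ∈ d.V) (j : ℕ) : d.κ (y + (j : ℝ) • e₁ m) = d.κ y :=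
  ((d.κ_eq_iff y hy _ (add_nat_mem hy j)).2 ⟨j, by simp⟩).symm

theorem kd_add_nat {y : Std (m + 1)} (hy : y ∈ d.V) (j : ℕ) :
    d.kd (y + (j : ℝ) • e₁ m) = d.kd y := by
  have h1 : HasMFDerivAt 𝓘(ℝ, Std (m + 1)) 𝓘(ℝ, Std (m + 1)) (fun z => z + (j : ℝ) • e₁ m) y
      (ContinuousLinearMap.id ℝ (Std (m + 1))) :=
    ((hasFDerivAt_id y).add_const ((j : ℝ) • e₁ m)).hasMFDerivAt
  have h2 := HasMFDerivAt.comp y (g := d.κ) (f := fun z => z + (j : ℝ) • e₁ m)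
    (mdifferentiableAt_κ (add_nat_mem hy j)).hasMFDerivAt h1
  have h3 : d.κ =ᶠ[nhds y] d.κ ∘ fun z => z + (j : ℝ) • e₁ m := by
    filter_upwards [d.V_isOpen.mem_nhds hy] with z hz using (κ_add_nat hz j).symm
  have h4 := hasMFDerivAt_unique (h2.congr_of_eventuallyEq h3) (mdifferentiableAt_κ hy).hasMFDerivAt
  exact h4

/-! ### The unperturbed Hamiltonian in coordinates -/

variable (d) in
/-- The Hamiltonian vector field of the unperturbed Hamiltonian, in coordinates. -/
def X₀ (y : Std (m + 1)) : Std (m + 1) := sgrad (fderiv ℝ (fun z => K.H (d.κ z)) y)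

theorem contDiffAt_ham {y : Std (m + 1)} (hy : y ∈ d.V) :
    ContDiffAt ℝ ∞ (fun z => K.H (d.κ z)) y := by
  rw [← contMDiffAt_iff_contDiffAt]
  exact (K.smooth _).comp y (contMDiffAt_κ hy)

theorem contDiffAt_X₀ {y : Std (m + 1)} (hy : y ∈ d.V) : ContDiffAt ℝ ∞ d.X₀ y :=
  sgrad.contDiff.contDiffAt.comp y ((contDiffAt_ham hy).fderiv_right (m := ∞) le_rfl)

theorem hamField_eq_kd {y : Std (m + 1)} (hy : y ∈ d.V) :
    (C.hamField K.H (d.κ y) : EuclideanSpace ℝ (Fin (2 * m + 2))) = d.kd y (d.X₀ y) :=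
  hamField_κ hy ((contDiffAt_ham hy).differentiableAt (by simp))

theorem X₀_add_nat {y : Std (m + 1)} (hy : y ∈ d.V) (j : ℕ) :
    d.X₀ (y + (j : ℝ) • e₁ m) = d.X₀ y := by
  have h3 : (fun z => K.H (d.κ (z + (j : ℝ) • e₁ m))) =ᶠ[nhds y] fun z => K.H (d.κ z) := by
    filter_upwards [d.V_isOpen.mem_nhds hy] with z hz
    rw [κ_add_nat hz]
  rw [X₀, X₀, ← h3.fderiv_eq, fderiv_comp_add_right (f := fun z => K.H (d.κ z))]

variable (d) in
/-- The linearization of the unperturbed Hamiltonian vector field along the circle. -/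
def A₀ (q : ℝ) : Std (m + 1) →L[ℝ] Std (m + 1) := fderiv ℝ d.X₀ (q • e₁ m)

theorem A₀_symm (q : ℝ) (v w : Std (m + 1)) : stdForm (d.A₀ q v) w = stdForm (d.A₀ q w) v :=
  stdForm_fderiv_sgrad_symm (contDiffAt_ham (d.V_circle q)) v w

theorem A₀_add_nat (q : ℝ) (j : ℕ) : d.A₀ (q + j) = d.A₀ q := by
  have h3 : (fun z => d.X₀ (z + (j : ℝ) • e₁ m)) =ᶠ[nhds (q • e₁ m)] d.X₀ := by
    filter_upwards [d.V_isOpen.mem_nhds (d.V_circle q)] with z hz using X₀_add_nat hz j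
  rw [A₀, A₀, ← h3.fderiv_eq, fderiv_comp_add_right (f := d.X₀), add_smul]

theorem t_gt : -C.ε < d.t := by linarith [C.ε_pos, d.t_pos]

theorem slope_t : K.slope d.t = d.T := d.period_eq.symm

theorem hasVel_circle (hφ : IsFlow (fun _ => C.reeb) φlam) (θ : ℝ) :
    HasVel (𝓡 (2 * m + 2)) (fun θ => C.G (φlam (-(d.T * θ)) d.p, d.t))
      (C.pushAt (φlam (-(d.T * θ)) d.p) d.t (-d.T • C.reebAt (φlam (-(d.T * θ)) d.p), 0)) θ := by
  have h1 : HasDerivAt (fun θ => -(d.T * θ)) (-d.T) θ :=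
    ((hasDerivAt_id θ).const_mul d.T).neg.congr_deriv (by simp)
  have h2 := hasVel_flow_comp hφ h1 (hasVel_const d.p θ)
  rw [map_zero, add_zero] at h2
  exact SymplecticCompletion.hasVel_G h2 (hasDerivAt_const θ d.t) t_gt

theorem kd_e₁ (hφ : IsFlow (fun _ => C.reeb) φlam) (θ : ℝ) :
    d.kd ((d.l * θ) • e₁ m) ((d.l : ℝ) • e₁ m) =
      C.pushAt (φlam (-(d.T * θ)) d.p) d.t (-d.T • C.reebAt (φlam (-(d.T * θ)) d.p), 0) := by
  have h1 : HasDerivAt (fun θ : ℝ => (d.l * θ) • e₁ m) ((d.l : ℝ) • e₁ m) θ := by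
    simpa using ((hasDerivAt_id θ).const_mul (d.l : ℝ)).smul_const (e₁ m)
  have h2 := (hasVel_iff_hasDerivAt.2 h1).comp (I' := 𝓡 (2 * m + 2)) (f := d.κ)
    (mdifferentiableAt_κ (d.V_circle _))
  simp only [d.κ_circle] at h2
  exact h2.unique (hasVel_circle hφ θ)

/-- In the coordinates `γ_H` is `θ ↦ ℓθ e₁`, and it is a trajectory because the slope of `h` at the
level `t` is `T`. So the field is constant along the whole circle. -/
theorem X₀_circle (hφ : IsFlow (fun _ => C.reeb) φlam) (q : ℝ) :
    d.X₀ (q • e₁ m) = (d.l : ℝ) • e₁ m := by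
  obtain ⟨θ, rfl⟩ : ∃ θ, q = d.l * θ := ⟨q / d.l, (mul_div_cancel₀ _ l_ne_zero).symm⟩
  apply injective_kd (d.V_circle (d.l * θ))
  rw [kd_e₁ hφ, ← hamField_eq_kd (d.V_circle _), d.κ_circle,
    SymplecticCompletion.AdmissibleHamiltonian.hamField_end _ d.t_pos, slope_t]

/-- The unperturbed field is constant on the circle, so its derivative along the circle vanishes. -/
theorem A₀_e₁ (hφ : IsFlow (fun _ => C.reeb) φlam) (q : ℝ) : d.A₀ q (e₁ m) = 0 := by
  have h1 : HasDerivAt (fun q : ℝ => q • e₁ m) (e₁ m) q := by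
    simpa using (hasDerivAt_id q).smul_const (e₁ m)
  have h2 := HasFDerivAt.comp_hasDerivAt (l := d.X₀) q
    ((contDiffAt_X₀ (d.V_circle q)).differentiableAt (by simp)).hasFDerivAt h1
  have h3 : d.X₀ ∘ (fun q : ℝ => q • e₁ m) = fun _ => (d.l : ℝ) • e₁ m :=
    funext fun q => X₀_circle hφ q
  rw [h3] at h2
  exact h2.unique (hasDerivAt_const q _)

/-! ### The linearized unperturbed flow -/

variable (d) in
/-- The rate `e^{-t} (h''(t) - h'(t))` of the shear. -/
def shearRate : ℝ := Real.exp (-d.t) * (deriv (deriv K.h) d.t - deriv K.h d.t)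

theorem shearRate_pos : 0 < d.shearRate :=
  mul_pos (Real.exp_pos _) (K.h_convex d.t d.t_pos.le d.t_lt)

variable (d) in
/-- The linearized unperturbed flow along the orbit, in the coordinates of the end. -/
def linFlow (θ : ℝ) : EuclideanSpace ℝ (Fin (2 * m + 1)) × ℝ →ₗ[ℝ]
    EuclideanSpace ℝ (Fin (2 * m + 2)) :=
  (C.pushAt (φlam (-(d.T * θ)) d.p) d.t).toLinearMap ∘ₗ
    (LinearMap.prod ((flowD m φlam (-(d.T * θ)) d.p).toLinearMap ∘ₗ LinearMap.fst ℝ _ _ -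
      (LinearMap.snd ℝ _ _).smulRight ((d.shearRate * θ) • C.reebAt (φlam (-(d.T * θ)) d.p)))
      (LinearMap.snd ℝ _ _))

theorem linFlow_apply (θ : ℝ) (x : EuclideanSpace ℝ (Fin (2 * m + 1)) × ℝ) :
    d.linFlow θ x = C.pushAt (φlam (-(d.T * θ)) d.p) d.t
      (flowD m φlam (-(d.T * θ)) d.p x.1 -
        x.2 • (d.shearRate * θ) • C.reebAt (φlam (-(d.T * θ)) d.p), x.2) := rfl

variable (d) in
/-- The inverse of the derivative of the parametrization of the end, at the starting point. -/
def pushInv : EuclideanSpace ℝ (Fin (2 * m + 2)) →ₗ[ℝ] EuclideanSpace ℝ (Fin (2 * m + 1)) × ℝ :=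
  (LinearEquiv.ofBijective (C.pushAt d.p d.t).toLinearMap
    ⟨C.pushAt_injective d.p t_gt, C.pushAt_surjective d.p t_gt⟩).symm.toLinearMap

theorem pushInv_pushAt (x : EuclideanSpace ℝ (Fin (2 * m + 1)) × ℝ) :
    d.pushInv (C.pushAt d.p d.t x) = x :=
  (LinearEquiv.ofBijective (C.pushAt d.p d.t).toLinearMap
    ⟨C.pushAt_injective d.p t_gt, C.pushAt_surjective d.p t_gt⟩).symm_apply_apply x

theorem pushAt_pushInv (w : EuclideanSpace ℝ (Fin (2 * m + 2))) :
    C.pushAt d.p d.t (d.pushInv w) = w := by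
  obtain ⟨x, rfl⟩ := C.pushAt_surjective d.p (t := d.t) t_gt w
  rw [pushInv_pushAt]

variable (d) in
/-- The linearized unperturbed flow along the orbit, in the symplectic coordinates. -/
def Zmat (θ : ℝ) : Mat (m + 1) :=
  frameRatio (C.formAt (d.κ ((d.l * θ) • e₁ m))) (d.kd ((d.l * θ) • e₁ m)).toLinearMap
    (d.linFlow θ ∘ₗ d.pushInv ∘ₗ (d.kd ((0 : ℝ) • e₁ m)).toLinearMap)

theorem kd_Zmat (θ : ℝ) (w : Std (m + 1)) :
    d.kd ((d.l * θ) • e₁ m) ((d.Zmat θ).mulVec w) =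
      d.linFlow θ (d.pushInv (d.kd ((0 : ℝ) • e₁ m) w)) :=
  (isSymplecticMap_kd (d.V_circle (d.l * θ))).map_frameRatio (surjective_kd (d.V_circle _)) w

theorem linFlow_zero (hφ : IsFlow (fun _ => C.reeb) φlam)
    (x : EuclideanSpace ℝ (Fin (2 * m + 1)) × ℝ) : d.linFlow 0 x = C.pushAt d.p d.t x := by
  rw [linFlow_apply]
  simp only [mul_zero, neg_zero, zero_smul, smul_zero, sub_zero]
  rw [hφ.zero, flowD_zero hφ]

theorem Zmat_zero (hφ : IsFlow (fun _ => C.reeb) φlam) : d.Zmat 0 = 1 := by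
  have h := (isSymplecticMap_kd (d.V_circle (d.l * 0))).eq_frameRatio (N := 1)
    (A := d.linFlow 0 ∘ₗ d.pushInv ∘ₗ (d.kd ((0 : ℝ) • e₁ m)).toLinearMap) ?_
  · exact h.symm
  · intro v
    simp only [LinearMap.comp_apply, linFlow_zero hφ, Matrix.one_mulVec,
      ContinuousLinearMap.coe_coe, mul_zero]
    rw [pushAt_pushInv]

end OrbitPerturbation

end

/-! ### The linearized unperturbed flow and its eigenvalue 1 -/

section

variable {m : ℕ} {What M : Type*}
  [TopologicalSpace What] [ChartedSpace (EuclideanSpace ℝ (Fin (2 * m + 2))) What]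
  [TopologicalSpace M] [ChartedSpace (EuclideanSpace ℝ (Fin (2 * m + 1))) M]
  [IsManifold (𝓡 (2 * m + 1)) ∞ M]
  {C : SymplecticCompletion m What M} {φlam : ℝ → M → M} {K : C.AdmissibleHamiltonian φlam}

theorem exists_curve (p : M) (v : EuclideanSpace ℝ (Fin (2 * m + 1))) :
    ∃ γ : ℝ → M, γ 0 = p ∧ ContMDiffAt 𝓘(ℝ, ℝ) (𝓡 (2 * m + 1)) ∞ γ 0 ∧
      HasVel (𝓡 (2 * m + 1)) γ v 0 := by
  let x₀ := extChartAt (𝓡 (2 * m + 1)) p p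
  let ψ := (extChartAt (𝓡 (2 * m + 1)) p).symm
  have hψ0 : ψ x₀ = p := extChartAt_to_inv p
  have hψ : ContMDiffAt 𝓘(ℝ, EuclideanSpace ℝ (Fin (2 * m + 1))) (𝓡 (2 * m + 1)) ∞ ψ x₀ :=
    (contMDiffOn_extChartAt_symm p).contMDiffAt (extChartAt_target_mem_nhds p)
  have : IsManifold (𝓡 (2 * m + 1)) 1 M := IsManifold.of_le (n := ∞) (by simp)
  have h := mfderivWithin_extChartAt_symm_comp_mfderiv_extChartAt' (I := 𝓡 (2 * m + 1)) (x := p)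
    (mem_extChartAt_source p)
  simp only [ModelWithCorners.range_eq_univ, mfderivWithin_univ] at h
  let v' : EuclideanSpace ℝ (Fin (2 * m + 1)) :=
    dmap (𝓡 (2 * m + 1)) 𝓘(ℝ, EuclideanSpace ℝ (Fin (2 * m + 1)))
      (extChartAt (𝓡 (2 * m + 1)) p) p v
  have hv' : dmap 𝓘(ℝ, EuclideanSpace ℝ (Fin (2 * m + 1))) (𝓡 (2 * m + 1)) ψ x₀ v' = v :=
    DFunLike.congr_fun h v
  have hl : HasDerivAt (fun σ : ℝ => x₀ + σ • v') v' 0 := by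
    simpa using ((hasDerivAt_id (0 : ℝ)).smul_const v').const_add x₀
  have hl0 : x₀ + (0 : ℝ) • v' = x₀ := by simp
  refine ⟨fun σ => ψ (x₀ + σ • v'), by beta_reduce; rw [hl0, hψ0], ?_, ?_⟩
  · have h2 : ContDiff ℝ ∞ (fun σ : ℝ => x₀ + σ • v') := by fun_prop
    exact ContMDiffAt.comp_of_eq (f := fun σ : ℝ => x₀ + σ • v') hψ h2.contMDiff.contMDiffAt hl0
  · have h3 := (hasVel_iff_hasDerivAt.2 hl).comp (I' := 𝓡 (2 * m + 1)) (f := ψ)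
      (by rw [hl0]; exact hψ.mdifferentiableAt (by simp))
    rwa [hl0, hv'] at h3

namespace OrbitPerturbation

variable {d : OrbitPerturbation C φlam K}

/-- On the end the trajectories of `X_H` are explicit. The family `F` moves the starting point with
velocity `v` in `M` and `a` in the level; `linFlow` is its derivative in `σ`, the shear being the
derivative of the slope. So it solves the variational equation. -/
theorem hasDerivAt_linFlow (hφ : IsFlow (fun _ => C.reeb) φlam)
    (x : EuclideanSpace ℝ (Fin (2 * m + 1)) × ℝ) (θ₀ : ℝ) :
    HasDerivAt (fun θ : ℝ => frameCoord (C.formAt (d.κ ((d.l * θ) • e₁ m)))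
        (d.kd ((d.l * θ) • e₁ m)).toLinearMap (d.linFlow θ x))
      (d.A₀ (d.l * θ₀) (frameCoord (C.formAt (d.κ ((d.l * θ₀) • e₁ m)))
        (d.kd ((d.l * θ₀) • e₁ m)).toLinearMap (d.linFlow θ₀ x))) θ₀ := by
  obtain ⟨v, a⟩ := x
  obtain ⟨γ, hγ0, hγ, hγv⟩ := exists_curve d.p v
  let F : ℝ × ℝ → What := fun z =>
    C.G (φlam (-(K.slope (d.t + z.2 * a) * z.1)) (γ z.2), d.t + z.2 * a)
  have hsl := SymplecticCompletion.AdmissibleHamiltonian.contDiff_slope (K := K)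
  have hF : ContMDiffAt 𝓘(ℝ, ℝ × ℝ) (𝓡 (2 * m + 2)) ∞ F (θ₀, 0) := by
    have h1 : ContDiff ℝ ∞ (fun z : ℝ × ℝ => -(K.slope (d.t + z.2 * a) * z.1)) :=
      ((hsl.comp (contDiff_const.add (contDiff_snd.mul contDiff_const))).mul contDiff_fst).neg
    have h2 : ContDiff ℝ ∞ (fun z : ℝ × ℝ => d.t + z.2 * a) :=
      contDiff_const.add (contDiff_snd.mul contDiff_const)
    have h3 : ContMDiffAt 𝓘(ℝ, ℝ × ℝ) (𝓡 (2 * m + 1)) ∞ (fun z : ℝ × ℝ => γ z.2) (θ₀, 0) :=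
      ContMDiffAt.comp (g := γ) (f := fun z : ℝ × ℝ => z.2) (θ₀, 0) hγ
        contDiff_snd.contMDiff.contMDiffAt
    have h4 : ContMDiffAt 𝓘(ℝ, ℝ × ℝ) (𝓡 (2 * m + 1)) ∞
        (fun z : ℝ × ℝ => φlam (-(K.slope (d.t + z.2 * a) * z.1)) (γ z.2)) (θ₀, 0) :=
      (hφ.smooth _).comp (θ₀, (0 : ℝ)) (h1.contMDiff.contMDiffAt.prodMk h3)
    refine ContMDiffAt.comp (g := C.G) (θ₀, (0 : ℝ)) (SymplecticCompletion.G_contMDiffAt _ ?_)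
      (h4.prodMk h2.contMDiff.contMDiffAt)
    have := t_gt (d := d)
    simpa using this
  have hFy : ∀ θ, F (θ, 0) = d.κ ((d.l * θ) • e₁ m) := by
    intro θ
    simp only [F, zero_mul, add_zero, hγ0, slope_t]
    rw [d.κ_circle]
  have hode : ∀ᶠ z in nhds (θ₀, (0 : ℝ)), ∀ x ∈ d.V, d.κ x = F z →
      HasVel (𝓡 (2 * m + 2)) (fun θ => F (θ, z.2)) (d.kd x (d.X₀ x)) z.1 := by
    -- The formula for `X_H` holds only at positive levels, so `σ` is kept small.
    have hpos : ∀ᶠ z : ℝ × ℝ in nhds (θ₀, (0 : ℝ)), 0 < d.t + z.2 * a := by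
      have hc : ContinuousAt (fun z : ℝ × ℝ => d.t + z.2 * a) (θ₀, 0) := by fun_prop
      exact hc.eventually (lt_mem_nhds (by simpa using d.t_pos))
    filter_upwards [hpos] with z hz x hx hxz
    rw [← hamField_eq_kd hx, hxz]
    simp only [F]
    rw [SymplecticCompletion.AdmissibleHamiltonian.hamField_end _ hz]
    set s := K.slope (d.t + z.2 * a)
    have h1 : HasDerivAt (fun θ => -(s * θ)) (-s) z.1 :=
      ((hasDerivAt_id z.1).const_mul s).neg.congr_deriv (by simp)
    have h2 := hasVel_flow_comp hφ h1 (hasVel_const (γ z.2) z.1)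
    rw [map_zero, add_zero] at h2
    exact SymplecticCompletion.hasVel_G h2 (hasDerivAt_const z.1 (d.t + z.2 * a))
      (by linarith [C.ε_pos])
  have hu : ∀ θ, HasVel (𝓡 (2 * m + 2)) (fun σ => F (θ, σ)) (d.linFlow θ (v, a)) 0 := by
    intro θ
    have h1 : HasDerivAt (fun σ => d.t + σ * a) a 0 := by
      simpa using ((hasDerivAt_id (0 : ℝ)).mul_const a).const_add d.t
    have h2 : HasDerivAt (fun σ => -(K.slope (d.t + σ * a) * θ)) (-(d.shearRate * a * θ)) 0 := by
      have h3 := SymplecticCompletion.AdmissibleHamiltonian.hasDerivAt_slope (K := K) (d.t + 0 * a)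
      have h4 := ((HasDerivAt.comp (h₂ := K.slope) (0 : ℝ) h3 h1).mul_const θ).neg
      refine h4.congr_deriv ?_
      simp [shearRate]
    have h5 := SymplecticCompletion.hasVel_G (hasVel_flow_comp hφ h2 hγv) h1
      (by simpa using t_gt (d := d))
    simp only [zero_mul, add_zero, hγ0, slope_t] at h5
    rw [linFlow_apply]
    convert h5 using 3
    module
  exact OrbitPerturbation.hasDerivAt_variation (X := fun _ => d.X₀) (y := fun θ : ℝ => (d.l * θ) • e₁ m)
    (by fun_prop) (fun θ => d.V_circle _) hF hFy
    ((contDiffAt_X₀ (d.V_circle _)).differentiableAt (by simp)) hode hu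

theorem isLinSol_Zmat (hφ : IsFlow (fun _ => C.reeb) φlam) :
    IsLinSol (fun θ : ℝ => d.A₀ (d.l * θ)) d.Zmat := by
  intro v θ
  simp only [Zmat, frameRatio_mulVec]
  exact hasDerivAt_linFlow hφ _ θ

theorem Zmat_mem (hφ : IsFlow (fun _ => C.reeb) φlam) (θ : ℝ) :
    d.Zmat θ ∈ Matrix.symplecticGroup (Fin (m + 1)) ℝ :=
  (isLinSol_Zmat (d := d) hφ).mem (fun _ => A₀_symm _) (Zmat_zero hφ) θ

theorem Zmat_e₁ (hφ : IsFlow (fun _ => C.reeb) φlam) (θ : ℝ) :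
    (d.Zmat θ).mulVec (e₁ m) = e₁ m :=
  ((isLinSol_Zmat (d := d) hφ).eq_mulVec (fun _ => A₀_symm _) (Zmat_zero hφ) (x := fun _ => e₁ m)
    (fun θ => by rw [A₀_e₁ hφ]; exact hasDerivAt_const θ _) θ).symm

/-- The coefficients have period 1 in `θ`, so `θ ↦ Z(θ+1)v` solves the same system. -/
theorem Zmat_add_one (hφ : IsFlow (fun _ => C.reeb) φlam) (θ : ℝ) :
    d.Zmat (θ + 1) = d.Zmat θ * d.Zmat 1 := by
  refine Matrix.ext_of_mulVec_single fun i => ?_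
  have := (isLinSol_Zmat (d := d) hφ).eq_mulVec (fun _ => A₀_symm _) (Zmat_zero hφ)
    (x := fun θ => (d.Zmat (θ + 1)).mulVec (Pi.single i 1)) (fun θ => ?_) θ
  · rw [this, zero_add, Matrix.mulVec_mulVec]
  · have h1 := (isLinSol_Zmat (d := d) hφ (Pi.single i 1) (θ + 1)).comp_add_const θ 1
    have h2 : d.A₀ (d.l * (θ + 1)) = d.A₀ (d.l * θ) := by
      rw [mul_add, mul_one, A₀_add_nat]
    simp only [h2] at h1
    exact h1

/-- The linearized unperturbed flow preserves the symplectic form. -/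
theorem formAt_linFlow (hφ : IsFlow (fun _ => C.reeb) φlam) (θ : ℝ)
    (x y : EuclideanSpace ℝ (Fin (2 * m + 1)) × ℝ) :
    C.formAt (C.G (φlam (-(d.T * θ)) d.p, d.t)) (d.linFlow θ x) (d.linFlow θ y) =
      C.formAt (C.G (d.p, d.t)) (C.pushAt d.p d.t x) (C.pushAt d.p d.t y) := by
  have h0 : d.κ ((0 : ℝ) • e₁ m) = C.G (d.p, d.t) := by
    have := d.κ_circle 0
    rwa [mul_zero, mul_zero, neg_zero, hφ.zero] at this
  have hs := surjective_kd (d.V_circle 0)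
  obtain ⟨v, hv⟩ := hs (C.pushAt d.p d.t x)
  obtain ⟨w, hw⟩ := hs (C.pushAt d.p d.t y)
  have h1 : ∀ x v, d.kd ((0 : ℝ) • e₁ m) v = C.pushAt d.p d.t x →
      d.linFlow θ x = d.kd ((d.l * θ) • e₁ m) ((d.Zmat θ).mulVec v) := by
    intro x v hv
    rw [kd_Zmat, hv, pushInv_pushAt]
  rw [h1 x v hv, h1 y w hw, ← hv, ← hw, ← d.κ_circle, ← h0]
  refine (isSymplecticMap_kd (d.V_circle _) _ _).trans ?_
  rw [mem_symplecticGroup_iff_stdForm.1 (Zmat_mem hφ θ)]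
  exact (isSymplecticMap_kd (d.V_circle 0) _ _).symm

/-- The invariance of `λ` under the Reeb flow is extracted from that of the symplectic form, by
pairing with the image of `∂_t`: its Reeb component does not contribute to `dλ`. -/
theorem lamAt_flowD (hφ : IsFlow (fun _ => C.reeb) φlam) (θ : ℝ)
    (v : EuclideanSpace ℝ (Fin (2 * m + 1))) :
    C.lamAt (φlam (-(d.T * θ)) d.p) (flowD m φlam (-(d.T * θ)) d.p v) = C.lamAt d.p v := by
  have h := formAt_linFlow (d := d) hφ θ (0, 1) (v, 0)
  rw [linFlow_apply, linFlow_apply, C.formAt_pushAt _ t_gt, C.formAt_pushAt _ t_gt] at h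
  have h' := mul_left_cancel₀ (Real.exp_pos d.t).ne' h
  simpa [C.dlam_reebAt] using h'

/-- This is `Z(θ) e₁ = e₁` read on the end, where `e₁` is a multiple of the Reeb field. -/
theorem flowD_reebAt (hφ : IsFlow (fun _ => C.reeb) φlam) (θ : ℝ) :
    flowD m φlam (-(d.T * θ)) d.p (C.reebAt d.p) = C.reebAt (φlam (-(d.T * θ)) d.p) := by
  have h0 := kd_e₁ (d := d) hφ 0
  rw [mul_zero, mul_zero, neg_zero, hφ.zero] at h0
  have h1 := kd_Zmat (d := d) θ ((d.l : ℝ) • e₁ m)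
  rw [Matrix.mulVec_smul, Zmat_e₁ hφ, kd_e₁ hφ, h0, pushInv_pushAt, linFlow_apply] at h1
  have h2 := congrArg Prod.fst (C.pushAt_injective _ t_gt h1)
  simp only [zero_smul, sub_zero, map_smul] at h2
  exact (smul_right_injective _ (neg_ne_zero.2 d.T_pos.ne') h2).symm

/-- Write the fixed vector as `v + a ∂_t`. Applying `λ` to the fixed point equation leaves `a` times
the shear rate, so `a = 0`. Then `v - λ(v) R_λ` lies in `ξ` and is fixed by the return map, so it
vanishes by transversal nondegeneracy, and only the direction of the circle remains. -/
theorem ker_Zmat_one (hφ : IsFlow (fun _ => C.reeb) φlam) (hnd : C.ReebNondegenerate φlam)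
    (w : Std (m + 1)) (hw : (d.Zmat 1).mulVec w = w) : ∃ a : ℝ, w = a • e₁ m := by
  -- Time `-1` is used because `X_H` runs against the Reeb field, so that `Z(-1)` involves the Reeb
  -- flow at time `+T`.
  have hw' : (d.Zmat (-1)).mulVec w = w := by
    have h1 := Zmat_add_one (d := d) hφ (-1)
    rw [neg_add_cancel, Zmat_zero hφ] at h1
    conv_lhs => rw [← hw]
    rw [Matrix.mulVec_mulVec, ← h1, Matrix.one_mulVec]
  have hk : d.kd ((d.l * (-1 : ℝ)) • e₁ m) = d.kd ((0 : ℝ) • e₁ m) := by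
    have h1 := kd_add_nat (d.V_circle (d.l * (-1 : ℝ))) d.l
    rw [← h1, ← add_smul]
    congr 2
    ring
  have h1 := kd_Zmat (d := d) (-1) w
  set x := d.pushInv (d.kd ((0 : ℝ) • e₁ m) w) with hx
  have hxw : C.pushAt d.p d.t x = d.kd ((0 : ℝ) • e₁ m) w := pushAt_pushInv _
  rw [hw', hk, ← hxw, linFlow_apply] at h1
  have hl := lamAt_flowD (d := d) hφ (-1) x.1
  have hR := flowD_reebAt (d := d) hφ (-1)
  have hT : -(d.T * (-1 : ℝ)) = d.T := by ring
  rw [hT] at h1 hl hR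
  rw [d.closed] at h1 hl hR
  have h2 := congrArg Prod.fst (C.pushAt_injective _ t_gt h1)
  simp only at h2
  have h3 : x.2 = 0 := by
    have h4 := congrArg (C.lamAt d.p) h2
    simp only [map_sub, map_smul, hl, C.lamAt_reebAt, smul_eq_mul] at h4
    have h5 : x.2 * d.shearRate = 0 := by linarith
    exact (mul_eq_zero.1 h5).resolve_right shearRate_pos.ne'
  rw [h3, zero_smul, sub_zero] at h2
  have h4 : x.1 - C.lamAt d.p x.1 • C.reebAt d.p = 0 := by
    refine hnd d.p d.T d.T_pos d.closed _ ?_ ?_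
    · change C.lamAt d.p (x.1 - C.lamAt d.p x.1 • C.reebAt d.p) = 0
      rw [map_sub, map_smul, C.lamAt_reebAt, smul_eq_mul, mul_one, sub_self]
    · change flowD m φlam d.T d.p (x.1 - C.lamAt d.p x.1 • C.reebAt d.p) = _
      rw [map_sub, map_smul, hR, ← h2]
  have h0 := kd_e₁ (d := d) hφ 0
  rw [mul_zero, mul_zero, neg_zero, hφ.zero] at h0
  refine ⟨-(C.lamAt d.p x.1 / d.T) * d.l, injective_kd (d.V_circle 0) ?_⟩
  rw [← hxw, mul_smul, map_smul, h0, ← map_smul]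
  congr 1
  refine Prod.ext ?_ ?_
  · change x.1 = -(C.lamAt d.p x.1 / d.T) • -d.T • C.reebAt d.p
    rw [sub_eq_zero] at h4
    rw [smul_smul, neg_mul_neg, div_mul_cancel₀ _ d.T_pos.ne']
    exact h4
  · simpa using h3

end OrbitPerturbation

end

/-! ### Variation of constants and uniform bounds -/

section LinearAlgebra

theorem hasDerivAt_of_stdForm {n : ℕ} {x : ℝ → Std n} {x' : Std n} {θ : ℝ}
    (h : ∀ w, HasDerivAt (fun θ => stdForm (x θ) w) (stdForm x' w) θ) : HasDerivAt x x' θ := by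
  rw [hasDerivAt_pi]
  rintro (i | i)
  · have := h (Pi.single (Sum.inr i) 1)
    simpa only [stdForm_antisymm _ (Pi.single _ _), stdForm_single_inr, neg_neg] using this
  · have := (h (Pi.single (Sum.inl i) 1)).fun_neg
    simpa only [stdForm_antisymm _ (Pi.single _ _), stdForm_single_inl, neg_neg] using this

theorem stdForm_sinv_mulVec {n : ℕ} {A : Mat n} (hA : A ∈ Matrix.symplecticGroup (Fin n) ℝ)
    (v w : Std n) : stdForm ((sinv A).mulVec v) w = stdForm v (A.mulVec w) := by
  rw [← mem_symplecticGroup_iff_stdForm.1 hA, Matrix.mulVec_mulVec, mul_sinv_self hA,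
    Matrix.one_mulVec]

/-- Variation of constants for a linear Hamiltonian equation. -/
theorem IsLinSol.hasDerivAt_sinv_mulVec {n : ℕ} {A : ℝ → Std n → Std n}
    (hA : ∀ θ v w, stdForm (A θ v) w = stdForm (A θ w) v) {Y : ℝ → Mat n} (hY : IsLinSol A Y)
    (hYsp : ∀ θ, Y θ ∈ Matrix.symplecticGroup (Fin n) ℝ) {x : ℝ → Std n} {r : Std n} {θ : ℝ}
    (hx : HasDerivAt x (A θ (x θ) + r) θ) :
    HasDerivAt (fun θ => (sinv (Y θ)).mulVec (x θ)) ((sinv (Y θ)).mulVec r) θ := by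
  refine hasDerivAt_of_stdForm fun w => ?_
  simp only [stdForm_sinv_mulVec (hYsp _)]
  refine (HasDerivAt.stdForm hx (hY w θ)).congr_deriv ?_
  rw [stdForm_add_left, hA, stdForm_antisymm (x θ)]
  ring

theorem exists_uniform_opBound {n : ℕ} {B : ℝ → Mat n} (hB : Continuous B) :
    ∃ C, 0 < C ∧ ∀ θ ∈ Icc (0 : ℝ) 1, OpBound (B θ) C := by
  let L : Mat n →ₗ[ℝ] (Std n →L[ℝ] Std n) :=
    (LinearMap.toContinuousLinearMap.toLinearMap :
      (Std n →ₗ[ℝ] Std n) →ₗ[ℝ] (Std n →L[ℝ] Std n)) ∘ₗ Matrix.toLin'.toLinearMap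
  have hL : Continuous fun θ => ‖L (B θ)‖ :=
    (L.continuous_of_finiteDimensional.comp hB).norm
  obtain ⟨θ₀, -, h⟩ := isCompact_Icc.exists_isMaxOn (nonempty_Icc.2 (zero_le_one' ℝ)) hL.continuousOn
  refine ⟨‖L (B θ₀)‖ + 1, by positivity, fun θ hθ v => ?_⟩
  refine (ContinuousLinearMap.le_opNorm (L (B θ)) v).trans
    (mul_le_mul_of_nonneg_right ?_ (norm_nonneg v))
  have : ‖L (B θ)‖ ≤ ‖L (B θ₀)‖ := h hθ
  linarith

end LinearAlgebra

section

variable {m : ℕ} {What M : Type*}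
  [TopologicalSpace What] [ChartedSpace (EuclideanSpace ℝ (Fin (2 * m + 2))) What]
  [TopologicalSpace M] [ChartedSpace (EuclideanSpace ℝ (Fin (2 * m + 1))) M]
  {C : SymplecticCompletion m What M} {φlam : ℝ → M → M} {K : C.AdmissibleHamiltonian φlam}

namespace OrbitPerturbation

variable {d : OrbitPerturbation C φlam K}

/-! ### The perturbation in coordinates -/

variable (d) in
/-- The perturbing function in coordinates. -/
def pert (θ : ℝ) (y : Std (m + 1)) : ℝ := d.ρ y * d.f (y (Sum.inl 0) - d.l * θ)

theorem e₁_apply : e₁ m (Sum.inl 0) = 1 := by simp [e₁]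

theorem contDiff_pert : ContDiff ℝ ∞ fun z : ℝ × Std (m + 1) => d.pert z.1 z.2 := by
  have h1 : ContDiff ℝ ∞ fun z : ℝ × Std (m + 1) => z.2 (Sum.inl 0) - d.l * z.1 := by fun_prop
  exact (d.ρ_smooth.comp contDiff_snd).mul (d.f_smooth.comp h1)

theorem contDiff_pert_right (θ : ℝ) : ContDiff ℝ ∞ (d.pert θ) :=
  contDiff_pert.comp (contDiff_const.prodMk contDiff_id)

/-- `bump` evaluates at an arbitrarily chosen preimage; any two differ by an integer multiple of
`e₁`, and both `ρ` and `f` are 1-periodic. -/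
theorem bump_κ {y : Std (m + 1)} (hy : y ∈ d.V) (θ : ℝ) : d.bump θ (d.κ y) = d.pert θ y := by
  have hx : ∃ y', y' ∈ d.V ∧ d.κ y' = d.κ y := ⟨y, hy, rfl⟩
  rw [bump, dif_pos hx]
  obtain ⟨j, hj⟩ := (d.κ_eq_iff y hy _ hx.choose_spec.1).1 hx.choose_spec.2.symm
  rw [hj, pert]
  have h1 : d.ρ (y + (j : ℝ) • e₁ m) = d.ρ y := by
    rw [Int.cast_smul_eq_zsmul]
    exact (Function.Periodic.zsmul d.ρ_periodic j) y
  have h2 : (y + (j : ℝ) • e₁ m) (Sum.inl 0) - d.l * θ = y (Sum.inl 0) - d.l * θ + j * 1 := by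
    simp only [Pi.add_apply, Pi.smul_apply, e₁_apply, smul_eq_mul]
    ring
  rw [h1, h2, (Function.Periodic.int_mul d.f_periodic j) _]

theorem bump_eq_zero {x : What} (hx : x ∉ d.U) (θ : ℝ) : d.bump θ x = 0 := by
  rw [bump, dif_neg]
  exact hx

variable (d) in
/-- The perturbed Hamiltonian vector field in coordinates. -/
def Xpert (δ θ : ℝ) (y : Std (m + 1)) : Std (m + 1) :=
  d.X₀ y + δ • sgrad (fderiv ℝ (d.pert θ) y)

theorem contDiff_sgrad_pert :
    ContDiff ℝ ∞ fun z : ℝ × Std (m + 1) => sgrad (fderiv ℝ (d.pert z.1) z.2) :=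
  sgrad.contDiff.comp (ContDiff.fderiv (f := fun z : ℝ × Std (m + 1) => d.pert z.1)
    (contDiff_pert.comp ((contDiff_fst.comp contDiff_fst).prodMk contDiff_snd)) contDiff_snd le_rfl)

theorem contDiffAt_Xpert {y : Std (m + 1)} (hy : y ∈ d.V) (δ θ : ℝ) :
    ContDiffAt ℝ ∞ (fun z : ℝ × Std (m + 1) => d.Xpert δ z.1 z.2) (θ, y) :=
  (ContDiffAt.comp (g := d.X₀) (f := Prod.snd) (θ, y) (contDiffAt_X₀ hy) contDiffAt_snd).add
    (contDiff_sgrad_pert.contDiffAt.const_smul δ)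

theorem pert_circle (θ q : ℝ) : d.pert θ (q • e₁ m) = d.f (q - d.l * θ) := by
  rw [pert, d.ρ_circle, one_mul, Pi.smul_apply, e₁_apply, smul_eq_mul, mul_one]

/-- Both factors are stationary: `ρ` attains its maximal value 1 on the circle, and along the orbit
the argument of `f` is constantly the critical point `q`. -/
theorem fderiv_pert_eq_zero {q : ℝ} (hq : deriv d.f q = 0) (θ : ℝ) :
    fderiv ℝ (d.pert θ) ((d.l * θ + q) • e₁ m) = 0 := by
  set y := (d.l * θ + q) • e₁ m with hy
  have hρ : HasFDerivAt d.ρ (0 : Std (m + 1) →L[ℝ] ℝ) y := by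
    have h1 : IsLocalMax d.ρ y := Filter.Eventually.of_forall fun z => by
      rw [hy, d.ρ_circle]; exact (d.ρ_mem z).2
    rw [← h1.fderiv_eq_zero]
    exact (d.ρ_smooth.differentiable (by simp) y).hasFDerivAt
  have hf : HasFDerivAt (fun z : Std (m + 1) => d.f (z (Sum.inl 0) - d.l * θ))
      (0 : Std (m + 1) →L[ℝ] ℝ) y := by
    have h1 : HasDerivAt d.f 0 (y (Sum.inl 0) - d.l * θ) := by
      have h2 : y (Sum.inl 0) - d.l * θ = q := by
        rw [hy, Pi.smul_apply, e₁_apply, smul_eq_mul]; ring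
      rw [h2, ← hq]
      exact (d.f_smooth.differentiable (by simp) q).hasDerivAt
    have h3 : DifferentiableAt ℝ (fun z : Std (m + 1) => z (Sum.inl 0) - d.l * θ) y := by fun_prop
    have := h1.comp_hasFDerivAt y h3.hasFDerivAt
    rwa [zero_smul] at this
  have := (hρ.mul hf).fderiv
  rw [smul_zero, smul_zero, add_zero] at this
  exact this

variable (d) in
/-- The linearization of the perturbing vector field along the orbit. -/
def pertHess (q θ : ℝ) : Std (m + 1) →L[ℝ] Std (m + 1) :=
  fderiv ℝ (fun z => sgrad (fderiv ℝ (d.pert θ) z)) ((d.l * θ + q) • e₁ m)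

theorem pertHess_symm (q θ : ℝ) (v w : Std (m + 1)) :
    stdForm (d.pertHess q θ v) w = stdForm (d.pertHess q θ w) v :=
  stdForm_fderiv_sgrad_symm (contDiff_pert_right θ).contDiffAt v w

theorem continuous_pertHess (q : ℝ) : Continuous (d.pertHess q) := by
  have h : ContDiff ℝ ∞ fun θ : ℝ => (d.l * θ + q) • e₁ m := by fun_prop
  exact (ContDiff.fderiv (f := fun θ z => sgrad (fderiv ℝ (d.pert θ) z))
    contDiff_sgrad_pert h (m := ∞) le_rfl).continuous

/-- On the circle `ρ = 1`, so the perturbation restricts to a translate of `f` there. The Hessian in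
the direction `e₁` involves this restriction only, and the translation moves along with the orbit.
-/
theorem stdForm_pertHess_e₁ (q θ : ℝ) :
    stdForm (d.pertHess q θ (e₁ m)) (e₁ m) = deriv (deriv d.f) q := by
  have hs := contDiff_pert_right (d := d) θ
  rw [pertHess, stdForm_fderiv_sgrad hs.contDiffAt]
  have hl : ∀ r : ℝ, HasDerivAt (fun r : ℝ => r • e₁ m) (e₁ m) r := fun r => by
    simpa using (hasDerivAt_id r).smul_const (e₁ m)
  have h1 : ∀ r : ℝ, fderiv ℝ (d.pert θ) (r • e₁ m) (e₁ m) = deriv d.f (r - d.l * θ) := by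
    intro r
    have h2 := HasFDerivAt.comp_hasDerivAt (l := d.pert θ) r
      (hs.differentiable (by simp) (r • e₁ m)).hasFDerivAt (hl r)
    have h3 : d.pert θ ∘ (fun r : ℝ => r • e₁ m) = fun r => d.f (r - d.l * θ) :=
      funext fun r => pert_circle θ r
    rw [h3] at h2
    rw [← h2.deriv, deriv_comp_sub_const]
  have h4 : Differentiable ℝ (fderiv ℝ (d.pert θ)) :=
    (hs.fderiv_right (m := ∞) le_rfl).differentiable (by simp)
  have h5 := HasFDerivAt.comp_hasDerivAt (l := fderiv ℝ (d.pert θ)) (d.l * θ + q)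
    (h4 ((d.l * θ + q) • e₁ m)).hasFDerivAt (hl _)
  have h6 := h5.clm_apply (hasDerivAt_const _ (e₁ m))
  rw [map_zero, add_zero] at h6
  have h7 : (fun r : ℝ => (fderiv ℝ (d.pert θ) ∘ fun r : ℝ => r • e₁ m) r (e₁ m)) =
      fun r => deriv d.f (r - d.l * θ) := funext h1
  rw [h7] at h6
  rw [← h6.deriv, deriv_comp_sub_const]
  congr 1
  ring

theorem fderiv_Xpert (δ q θ : ℝ) :
    fderiv ℝ (d.Xpert δ θ) ((d.l * θ + q) • e₁ m) = d.A₀ (d.l * θ + q) + δ • d.pertHess q θ := by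
  have h1 : DifferentiableAt ℝ d.X₀ ((d.l * θ + q) • e₁ m) :=
    (contDiffAt_X₀ (d.V_circle _)).differentiableAt (by simp)
  have h2 : DifferentiableAt ℝ (fun z => sgrad (fderiv ℝ (d.pert θ) z)) ((d.l * θ + q) • e₁ m) :=
    ((contDiff_sgrad_pert (d := d)).comp (contDiff_const.prodMk contDiff_id) :
      ContDiff ℝ ∞ fun z => sgrad (fderiv ℝ (d.pert θ) z)).differentiable (by simp) _
  exact (h1.hasFDerivAt.add (h2.hasFDerivAt.const_smul δ)).fderiv

theorem Xpert_circle (hφ : IsFlow (fun _ => C.reeb) φlam) {q : ℝ} (hq : deriv d.f q = 0)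
    (δ θ : ℝ) : d.Xpert δ θ ((d.l * θ + q) • e₁ m) = (d.l : ℝ) • e₁ m := by
  rw [Xpert, X₀_circle hφ, fderiv_pert_eq_zero hq, map_zero, smul_zero, add_zero]

end OrbitPerturbation

/-! ### The flow of the perturbed Hamiltonian -/

variable {ι : Type*} [Fintype ι] {d : ι → OrbitPerturbation C φlam K}

theorem perturbedHamiltonian_κ (hdisj : ∀ i j, i ≠ j → Disjoint (d i).U (d j).U) (δ θ : ℝ) {i : ι}
    {y : Std (m + 1)} (hy : y ∈ (d i).V) :
    perturbedHamiltonian d δ θ ((d i).κ y) = K.H ((d i).κ y) + δ * (d i).pert θ y := by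
  rw [perturbedHamiltonian, Finset.sum_eq_single i, OrbitPerturbation.bump_κ hy]
  · intro j _ hj
    exact OrbitPerturbation.bump_eq_zero
      ((disjoint_left.1 (hdisj i j hj.symm)) (mem_image_of_mem _ hy)) θ
  · intro h
    exact absurd (Finset.mem_univ i) h

theorem hamField_perturbed (hdisj : ∀ i j, i ≠ j → Disjoint (d i).U (d j).U) (δ θ : ℝ) {i : ι}
    {y : Std (m + 1)} (hy : y ∈ (d i).V) :
    (C.hamField (perturbedHamiltonian d δ θ) ((d i).κ y) : EuclideanSpace ℝ (Fin (2 * m + 2))) =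
      (d i).kd y ((d i).Xpert δ θ y) := by
  have h1 : (fun z => perturbedHamiltonian d δ θ ((d i).κ z)) =ᶠ[nhds y]
      fun z => K.H ((d i).κ z) + δ * (d i).pert θ z := by
    filter_upwards [(d i).V_isOpen.mem_nhds hy] with z hz using perturbedHamiltonian_κ hdisj δ θ hz
  have h2 : DifferentiableAt ℝ (fun z => K.H ((d i).κ z)) y :=
    (OrbitPerturbation.contDiffAt_ham hy).differentiableAt (by simp)
  have h3 : DifferentiableAt ℝ ((d i).pert θ) y :=
    (OrbitPerturbation.contDiff_pert_right θ).differentiable (by simp) y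
  have h4 := (h2.hasFDerivAt.add (h3.hasFDerivAt.const_mul δ)).congr_of_eventuallyEq h1
  rw [OrbitPerturbation.hamField_κ hy h4.differentiableAt, h4.fderiv, map_add, map_smul]
  rfl

theorem IsFlow.hasVel {n : ℕ} {X : Type*} [TopologicalSpace X]
    [ChartedSpace (EuclideanSpace ℝ (Fin n)) X] {V : ℝ → ∀ x : X, TangentSpace (𝓡 n) x}
    {φ : ℝ → X → X} (hφ : IsFlow V φ) (x : X) (τ : ℝ) :
    HasVel (𝓡 n) (fun τ => φ τ x) (V τ (φ τ x)) τ := by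
  refine ⟨?_, hφ.velocity τ x⟩
  exact ((hφ.smooth (τ, x)).mdifferentiableAt (by simp)).comp τ
    (f := fun τ : ℝ => (τ, x)) (mdifferentiableAt_id.prodMk mdifferentiableAt_const)

/-! ### The surviving orbits and the linearization along them -/

namespace OrbitPerturbation

theorem hasVel_perturbed (hdisj : ∀ i j, i ≠ j → Disjoint (d i).U (d j).U) {δ : ℝ}
    {φ : ℝ → What → What} (hφ : IsFlow (fun θ => C.hamField (perturbedHamiltonian d δ θ)) φ) {i : ι}
    {x : What} {θ : ℝ} {y : Std (m + 1)} (hy : y ∈ (d i).V) (h : (d i).κ y = φ θ x) :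
    HasVel (𝓡 (2 * m + 2)) (fun θ => φ θ x) ((d i).kd y ((d i).Xpert δ θ y)) θ := by
  have h1 := hφ.hasVel x θ
  rw [← hamField_perturbed hdisj δ θ hy, h]
  exact h1

/-- At a critical point of `f` the perturbed field agrees with the unperturbed one along the orbit,
so the orbit is an integral curve in the coordinates; `eq_of_hasVel` identifies it with the given
flow for all times. -/
theorem flow_orbit [IsManifold (𝓡 (2 * m + 2)) ∞ What] [T2Space What]
    (hlam : IsFlow (fun _ => C.reeb) φlam) (hdisj : ∀ i j, i ≠ j → Disjoint (d i).U (d j).U) {δ : ℝ}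
    {φ : ℝ → What → What} (hφ : IsFlow (fun θ => C.hamField (perturbedHamiltonian d δ θ)) φ) {i : ι}
    {q : ℝ} (hq : deriv (d i).f q = 0) (θ : ℝ) :
    φ θ ((d i).orbit q 0) = (d i).orbit q θ := by
  refine eq_of_hasVel (d := d i) (c := fun θ => φ θ ((d i).orbit q 0))
    (y := fun θ : ℝ => ((d i).l * θ + q) • e₁ m) (X := (d i).Xpert δ)
    (fun θ => (d i).V_circle _) (fun θ => (contDiffAt_Xpert ((d i).V_circle _) δ θ).of_le (by simp))
    (fun θ => ?_) ?_ (fun θ x hx h => hasVel_perturbed hdisj hφ hx h) ?_ θ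
  · rw [Xpert_circle hlam hq]
    simpa using (((hasDerivAt_id θ).const_mul ((d i).l : ℝ)).add_const q).smul_const (e₁ m)
  · exact hφ.smooth.continuous.comp (continuous_id.prodMk continuous_const)
  · exact hφ.zero _

theorem orbit_add_one (d : OrbitPerturbation C φlam K) (q θ : ℝ) :
    d.orbit q (θ + 1) = d.orbit q θ := by
  rw [orbit, orbit, ← κ_add_nat (d.V_circle (d.l * θ + q)) d.l, ← add_smul]
  congr 2
  ring

/-- The linearized perturbed flow along an orbit, in the symplectic coordinates. -/
def Mmat (d : OrbitPerturbation C φlam K) (φ : ℝ → What → What) (q θ : ℝ) : Mat (m + 1) :=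
  frameRatio (C.formAt (d.κ ((d.l * θ + q) • e₁ m))) (d.kd ((d.l * θ + q) • e₁ m)).toLinearMap
    ((dmap (𝓡 (2 * m + 2)) (𝓡 (2 * m + 2)) (φ θ) (d.orbit q 0)).toLinearMap ∘ₗ
      (d.kd (q • e₁ m)).toLinearMap)

theorem kd_Mmat (d : OrbitPerturbation C φlam K) (φ : ℝ → What → What) (q θ : ℝ)
    (w : Std (m + 1)) : d.kd ((d.l * θ + q) • e₁ m) ((d.Mmat φ q θ).mulVec w) =
      dmap (𝓡 (2 * m + 2)) (𝓡 (2 * m + 2)) (φ θ) (d.orbit q 0) (d.kd (q • e₁ m) w) :=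
  (isSymplecticMap_kd (d.V_circle _)).map_frameRatio (surjective_kd (d.V_circle _)) w

theorem Mmat_zero {δ : ℝ}
    {φ : ℝ → What → What} (hφ : IsFlow (fun θ => C.hamField (perturbedHamiltonian d δ θ)) φ) (i : ι)
    (q : ℝ) : (d i).Mmat φ q 0 = 1 := by
  have h := (isSymplecticMap_kd ((d i).V_circle ((d i).l * 0 + q))).eq_frameRatio (N := 1)
    (A := (dmap (𝓡 (2 * m + 2)) (𝓡 (2 * m + 2)) (φ 0) ((d i).orbit q 0)).toLinearMap ∘ₗ
      ((d i).kd (q • e₁ m)).toLinearMap) ?_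
  · exact h.symm
  · intro v
    have h1 : φ 0 = id := funext hφ.zero
    simp only [LinearMap.comp_apply, Matrix.one_mulVec, ContinuousLinearMap.coe_coe, mul_zero,
      zero_add]
    rw [h1, dmap, mfderiv_id]
    rfl

section

variable [IsManifold (𝓡 (2 * m + 2)) ∞ What] [T2Space What]

/-- The variational equation is applied to the flow of the segments `q e₁ + σ v`. -/
theorem isLinSol_Mmat (hlam : IsFlow (fun _ => C.reeb) φlam)
    (hdisj : ∀ i j, i ≠ j → Disjoint (d i).U (d j).U) {δ : ℝ}
    {φ : ℝ → What → What} (hφ : IsFlow (fun θ => C.hamField (perturbedHamiltonian d δ θ)) φ) {i : ι}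
    {q : ℝ} (hq : deriv (d i).f q = 0) :
    IsLinSol (fun θ v => (d i).A₀ ((d i).l * θ + q) v + δ • (d i).pertHess q θ v)
      ((d i).Mmat φ q) := by
  intro v θ₀
  simp only [Mmat, frameRatio_mulVec]
  have h0 : (d i).orbit q 0 = (d i).κ (q • e₁ m) := by rw [orbit, mul_zero, zero_add]
  let F : ℝ × ℝ → What := fun z => φ z.1 ((d i).κ (q • e₁ m + z.2 • v))
  have hl : HasDerivAt (fun σ : ℝ => q • e₁ m + σ • v) v 0 := by
    simpa using ((hasDerivAt_id (0 : ℝ)).smul_const v).const_add (q • e₁ m)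
  have hl0 : q • e₁ m + (0 : ℝ) • v = q • e₁ m := by simp
  have hκ := contMDiffAt_κ ((d i).V_circle q)
  have hF : ContMDiffAt 𝓘(ℝ, ℝ × ℝ) (𝓡 (2 * m + 2)) ∞ F (θ₀, 0) := by
    have h1 : ContDiff ℝ ∞ fun z : ℝ × ℝ => q • e₁ m + z.2 • v := by fun_prop
    have h2 : ContMDiffAt 𝓘(ℝ, ℝ × ℝ) (𝓡 (2 * m + 2)) ∞
        (fun z : ℝ × ℝ => (d i).κ (q • e₁ m + z.2 • v)) (θ₀, 0) :=
      ContMDiffAt.comp_of_eq (f := fun z : ℝ × ℝ => q • e₁ m + z.2 • v) hκ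
        h1.contMDiff.contMDiffAt hl0
    exact (hφ.smooth _).comp (θ₀, (0 : ℝ))
      ((contDiff_fst (𝕜 := ℝ) (n := ∞) (E := ℝ) (F := ℝ)).contMDiff.contMDiffAt.prodMk h2)
  have hFy : ∀ θ, F (θ, 0) = (d i).κ (((d i).l * θ + q) • e₁ m) := by
    intro θ
    simp only [F]
    rw [hl0, ← h0]
    exact flow_orbit hlam hdisj hφ hq θ
  have hu : ∀ θ, HasVel (𝓡 (2 * m + 2)) (fun σ => F (θ, σ))
      (dmap (𝓡 (2 * m + 2)) (𝓡 (2 * m + 2)) (φ θ) ((d i).orbit q 0) ((d i).kd (q • e₁ m) v)) 0 := by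
    intro θ
    have h1 := (hasVel_iff_hasDerivAt.2 hl).comp (I' := 𝓡 (2 * m + 2)) (f := (d i).κ)
      (by rw [hl0]; exact hκ.mdifferentiableAt (by simp))
    have hφθ : ContMDiff (𝓡 (2 * m + 2)) (𝓡 (2 * m + 2)) ∞ (φ θ) :=
      hφ.smooth.comp (contMDiff_const.prodMk contMDiff_id)
    have h2 := h1.comp (I' := 𝓡 (2 * m + 2)) (f := φ θ) (hφθ.mdifferentiable (by simp) _)
    rw [hl0, ← h0] at h2
    exact h2
  have h := OrbitPerturbation.hasDerivAt_variation (d := d i) (X := (d i).Xpert δ)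
    (y := fun θ : ℝ => ((d i).l * θ + q) • e₁ m) (θ₀ := θ₀) (by fun_prop)
    (fun θ => (d i).V_circle _) hF hFy
    (((contDiffAt_Xpert ((d i).V_circle _) δ θ₀).comp _
      (contDiffAt_const.prodMk contDiffAt_id)).differentiableAt (by simp))
    (Filter.Eventually.of_forall fun z x hx hxz => hasVel_perturbed hdisj hφ hx hxz) hu
  beta_reduce at h
  rw [fderiv_Xpert] at h
  exact h

end

end OrbitPerturbation

end

/-! ### The relative linearized flow and nondegeneracy -/

section

variable {m : ℕ} {What M : Type*}
  [TopologicalSpace What] [ChartedSpace (EuclideanSpace ℝ (Fin (2 * m + 2))) What]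
  [TopologicalSpace M] [ChartedSpace (EuclideanSpace ℝ (Fin (2 * m + 1))) M]
  {C : SymplecticCompletion m What M} {φlam : ℝ → M → M} {K : C.AdmissibleHamiltonian φlam}
  {ι : Type*} [Fintype ι] {d : ι → OrbitPerturbation C φlam K}

namespace OrbitPerturbation

theorem Mmat_mem [IsManifold (𝓡 (2 * m + 2)) ∞ What] [T2Space What]
    (hlam : IsFlow (fun _ => C.reeb) φlam)
    (hdisj : ∀ i j, i ≠ j → Disjoint (d i).U (d j).U) {δ : ℝ}
    {φ : ℝ → What → What} (hφ : IsFlow (fun θ => C.hamField (perturbedHamiltonian d δ θ)) φ) {i : ι}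
    {q : ℝ} (hq : deriv (d i).f q = 0) (θ : ℝ) :
    (d i).Mmat φ q θ ∈ Matrix.symplecticGroup (Fin (m + 1)) ℝ := by
  refine (isLinSol_Mmat hlam hdisj hφ hq).mem (fun θ v w => ?_) (Mmat_zero hφ i q) θ
  rw [stdForm_add_left, stdForm_add_left, stdForm_smul_left, stdForm_smul_left, A₀_symm,
    pertHess_symm]

/-- The linearized perturbed flow, relative to the unperturbed one. -/
def Nmat (d : OrbitPerturbation C φlam K) (φ : ℝ → What → What) (q θ : ℝ) : Mat (m + 1) :=
  sinv (d.Zmat (θ + q / d.l)) * d.Mmat φ q θ * d.Zmat (q / d.l)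

/-- The generator of the relative linearized flow, for `δ = 1`. -/
def Bmat (d : OrbitPerturbation C φlam K) (q θ : ℝ) : Mat (m + 1) :=
  sinv (d.Zmat (θ + q / d.l)) * LinearMap.toMatrix' (d.pertHess q θ).toLinearMap *
    d.Zmat (θ + q / d.l)

theorem continuous_Bmat [IsManifold (𝓡 (2 * m + 1)) ∞ M]
    (hlam : IsFlow (fun _ => C.reeb) φlam) (d : OrbitPerturbation C φlam K)
    (q : ℝ) : Continuous (d.Bmat q) := by
  have hZ : Continuous fun θ => d.Zmat (θ + q / d.l) :=
    (isLinSol_Zmat hlam).continuous.comp (continuous_id.add continuous_const)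
  have hS : Continuous fun θ => LinearMap.toMatrix' (d.pertHess q θ).toLinearMap := by
    refine continuous_matrix fun i j => ?_
    have h : Continuous fun θ => d.pertHess q θ (Pi.single j 1) i :=
      (continuous_apply i).comp ((continuous_pertHess q).clm_apply continuous_const)
    refine h.congr fun θ => ?_
    rw [LinearMap.toMatrix'_apply]
    rfl
  exact ((continuous_sinv.comp hZ).matrix_mul hS).matrix_mul hZ

/-- `Z` is symplectic and fixes `e₁`, so the conjugation does not affect this value. Its
independence of `θ` is what makes the first-order term of `N` explicit. -/
theorem stdForm_Bmat_e₁ [IsManifold (𝓡 (2 * m + 1)) ∞ M]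
    (hlam : IsFlow (fun _ => C.reeb) φlam) (d : OrbitPerturbation C φlam K)
    (q θ : ℝ) : stdForm ((d.Bmat q θ).mulVec (e₁ m)) (e₁ m) = deriv (deriv d.f) q := by
  rw [Bmat, ← Matrix.mulVec_mulVec, ← Matrix.mulVec_mulVec, stdForm_sinv_mulVec (Zmat_mem hlam _),
    Zmat_e₁ hlam, LinearMap.toMatrix'_mulVec]
  exact stdForm_pertHess_e₁ q θ

/-- By variation of constants the unperturbed part of the equation drops out, and only a generator
proportional to `δ` remains. -/
theorem hasDerivAt_Nmat [IsManifold (𝓡 (2 * m + 2)) ∞ What] [T2Space What]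
    [IsManifold (𝓡 (2 * m + 1)) ∞ M]
    (hlam : IsFlow (fun _ => C.reeb) φlam)
    (hdisj : ∀ i j, i ≠ j → Disjoint (d i).U (d j).U) {δ : ℝ}
    {φ : ℝ → What → What} (hφ : IsFlow (fun θ => C.hamField (perturbedHamiltonian d δ θ)) φ) {i : ι}
    {q : ℝ} (hq : deriv (d i).f q = 0) (v : Std (m + 1)) (θ : ℝ) :
    HasDerivAt (fun θ => ((d i).Nmat φ q θ).mulVec v)
      (δ • ((d i).Bmat q θ).mulVec (((d i).Nmat φ q θ).mulVec v)) θ := by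
  set a := q / (d i).l with ha
  have hal : ((d i).l : ℝ) * a = q := mul_div_cancel₀ _ l_ne_zero
  have hZ : IsLinSol (fun θ : ℝ => (d i).A₀ ((d i).l * θ + q)) fun θ => (d i).Zmat (θ + a) := by
    intro v θ
    have h := (isLinSol_Zmat (d := d i) hlam v (θ + a)).comp_add_const θ a
    beta_reduce at h
    rwa [mul_add, hal] at h
  have hM := isLinSol_Mmat hlam hdisj hφ hq (((d i).Zmat a).mulVec v) θ
  have h := hZ.hasDerivAt_sinv_mulVec (A := fun θ : ℝ => (d i).A₀ ((d i).l * θ + q))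
    (fun θ v w => A₀_symm _ v w) (fun θ => Zmat_mem hlam _) hM
  have hN : ∀ θ, ((d i).Nmat φ q θ).mulVec v = (sinv ((d i).Zmat (θ + a))).mulVec
      (((d i).Mmat φ q θ).mulVec (((d i).Zmat a).mulVec v)) := by
    intro θ
    rw [Nmat, Matrix.mulVec_mulVec, Matrix.mulVec_mulVec, mul_assoc]
  simp only [hN]
  refine h.congr_deriv ?_
  rw [Matrix.mulVec_smul, Bmat, ← ha, ← Matrix.mulVec_mulVec, ← Matrix.mulVec_mulVec,
    Matrix.mulVec_mulVec _ _ (sinv ((d i).Zmat (θ + a))), mul_sinv_self (Zmat_mem hlam _),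
    Matrix.one_mulVec, LinearMap.toMatrix'_mulVec]
  rfl

theorem Zmat_mul_Nmat [IsManifold (𝓡 (2 * m + 1)) ∞ M]
    (hlam : IsFlow (fun _ => C.reeb) φlam) (d : OrbitPerturbation C φlam K)
    (φ : ℝ → What → What) (q θ : ℝ) :
    d.Zmat (θ + q / d.l) * d.Nmat φ q θ * sinv (d.Zmat (q / d.l)) = d.Mmat φ q θ := by
  rw [Nmat, mul_assoc, mul_assoc, mul_sinv_self (Zmat_mem hlam _), mul_one, ← mul_assoc,
    mul_sinv_self (Zmat_mem hlam _), one_mul]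

/-- The vector `e^{-t/2} ∂/∂t` at the starting point, in the symplectic coordinates. -/
def eta (d : OrbitPerturbation C φlam K) : Std (m + 1) :=
  frameCoord (C.formAt (d.κ ((0 : ℝ) • e₁ m))) (d.kd ((0 : ℝ) • e₁ m)).toLinearMap
    (Real.exp (-d.t / 2) • C.pushAt d.p d.t (0, 1))

theorem κ_zero (hlam : IsFlow (fun _ => C.reeb) φlam) (d : OrbitPerturbation C φlam K) :
    d.κ ((0 : ℝ) • e₁ m) = C.G (d.p, d.t) := by
  have := d.κ_circle 0
  rwa [mul_zero, mul_zero, neg_zero, hlam.zero] at this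

/-- On the end, `e₁` is a multiple of the Reeb field, and `∂_t` pairs nontrivially with it. -/
theorem stdForm_eta_ne_zero (hlam : IsFlow (fun _ => C.reeb) φlam)
    (d : OrbitPerturbation C φlam K) : stdForm d.eta (e₁ m) ≠ 0 := by
  have h0 := kd_e₁ (d := d) hlam 0
  rw [mul_zero, mul_zero, neg_zero, hlam.zero] at h0
  have h1 : stdForm d.eta ((d.l : ℝ) • e₁ m) ≠ 0 := by
    have hk := isSymplecticMap_kd (d.V_circle 0)
    have h2 := hk d.eta ((d.l : ℝ) • e₁ m)
    conv_lhs at h2 => rw [eta, hk.map_frameCoord (surjective_kd (d.V_circle 0)), ContinuousLinearMap.coe_coe, h0,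
      map_smul, LinearMap.smul_apply, κ_zero hlam, C.formAt_pushAt _ t_gt]
    rw [← h2]
    simp [C.lamAt_reebAt, d.T_pos.ne']
  rw [stdForm_smul_right] at h1
  exact right_ne_zero_of_mul h1

/-- For small `δ`, the linearized perturbed flow is homotopic to the composition of the
unperturbed one with a shear. -/
theorem exists_Nmat_homotopy [IsManifold (𝓡 (2 * m + 2)) ∞ What] [T2Space What]
    [IsManifold (𝓡 (2 * m + 1)) ∞ M]
    (hlam : IsFlow (fun _ => C.reeb) φlam)
    (hnd : C.ReebNondegenerate φlam) (hdisj : ∀ i j, i ≠ j → Disjoint (d i).U (d j).U) {i : ι}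
    {q : ℝ} (hq : deriv (d i).f q = 0) (hq' : deriv (deriv (d i).f) q ≠ 0) :
    ∃ δ₀ : ℝ, 0 < δ₀ ∧ ∀ δ : ℝ, 0 < δ → δ ≤ δ₀ → ∀ φ : ℝ → What → What,
      IsFlow (fun θ => C.hamField (perturbedHamiltonian d δ θ)) φ →
      ∃ (c : ℝ) (H : ℝ → ℝ → Mat (m + 1)), 0 < c * deriv (deriv (d i).f) q ∧
        ContinuousOn (fun z : ℝ × ℝ => H z.1 z.2) (Icc 0 1 ×ˢ Icc 0 1) ∧
        (∀ u ∈ Icc (0 : ℝ) 1, ∀ s ∈ Icc (0 : ℝ) 1,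
          H u s ∈ Matrix.symplecticGroup (Fin (m + 1)) ℝ) ∧
        (∀ u ∈ Icc (0 : ℝ) 1, H u 0 = 1) ∧
        (∀ u ∈ Icc (0 : ℝ) 1, (1 - (d i).Zmat 1 * H u 1).det ≠ 0) ∧
        (∀ s ∈ Icc (0 : ℝ) 1, H 0 s = 1 + (c * s) • etaMat (d i).eta) ∧
        (∀ s ∈ Icc (0 : ℝ) 1, H 1 s = (d i).Nmat φ q s) := by
  -- The generator `Bmat` involves neither `δ` nor the perturbed flow, so the bound, and with it
  -- `δ₀`, is uniform in both.
  obtain ⟨B, hB, hB'⟩ := exists_uniform_opBound (continuous_Bmat hlam (d i) q)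
  obtain ⟨δ₀, hδ₀, h⟩ := exists_perturbation_homotopy (Zmat_mem (d := d i) hlam 1) (Zmat_e₁ hlam 1)
    (ker_Zmat_one hlam hnd) hB hB' (fun θ _ => stdForm_Bmat_e₁ hlam (d i) q θ) hq'
    (stdForm_eta_ne_zero hlam (d i))
  refine ⟨δ₀, hδ₀, fun δ hδ hδ' φ hφ => h δ hδ hδ' _ (fun θ _ => ?_) ?_
    fun v θ _ => hasDerivAt_Nmat hlam hdisj hφ hq v θ⟩
  · exact mul_mem (mul_mem (sinv_mem (Zmat_mem hlam _)) (Mmat_mem hlam hdisj hφ hq θ))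
      (Zmat_mem hlam _)
  · rw [Nmat, Mmat_zero hφ, mul_one, zero_add, sinv_mul_self (Zmat_mem hlam _)]

/-- The return map is conjugate, through the coordinates and `Z(q/ℓ)`, to `Z(1) N(1)`, so a fixed
vector of the one gives a fixed vector of the other. -/
theorem isNondegenerateOrbit [IsManifold (𝓡 (2 * m + 2)) ∞ What] [T2Space What]
    [IsManifold (𝓡 (2 * m + 1)) ∞ M]
    (hlam : IsFlow (fun _ => C.reeb) φlam)
    (hdisj : ∀ i j, i ≠ j → Disjoint (d i).U (d j).U) {δ : ℝ}
    {φ : ℝ → What → What} (hφ : IsFlow (fun θ => C.hamField (perturbedHamiltonian d δ θ)) φ) {i : ι}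
    {q : ℝ} (hq : deriv (d i).f q = 0) (hdet : (1 - (d i).Zmat 1 * (d i).Nmat φ q 1).det ≠ 0) :
    IsNondegenerateOrbit (d i) φ q := by
  refine ⟨flow_orbit hlam hdisj hφ hq, orbit_add_one (d i) q, fun v hv => ?_⟩
  obtain ⟨w, rfl⟩ := surjective_kd ((d i).V_circle q) v
  have h1 := kd_Mmat (d i) φ q 1 w
  have hk : (d i).kd (((d i).l * 1 + q) • e₁ m) = (d i).kd (q • e₁ m) := by
    rw [← kd_add_nat ((d i).V_circle q) (d i).l, ← add_smul, mul_one, add_comm (q : ℝ)]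
  have h2 : ((d i).Mmat φ q 1).mulVec w = w := by
    apply injective_kd ((d i).V_circle q)
    rw [hk] at h1
    exact h1.trans hv
  set a := q / (d i).l with ha
  set w' := (sinv ((d i).Zmat a)).mulVec w with hw'
  have hw : ((d i).Zmat a).mulVec w' = w := by
    rw [hw', Matrix.mulVec_mulVec, mul_sinv_self (Zmat_mem hlam _), Matrix.one_mulVec]
  have h3 : ((d i).Zmat 1 * (d i).Nmat φ q 1).mulVec w' = w' := by
    rw [← Zmat_mul_Nmat hlam, add_comm (1 : ℝ), Zmat_add_one hlam, ← ha,
      ← Matrix.mulVec_mulVec, ← hw', mul_assoc, ← Matrix.mulVec_mulVec] at h2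
    conv_rhs => rw [hw', ← h2]
    rw [Matrix.mulVec_mulVec _ (sinv _), sinv_mul_self (Zmat_mem hlam _), Matrix.one_mulVec]
  have h4 : w' = 0 := by
    refine Matrix.eq_zero_of_mulVec_eq_zero hdet ?_
    rw [Matrix.sub_mulVec, Matrix.one_mulVec, h3, sub_self]
  rw [← hw, h4, Matrix.mulVec_zero, map_zero]

end OrbitPerturbation

end

/-! ### Angles along the boundary of a surface -/

theorem surface_bdry₁_zero {g : ℕ} : (Surface.bdry₁ 0 : Surface g) = Quot.mk _ (0, 1) := by
  rw [Surface.bdry₁, zero_div]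

theorem surface_period {g : ℕ} (s : Icc (0 : ℝ) 1) :
    (Quot.mk _ (1, s) : Surface g) = Quot.mk _ (0, s) := by
  have := Quot.sound (SurfaceRel.period (g := g) 0 s)
  rw [zero_add] at this
  exact this.symm

theorem surface_edgeX {g i : ℕ} (hi : i < g) {r : ℝ} (hr : r ∈ Icc (0 : ℝ) 1) :
    (Quot.mk _ ((4 * i + 1 + r) / (4 * g + 1), 1) : Surface g) =
      Quot.mk _ ((4 * i + 4 - r) / (4 * g + 1), 1) := Quot.sound (SurfaceRel.edgeX i hi r hr)

theorem surface_edgeY {g i : ℕ} (hi : i < g) {r : ℝ} (hr : r ∈ Icc (0 : ℝ) 1) :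
    (Quot.mk _ ((4 * i + 2 + r) / (4 * g + 1), 1) : Surface g) =
      Quot.mk _ ((4 * i + 5 - r) / (4 * g + 1), 1) := Quot.sound (SurfaceRel.edgeY i hi r hr)

/-- The end points of the four edges of a handle are identified in a chain, so that all vertices on
the outer circle are the same point. -/
theorem surface_vertex {g i : ℕ} (hi : i ≤ g) :
    (Quot.mk _ (((4 * i + 1 : ℝ)) / (4 * g + 1), 1) : Surface g) = Surface.bdry₁ 1 := by
  induction i with
  | zero => simp [Surface.bdry₁]
  | succ i ih =>
    rw [← ih (by omega)]
    have h1 := surface_edgeX (g := g) (i := i) (by omega) (r := 0) (by simp)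
    have h2 := surface_edgeX (g := g) (i := i) (by omega) (r := 1) (by simp)
    have h3 := surface_edgeY (g := g) (i := i) (by omega) (r := 0) (by simp)
    have h4 := surface_edgeY (g := g) (i := i) (by omega) (r := 1) (by simp)
    rw [add_zero, sub_zero] at h1 h3
    rw [show (4 * i + 1 + 1 : ℝ) = 4 * i + 2 by ring,
      show (4 * i + 4 - 1 : ℝ) = 4 * i + 3 by ring] at h2
    rw [show (4 * i + 2 + 1 : ℝ) = 4 * i + 3 by ring,
      show (4 * i + 5 - 1 : ℝ) = 4 * i + 4 by ring] at h4
    rw [show (4 * (i + 1 : ℕ) + 1 : ℝ) = 4 * i + 5 by push_cast; ring, ← h3, h2, h4, ← h1]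

/-- The end points of the boundary circle `∂₁` coincide. -/
theorem surface_bdry₁_one {g : ℕ} : (Surface.bdry₁ 1 : Surface g) = Surface.bdry₁ 0 := by
  have h := surface_vertex (le_refl g)
  rw [div_self (by positivity), surface_period] at h
  rw [← h, surface_bdry₁_zero]

theorem continuous_bdry₁ {g : ℕ} : Continuous (Surface.bdry₁ : ℝ → Surface g) :=
  continuous_quot_mk.comp ((continuous_id.div_const _).prodMk continuous_const)

/-- In `x y x⁻¹ y⁻¹` each edge is run through once in either direction, so the increments cancel. -/
theorem AngleInc.commutator {e : ℝ → ℂ} {n : ℝ} {i : ℕ} (hn : 0 < n)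
    (he : ContinuousOn e (Icc ((4 * i + 1) / n) ((4 * i + 5) / n)))
    (h0 : ∀ r ∈ Icc ((4 * i + 1) / n) ((4 * i + 5) / n), e r ≠ 0)
    (hX : ∀ r ∈ Icc (0 : ℝ) 1, e ((4 * i + 1 + r) / n) = e ((4 * i + 4 - r) / n))
    (hY : ∀ r ∈ Icc (0 : ℝ) 1, e ((4 * i + 2 + r) / n) = e ((4 * i + 5 - r) / n)) :
    AngleInc e ((4 * i + 1) / n) ((4 * i + 5) / n) 0 := by
  have le : ∀ {x y : ℝ}, x ≤ y → x / n ≤ y / n := fun h => div_le_div_of_nonneg_right h hn.le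
  have ex : ∀ x y : ℝ, 4 * i + 1 ≤ x → x ≤ y → y ≤ 4 * i + 5 → ∃ r, AngleInc e (x / n) (y / n) r :=
    fun x y h1 h2 h3 => AngleInc.exists (le h2) (he.mono (Icc_subset_Icc (le h1) (le h3)))
      fun r hr => h0 r (Icc_subset_Icc (le h1) (le h3) hr)
  obtain ⟨r₁, h₁⟩ := ex (4 * i + 1) (4 * i + 2) (by linarith) (by linarith) (by linarith)
  obtain ⟨r₂, h₂⟩ := ex (4 * i + 2) (4 * i + 3) (by linarith) (by linarith) (by linarith)
  have h₃ : AngleInc e ((4 * i + 3) / n) ((4 * i + 4) / n) (-r₁) := by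
    -- The reflection `x ↦ (8i+5)/n - x` exchanges the two copies of the edge `x_i`; the one with
    -- `8i+7` below does the same for `y_i`.
    have := h₁.reverse (a' := (4 * i + 3) / n) (b' := (4 * i + 4) / n)
      (g := fun x => (8 * i + 5) / n - x) (by fun_prop) (fun x hx => ?_) (by ring) (by ring)
    · refine this.congr fun x hx => ?_
      have h := hX (4 * i + 4 - x * n) ⟨?_, ?_⟩
      · have e1 : (4 * i + 1 + (4 * i + 4 - x * n)) / n = (8 * i + 5) / n - x := by field_simp; ring
        have e2 : (4 * i + 4 - (4 * i + 4 - x * n)) / n = x := by field_simp; ring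
        rw [e1, e2] at h
        exact h.symm
      · have := (le_div_iff₀ hn).1 hx.2; linarith
      · have := (div_le_iff₀ hn).1 hx.1; linarith
    · have e1 : (4 * i + 1) / n = (8 * i + 5) / n - (4 * i + 4) / n := by ring
      have e2 : (4 * i + 2) / n = (8 * i + 5) / n - (4 * i + 3) / n := by ring
      constructor
      · rw [e1]; linarith [hx.2]
      · rw [e2]; linarith [hx.1]
  have h₄ : AngleInc e ((4 * i + 4) / n) ((4 * i + 5) / n) (-r₂) := by
    have := h₂.reverse (a' := (4 * i + 4) / n) (b' := (4 * i + 5) / n)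
      (g := fun x => (8 * i + 7) / n - x) (by fun_prop) (fun x hx => ?_) (by ring) (by ring)
    · refine this.congr fun x hx => ?_
      have h := hY (4 * i + 5 - x * n) ⟨?_, ?_⟩
      · have e1 : (4 * i + 2 + (4 * i + 5 - x * n)) / n = (8 * i + 7) / n - x := by field_simp; ring
        have e2 : (4 * i + 5 - (4 * i + 5 - x * n)) / n = x := by field_simp; ring
        rw [e1, e2] at h
        exact h.symm
      · have := (le_div_iff₀ hn).1 hx.2; linarith
      · have := (div_le_iff₀ hn).1 hx.1; linarith
    · have e1 : (4 * i + 2) / n = (8 * i + 7) / n - (4 * i + 5) / n := by ring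
      have e2 : (4 * i + 3) / n = (8 * i + 7) / n - (4 * i + 4) / n := by ring
      constructor
      · rw [e1]; linarith [hx.2]
      · rw [e2]; linarith [hx.1]
  have h := ((h₁.trans (le (by linarith)) (le (by linarith)) h₂).trans (le (by linarith))
    (le (by linarith)) h₃).trans (le (by linarith)) (le (by linarith)) h₄
  rwa [show r₁ + r₂ + -r₁ + -r₂ = 0 by ring] at h

/-- The change of the angle of a function on a surface is the same along both boundary circles. -/
theorem AngleInc.surface {g : ℕ} {c : Surface g → ℂ} (hc : Continuous c) (h0 : ∀ z, c z ≠ 0)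
    {R : ℝ} (h : AngleInc (fun r => c (Surface.bdry₀ r)) 0 1 R) :
    AngleInc (fun r => c (Surface.bdry₁ r)) 0 1 R := by
  let pr : ℝ → Icc (0 : ℝ) 1 := projIcc 0 1 zero_le_one
  have hpr0 : pr 0 = 0 := projIcc_left zero_le_one
  have hpr1 : pr 1 = 1 := projIcc_right zero_le_one
  let F : ℝ → ℝ → ℂ := fun r s => c (Quot.mk _ (r, pr s))
  have hF : Continuous fun z : ℝ × ℝ => F z.1 z.2 :=
    hc.comp (continuous_quot_mk.comp (continuous_fst.prodMk (continuous_projIcc.comp continuous_snd)))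
  -- The annulus carries the increment from `∂₀` to the outer circle before gluing. Below, only the
  -- first of its `4g+1` edges contributes, and that edge is `∂₁`.
  have h1 : AngleInc (fun r => F r 1) 0 1 R := by
    refine AngleInc.rect_loops zero_le_one zero_le_one hF.continuousOn (fun _ _ _ _ => h0 _)
      (fun s _ => by simp only [F]; rw [surface_period]) ?_
    simp only [F, hpr0]
    exact h
  let e : ℝ → ℂ := fun r => F r 1
  have he : Continuous e := hF.comp (continuous_id.prodMk continuous_const)
  set n : ℝ := 4 * g + 1 with hn
  have hn0 : 0 < n := by positivity
  obtain ⟨R₁, hR₁⟩ := AngleInc.exists (a := 0) (b := 1 / n) (by positivity) he.continuousOn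
    (fun _ _ => h0 _)
  have key : ∀ i : ℕ, i ≤ g → AngleInc e 0 ((4 * i + 1) / n) R₁ := by
    intro i
    induction i with
    | zero => intro _; simpa using hR₁
    | succ i ih =>
      intro hi
      have h2 := AngleInc.commutator (e := e) hn0 (i := i) he.continuousOn (fun _ _ => h0 _)
        (fun r hr => by
          simp only [e, F, hpr1, hn]
          rw [surface_edgeX (by omega) hr])
        (fun r hr => by
          simp only [e, F, hpr1, hn]
          rw [surface_edgeY (by omega) hr])
      have h3 := (ih (by omega)).trans (by positivity)
        (div_le_div_of_nonneg_right (by linarith) hn0.le) h2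
      rw [add_zero] at h3
      convert h3 using 2
      push_cast
      ring
  have h4 := key g le_rfl
  rw [← hn, div_self hn0.ne'] at h4
  have hR : R = R₁ := h1.unique zero_le_one h4
  rw [hR]
  have h5 := hR₁.comp (a' := 0) (b' := 1) (g := fun r => r / n) (by fun_prop)
    (fun r hr => ⟨div_nonneg hr.1 hn0.le, div_le_div_of_nonneg_right hr.2 hn0.le⟩) (by simp) (by simp)
  refine h5.congr fun r _ => ?_
  simp only [e, F, hpr1]
  rfl

/-! ### Comparison of trivializations over a capping surface -/

theorem continuous_dsum_planeMat {m : ℕ} {Y : Type*} [TopologicalSpace Y] {s : Set Y}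
    {a b c d : Y → ℝ} (ha : ContinuousOn a s) (hb : ContinuousOn b s) (hc : ContinuousOn c s)
    (hd : ContinuousOn d s) :
    ContinuousOn (fun y => dsum (1 : Mat m) (planeMat (a y) (b y) (c y) (d y))) s :=
  continuous_dsum.comp_continuousOn (continuousOn_const.prodMk
    (continuous_planeMat.comp_continuousOn (ha.prodMk (hb.prodMk (hc.prodMk hd)))))

theorem joinedIn_segment {m : ℕ} {a b : ℝ} (hab : 0 < a * b) :
    JoinedIn (Matrix.symplecticGroup (Fin (m + 1)) ℝ : Set (Mat (m + 1)))
      (dsum 1 (planeMat a 0 0 a⁻¹)) (dsum 1 (planeMat b 0 0 b⁻¹)) := by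
  have hne : ∀ u ∈ Icc (0 : ℝ) 1, a + u * (b - a) ≠ 0 := by
    intro u hu h
    have h1 : a * (a + u * (b - a)) = (1 - u) * a ^ 2 + u * (a * b) := by ring
    have ha : 0 < a ^ 2 := pow_two_pos_of_ne_zero (left_ne_zero_of_mul hab.ne')
    rw [h, mul_zero] at h1
    rcases hu.1.eq_or_lt with h0 | h0
    · rw [← h0] at h1; linarith
    · have := mul_pos h0 hab
      have := mul_nonneg (sub_nonneg.2 hu.2) ha.le
      linarith
  refine JoinedIn.ofLine (f := fun u => dsum 1 (planeMat (a + u * (b - a)) 0 0 (a + u * (b - a))⁻¹))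
    ?_ (by simp) (by simp) ?_
  · have h : ContinuousOn (fun u : ℝ => a + u * (b - a)) (Icc 0 1) := by fun_prop
    exact continuous_dsum_planeMat h continuousOn_const continuousOn_const (h.inv₀ hne)
  · rintro _ ⟨u, hu, rfl⟩
    exact dsum_mem (one_mem _) (planeMat_mem (by rw [mul_inv_cancel₀ (hne u hu)]; ring))

/-- For positive `a` scaling suffices; for negative `a` a rotation by `π` of the plane first leads
to `-1`. -/
theorem joinedIn_dsum_diagonal {m : ℕ} {a : ℝ} (ha : a ≠ 0) :
    JoinedIn (Matrix.symplecticGroup (Fin (m + 1)) ℝ : Set (Mat (m + 1)))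
      1 (dsum 1 (planeMat a 0 0 a⁻¹)) := by
  have h1 : (1 : Mat (m + 1)) = dsum 1 (planeMat 1 0 0 1⁻¹) := by
    rw [inv_one, planeMat_one, dsum_one]
  rcases lt_or_gt_of_ne ha with h | h
  · have h2 : JoinedIn (Matrix.symplecticGroup (Fin (m + 1)) ℝ : Set (Mat (m + 1)))
        (dsum 1 (planeMat 1 0 0 1⁻¹)) (dsum 1 (planeMat (-1) 0 0 (-1)⁻¹)) := by
      refine JoinedIn.ofLine (f := fun u => dsum 1 (planeMat (Real.cos (Real.pi * u))
        (-Real.sin (Real.pi * u)) (Real.sin (Real.pi * u)) (Real.cos (Real.pi * u)))) ?_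
        (by simp) (by simp [inv_neg]) ?_
      · exact continuous_dsum_planeMat (by fun_prop) (by fun_prop) (by fun_prop) (by fun_prop)
      · rintro _ ⟨u, -, rfl⟩
        exact dsum_mem (one_mem _) (planeMat_mem (by
          linear_combination Real.cos_sq_add_sin_sq (Real.pi * u)))
    rw [h1]
    exact h2.trans (joinedIn_segment (by linarith))
  · rw [h1]
    exact joinedIn_segment (by linarith)

/-- If a trivialization is homotopic to a split one along one boundary circle of a surface, then its
comparison with a split trivialization on the other end of a cylinder attached to the surface is
null homotopic. -/
theorem angleInc_capping {g m : ℕ} {Dθ Dc : ℝ → ℝ → Mat (m + 1)} {DS : Surface g → Mat (m + 1)}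
    (hθ : Continuous fun z : ℝ × ℝ => Dθ z.1 z.2)
    (hθsp : ∀ r s, Dθ r s ∈ Matrix.symplecticGroup (Fin (m + 1)) ℝ)
    (hθper : ∀ s, Dθ 1 s = Dθ 0 s)
    (hθ1 : ∀ r, ∃ a : ℝ, a ≠ 0 ∧ Dθ r 1 = dsum 1 (planeMat a 0 0 a⁻¹)) (hS : Continuous DS)
    (hSsp : ∀ z, DS z ∈ Matrix.symplecticGroup (Fin (m + 1)) ℝ)
    (hS0 : ∀ r ∈ Icc (0 : ℝ) 1, DS (Surface.bdry₀ r) = Dθ r 0)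
    (hc : ContinuousOn (fun z : ℝ × ℝ => Dc z.1 z.2) (Icc 0 1 ×ˢ Icc 0 1))
    (hcsp : ∀ r ∈ Icc (0 : ℝ) 1, ∀ s ∈ Icc (0 : ℝ) 1,
      Dc r s ∈ Matrix.symplecticGroup (Fin (m + 1)) ℝ)
    (hcper : ∀ s ∈ Icc (0 : ℝ) 1, Dc 1 s = Dc 0 s)
    (hc0 : ∀ r ∈ Icc (0 : ℝ) 1, Dc r 0 = DS (Surface.bdry₁ r)) :
    AngleInc (fun r => complexDet (Dc r 1)) 0 1 0 ∧
      JoinedIn (Matrix.symplecticGroup (Fin (m + 1)) ℝ : Set (Mat (m + 1))) 1 (Dc 0 1) := by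
  have z0 : (0 : ℝ) ∈ Icc (0 : ℝ) 1 := by simp
  constructor
  -- At the split end `complexDet` is a real multiple of a constant, so the degree is zero.
  -- Homotopies of loops carry this over `Dθ`, then across the surface, then along the cylinder.
  · have h1 : AngleInc (fun r => complexDet (Dθ r 1)) 0 1 0 := by
      have hne : complexDet (1 : Mat m) ≠ 0 := complexDet_ne_zero (one_mem _)
      have hcont : Continuous fun r => complexDet (Dθ r 1) / complexDet (1 : Mat m) :=
        (continuous_complexDet.comp (hθ.comp (continuous_id.prodMk continuous_const))).div_const _
      have h2 := AngleInc.of_im_eq_zero (a := 0) (b := 1) hcont.continuousOn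
        (fun r _ => div_ne_zero (complexDet_ne_zero (hθsp r 1)) hne) (fun r _ => by
          obtain ⟨a, -, ha⟩ := hθ1 r
          rw [ha, complexDet_dsum, mul_div_cancel_left₀ _ hne, complexDet_planeMat]
          simp)
      exact (h2.const_mul hne).congr fun r _ => (mul_div_cancel₀ _ hne).symm
    have h2 : AngleInc (fun r => complexDet (Dθ r 0)) 0 1 0 := by
      let F : ℝ → ℝ → ℂ := fun r s => complexDet (Dθ r (1 - s))
      have hF : Continuous fun z : ℝ × ℝ => F z.1 z.2 := continuous_complexDet.comp
        (hθ.comp (continuous_fst.prodMk (continuous_const.sub continuous_snd)))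
      have h3 : AngleInc (fun r => F r 0) 0 1 0 := h1.congr fun r _ => by
        simp only [F, sub_zero]
      have h4 : AngleInc (fun r => F r 1) 0 1 0 :=
        AngleInc.rect_loops zero_le_one zero_le_one hF.continuousOn
          (fun r _ s _ => complexDet_ne_zero (hθsp r _)) (fun s _ => by simp only [F, hθper]) h3
      exact h4.congr fun r _ => by simp only [F, sub_self]
    have h3 := AngleInc.surface (c := fun z => complexDet (DS z)) (continuous_complexDet.comp hS)
      (fun z => complexDet_ne_zero (hSsp z))
      (h2.congr fun r hr => by rw [hS0 r hr])
    let F : ℝ → ℝ → ℂ := fun r s => complexDet (Dc r s)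
    have hF : ContinuousOn (fun z : ℝ × ℝ => F z.1 z.2) (Icc 0 1 ×ˢ Icc 0 1) :=
      continuous_complexDet.comp_continuousOn hc
    have h4 : AngleInc (fun r => F r 0) 0 1 0 := h3.congr fun r hr => by
      simp only [F, hc0 r hr]
    exact AngleInc.rect_loops zero_le_one zero_le_one hF
      (fun r hr s hs => complexDet_ne_zero (hcsp r hr s hs))
      (fun s hs => by simp only [F, hcper s hs]) h4
  -- The same three pieces are traversed along `r = 0`, from the split end to the end of the
  -- cylinder.
  · obtain ⟨a, ha, h0⟩ := hθ1 0
    have h1 := joinedIn_dsum_diagonal (m := m) ha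
    rw [← h0] at h1
    have h2 : JoinedIn (Matrix.symplecticGroup (Fin (m + 1)) ℝ : Set (Mat (m + 1)))
        (Dθ 0 1) (Dθ 0 0) :=
      JoinedIn.ofLine (f := fun u => Dθ 0 (1 - u))
        (hθ.comp (continuous_const.prodMk (continuous_const.sub continuous_id))).continuousOn
        (by simp) (by simp) (by rintro _ ⟨u, -, rfl⟩; exact hθsp _ _)
    have h3 : JoinedIn (Matrix.symplecticGroup (Fin (m + 1)) ℝ : Set (Mat (m + 1)))
        (Dθ 0 0) (Dc 0 0) := by
      rw [← hS0 0 z0, hc0 0 z0, surface_bdry₁_zero]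
      refine JoinedIn.ofLine (f := fun u => DS (Quot.mk _ (0, projIcc 0 1 zero_le_one u)))
        (hS.comp (continuous_quot_mk.comp
          (continuous_const.prodMk continuous_projIcc))).continuousOn ?_ ?_
        (by rintro _ ⟨u, -, rfl⟩; exact hSsp _)
      · rw [projIcc_left]; rfl
      · rw [projIcc_right]; rfl
    have h4 : JoinedIn (Matrix.symplecticGroup (Fin (m + 1)) ℝ : Set (Mat (m + 1)))
        (Dc 0 0) (Dc 0 1) :=
      JoinedIn.ofLine (f := fun u => Dc 0 u)
        (hc.comp (continuousOn_const.prodMk continuousOn_id) fun u hu => ⟨z0, hu⟩)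
        rfl rfl (by rintro _ ⟨u, hu, rfl⟩; exact hcsp 0 z0 u hu)
    exact ((h1.trans h2).trans h3).trans h4

section

variable {m : ℕ} {What M : Type*}
  [TopologicalSpace What] [ChartedSpace (EuclideanSpace ℝ (Fin (2 * m + 2))) What]
  [TopologicalSpace M] [ChartedSpace (EuclideanSpace ℝ (Fin (2 * m + 1))) M]
  {C : SymplecticCompletion m What M} {φlam : ℝ → M → M} {K : C.AdmissibleHamiltonian φlam}

theorem zero_gt : -C.ε < 0 := neg_lt_zero.2 C.ε_pos

theorem mul_t_gt {d : OrbitPerturbation C φlam K} {s : ℝ} (hs : s ∈ Icc (0 : ℝ) 1) :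
    -C.ε < s * d.t :=
  zero_gt.trans_le (mul_nonneg hs.1 d.t_pos.le)

/-! ### Continuity of the comparison of frames -/

theorem continuousOn_dmap {E : Type*} [NormedAddCommGroup E] [NormedSpace ℝ E] {n : ℕ} {X : Type*}
    [TopologicalSpace X] [ChartedSpace (EuclideanSpace ℝ (Fin n)) X] [IsManifold (𝓡 n) ∞ X]
    {f : E → X} {V : Set E} (hV : IsOpen V) (hf : ContMDiffOn 𝓘(ℝ, E) (𝓡 n) ∞ f V) {Y : Type*}
    [TopologicalSpace Y] {s : Set Y} {y : Y → E} (hy : ContinuousOn y s)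
    (hyV : ∀ x ∈ s, y x ∈ V) (v : E) :
    ContinuousOn (fun x => (⟨f (y x), dmap 𝓘(ℝ, E) (𝓡 n) f (y x) v⟩ : TangentBundle (𝓡 n) X)) s := by
  have : IsManifold (𝓡 n) 1 X := IsManifold.of_le (n := ∞) (by simp)
  have hu := hV.uniqueMDiffOn (I := 𝓘(ℝ, E))
  have h1 := hf.continuousOn_tangentMapWithin (by simp) hu
  have h2 : ContinuousOn (fun x => (⟨y x, v⟩ : TangentBundle 𝓘(ℝ, E) E)) s :=
    (tangentBundleModelSpaceHomeomorph 𝓘(ℝ, E)).symm.continuous.comp_continuousOn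
      (hy.prodMk continuousOn_const)
  refine (h1.comp h2 fun x hx => hyV x hx).congr fun x hx => ?_
  rw [Function.comp_apply, tangentMapWithin_eq_tangentMap (hu _ (hyV x hx))
    ((hf.contMDiffAt (hV.mem_nhds (hyV x hx))).mdifferentiableAt (by simp))]
  rfl

variable [IsManifold (𝓡 (2 * m + 2)) ∞ What]

theorem continuousOn_frameRatio {Y : Type*} [TopologicalSpace Y] {s : Set Y} {u : Y → What}
    {A B : Y → Std (m + 1) →ₗ[ℝ] EuclideanSpace ℝ (Fin (2 * m + 2))}
    (hA : ∀ v, ContinuousOn (fun y => (⟨u y, A y v⟩ : TangentBundle (𝓡 (2 * m + 2)) What)) s)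
    (hB : ∀ v, ContinuousOn (fun y => (⟨u y, B y v⟩ : TangentBundle (𝓡 (2 * m + 2)) What)) s) :
    ContinuousOn (fun y => frameRatio (C.formAt (u y)) (B y) (A y)) s := by
  have h : ∀ v w, ContinuousOn (fun y => C.formAt (u y) (A y v) (B y w)) s := fun v w =>
    continuousOn_twoForm C.isSymplectic.smooth (hA v) (hB w)
  refine continuousOn_pi.2 fun i => continuousOn_pi.2 fun j => ?_
  rcases i with i | i
  · exact h _ _
  · exact (h _ _).neg

theorem OrbitPerturbation.continuousOn_kd {d : OrbitPerturbation C φlam K} {Y : Type*}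
    [TopologicalSpace Y] {s : Set Y} {y : Y → Std (m + 1)} (hy : ContinuousOn y s)
    (hV : ∀ x ∈ s, y x ∈ d.V) (v : Std (m + 1)) :
    ContinuousOn (fun x => (⟨d.κ (y x), d.kd (y x) v⟩ : TangentBundle (𝓡 (2 * m + 2)) What)) s :=
  continuousOn_dmap d.V_isOpen d.κ_smooth hy hV v

/-- The vector part of a point of the tangent bundle, in the model space. -/
def fiberVal {n : ℕ} {X : Type*} [TopologicalSpace X] [ChartedSpace (EuclideanSpace ℝ (Fin n)) X]
    (x : TangentBundle (𝓡 n) X) : EuclideanSpace ℝ (Fin n) := x.2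

namespace CappingData

variable [IsManifold (𝓡 (2 * m + 1)) ∞ M] {d : OrbitPerturbation C φlam K} (c : CappingData d)

/-! ### The frames of the capping data, on the model spaces -/

/-- The frame `Φ_b`. -/
def bFrame (r : ℝ) : Std m →ₗ[ℝ] EuclideanSpace ℝ (Fin (2 * m + 1)) := c.Φb.map r

/-- The frame `Φ_γ`. -/
def γFrame (z : Surface c.g) : Std m →ₗ[ℝ] EuclideanSpace ℝ (Fin (2 * m + 1)) := c.Φγ.map z

/-- The homotopy `Θ` of frames. -/
def θFrame (r s : ℝ) : Std (m + 1) →ₗ[ℝ] EuclideanSpace ℝ (Fin (2 * m + 2)) :=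
  c.Θ.map (r, projIcc 0 1 zero_le_one s)

/-- The frame of `TŴ` over the surface. -/
def sFrame (z : Surface c.g) : Std (m + 1) →ₗ[ℝ] EuclideanSpace ℝ (Fin (2 * m + 2)) := c.ΦS.map z

/-- The frame of `TŴ` over the cylinder. -/
def cylFrame (r s : ℝ) : Std (m + 1) →ₗ[ℝ] EuclideanSpace ℝ (Fin (2 * m + 2)) :=
  c.Φcyl.map (r, projIcc 0 1 zero_le_one s)

theorem isSymplecticMap_bFrame (r : ℝ) : IsSymplecticMap (C.dlam (c.lb r)) (c.bFrame r) :=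
  fun v w => c.Φb.symplectic r v w

theorem isSymplecticMap_γFrame (z : Surface c.g) : IsSymplecticMap (C.dlam (c.σ z)) (c.γFrame z) :=
  fun v w => c.Φγ.symplectic z v w

theorem isSymplecticMap_θFrame (r s : ℝ) :
    IsSymplecticMap (C.formAt (C.G (c.lb r, 0))) (c.θFrame r s) :=
  fun v w => c.Θ.symplectic (r, projIcc 0 1 zero_le_one s) v w

theorem isSymplecticMap_sFrame (z : Surface c.g) :
    IsSymplecticMap (C.formAt (C.G (c.σ z, 0))) (c.sFrame z) := fun v w => c.ΦS.symplectic z v w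

theorem isSymplecticMap_cylFrame (r : ℝ) {s : ℝ} (hs : s ∈ Icc (0 : ℝ) 1) :
    IsSymplecticMap (C.formAt (C.G (φlam (d.T * r) d.p, s * d.t))) (c.cylFrame r s) := by
  have h : IsSymplecticMap (C.formAt (C.G (φlam (d.T * r) d.p,
      (projIcc 0 1 zero_le_one s : Icc (0 : ℝ) 1) * d.t))) (c.cylFrame r s) :=
    fun v w => c.Φcyl.symplectic (r, projIcc 0 1 zero_le_one s) v w
  rwa [projIcc_of_mem _ hs] at h

theorem lamAt_bFrame (r : ℝ) (v : Std m) : C.lamAt (c.lb r) (c.bFrame r v) = 0 := c.Φb_mem r v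

theorem lamAt_γFrame (z : Surface c.g) (v : Std m) : C.lamAt (c.σ z) (c.γFrame z v) = 0 :=
  c.Φγ_mem z v

theorem lb_add_one (r : ℝ) : c.lb (r + 1) = c.lb r :=
  congrArg Bundle.TotalSpace.proj (c.Φb_periodic r 0)

theorem bFrame_add_one (r : ℝ) : c.bFrame (r + 1) = c.bFrame r :=
  LinearMap.ext fun v => congrArg fiberVal (c.Φb_periodic r v)

theorem θFrame_add_one (r s : ℝ) : c.θFrame (r + 1) s = c.θFrame r s :=
  LinearMap.ext fun v => congrArg fiberVal (c.Θ_periodic r (projIcc 0 1 zero_le_one s) v)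

theorem cylFrame_add_one (r s : ℝ) : c.cylFrame (r + 1) s = c.cylFrame r s :=
  LinearMap.ext fun v => congrArg fiberVal (c.Φcyl_periodic r (projIcc 0 1 zero_le_one s) v)

theorem γFrame_start {r : ℝ} (hr : r ∈ Icc (0 : ℝ) 1) : c.γFrame (Surface.bdry₀ r) = c.bFrame r :=
  LinearMap.ext fun v => congrArg fiberVal (c.Φγ_start r hr v)

theorem sFrame_start {r : ℝ} (hr : r ∈ Icc (0 : ℝ) 1) : c.sFrame (Surface.bdry₀ r) = c.θFrame r 0 := by
  refine LinearMap.ext fun v => ?_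
  have h1 := congrArg fiberVal ((c.ΦS_start r hr v).trans (c.Θ_start r v).symm)
  rw [θFrame, projIcc_left]
  exact h1

theorem cylFrame_start {r : ℝ} (hr : r ∈ Icc (0 : ℝ) 1) :
    c.cylFrame r 0 = c.sFrame (Surface.bdry₁ r) := by
  refine LinearMap.ext fun v => ?_
  rw [cylFrame, projIcc_left]
  exact congrArg fiberVal (c.Φcyl_start r hr v)

/-! ### Comparison with the split frames -/

/-- The homotopy `Θ`, compared with the split frame. -/
def θRatio (r s : ℝ) : Mat (m + 1) :=
  frameRatio (C.formAt (C.G (c.lb r, 0))) (C.splitFrame (c.lb r) 0 (c.bFrame r)) (c.θFrame r s)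

/-- The frame over the surface, compared with the split frame. -/
def sRatio (z : Surface c.g) : Mat (m + 1) :=
  frameRatio (C.formAt (C.G (c.σ z, 0))) (C.splitFrame (c.σ z) 0 (c.γFrame z)) (c.sFrame z)

/-- The frame over the cylinder, compared with the split frame. -/
def cylRatio (r s : ℝ) : Mat (m + 1) :=
  frameRatio (C.formAt (C.G (φlam (d.T * r) d.p, s * d.t)))
    (C.splitFrame (φlam (d.T * r) d.p) (s * d.t) (c.γFrame (Surface.bdry₁ r))) (c.cylFrame r s)

theorem isSymplecticMap_splitFrame_γ {r : ℝ} (hr : r ∈ Icc (0 : ℝ) 1) {t : ℝ} (ht : -C.ε < t) :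
    IsSymplecticMap (C.formAt (C.G (φlam (d.T * r) d.p, t)))
      (C.splitFrame (φlam (d.T * r) d.p) t (c.γFrame (Surface.bdry₁ r))) := by
  rw [← c.σ_end r hr]
  exact C.isSymplecticMap_splitFrame _ ht (c.isSymplecticMap_γFrame _) (c.lamAt_γFrame _)

theorem θRatio_mem (r s : ℝ) : c.θRatio r s ∈ Matrix.symplecticGroup (Fin (m + 1)) ℝ := by
  have h := C.isSymplecticMap_splitFrame (c.lb r) zero_gt (c.isSymplecticMap_bFrame r)
    (c.lamAt_bFrame r)
  exact h.frameRatio_mem (h.surjective finrank_model) (c.isSymplecticMap_θFrame r s)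

theorem sRatio_mem (z : Surface c.g) : c.sRatio z ∈ Matrix.symplecticGroup (Fin (m + 1)) ℝ := by
  have h := C.isSymplecticMap_splitFrame (c.σ z) zero_gt (c.isSymplecticMap_γFrame z)
    (c.lamAt_γFrame z)
  exact h.frameRatio_mem (h.surjective finrank_model) (c.isSymplecticMap_sFrame z)

theorem cylRatio_mem {r s : ℝ} (hr : r ∈ Icc (0 : ℝ) 1) (hs : s ∈ Icc (0 : ℝ) 1) :
    c.cylRatio r s ∈ Matrix.symplecticGroup (Fin (m + 1)) ℝ := by
  have h := c.isSymplecticMap_splitFrame_γ hr (mul_t_gt (d := d) hs)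
  exact h.frameRatio_mem (h.surjective finrank_model) (c.isSymplecticMap_cylFrame r hs)

theorem θRatio_one (s : ℝ) : c.θRatio 1 s = c.θRatio 0 s := by
  have h1 := c.lb_add_one 0
  have h2 := c.bFrame_add_one 0
  have h3 := c.θFrame_add_one 0 s
  rw [zero_add] at h1 h2 h3
  rw [θRatio, θRatio, h1, h2, h3]

theorem sRatio_start {r : ℝ} (hr : r ∈ Icc (0 : ℝ) 1) :
    c.sRatio (Surface.bdry₀ r) = c.θRatio r 0 := by
  rw [sRatio, θRatio, c.σ_start r hr, c.γFrame_start hr, c.sFrame_start hr]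

theorem cylRatio_start {r : ℝ} (hr : r ∈ Icc (0 : ℝ) 1) :
    c.cylRatio r 0 = c.sRatio (Surface.bdry₁ r) := by
  rw [cylRatio, sRatio, zero_mul, c.σ_end r hr, c.cylFrame_start hr]

theorem cylRatio_one (hlam : IsFlow (fun _ => C.reeb) φlam) (s : ℝ) :
    c.cylRatio 1 s = c.cylRatio 0 s := by
  have h3 := c.cylFrame_add_one 0 s
  rw [zero_add] at h3
  rw [cylRatio, cylRatio, mul_one, mul_zero, d.closed, hlam.zero, surface_bdry₁_one, h3]

theorem continuous_lb : Continuous c.lb :=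
  (FiberBundle.continuous_proj (EuclideanSpace ℝ (Fin (2 * m + 1)))
    (TangentSpace (𝓡 (2 * m + 1)))).comp (c.Φb.continuous_map 0)

theorem continuous_σ : Continuous c.σ :=
  (FiberBundle.continuous_proj (EuclideanSpace ℝ (Fin (2 * m + 1)))
    (TangentSpace (𝓡 (2 * m + 1)))).comp (c.Φγ.continuous_map 0)

theorem continuous_θRatio (hlam : IsFlow (fun _ => C.reeb) φlam) :
    Continuous fun z : ℝ × ℝ => c.θRatio z.1 z.2 := by
  rw [← continuousOn_univ]
  refine continuousOn_frameRatio (fun v => ?_) fun v => ?_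
  · have h : Continuous fun z : ℝ × ℝ => (z.1, projIcc (0 : ℝ) 1 zero_le_one z.2) :=
      continuous_fst.prodMk (continuous_projIcc.comp continuous_snd)
    exact ((c.Θ.continuous_map v).comp h).continuousOn
  · exact C.continuousOn_splitFrame hlam (u := fun z : ℝ × ℝ => c.lb z.1) (τ := fun _ => 0)
      (Φ := fun z => c.bFrame z.1) (c.continuous_lb.comp continuous_fst).continuousOn
      (fun v => ((c.Φb.continuous_map v).comp continuous_fst).continuousOn) continuousOn_const
      (fun _ _ => zero_gt) v

theorem continuous_sRatio (hlam : IsFlow (fun _ => C.reeb) φlam) : Continuous c.sRatio := by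
  rw [← continuousOn_univ]
  refine continuousOn_frameRatio (fun v => (c.ΦS.continuous_map v).continuousOn) fun v => ?_
  exact C.continuousOn_splitFrame hlam (u := c.σ) (τ := fun _ => 0)
      (Φ := fun z => c.γFrame z) c.continuous_σ.continuousOn
      (fun v => (c.Φγ.continuous_map v).continuousOn) continuousOn_const (fun _ _ => zero_gt) v

theorem continuousOn_splitFrame_γ (hlam : IsFlow (fun _ => C.reeb) φlam) {Y : Type*}
    [TopologicalSpace Y] {s : Set Y} {r τ : Y → ℝ} (hr : ContinuousOn r s)
    (hr' : ∀ y ∈ s, r y ∈ Icc (0 : ℝ) 1) (hτ : ContinuousOn τ s) (hτ' : ∀ y ∈ s, -C.ε < τ y)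
    (v : Std (m + 1)) :
    ContinuousOn (fun y => (⟨C.G (φlam (d.T * r y) d.p, τ y),
      C.splitFrame (φlam (d.T * r y) d.p) (τ y) (c.γFrame (Surface.bdry₁ (r y))) v⟩ :
        TangentBundle (𝓡 (2 * m + 2)) What)) s := by
  have h := C.continuousOn_splitFrame hlam (u := fun y => c.σ (Surface.bdry₁ (r y))) (τ := τ)
    (Φ := fun y => c.γFrame (Surface.bdry₁ (r y)))
    ((c.continuous_σ.comp continuous_bdry₁).comp_continuousOn hr)
    (fun v => ((c.Φγ.continuous_map v).comp continuous_bdry₁).comp_continuousOn hr) hτ hτ' v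
  refine h.congr fun y hy => ?_
  beta_reduce
  rw [c.σ_end _ (hr' y hy)]

theorem continuousOn_cylRatio (hlam : IsFlow (fun _ => C.reeb) φlam) :
    ContinuousOn (fun z : ℝ × ℝ => c.cylRatio z.1 z.2) (Icc 0 1 ×ˢ Icc 0 1) := by
  refine continuousOn_frameRatio (fun v => ?_) fun v => ?_
  · have h : Continuous fun z : ℝ × ℝ => (z.1, projIcc (0 : ℝ) 1 zero_le_one z.2) :=
      continuous_fst.prodMk (continuous_projIcc.comp continuous_snd)
    refine ((c.Φcyl.continuous_map v).comp h).continuousOn.congr fun z hz => ?_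
    have h1 : ((projIcc 0 1 zero_le_one z.2 : Icc (0 : ℝ) 1) : ℝ) = z.2 := by
      rw [projIcc_of_mem _ hz.2]
    have h2 : ∀ x : ℝ, x = z.2 →
        (⟨C.G (φlam (d.T * z.1) d.p, z.2 * d.t), c.cylFrame z.1 z.2 v⟩ :
          TangentBundle (𝓡 (2 * m + 2)) What) =
        ⟨C.G (φlam (d.T * z.1) d.p, x * d.t), c.cylFrame z.1 z.2 v⟩ := by
      rintro x rfl; rfl
    exact h2 _ h1
  · exact c.continuousOn_splitFrame_γ hlam continuousOn_fst (fun z hz => hz.1)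
      (continuousOn_snd.mul continuousOn_const) (fun z hz => mul_t_gt hz.2) v

theorem eq_inclStd_add (v : Std (m + 1)) : v = inclStd (projStd v) +
    v (Sum.inl (Fin.last m)) • Pi.single (Sum.inl (Fin.last m)) 1 +
    v (Sum.inr (Fin.last m)) • Pi.single (Sum.inr (Fin.last m)) 1 := by
  ext (i | i) <;> refine Fin.lastCases ?_ (fun j => ?_) i <;>
    simp [inclStd, projStd, Fin.castSucc_ne_last]

/-- At the end of the homotopy the frame agrees with the split one on `ξ` and rescales `∂_t` and
`R_λ`; being symplectic, it does so by reciprocal factors. -/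
theorem exists_θRatio_eq (r : ℝ) :
    ∃ a : ℝ, a ≠ 0 ∧ c.θRatio r 1 = dsum 1 (planeMat a 0 0 a⁻¹) := by
  obtain ⟨a, ha⟩ := c.Θ_liouville r
  obtain ⟨b, hb⟩ := c.Θ_reeb r
  have ha' : c.θFrame r 1 (Pi.single (Sum.inl (Fin.last m)) 1) =
      a • C.pushAt (c.lb r) 0 (0, 1) := by
    rw [θFrame, projIcc_right]; exact ha
  have hb' : c.θFrame r 1 (Pi.single (Sum.inr (Fin.last m)) 1) =
      b • C.pushAt (c.lb r) 0 (C.reebAt (c.lb r), 0) := by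
    rw [θFrame, projIcc_right]; exact hb
  have hx : ∀ v, c.θFrame r 1 (inclStd v) = C.pushAt (c.lb r) 0 (c.bFrame r v, 0) := by
    intro v
    rw [θFrame, projIcc_right]; exact c.Θ_xi r v
  have hab : a * b = 1 := by
    have h := c.isSymplecticMap_θFrame r 1 (Pi.single (Sum.inl (Fin.last m)) 1)
      (Pi.single (Sum.inr (Fin.last m)) 1)
    rw [ha', hb', map_smul, map_smul, LinearMap.smul_apply, C.formAt_pushAt _ zero_gt,
      stdForm_single_inl] at h
    simpa [C.lamAt_reebAt, mul_comm] using h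
  have ha0 : a ≠ 0 := left_ne_zero_of_mul (hab.symm ▸ one_ne_zero)
  have hb0 : b = a⁻¹ := eq_inv_of_mul_eq_one_right hab
  refine ⟨a, ha0, ?_⟩
  have hs := C.isSymplecticMap_splitFrame (c.lb r) zero_gt (c.isSymplecticMap_bFrame r)
    (c.lamAt_bFrame r)
  refine (hs.eq_frameRatio fun v => ?_).symm
  conv_rhs => rw [eq_inclStd_add v]
  rw [map_add, map_add, map_smul, map_smul, ha', hb', hx, C.splitFrame_apply, projStd_dsum_mulVec,
    dsum_planeMat_mulVec_inl, dsum_planeMat_mulVec_inr, Matrix.one_mulVec, hb0,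
    show Real.exp (-0 / 2) = 1 by simp, one_smul]
  refine Eq.trans (congrArg _ (a₂ := ((c.bFrame r (projStd v), 0) +
    v (Sum.inl (Fin.last m)) • a • (0, 1) +
      v (Sum.inr (Fin.last m)) • a⁻¹ • (C.reebAt (c.lb r), 0))) ?_) ?_
  · simp [mul_comm, smul_smul]
  · simp only [map_add, map_smul]

/-- The frame over the end of the cylinder is homotopic to the split frame. -/
theorem angleInc_cylRatio (hlam : IsFlow (fun _ => C.reeb) φlam) :
    AngleInc (fun r => complexDet (c.cylRatio r 1)) 0 1 0 ∧
      JoinedIn (Matrix.symplecticGroup (Fin (m + 1)) ℝ : Set (Mat (m + 1))) 1 (c.cylRatio 0 1) :=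
  angleInc_capping (c.continuous_θRatio hlam) c.θRatio_mem c.θRatio_one c.exists_θRatio_eq
    (c.continuous_sRatio hlam) c.sRatio_mem (fun _ hr => c.sRatio_start hr)
    (c.continuousOn_cylRatio hlam) (fun _ hr _ hs => c.cylRatio_mem hr hs)
    (fun s _ => c.cylRatio_one hlam s) fun _ hr => c.cylRatio_start hr

end CappingData

end

/-! ### The frames in symplectic coordinates, and the index of the orbit -/

section

variable {m : ℕ} {What M : Type*}
  [TopologicalSpace What] [ChartedSpace (EuclideanSpace ℝ (Fin (2 * m + 2))) What]
  [TopologicalSpace M] [ChartedSpace (EuclideanSpace ℝ (Fin (2 * m + 1))) M]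
  {C : SymplecticCompletion m What M} {φlam : ℝ → M → M} {K : C.AdmissibleHamiltonian φlam}
  {d : OrbitPerturbation C φlam K}

theorem OrbitPerturbation.κ_neg (r : ℝ) : d.κ ((d.l * (-r)) • e₁ m) = C.G (φlam (d.T * r) d.p, d.t) := by
  rw [d.κ_circle, mul_neg, neg_neg]

variable [IsManifold (𝓡 (2 * m + 2)) ∞ What] [IsManifold (𝓡 (2 * m + 1)) ∞ M]
  (c : CappingData d)

namespace CappingData

open OrbitPerturbation

/-- The frame over the end of the cylinder, in the symplectic coordinates. -/
def coordFrame (θ : ℝ) : Mat (m + 1) :=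
  frameRatio (C.formAt (d.κ ((d.l * θ) • e₁ m))) (d.kd ((d.l * θ) • e₁ m)).toLinearMap
    (c.cylFrame (-θ) 1)

/-- The split frame over the end of the cylinder, in the symplectic coordinates. -/
def coordSplit (r : ℝ) : Mat (m + 1) :=
  frameRatio (C.formAt (d.κ ((d.l * (-r)) • e₁ m))) (d.kd ((d.l * (-r)) • e₁ m)).toLinearMap
    (C.splitFrame (φlam (d.T * r) d.p) d.t (c.γFrame (Surface.bdry₁ r)))

theorem isSymplecticMap_cyl (θ : ℝ) :
    IsSymplecticMap (C.formAt (d.κ ((d.l * θ) • e₁ m))) (c.cylFrame (-θ) 1) := by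
  have h := c.isSymplecticMap_cylFrame (-θ) (right_mem_Icc.2 zero_le_one)
  rwa [one_mul, mul_neg, ← d.κ_circle] at h

theorem isSymplecticMap_split {r : ℝ} (hr : r ∈ Icc (0 : ℝ) 1) :
    IsSymplecticMap (C.formAt (d.κ ((d.l * (-r)) • e₁ m)))
      (C.splitFrame (φlam (d.T * r) d.p) d.t (c.γFrame (Surface.bdry₁ r))) := by
  rw [κ_neg]
  exact c.isSymplecticMap_splitFrame_γ hr t_gt

theorem coordFrame_mem (θ : ℝ) : c.coordFrame θ ∈ Matrix.symplecticGroup (Fin (m + 1)) ℝ :=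
  (isSymplecticMap_kd (d.V_circle _)).frameRatio_mem (surjective_kd (d.V_circle _))
    (c.isSymplecticMap_cyl θ)

theorem coordSplit_mem {r : ℝ} (hr : r ∈ Icc (0 : ℝ) 1) :
    c.coordSplit r ∈ Matrix.symplecticGroup (Fin (m + 1)) ℝ :=
  (isSymplecticMap_kd (d.V_circle _)).frameRatio_mem (surjective_kd (d.V_circle _))
    (c.isSymplecticMap_split hr)

theorem coordFrame_add_one (θ : ℝ) : c.coordFrame (θ + 1) = c.coordFrame θ := by
  have h1 := c.cylFrame_add_one (-(θ + 1)) 1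
  rw [show -(θ + 1) + 1 = -θ by ring] at h1
  have h2 : ((d.l : ℝ) * (θ + 1)) • e₁ m = (d.l * θ) • e₁ m + (d.l : ℝ) • e₁ m := by
    rw [← add_smul, mul_add, mul_one]
  rw [coordFrame, coordFrame, h1, h2, κ_add_nat (d.V_circle _), kd_add_nat (d.V_circle _)]

theorem coordSplit_one (hlam : IsFlow (fun _ => C.reeb) φlam) : c.coordSplit 1 = c.coordSplit 0 := by
  have h2 : ((d.l : ℝ) * (-0)) • e₁ m = (d.l * (-1 : ℝ)) • e₁ m + (d.l : ℝ) • e₁ m := by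
    rw [← add_smul]; congr 1; ring
  rw [coordSplit, coordSplit, h2, κ_add_nat (d.V_circle _), kd_add_nat (d.V_circle _), mul_one,
    mul_zero, d.closed, hlam.zero, surface_bdry₁_one]

theorem continuous_coordFrame : Continuous c.coordFrame := by
  rw [← continuousOn_univ]
  refine continuousOn_frameRatio (fun v => ?_) fun v => ?_
  · have h := (c.Φcyl.continuous_map v).comp
      (continuous_neg.prodMk (continuous_const (y := (projIcc (0 : ℝ) 1 zero_le_one 1))))
    refine h.continuousOn.congr fun θ _ => ?_
    have h1 : C.G (φlam (d.T * (-θ)) d.p, ((projIcc (0 : ℝ) 1 zero_le_one 1 : Icc (0 : ℝ) 1) : ℝ) *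
        d.t) = d.κ ((d.l * θ) • e₁ m) := by
      rw [projIcc_right, d.κ_circle, mul_neg]
      simp
    have h2 : ∀ x, x = d.κ ((d.l * θ) • e₁ m) →
        (⟨d.κ ((d.l * θ) • e₁ m), c.cylFrame (-θ) 1 v⟩ : TangentBundle (𝓡 (2 * m + 2)) What) =
        ⟨x, c.cylFrame (-θ) 1 v⟩ := by
      rintro x rfl; rfl
    exact h2 _ h1
  · exact continuousOn_kd (y := fun θ : ℝ => (d.l * θ) • e₁ m) (by fun_prop)
      (fun θ _ => d.V_circle _) v

theorem continuousOn_coordSplit (hlam : IsFlow (fun _ => C.reeb) φlam) :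
    ContinuousOn c.coordSplit (Icc 0 1) := by
  refine continuousOn_frameRatio (fun v => ?_) fun v => ?_
  · have h := c.continuousOn_splitFrame_γ hlam (s := Icc (0 : ℝ) 1) continuousOn_id
      (fun _ h => h) (continuousOn_const (c := d.t)) (fun _ _ => t_gt) v
    refine h.congr fun r _ => ?_
    beta_reduce
    rw [κ_neg]
    rfl
  · exact continuousOn_kd (y := fun r : ℝ => (d.l * (-r)) • e₁ m) (by fun_prop)
      (fun θ _ => d.V_circle _) v

/-- The comparison of the two frames does not depend on the coordinates, so the degree computed over
the capping surface applies here. -/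
theorem sinv_coordSplit_mul {r : ℝ} (hr : r ∈ Icc (0 : ℝ) 1) :
    sinv (c.coordSplit r) * c.coordFrame (-r) = c.cylRatio r 1 := by
  have hk := isSymplecticMap_kd (d.V_circle (d.l * (-r)))
  have hks := surjective_kd (d.V_circle (d.l * (-r)))
  have hs := c.isSymplecticMap_split hr
  have hss := hs.surjective finrank_model
  rw [coordSplit, hk.sinv_frameRatio hks hs hss, coordFrame, hs.frameRatio_mul hss hk hks, neg_neg,
    cylRatio, one_mul, κ_neg]

/-- The frame `Φ_γ` spans the contact distribution. -/
theorem mem_range_γFrame (z : Surface c.g) {w : EuclideanSpace ℝ (Fin (2 * m + 1))}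
    (hw : C.lamAt (c.σ z) w = 0) : ∃ v, c.γFrame z v = w := by
  have hs := C.isSymplecticMap_splitFrame (c.σ z) zero_gt (c.isSymplecticMap_γFrame z)
    (c.lamAt_γFrame z)
  obtain ⟨v, hv⟩ := hs.surjective finrank_model (C.pushAt (c.σ z) 0 (w, 0))
  rw [C.splitFrame_apply, show Real.exp (-0 / 2) = 1 by simp, one_smul] at hv
  have h1 := congrArg Prod.fst (C.pushAt_injective _ zero_gt hv)
  simp only at h1
  have h2 := congrArg (C.lamAt (c.σ z)) h1
  rw [map_add, map_smul, c.lamAt_γFrame, C.lamAt_reebAt, hw, zero_add, smul_eq_mul, mul_one] at h2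
  exact ⟨projStd v, by rw [← h1, h2, zero_smul, add_zero]⟩

theorem σ_bdry₁_zero (hlam : IsFlow (fun _ => C.reeb) φlam) : c.σ (Surface.bdry₁ 0) = d.p := by
  rw [c.σ_end 0 (by simp), mul_zero, hlam.zero]

/-- `reebPath` is defined through `invFun`, which inverts the frame only on its range. The
linearized Reeb flow lands there because it preserves `λ` and the frame spans `ξ`. -/
theorem γFrame_reebPath (hlam : IsFlow (fun _ => C.reeb) φlam) {s : ℝ} (hs : s ∈ Icc (0 : ℝ) 1)
    (v : Std m) : c.γFrame (Surface.bdry₁ s) ((c.reebPath s).mulVec v) =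
      flowD m φlam (d.T * s) d.p (c.γFrame (Surface.bdry₁ 0) v) := by
  have hγ := c.isSymplecticMap_γFrame (Surface.bdry₁ s)
  have hr : ∀ v, ∃ w, c.γFrame (Surface.bdry₁ s) w =
      flowD m φlam (d.T * s) d.p (c.γFrame (Surface.bdry₁ 0) v) := by
    intro v
    refine c.mem_range_γFrame _ ?_
    have h1 := lamAt_flowD (d := d) hlam (-s) (c.γFrame (Surface.bdry₁ 0) v)
    have h2 := c.lamAt_γFrame (Surface.bdry₁ 0) v
    rw [c.σ_bdry₁_zero hlam] at h2
    rw [mul_neg, neg_neg, h2] at h1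
    rw [c.σ_end s hs, h1]
  have h1 : c.reebPath s = frameRatio (C.dlam (c.σ (Surface.bdry₁ s))) (c.γFrame (Surface.bdry₁ s))
      ((flowD m φlam (d.T * s) d.p).toLinearMap ∘ₗ c.γFrame (Surface.bdry₁ 0)) :=
    hγ.transportMatrix_eq (L := (flowD m φlam (d.T * s) d.p).toLinearMap)
      (A := c.γFrame (Surface.bdry₁ 0)) hr
  obtain ⟨w, hw⟩ := hr v
  rw [h1, frameRatio_mulVec, LinearMap.comp_apply, ContinuousLinearMap.coe_coe, ← hw,
    hγ.frameCoord_map]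

/-- In the split frame the flow at time `-s` is block diagonal. It acts by the Reeb path on `ξ`,
fixes `R_λ`, and sends `∂_t` to `∂_t` plus `s` times the shear rate times `R_λ`. -/
theorem Zmat_neg (hlam : IsFlow (fun _ => C.reeb) φlam) {s : ℝ} (hs : s ∈ Icc (0 : ℝ) 1) :
    d.Zmat (-s) = c.coordSplit s * dsum (c.reebPath s) (planeMat 1 0 (d.shearRate * s) 1) *
      sinv (c.coordSplit 0) := by
  have z0 : (0 : ℝ) ∈ Icc (0 : ℝ) 1 := by simp
  have hk := isSymplecticMap_kd (d.V_circle (d.l * (-s)))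
  have hks := surjective_kd (d.V_circle (d.l * (-s)))
  have h : d.Zmat (-s) * c.coordSplit 0 =
      c.coordSplit s * dsum (c.reebPath s) (planeMat 1 0 (d.shearRate * s) 1) := by
    refine Matrix.ext_of_mulVec_single fun i => ?_
    set v : Std (m + 1) := Pi.single i 1
    rw [← Matrix.mulVec_mulVec, ← Matrix.mulVec_mulVec]
    apply injective_kd (d.V_circle (d.l * (-s)))
    have h0 : d.kd ((0 : ℝ) • e₁ m) ((c.coordSplit 0).mulVec v) =
        C.splitFrame d.p d.t (c.γFrame (Surface.bdry₁ 0)) v := by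
      have h1 := (isSymplecticMap_kd (d.V_circle (d.l * (-0)))).map_frameRatio
        (surjective_kd (d.V_circle (d.l * (-0))))
        (A := C.splitFrame (φlam (d.T * 0) d.p) d.t (c.γFrame (Surface.bdry₁ 0))) v
      rw [show (d.l : ℝ) * (-0) = 0 by ring, mul_zero, hlam.zero] at h1
      rw [coordSplit, show (d.l : ℝ) * (-0) = 0 by ring, mul_zero, hlam.zero]
      exact h1
    have hT : -(d.T * -s) = d.T * s := by ring
    have hR := flowD_reebAt (d := d) hlam (-s)
    rw [hT] at hR
    have hL := kd_Zmat (d := d) (-s) ((c.coordSplit 0).mulVec v)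
    rw [h0, C.splitFrame_apply, ← map_smul, pushInv_pushAt, map_smul, linFlow_apply, hT] at hL
    refine hL.trans ((hk.map_frameRatio hks (A := C.splitFrame (φlam (d.T * s) d.p) d.t
      (c.γFrame (Surface.bdry₁ s))) _).trans ?_).symm
    rw [C.splitFrame_apply, projStd_dsum_mulVec, dsum_planeMat_mulVec_inl,
      dsum_planeMat_mulVec_inr, c.γFrame_reebPath hlam hs]
    refine congrArg _ (congrArg _ (Prod.ext ?_ ?_))
    · simp only [map_add, map_smul, hR]
      module
    · simp
  rw [← h, mul_assoc, mul_sinv_self (c.coordSplit_mem z0), mul_one]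

/-- So the shear in the direction `eta` acts only on the plane of `∂_t` and `R_λ` in the split
frame. -/
theorem coordSplit_zero_mulVec_eLast (hlam : IsFlow (fun _ => C.reeb) φlam) :
    (c.coordSplit 0).mulVec (eLast m) = d.eta := by
  rw [coordSplit, frameRatio_mulVec, C.splitFrame_apply, eta,
    show (d.l : ℝ) * (-0) = 0 by ring, mul_zero, hlam.zero]
  have h1 : projStd (eLast m) = 0 := by
    ext (i | i) <;> simp [projStd, eLast, Fin.castSucc_ne_last]
  have h2 : eLast m (Sum.inr (Fin.last m)) = 0 := by simp [eLast]
  have h3 : eLast m (Sum.inl (Fin.last m)) = 1 := by simp [eLast]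
  rw [h1, h2, h3, map_zero, zero_add]
  simp only [zero_smul]

/-- The orbit starting at `q` is `γ_H` shifted in time by `q/ℓ`, so the frame and the unperturbed
flow are those of `γ_H` with the base point moved to `q/ℓ`. -/
theorem orbitPath_eq (hlam : IsFlow (fun _ => C.reeb) φlam) {φ : ℝ → What → What} {q : ℝ} (θ : ℝ) :
    c.orbitPath φ q θ = framedPath c.coordFrame d.Zmat (d.Nmat φ q) (q / d.l) θ := by
  set a := q / d.l with ha
  have hal : (d.l : ℝ) * a = q := mul_div_cancel₀ _ l_ne_zero
  rw [framedPath, ha, Zmat_mul_Nmat hlam, ← ha]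
  have hA := c.isSymplecticMap_cyl (θ + a)
  have hAs := hA.surjective finrank_model
  have hk := isSymplecticMap_kd (d.V_circle (d.l * (θ + a)))
  have hks := surjective_kd (d.V_circle (d.l * (θ + a)))
  have hpr : c.cylFrame (-(θ + a)) 1 = c.orbitFrame q θ := by
    rw [cylFrame, projIcc_right]; rfl
  have hpr0 : c.cylFrame (-a) 1 = c.orbitFrame q 0 := by
    rw [cylFrame, projIcc_right, orbitFrame, zero_add]; rfl
  have h1 : c.orbitPath φ q θ = frameRatio (C.formAt (d.κ ((d.l * (θ + a)) • e₁ m)))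
      (c.cylFrame (-(θ + a)) 1)
      ((dmap (𝓡 (2 * m + 2)) (𝓡 (2 * m + 2)) (φ θ) (d.orbit q 0)).toLinearMap ∘ₗ
        c.cylFrame (-a) 1) := by
    rw [← hA.transportMatrix_eq (fun v => hAs _), hpr, hpr0]
    rfl
  rw [h1]
  symm
  refine hA.eq_frameRatio fun v => ?_
  rw [← Matrix.mulVec_mulVec, ← Matrix.mulVec_mulVec, coordFrame, hk.sinv_frameRatio hks hA hAs,
    hA.map_frameRatio hAs, LinearMap.comp_apply, ContinuousLinearMap.coe_coe,
    ContinuousLinearMap.coe_coe]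
  have h2 := kd_Mmat d φ q θ ((c.coordFrame a).mulVec v)
  have h3 := (isSymplecticMap_kd (d.V_circle (d.l * a))).map_frameRatio
    (surjective_kd (d.V_circle (d.l * a))) (A := c.cylFrame (-a) 1) v
  have h4 : d.kd (q • e₁ m) ((c.coordFrame a).mulVec v) = c.cylFrame (-a) 1 v := by
    rw [← hal]; exact h3
  rw [h4] at h2
  rw [mul_add, hal]
  exact h2

/-- The index of the linearized flow, if the relative linearized flow is homotopic to a shear. -/
theorem orbitPath_index (hlam : IsFlow (fun _ => C.reeb) φlam) {φ : ℝ → What → What} {q x : ℝ}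
    {H : ℝ → ℝ → Mat (m + 1)}
    (hH : ContinuousOn (fun z : ℝ × ℝ => H z.1 z.2) (Icc 0 1 ×ˢ Icc 0 1))
    (hHsp : ∀ u ∈ Icc (0 : ℝ) 1, ∀ s ∈ Icc (0 : ℝ) 1,
      H u s ∈ Matrix.symplecticGroup (Fin (m + 1)) ℝ)
    (hH0 : ∀ u ∈ Icc (0 : ℝ) 1, H u 0 = 1)
    (hdet : ∀ u ∈ Icc (0 : ℝ) 1, (1 - d.Zmat 1 * H u 1).det ≠ 0)
    (hHs : ∀ s ∈ Icc (0 : ℝ) 1, H 0 s = 1 + (x * s) • etaMat d.eta)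
    (hHN : ∀ s ∈ Icc (0 : ℝ) 1, H 1 s = d.Nmat φ q s) {k j : ℤ} (hk : c.HasReebIndex k)
    (hj : IsConleyZehnderIndex (fun θ => shearMat (d.shearRate * θ) (x * θ)) j) :
    IsConleyZehnderIndex (c.orbitPath φ q) (-k + j) := by
  have z0 : (0 : ℝ) ∈ Icc (0 : ℝ) 1 := by simp
  -- The ratio of the frames has degree zero and starts in the identity component; `γ` is the path
  -- `Γ` required by the change of frames.
  obtain ⟨hdeg, γ, hγ⟩ := c.angleInc_cylRatio hlam
  have h1 := index_shear_framedPath (F := c.coordFrame) (Z := d.Zmat) (E := c.coordSplit)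
    (Γ := γ.extend) (c := x) c.continuous_coordFrame c.coordFrame_mem c.coordFrame_add_one
    (Zmat_zero hlam) (Zmat_add_one hlam) (c.continuousOn_coordSplit hlam)
    (fun s hs => c.coordSplit_mem hs) (c.coordSplit_one hlam) (fun s hs => c.Zmat_neg hlam hs)
    (hdeg.congr fun r hr => by rw [c.sinv_coordSplit_mul hr]) γ.continuous_extend.continuousOn
    (fun s hs => by
      rw [γ.extend_apply hs]
      exact hγ _)
    γ.extend_zero
    (by
      have := c.sinv_coordSplit_mul z0
      rw [neg_zero] at this
      rw [γ.extend_one, this]) hk hj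
  rw [c.coordSplit_zero_mulVec_eLast hlam] at h1
  have h2 : IsConleyZehnderIndex (framedPath c.coordFrame d.Zmat (H 0) 0) (-k + j) :=
    h1.congr fun s hs => by rw [framedPath, framedPath, hHs s hs]
  have h3 := h2.framedPath_homotopy (a := q / d.l) c.continuous_coordFrame
    (isLinSol_Zmat hlam).continuous c.coordFrame_mem (Zmat_mem hlam) c.coordFrame_add_one
    (Zmat_add_one hlam) hH hHsp hH0 hdet
  exact h3.congr fun s hs => by
    rw [c.orbitPath_eq hlam, framedPath, framedPath, hHN s hs]

end CappingData

end

end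

end MorseBott

theorem MorseBott.OrbitPerturbation.exists_index {m : ℕ} {What M : Type*}
    [TopologicalSpace What] [ChartedSpace (EuclideanSpace ℝ (Fin (2 * m + 2))) What]
    [IsManifold (𝓡 (2 * m + 2)) ∞ What] [T2Space What]
    [TopologicalSpace M] [ChartedSpace (EuclideanSpace ℝ (Fin (2 * m + 1))) M]
    [IsManifold (𝓡 (2 * m + 1)) ∞ M]
    {C : MorseBott.SymplecticCompletion m What M}
    {φlam : ℝ → M → M} (hφlam : MorseBott.IsFlow (fun _ => C.reeb) φlam)
    (hnondeg : C.ReebNondegenerate φlam)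
    {K : C.AdmissibleHamiltonian φlam}
    {ι : Type*} [Fintype ι] {d : ι → MorseBott.OrbitPerturbation C φlam K}
    (hdisj : ∀ i j, i ≠ j → Disjoint (d i).U (d j).U) (i : ι) :
    ∃ δ₀ > 0, ∀ δ : ℝ, 0 < δ → δ ≤ δ₀ →
      ∀ φ : ℝ → What → What,
        MorseBott.IsFlow (fun θ => C.hamField (MorseBott.perturbedHamiltonian d δ θ)) φ →
        MorseBott.IsNondegenerateOrbit (d i) φ (d i).qmin ∧
          MorseBott.IsNondegenerateOrbit (d i) φ (d i).qmax ∧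
          ∀ (c : MorseBott.CappingData (d i)) (k : ℤ), c.HasReebIndex k →
            c.HasOrbitIndex φ (d i).qmin (k + 1) ∧ c.HasOrbitIndex φ (d i).qmax k := by
  have z1 : (1 : ℝ) ∈ Icc (0 : ℝ) 1 := by simp
  have hmin : deriv (d i).f (d i).qmin = 0 := ((d i).f_crit _).2 (Or.inl ⟨0, by simp⟩)
  have hmax : deriv (d i).f (d i).qmax = 0 := ((d i).f_crit _).2 (Or.inr ⟨0, by simp⟩)
  obtain ⟨δ₁, hδ₁, h₁⟩ := exists_Nmat_homotopy hφlam hnondeg hdisj hmin (d i).f_min.ne'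
  obtain ⟨δ₂, hδ₂, h₂⟩ := exists_Nmat_homotopy hφlam hnondeg hdisj hmax (d i).f_max.ne
  refine ⟨min δ₁ δ₂, lt_min hδ₁ hδ₂, fun δ hδ hδ' φ hφ => ?_⟩
  obtain ⟨a, H, ha, hH, hHsp, hH0, hdet, hHs, hHN⟩ := h₁ δ hδ (hδ'.trans (min_le_left _ _)) φ hφ
  obtain ⟨b, L, hb, hL, hLsp, hL0, hdet', hLs, hLN⟩ := h₂ δ hδ (hδ'.trans (min_le_right _ _)) φ hφ
  refine ⟨isNondegenerateOrbit hφlam hdisj hφ hmin (hHN 1 z1 ▸ hdet 1 z1),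
    isNondegenerateOrbit hφlam hdisj hφ hmax (hLN 1 z1 ▸ hdet' 1 z1), fun c k hk => ⟨?_, ?_⟩⟩
  -- The rate of the model shear has the sign of the second derivative of `f`: positive at the
  -- minimum, where the plane contributes `-1`, and negative at the maximum, where it contributes
  -- `0`.
  · have h := c.orbitPath_index hφlam hH hHsp hH0 hdet hHs hHN hk (MorseBott.shear_index_neg_one
      shearRate_pos ((pos_iff_pos_of_mul_pos ha).2 (d i).f_min))
    rwa [show -k + -1 = -(k + 1) by ring] at h
  · have h := c.orbitPath_index hφlam hL hLsp hL0 hdet' hLs hLN hk (MorseBott.shear_index_zero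
      shearRate_pos ((neg_iff_neg_of_mul_pos hb).2 (d i).f_max))
    rwa [add_zero] at h

theorem lemma3 {m : ℕ} {What M : Type*}
    [TopologicalSpace What] [ChartedSpace (EuclideanSpace ℝ (Fin (2 * m + 2))) What]
    [IsManifold (𝓡 (2 * m + 2)) ∞ What] [T2Space What] [SigmaCompactSpace What]
    [TopologicalSpace M] [ChartedSpace (EuclideanSpace ℝ (Fin (2 * m + 1))) M]
    [IsManifold (𝓡 (2 * m + 1)) ∞ M] [T2Space M] [CompactSpace M]
    (C : MorseBott.SymplecticCompletion m What M)
    (φlam : ℝ → M → M) (hφlam : MorseBott.IsFlow (fun _ => C.reeb) φlam)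
    (hnondeg : C.ReebNondegenerate φlam)
    (K : C.AdmissibleHamiltonian φlam)
    {ι : Type*} [Fintype ι] (d : ι → MorseBott.OrbitPerturbation C φlam K)
    (hdisj : ∀ i j, i ≠ j → Disjoint (d i).U (d j).U) :
    ∃ δ₀ > 0, ∀ δ : ℝ, 0 < δ → δ ≤ δ₀ →
      ∀ φ : ℝ → What → What,
        MorseBott.IsFlow (fun θ => C.hamField (MorseBott.perturbedHamiltonian d δ θ)) φ →
        ∀ i, MorseBott.IsNondegenerateOrbit (d i) φ (d i).qmin ∧
          MorseBott.IsNondegenerateOrbit (d i) φ (d i).qmax ∧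
          ∀ (c : MorseBott.CappingData (d i)) (k : ℤ), c.HasReebIndex k →
            c.HasOrbitIndex φ (d i).qmin (k + 1) ∧ c.HasOrbitIndex φ (d i).qmax k := by
  choose δ₀ hδ₀ h using
    MorseBott.OrbitPerturbation.exists_index hφlam hnondeg (d := d) hdisj
  rcases isEmpty_or_nonempty ι with hι | hι
  · exact ⟨1, one_pos, fun δ _ _ φ _ i => isEmptyElim i⟩
  · obtain ⟨i₀, hi₀⟩ := Finite.exists_min δ₀
    exact ⟨δ₀ i₀, hδ₀ i₀, fun δ hδ hδ' φ hφ i => h i δ hδ (hδ'.trans (hi₀ i)) φ hφ⟩
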